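/- **Setting.** Let $d\ge1$, $\beta\in(0,\infty)$, $\mathbb T^d=(\mathbb R/\mathbb Z)^d$, $\mathbb D=\mathbb T^d\times\mathbb R^d$ with points $z=(x,v)$, and $M_\beta(v)=(\beta/2\pi)^{d/2}e^{-\beta|v|^2/2}$. Write $\langle h\rangle_v=\int_{\mathbb R^d}hM_\beta\,dv$. Let $L^2_\beta(\mathbb D^{m+1})$ be the space of functions $G(z_0,\dots,z_m)$, symmetric in the last $m$ entries, with $\int|G|^2M_\beta^{\otimes(m+1)}<\infty$. Let $H^1_\beta(\mathbb R^d)$ have the norm $(\int(|h|^2+|\nabla h|^2)M_\beta)^{1/2}$, and let $H^{-1}_\beta(\mathbb R^d)$ be its dual with respect to the scalar product of $L^2(M_\beta\,dv)$. Let $V\in W^{1,\infty}(\mathbb T^d)$ be real and even with $\widehat V(k)=\int_{\mathbb T^d}V(x)e^{-ik\cdot x}dx\ge0$ for all $k\in2\pi\mathbb Z^d$, and let $g^\circ\in H^1_\beta(\mathbb R^d)$. For $N\ge1$ set, in the sense of distributions, $L_{m+1}=\sum_{j=0}^mL_{m+1}^{(j)}$ with $$iL_{m+1}^{(j)}G=v_j\cdot\nabla_{x_j}G+\mathbf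 1_{j\ne0}\tfrac{N+1-m}N\,\beta v_j\cdot\int_{\mathbb D}\nabla V(x_j-x_*)\,G(z_0,\dots,z_*,\dots,z_m)\,M_\beta(v_*)\,dz_*$$ ($z_*$ in the place of $z_j$), $$M_{m+2}^{m+1}G=\tfrac{N-m}N\sum_{j=0}^m\int_{\mathbb D}\nabla V(x_j-x_*)\cdot(\nabla_{v_j}-\beta v_j)G(z_0,\dots,z_m,z_*)\,M_\beta(v_*)\,dz_*,$$ $$S_1^3g^\circ(z_0,z_1,z_2)=\sum_{1\le j\ne l\le2}\nabla V(x_j-x_l)\cdot(-\beta v_j)\,g^\circ(v_0),$$ and $\varepsilon^\circ_{\beta,1}(k,\omega)=1+\beta\widehat V(k)\big\langle\tfrac{k\cdot v_*}{k\cdot v_*-\omega}\big\rangle_{v_*}$. **Proposition 5.6.** For all $N\ge1$ and $\operatorname{Im}\omega>0$, the functions $G_3=(iL_3-i\omega)^{-1}S_1^3g^\circ\in L^2_\beta(\mathbb D^3)$, $M_3^2G_3\in L^2_\beta(\mathbb D^2)$ and $G_2=(iL_2-i\omega)^{-1}M_3^2G_3\in L^2_\beta(\mathbb D^2)$ exist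 and are uniquely determined. The following convergence holds in $H^{-1}_\beta(\mathbb R^d)$, uniformly for $N\ge1$: $$\lim_{\omega\to0,\ \operatorname{Im}\omega>0}\int_{\mathbb T^d}\big(M_2^1(iL_2-i\omega)^{-1}M_3^2(iL_3-i\omega)^{-1}S_1^3g^\circ\big)(x,v)\,dx$$ $$=-(\nabla_v-\beta v)\cdot\bigg(\sum_{k\in2\pi\mathbb Z^d\setminus\{0\}}\beta\widehat V(k)\,(k\otimes k)\,\frac{\pi\widehat V(k)^2\langle\delta(k\cdot(v_*-v))\rangle_{v_*}}{|\varepsilon^\circ_{\beta,1}(k,k\cdot v+i0)|^2}\;\tfrac{N-1}N\,\frac{1+\beta\widehat V(k)}{1+\frac{N-1}N\beta\widehat V(k)}\bigg)(\nabla_v-\beta v)g^\circ(v).$$ Here, for $k\neq 0$, the boundary value $\varepsilon^\circ_{\beta,1}(k,k\cdot v+i0)=\lim_{\eta\downarrow0}\varepsilon^\circ_{\beta,1}(k,k\cdot v+i\eta)$ exists and is nonzero, the limit $\langle\delta(k\cdot(v_*-v))\rangle_{v_*}=\lim_{\eta\downarrow0}\frac1{2\eta}\int_{|k\cdot(v_*-v)|<\eta}M_\beta(v_*)\,dv_*$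 exists, the sum over $k$ converges absolutely for each $v$, and the product of the tensor in large brackets with $(\nabla_v-\beta v)g^\circ$ lies in $L^2(M_\beta\,dv)$. In addition, for all $N\ge1$ and $\operatorname{Im}\omega>0$, the argument of the limit can be written as $(\nabla_v-\beta v)\cdot G^\omega_{N,\beta}(v)$ for a measurable vector field $G^\omega_{N,\beta}$ with $|G^\omega_{N,\beta}(v)|\le C\,|(\nabla_v-\beta v)g^\circ(v)|$ for almost every $v$, where $C$ depends only on $d$, $\beta$ and an upper bound $K$ for $\|V\|_{L^\infty}$ and $\|\nabla V\|_{L^\infty}$. -/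

import Mathlib

open MeasureTheory Filter Topology

noncomputable section

/-! ### Phase space, Maxwellian, weighted Lebesgue spaces -/

/-- Velocity space `ℝᵈ` with its Euclidean norm. -/
abbrev Vel (d : ℕ) : Type := EuclideanSpace ℝ (Fin d)

/-- The torus `𝕋ᵈ = (ℝ/ℤ)ᵈ`. -/
abbrev Torus (d : ℕ) : Type := UnitAddTorus (Fin d)

/-- One-particle phase space `𝔻 = 𝕋ᵈ × ℝᵈ`, with points `z = (x, v)`. -/
abbrev Phase (d : ℕ) : Type := Torus d × Vel d

/-- The projection `ℝᵈ → 𝕋ᵈ`. -/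
def toTorus {d : ℕ} (y : Vel d) : Torus d := fun i => ((y i : ℝ) : UnitAddCircle)

/-- Lebesgue measure on the torus, normalized to total mass one. -/
def torusMeasure (d : ℕ) : Measure (Torus d) :=
  Measure.pi fun _ : Fin d => (AddCircle.haarAddCircle : Measure UnitAddCircle)

/-- The Maxwellian density `M_β(v) = (β/2π)^{d/2} e^{-β|v|²/2}`. -/
def maxwellDensity {d : ℕ} (β : ℝ) (v : Vel d) : ℝ :=
  (β / (2 * Real.pi)) ^ ((d : ℝ) / 2) * Real.exp (-(β / 2) * ‖v‖ ^ 2)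

/-- The measure `M_β(v) dv` on `ℝᵈ`. -/
def maxwell (d : ℕ) (β : ℝ) : Measure (Vel d) :=
  volume.withDensity fun v => ENNReal.ofReal (maxwellDensity β v)

/-- The measure `M_β(v) dx dv` on `𝔻`. -/
def phaseMeasure (d : ℕ) (β : ℝ) : Measure (Phase d) :=
  (torusMeasure d).prod (maxwell d β)

/-- The measure `M_β^{⊗ n} dz` on `𝔻ⁿ`. -/
def phaseMeasureN (d : ℕ) (β : ℝ) (n : ℕ) : Measure (Fin n → Phase d) :=
  Measure.pi fun _ : Fin n => phaseMeasure d β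

/-- Membership in `L²_β(𝔻^{m+1})`: square integrable with respect to `M_β^{⊗(m+1)} dz`, and
symmetric in the last `m` entries. -/
def MemL2 {d : ℕ} (β : ℝ) (m : ℕ) (G : (Fin (m + 1) → Phase d) → ℂ) : Prop :=
  MemLp G 2 (phaseMeasureN d β (m + 1)) ∧
    ∀ σ : Equiv.Perm (Fin (m + 1)), σ 0 = 0 →
      (fun z => G fun j => z (σ j)) =ᵐ[phaseMeasureN d β (m + 1)] G

/-! ### Test functions and derivatives -/

/-- `φ ∈ C_c^∞(𝔻ⁿ)`: the lift of `φ` to `(ℝᵈ × ℝᵈ)ⁿ`, periodic in the positions, is smooth,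
and `φ` has compact support. -/
def IsPhaseTest {d n : ℕ} (φ : (Fin n → Phase d) → ℂ) : Prop :=
  ContDiff ℝ (⊤ : ℕ∞) (fun y : Fin n → Vel d × Vel d => φ fun j => (toTorus (y j).1, (y j).2)) ∧
    HasCompactSupport φ

/-- `φ ∈ C_c^∞(ℝᵈ)`. -/
def IsVelTest {d : ℕ} (φ : Vel d → ℂ) : Prop := ContDiff ℝ (⊤ : ℕ∞) φ ∧ HasCompactSupport φ

/-- The partial derivative `∂_i φ` on `ℝᵈ`. -/
def velPartial {d : ℕ} (φ : Vel d → ℂ) (i : Fin d) (v : Vel d) : ℂ :=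
  fderiv ℝ φ v (EuclideanSpace.single i 1)

/-- `v_j · ∇_{x_j} φ`. -/
def transportDeriv {d n : ℕ} (j : Fin n) (φ : (Fin n → Phase d) → ℂ) (z : Fin n → Phase d) : ℂ :=
  deriv (fun t : ℝ => φ (Function.update z j ((z j).1 + toTorus (t • (z j).2), (z j).2))) 0

/-- `w · ∇_{v_j} φ`. -/
def velDeriv {d n : ℕ} (j : Fin n) (w : Vel d) (φ : (Fin n → Phase d) → ℂ)
    (z : Fin n → Phase d) : ℂ :=
  deriv (fun t : ℝ => φ (Function.update z j ((z j).1, (z j).2 + t • w))) 0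

/-! ### The interaction potential -/

/-- `V ∈ W^{1,∞}(𝕋ᵈ)` with weak gradient `∇V = DV`, and with `‖V‖_{L^∞} ≤ K`,
`‖∇V‖_{L^∞} ≤ K`. -/
structure IsW1Infty {d : ℕ} (V : Torus d → ℝ) (DV : Torus d → Vel d) (K : ℝ) : Prop where
  meas : AEStronglyMeasurable V (torusMeasure d)
  meas_grad : AEStronglyMeasurable DV (torusMeasure d)
  bound : ∀ᵐ x ∂torusMeasure d, |V x| ≤ K
  bound_grad : ∀ᵐ x ∂torusMeasure d, ‖DV x‖ ≤ K
  weak_grad : ∀ ψ : Torus d → ℝ, ContDiff ℝ (⊤ : ℕ∞) (fun y : Vel d => ψ (toTorus y)) → ∀ i : Fin d,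
    ∫ x, V x * deriv (fun t : ℝ => ψ (x + toTorus (EuclideanSpace.single i t))) 0 ∂torusMeasure d
      = -∫ x, DV x i * ψ x ∂torusMeasure d

/-- The wave vector `k = 2πn ∈ 2πℤᵈ`. -/
def waveVec {d : ℕ} (n : Fin d → ℤ) : Vel d := WithLp.toLp 2 fun i => 2 * Real.pi * (n i : ℝ)

/-- The Fourier coefficient `V̂(k) = ∫ V(x) e^{-ik·x} dx` at `k = 2πn`; it is real for even `V`,
and only even potentials are considered. -/
def potHat {d : ℕ} (V : Torus d → ℝ) (n : Fin d → ℤ) : ℝ :=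
  (UnitAddTorus.mFourierCoeff (fun x => (V x : ℂ)) n).re

/-! ### The operators of the cumulant hierarchy

`L_{m+1}` and `M_{m+2}^{m+1}` are defined in the sense of distributions, through the bilinear
duality `⟨F, φ⟩ = ∫ F φ M_β^{⊗(m+1)} dz` with `φ ∈ C_c^∞(𝔻^{m+1})`. For this duality the adjoint
of `v_j · ∇_{x_j}` is `-v_j · ∇_{x_j}`, and that of `∇_{v_j} - β v_j` is `-∇_{v_j}`. -/

/-- `⟨i L_{m+1} G, φ⟩`, where `i L_{m+1} = ∑_j i L_{m+1}^{(j)}` and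
`i L_{m+1}^{(j)} G = v_j · ∇_{x_j} G
  + 1_{j≠0} ((N+1-m)/N) β v_j · ∫ ∇V(x_j - x_*) G(.., z_*, ..) M_β(v_*) dz_*`,
with `z_*` in the slot of `z_j`. -/
def vlasovPair {d : ℕ} (N m : ℕ) (β : ℝ) (DV : Torus d → Vel d)
    (G φ : (Fin (m + 1) → Phase d) → ℂ) : ℂ :=
  ∑ j : Fin (m + 1),
    (-(∫ z, G z * transportDeriv j φ z ∂phaseMeasureN d β (m + 1))
      + if j = 0 then 0 else
          ((((N : ℝ) + 1 - m) / N : ℝ) : ℂ) *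
            ∫ z, (∫ zs, ((β * inner ℝ (z j).2 (DV ((z j).1 - zs.1)) : ℝ) : ℂ) *
                G (Function.update z j zs) ∂phaseMeasure d β) * φ z
              ∂phaseMeasureN d β (m + 1))

/-- `G = (i L_{m+1} - i ω)⁻¹ R` in `L²_β(𝔻^{m+1})`. -/
def IsResolvent {d : ℕ} (N m : ℕ) (β : ℝ) (DV : Torus d → Vel d) (ω : ℂ)
    (R G : (Fin (m + 1) → Phase d) → ℂ) : Prop :=
  MemL2 β m G ∧ ∀ φ : (Fin (m + 1) → Phase d) → ℂ, IsPhaseTest φ →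
    vlasovPair N m β DV G φ - Complex.I * ω * ∫ z, G z * φ z ∂phaseMeasureN d β (m + 1)
      = ∫ z, R z * φ z ∂phaseMeasureN d β (m + 1)

/-- `⟨M_{m+2}^{m+1} G, φ⟩`, where `M_{m+2}^{m+1} G = ((N-m)/N) ∑_{j=0}^m
∫ ∇V(x_j - x_*) · (∇_{v_j} - β v_j) G(z_0, …, z_m, z_*) M_β(v_*) dz_*`. -/
def meanPair {d : ℕ} (N m : ℕ) (β : ℝ) (DV : Torus d → Vel d)
    (G : (Fin (m + 1 + 1) → Phase d) → ℂ) (φ : (Fin (m + 1) → Phase d) → ℂ) : ℂ :=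
  ((((N : ℝ) - m) / N : ℝ) : ℂ) * ∑ j : Fin (m + 1),
    -(∫ z, (∫ zs, G (Fin.snoc (α := fun _ => Phase d) z zs) *
        velDeriv j (DV ((z j).1 - zs.1)) φ z ∂phaseMeasure d β) ∂phaseMeasureN d β (m + 1))

/-- `S_1^3 g`, where `(S_1^3 g)(z_0, z_1, z_2) = ∑_{1 ≤ j ≠ l ≤ 2} ∇V(x_j - x_l) · (-β v_j) g(v_0)`
for a function `g = g(v)`. -/
def sourceThree {d : ℕ} (β : ℝ) (DV : Torus d → Vel d) (g : Vel d → ℂ)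
    (z : Fin 3 → Phase d) : ℂ :=
  ((inner ℝ (DV ((z 1).1 - (z 2).1)) (-(β • (z 1).2))
    + inner ℝ (DV ((z 2).1 - (z 1).1)) (-(β • (z 2).2)) : ℝ) : ℂ) * g (z 0).2

/-- The successive applications of the operators to `g`:
`G₃ = (i L_3 - iω)⁻¹ S_1^3 g`, `R = M_3^2 G₃ ∈ L²_β(𝔻²)`, `G₂ = (i L_2 - iω)⁻¹ R`. -/
structure IsThreeCorr {d : ℕ} (N : ℕ) (β : ℝ) (DV : Torus d → Vel d) (g : Vel d → ℂ) (ω : ℂ)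
    (G₃ : (Fin 3 → Phase d) → ℂ) (R G₂ : (Fin 2 → Phase d) → ℂ) : Prop where
  resolvent_three : IsResolvent N 2 β DV ω (sourceThree β DV g) G₃
  memL2_mean : MemL2 β 1 R
  mean_three : ∀ φ : (Fin 2 → Phase d) → ℂ, IsPhaseTest φ →
    meanPair N 1 β DV G₃ φ = ∫ z, R z * φ z ∂phaseMeasureN d β 2
  resolvent_two : IsResolvent N 1 β DV ω R G₂

/-- The distribution `∫_{𝕋ᵈ} (M_2^1 G₂)(x, ·) dx` on `ℝᵈ`, tested against `φ = φ(v)`. -/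
def spaceAvgMean {d : ℕ} (N : ℕ) (β : ℝ) (DV : Torus d → Vel d) (G₂ : (Fin 2 → Phase d) → ℂ)
    (φ : Vel d → ℂ) : ℂ :=
  meanPair N 0 β DV G₂ fun z => φ (z 0).2

/-! ### Sobolev spaces on velocity space -/

/-- `g ∈ H¹_β(ℝᵈ)` with weak gradient `∇g = Dg`. -/
structure IsH1 {d : ℕ} (β : ℝ) (g : Vel d → ℂ) (Dg : Vel d → EuclideanSpace ℂ (Fin d)) :
    Prop where
  memLp : MemLp g 2 (maxwell d β)
  memLp_grad : MemLp Dg 2 (maxwell d β)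
  weak_grad : ∀ φ : Vel d → ℂ, IsVelTest φ → ∀ i : Fin d,
    ∫ v, g v * velPartial φ i v = -∫ v, Dg v i * φ v

/-- The vector field `(∇_v - β v) g`, for `∇g = Dg`. -/
def twistedGrad {d : ℕ} (β : ℝ) (g : Vel d → ℂ) (Dg : Vel d → EuclideanSpace ℂ (Fin d))
    (v : Vel d) : EuclideanSpace ℂ (Fin d) :=
  WithLp.toLp 2 fun i => Dg v i - ((β * v i : ℝ) : ℂ) * g v

/-- The norm of `H¹_β(ℝᵈ)` on test functions. -/
def h1Norm {d : ℕ} (β : ℝ) (φ : Vel d → ℂ) : ℝ :=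
  Real.sqrt (∫ v, (‖φ v‖ ^ 2 + ∑ i : Fin d, ‖velPartial φ i v‖ ^ 2) ∂maxwell d β)

/-- `‖T‖_{H^{-1}_β(ℝᵈ)} ≤ c` for a distribution `T`, the dual norm of `H¹_β(ℝᵈ)` being tested on
the dense subspace `C_c^∞(ℝᵈ)`. -/
def HNegOneLe {d : ℕ} (β : ℝ) (T : (Vel d → ℂ) → ℂ) (c : ℝ) : Prop :=
  ∀ φ : Vel d → ℂ, IsVelTest φ → ‖T φ‖ ≤ c * h1Norm β φ

/-- The distribution `(∇_v - β v) · F`, for the duality `⟨T, φ⟩ = ∫ T φ M_β`. -/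
def twistedDiv {d : ℕ} (β : ℝ) (F : Vel d → EuclideanSpace ℂ (Fin d)) (φ : Vel d → ℂ) : ℂ :=
  -∫ v, ∑ i : Fin d, F v i * velPartial φ i v ∂maxwell d β

/-! ### Dispersion function and limiting diffusion tensor -/

/-- `ε°_{β,m}(k, ω) = 1 + ((N+1-m)/N) β V̂(k) ⟨k·v / (k·v - ω)⟩_v` at `k = 2πn`. -/
def dispersion {d : ℕ} (N m : ℕ) (β : ℝ) (V : Torus d → ℝ) (n : Fin d → ℤ) (ω : ℂ) : ℂ :=
  1 + (((((N : ℝ) + 1 - m) / N) * β * potHat V n : ℝ) : ℂ) *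
    ∫ v, ((inner ℝ (waveVec n) v : ℝ) : ℂ) / (((inner ℝ (waveVec n) v : ℝ) : ℂ) - ω) ∂maxwell d β

/-- The boundary value `ε°_{β,m}(k, r + i0)`. -/
def dispersionBdry {d : ℕ} (N m : ℕ) (β : ℝ) (V : Torus d → ℝ) (n : Fin d → ℤ) (r : ℝ) : ℂ :=
  limUnder (𝓝[>] (0 : ℝ)) fun η => dispersion N m β V n ((r : ℂ) + (η : ℂ) * Complex.I)

/-- The mean over `v_*` of the approximation `(2η)⁻¹ 1_{(-η, η)}(k·(v_* - v))` of the Dirac mass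
`δ(k·(v_* - v))`. -/
def deltaApprox {d : ℕ} (β : ℝ) (k v : Vel d) (η : ℝ) : ℝ :=
  (2 * η)⁻¹ * (maxwell d β).real {w | |inner ℝ k (w - v)| < η}

/-- `⟨δ(k·(v_* - v))⟩_{v_*}`. -/
def deltaAvg {d : ℕ} (β : ℝ) (k v : Vel d) : ℝ :=
  limUnder (𝓝[>] (0 : ℝ)) (deltaApprox β k v)

/-- The `(i, l)` entry of the term of index `k = 2πn` of the limiting tensor,
`β V̂(k) (k⊗k) (π V̂(k)² ⟨δ(k·(v_*-v))⟩_{v_*} / |ε°_{β,1}(k, k·v+i0)|²)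
  · ((N-1)/N) (1 + β V̂(k)) / (1 + ((N-1)/N) β V̂(k))`. -/
def tensorTerm {d : ℕ} (N : ℕ) (β : ℝ) (V : Torus d → ℝ) (v : Vel d) (i l : Fin d)
    (n : Fin d → ℤ) : ℝ :=
  β * potHat V n * (waveVec n i * waveVec n l) *
    (Real.pi * potHat V n ^ 2 * deltaAvg β (waveVec n) v /
      ‖dispersionBdry N 1 β V n (inner ℝ (waveVec n) v)‖ ^ 2) *
    (((N : ℝ) - 1) / N * ((1 + β * potHat V n) / (1 + ((N : ℝ) - 1) / N * (β * potHat V n))))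

/-- The vector field `A_N(v) (∇_v - β v) g(v)`, where the tensor `A_N(v)` is the sum of the
terms above over `k ∈ 2πℤᵈ`. -/
def limitField {d : ℕ} (N : ℕ) (β : ℝ) (V : Torus d → ℝ) (g : Vel d → ℂ)
    (Dg : Vel d → EuclideanSpace ℂ (Fin d)) (v : Vel d) : EuclideanSpace ℂ (Fin d) :=
  WithLp.toLp 2 fun i =>
    ∑ l : Fin d, ((∑' n : Fin d → ℤ, tensorTerm N β V v i l n : ℝ) : ℂ) * twistedGrad β g Dg v l

end

open MeasureTheory Filter Topology

noncomputable section
open Complex Set Function ProbabilityTheory UnitAddTorus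
open scoped Real ComplexConjugate FourierTransform SchwartzMap
open Finset (sum_congr mul_sum sum_mul sum_le_sum mem_univ)

variable {d n N : ℕ} {β K α γ : ℝ} {z ζ ω : ℂ} {V : Torus d → ℝ} {DV : Torus d → Vel d}
  {g : Vel d → ℂ} {Dg : Vel d → EuclideanSpace ℂ (Fin d)}

local notation "ℤᵈ" => Fin d → ℤ
local notation "ℂᵈ" => EuclideanSpace ℂ (Fin d)
local notation "𝔗" => torusMeasure d
local notation "ℳ" => maxwell d β
local notation "ℨ" => phaseMeasure d β
local notation "𝔓" => phaseMeasureN d β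


lemma integral_congr_fun {X E : Type*} [MeasurableSpace X] [NormedAddCommGroup E] [NormedSpace ℝ E]
    {μ : Measure X} {f g : X → E} (h : ∀ x, f x = g x) : ∫ x, f x ∂μ = ∫ x, g x ∂μ :=
  congrArg _ (funext h)

/-- The standard normal law on `ℝ`. -/
abbrev stdNormal : Measure ℝ := gaussianReal 0 1

lemma integrable_abs_pow_stdNormal (j : ℕ) : Integrable (fun p : ℝ => |p| ^ j) stdNormal := by
  rcases Nat.eq_zero_or_pos j with rfl | hj
  · simp
  · have h := (memLp_id_gaussianReal' (μ := 0) (v := 1) (j : ENNReal) (by simp)).integrable_norm_pow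
      (by omega)
    simpa using h

lemma integrable_pow_mul_stdNormal (j : ℕ) {f : ℝ → ℂ} (hf : AEStronglyMeasurable f stdNormal)
    {c : ℝ} (hc : ∀ p, ‖f p‖ ≤ c) : Integrable (fun p : ℝ => (p : ℂ) ^ j * f p) stdNormal := by
  refine ((integrable_abs_pow_stdNormal j).mul_const c).mono'
    ((by fun_prop : Continuous fun p : ℝ => (p : ℂ) ^ j).aestronglyMeasurable.mul hf)
    (ae_of_all _ fun p => ?_)
  rw [norm_mul, norm_pow, norm_real, Real.norm_eq_abs]
  exact mul_le_mul_of_nonneg_left (hc p) (by positivity)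

/-- The moments `∫ pʲ e^{-ips}` of the standard normal law. -/
def gaussMoment (j : ℕ) (s : ℝ) : ℂ := ∫ p : ℝ, (p : ℂ) ^ j * cexp (-(I * p * s)) ∂stdNormal

lemma norm_cexp_neg_I_mul (p s : ℝ) : ‖cexp (-(I * p * s))‖ = 1 := by
  rw [norm_exp]; simp

lemma integrable_gaussMoment (j : ℕ) (s : ℝ) :
    Integrable (fun p : ℝ => (p : ℂ) ^ j * cexp (-(I * p * s))) stdNormal :=
  integrable_pow_mul_stdNormal j (by fun_prop)
    (fun p => (norm_cexp_neg_I_mul p s).le)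

lemma hasDerivAt_gaussMoment (j : ℕ) (s : ℝ) :
    HasDerivAt (gaussMoment j) (-I * gaussMoment (j + 1) s) s := by
  have h := hasDerivAt_integral_of_dominated_loc_of_deriv_le (μ := stdNormal)
    (F := fun (s : ℝ) (p : ℝ) => (p : ℂ) ^ j * cexp (-(I * p * s)))
    (F' := fun (s : ℝ) (p : ℝ) => -I * ((p : ℂ) ^ (j + 1) * cexp (-(I * p * s))))
    (bound := fun p => |p| ^ (j + 1)) (x₀ := s) (s := univ) univ_mem
    (Eventually.of_forall fun x => (integrable_gaussMoment j x).1) (integrable_gaussMoment j s)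
    ((integrable_gaussMoment (j + 1) s).const_mul _).1 (ae_of_all _ fun p x _ => by
      rw [norm_mul, norm_mul, norm_cexp_neg_I_mul]; simp)
    (integrable_abs_pow_stdNormal _) (ae_of_all _ fun p x _ => by
      have h1 : HasDerivAt (fun x : ℝ => -(I * p * (x : ℂ))) (-(I * p * 1)) x :=
        ((hasDerivAt_id x).ofReal_comp.const_mul (I * p)).neg
      have h2 := h1.cexp.const_mul ((p : ℂ) ^ j)
      exact h2.congr_deriv (by ring))
  have h2 := h.2
  rw [integral_const_mul] at h2
  exact h2

lemma gaussMoment_zero (s : ℝ) : gaussMoment 0 s = (rexp (-s ^ 2 / 2) : ℂ) := by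
  have h := charFun_gaussianReal (μ := 0) (v := 1) (-s)
  rw [charFun_apply_real] at h
  rw [gaussMoment]
  convert h using 1
  · refine integral_congr_fun fun p => ?_
    simp only [pow_zero, one_mul]
    congr 1
    push_cast
    ring
  · push_cast
    congr 1
    simp
    rw [neg_div]

lemma hasDerivAt_gauss (s : ℝ) :
    HasDerivAt (fun s : ℝ => (rexp (-s ^ 2 / 2) : ℂ)) (-s * rexp (-s ^ 2 / 2) : ℂ) s := by
  have h : HasDerivAt (fun s : ℝ => -s ^ 2 / 2) (-s) s := by
    have := ((hasDerivAt_pow 2 s).neg.div_const 2)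
    exact this.congr_deriv (by norm_num; ring)
  have h2 := h.exp.ofReal_comp
  exact h2.congr_deriv (by push_cast; ring)

lemma gaussMoment_one (s : ℝ) : gaussMoment 1 s = -I * s * (rexp (-s ^ 2 / 2) : ℂ) := by
  have h := hasDerivAt_gaussMoment 0 s
  have h0 : gaussMoment 0 = fun s : ℝ => (rexp (-s ^ 2 / 2) : ℂ) := funext gaussMoment_zero
  rw [h0] at h
  have := h.unique (hasDerivAt_gauss s)
  have hI : gaussMoment 1 s = I * (-I * gaussMoment (0 + 1) s) := by
    rw [← mul_assoc]; simp
  rw [hI, this]; ring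

lemma gaussMoment_two (s : ℝ) :
    gaussMoment 2 s = (1 - s ^ 2) * (rexp (-s ^ 2 / 2) : ℂ) := by
  have h := hasDerivAt_gaussMoment 1 s
  have h0 : gaussMoment 1 = fun s : ℝ => -I * s * (rexp (-s ^ 2 / 2) : ℂ) :=
    funext gaussMoment_one
  rw [h0] at h
  have h1 : HasDerivAt (fun s : ℝ => -I * (s : ℂ)) (-I * 1) s :=
    (hasDerivAt_id s).ofReal_comp.const_mul (-I)
  have := h.unique (h1.mul (hasDerivAt_gauss s))
  have hI : gaussMoment 2 s = I * (-I * gaussMoment (1 + 1) s) := by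
    rw [← mul_assoc]; simp
  rw [hI, this]
  linear_combination ((rexp (-s ^ 2 / 2) : ℂ) * (-1 + s ^ 2)) * I_sq

lemma poly_mul_gauss_le (s : ℝ) :
    (1 + s + s ^ 2) * rexp (-s ^ 2 / 2) ≤ 20 * rexp (-s) := by
  have h : rexp (-s ^ 2 / 2) = rexp (-s) * (rexp (s ^ 2 / 2 - s))⁻¹ := by
    rw [← Real.exp_neg, ← Real.exp_add]; ring_nf
  have h1 : s ^ 2 / 2 - s + 1 ≤ rexp (s ^ 2 / 2 - s) := Real.add_one_le_exp _
  have h2 : 0 < rexp (s ^ 2 / 2 - s) := Real.exp_pos _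
  rw [h, ← mul_assoc, mul_comm _ (rexp (-s)), mul_assoc, mul_comm 20]
  refine mul_le_mul_of_nonneg_left ?_ (Real.exp_pos _).le
  rw [← div_eq_mul_inv, div_le_iff₀ h2]
  nlinarith [sq_nonneg (9 * s - 10.5)]

lemma norm_gaussMoment_le {j : ℕ} (hj : j ≤ 2) {s : ℝ} (hs : 0 ≤ s) :
    ‖gaussMoment j s‖ ≤ 20 * rexp (-s) := by
  refine le_trans ?_ (poly_mul_gauss_le s)
  have he := Real.exp_pos (-s ^ 2 / 2)
  interval_cases j
  · rw [gaussMoment_zero, norm_real, Real.norm_of_nonneg he.le]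
    nlinarith [mul_nonneg hs he.le, mul_nonneg (sq_nonneg s) he.le]
  · rw [gaussMoment_one, norm_mul, norm_mul, norm_neg, norm_I, norm_real, norm_real,
      Real.norm_eq_abs, Real.norm_eq_abs, abs_of_pos he, abs_of_nonneg hs]
    nlinarith [mul_nonneg (sq_nonneg s) he.le]
  · rw [gaussMoment_two, norm_mul, norm_real, Real.norm_of_nonneg he.le]
    refine mul_le_mul_of_nonneg_right ?_ he.le
    have : ((1 : ℂ) - s ^ 2) = ((1 - s ^ 2 : ℝ) : ℂ) := by push_cast; ring
    rw [this, norm_real, Real.norm_eq_abs, abs_le]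
    constructor <;> nlinarith [sq_nonneg s]

@[fun_prop] lemma continuous_gaussMoment (j : ℕ) : Continuous (gaussMoment j) :=
  continuous_iff_continuousAt.2 fun s => (hasDerivAt_gaussMoment j s).continuousAt

/-! ### The Cauchy transform of the Gaussian in the upper half-plane -/

lemma norm_cexp_I_mul_le (hz : 0 ≤ z.im) {t : ℝ} (ht : 0 ≤ t) :
    ‖cexp (I * z * t)‖ ≤ 1 := by
  rw [norm_exp]
  simp only [mul_re, I_re, zero_mul, I_im, one_mul, zero_sub, ofReal_re, ofReal_im, mul_zero,
    sub_zero, Real.exp_le_one_iff]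
  nlinarith [mul_nonneg hz ht]

lemma norm_cexp_I_mul (z : ℂ) (t : ℝ) : ‖cexp (I * z * t)‖ = rexp (-z.im * t) := by
  rw [norm_exp]; simp

/-- `i ∫₀^∞ e^{izt} (∫ pʲ e^{-ip(s+t)}) dt`, which is `⟨pʲ e^{-ips} / (p - z)⟩` for `Im z > 0`. -/
def gaussCauchy (j : ℕ) (z : ℂ) (s : ℝ) : ℂ :=
  I * ∫ t : ℝ in Ioi 0, cexp (I * z * t) * gaussMoment j (s + t)

lemma integrableOn_gaussCauchy {j : ℕ} (hj : j ≤ 2) (hz : 0 ≤ z.im) {s : ℝ} (hs : 0 ≤ s) :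
    IntegrableOn (fun t : ℝ => cexp (I * z * t) * gaussMoment j (s + t)) (Ioi 0) := by
  have hc := continuous_gaussMoment j
  refine Integrable.mono' ((integrableOn_exp_neg_Ioi 0).const_mul 20)
    (by fun_prop) ?_
  refine ae_restrict_of_forall_mem measurableSet_Ioi fun t ht => ?_
  have ht : 0 < t := ht
  rw [norm_mul]
  have h1 := norm_cexp_I_mul_le hz ht.le
  have h2 := norm_gaussMoment_le hj (add_nonneg hs ht.le)
  have h3 : rexp (-(s + t)) ≤ rexp (-t) := Real.exp_le_exp.2 (by linarith)
  calc _ ≤ 1 * (20 * rexp (-(s + t))) := mul_le_mul h1 h2 (norm_nonneg _) zero_le_one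
    _ ≤ _ := by linarith

lemma norm_gaussCauchy_le {j : ℕ} (hj : j ≤ 2) (hz : 0 ≤ z.im) {s : ℝ} (hs : 0 ≤ s) :
    ‖gaussCauchy j z s‖ ≤ 20 * rexp (-s) := by
  rw [gaussCauchy, norm_mul, norm_I, one_mul]
  have : 20 * rexp (-s) = ∫ t : ℝ in Ioi 0, 20 * rexp (-s) * rexp (-t) := by
    rw [integral_const_mul, integral_exp_neg_Ioi_zero, mul_one]
  rw [this]
  refine norm_integral_le_of_norm_le ((integrableOn_exp_neg_Ioi 0).const_mul _) ?_
  refine ae_restrict_of_forall_mem measurableSet_Ioi fun t ht => ?_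
  have ht : 0 < t := ht
  rw [norm_mul]
  have h1 := norm_cexp_I_mul_le hz ht.le
  have h2 := norm_gaussMoment_le hj (add_nonneg hs ht.le)
  calc _ ≤ 1 * (20 * rexp (-(s + t))) := mul_le_mul h1 h2 (norm_nonneg _) zero_le_one
    _ = _ := by rw [neg_add, Real.exp_add]; ring

lemma sub_ne_zero_of_im_pos (hz : 0 < z.im) (p : ℝ) : (p : ℂ) - z ≠ 0 := by
  intro h
  have := congrArg Complex.im h
  simp at this
  linarith

lemma norm_inv_sub_le (hz : 0 < z.im) (p : ℝ) : ‖((p : ℂ) - z)⁻¹‖ ≤ z.im⁻¹ := by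
  rw [norm_inv]
  refine inv_anti₀ hz ?_
  have := abs_im_le_norm ((p : ℂ) - z)
  simp only [sub_im, ofReal_im, zero_sub, abs_neg] at this
  exact (le_abs_self _).trans this

lemma inv_sub_eq_integral (hz : 0 < z.im) (p : ℝ) :
    ((p : ℂ) - z)⁻¹ = I * ∫ t : ℝ in Ioi 0, cexp (I * z * t) * cexp (-(I * p * t)) := by
  have h : ∀ t : ℝ, cexp (I * z * t) * cexp (-(I * p * t)) = cexp (-(I * (p - z)) * t) := by
    intro t; rw [← Complex.exp_add]; congr 1; ring
  simp_rw [h]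
  have hre : (-(I * (p - z))).re < 0 := by simpa using hz
  rw [integral_exp_mul_complex_Ioi hre]
  have hne := sub_ne_zero_of_im_pos hz p
  simp
  field_simp
  simp

lemma integral_moment_div (hz : 0 < z.im) (j : ℕ) (s : ℝ) :
    ∫ p : ℝ, (p : ℂ) ^ j * cexp (-(I * p * s)) / (p - z) ∂stdNormal = gaussCauchy j z s := by
  have hint : Integrable (uncurry fun (p : ℝ) (t : ℝ) =>
      (p : ℂ) ^ j * cexp (-(I * p * s)) * (cexp (I * z * t) * cexp (-(I * p * t))))
      (stdNormal.prod (volume.restrict (Ioi 0))) := by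
    have h1 : Integrable (fun x : ℝ × ℝ => |x.1| ^ j * rexp (-z.im * x.2))
        (stdNormal.prod (volume.restrict (Ioi 0))) :=
      (integrable_abs_pow_stdNormal j).mul_prod (exp_neg_integrableOn_Ioi 0 hz)
    refine h1.mono' (by unfold uncurry; fun_prop : Continuous _).aestronglyMeasurable
      (ae_of_all _ fun x => ?_)
    simp only [uncurry]
    rw [norm_mul, norm_mul, norm_mul, norm_cexp_neg_I_mul, norm_cexp_neg_I_mul, norm_cexp_I_mul]
    simp
  calc _ = ∫ p : ℝ, I * ∫ t : ℝ in Ioi 0,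
        (p : ℂ) ^ j * cexp (-(I * p * s)) * (cexp (I * z * t) * cexp (-(I * p * t)))
          ∂volume ∂stdNormal := by
        refine integral_congr_fun fun p => ?_
        rw [integral_const_mul, div_eq_mul_inv, inv_sub_eq_integral hz p]
        ring
    _ = gaussCauchy j z s := by
        rw [integral_const_mul, integral_integral_swap hint, gaussCauchy]
        congr 1
        refine integral_congr_fun fun t => ?_
        rw [gaussMoment, ← integral_const_mul]
        refine integral_congr_fun fun p => ?_
        have : cexp (-(I * p * ((s + t : ℝ) : ℂ))) = cexp (-(I * p * s)) * cexp (-(I * p * t)) := by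
          rw [← Complex.exp_add]; congr 1; push_cast; ring
        rw [this]; ring

lemma gaussCauchy_succ {j : ℕ} (hj : j ≤ 1) (hz : 0 ≤ z.im) {s : ℝ} (hs : 0 ≤ s) :
    gaussCauchy (j + 1) z s = z * gaussCauchy j z s + gaussMoment j s := by
  have h0 := integrableOn_gaussCauchy (by omega : j ≤ 2) hz hs
  have h1 := integrableOn_gaussCauchy (by omega : j + 1 ≤ 2) hz hs
  have hd : ∀ t ∈ Ici (0 : ℝ), HasDerivAt (fun t : ℝ => cexp (I * z * t) * gaussMoment j (s + t))
      (I * z * (cexp (I * z * t) * gaussMoment j (s + t))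
        + -I * (cexp (I * z * t) * gaussMoment (j + 1) (s + t))) t := by
    intro t _
    have e1 : HasDerivAt (fun t : ℝ => I * z * (t : ℂ)) (I * z * 1) t :=
      (hasDerivAt_id t).ofReal_comp.const_mul (I * z)
    have e2 : HasDerivAt (fun t : ℝ => gaussMoment j (s + t)) (-I * gaussMoment (j + 1) (s + t)) t :=
      (hasDerivAt_gaussMoment j (s + t)).comp_const_add s t
    exact (e1.cexp.mul e2).congr_deriv (by ring)
  have hlim : Tendsto (fun t : ℝ => cexp (I * z * t) * gaussMoment j (s + t)) atTop (𝓝 0) := by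
    have hl : Tendsto (fun t : ℝ => 20 * rexp (-t)) atTop (𝓝 0) := by
      simpa using (Real.tendsto_exp_neg_atTop_nhds_zero).const_mul 20
    refine squeeze_zero_norm' ?_ hl
    filter_upwards [eventually_ge_atTop 0] with t ht
    rw [norm_mul]
    have h1 := norm_cexp_I_mul_le hz ht
    have h2 := norm_gaussMoment_le (by omega : j ≤ 2) (add_nonneg hs ht)
    have h3 : rexp (-(s + t)) ≤ rexp (-t) := Real.exp_le_exp.2 (by linarith)
    calc _ ≤ 1 * (20 * rexp (-(s + t))) := mul_le_mul h1 h2 (norm_nonneg _) zero_le_one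
      _ ≤ _ := by linarith
  have h := integral_Ioi_of_hasDerivAt_of_tendsto' hd
    ((h0.const_mul (I * z)).add (h1.const_mul (-I))) hlim
  rw [integral_add (h0.const_mul (I * z)) (h1.const_mul (-I)), integral_const_mul,
    integral_const_mul] at h
  simp only [ofReal_zero, mul_zero, Complex.exp_zero, add_zero, one_mul, zero_sub] at h
  simp only [gaussCauchy]
  linear_combination -h

/-- The Cauchy transform `⟨1 / (p - z)⟩` of the standard normal law, continued to `Im z ≥ 0`. -/
def gaussJ (z : ℂ) : ℂ := gaussCauchy 0 z 0

/-- `⟨p / (p - z)⟩` for the standard normal law, continued to `Im z ≥ 0`. -/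
def gaussK (z : ℂ) : ℂ := 1 + z * gaussJ z

lemma gaussK_eq (hz : 0 ≤ z.im) : gaussK z = gaussCauchy 1 z 0 := by
  rw [gaussCauchy_succ zero_le_one hz le_rfl, gaussMoment_zero, gaussK, gaussJ]
  simp [add_comm]

lemma mul_gaussK (hz : 0 ≤ z.im) : z * gaussK z = gaussCauchy 2 z 0 := by
  rw [gaussCauchy_succ le_rfl hz le_rfl, gaussMoment_one, gaussK_eq hz]
  simp

lemma norm_gaussJ_le (hz : 0 ≤ z.im) : ‖gaussJ z‖ ≤ 20 := by
  rw [gaussJ]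
  simpa using norm_gaussCauchy_le (j := 0) (by norm_num) hz le_rfl

lemma norm_gaussK_le (hz : 0 ≤ z.im) : ‖gaussK z‖ ≤ 20 := by
  rw [gaussK_eq hz]
  simpa using norm_gaussCauchy_le (j := 1) (by norm_num) hz le_rfl

lemma norm_mul_gaussK_le (hz : 0 ≤ z.im) : ‖z‖ * ‖gaussK z‖ ≤ 20 := by
  rw [← norm_mul, mul_gaussK hz]
  simpa using norm_gaussCauchy_le (j := 2) (by norm_num) hz le_rfl

lemma integral_inv_sub (hz : 0 < z.im) :
    ∫ p : ℝ, ((p : ℂ) - z)⁻¹ ∂stdNormal = gaussJ z := by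
  rw [gaussJ, ← integral_moment_div hz]
  simp

lemma integral_div_sub (hz : 0 < z.im) :
    ∫ p : ℝ, (p : ℂ) / (p - z) ∂stdNormal = gaussK z := by
  rw [gaussK_eq hz.le, ← integral_moment_div hz]
  simp

lemma continuousOn_gaussJ : ContinuousOn gaussJ {z : ℂ | 0 ≤ z.im} := by
  intro z hz
  have hc := continuous_gaussMoment 0
  refine ContinuousWithinAt.mul continuousWithinAt_const ?_
  refine continuousWithinAt_of_dominated (bound := fun t => 20 * rexp (-t))
    (Eventually.of_forall fun x => (by fun_prop)) ?_
    ((integrableOn_exp_neg_Ioi 0).const_mul _) (ae_of_all _ fun t =>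
      (by fun_prop : Continuous _).continuousWithinAt)
  filter_upwards [self_mem_nhdsWithin] with x hx
  refine ae_restrict_of_forall_mem measurableSet_Ioi fun t ht => ?_
  have ht : 0 < t := ht
  rw [norm_mul]
  have h1 := norm_cexp_I_mul_le hx ht.le
  have h2 := norm_gaussMoment_le (j := 0) (by norm_num) (s := 0 + t) (by linarith)
  calc _ ≤ 1 * (20 * rexp (-(0 + t))) := mul_le_mul h1 h2 (norm_nonneg _) zero_le_one
    _ = _ := by simp

lemma continuousOn_gaussK : ContinuousOn gaussK {z : ℂ | 0 ≤ z.im} :=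
  continuousOn_const.add (continuousOn_id.mul continuousOn_gaussJ)

lemma gaussJ_ofReal_im (x : ℝ) :
    (gaussJ x).im = π * ((√(2 * π))⁻¹ * rexp (-x ^ 2 / 2)) := by
  have h0 : (0 : ℝ) ≤ (x : ℂ).im := by simp
  have hint := integrableOn_gaussCauchy (j := 0) (by norm_num) h0 le_rfl
  have h1 : (gaussJ x).im = ∫ t : ℝ in Ioi 0, Real.cos (x * t) * rexp (-t ^ 2 / 2) := by
    rw [gaussJ, gaussCauchy, I_mul_im, ← RCLike.re_to_complex, ← integral_re hint]
    refine integral_congr_fun fun t => ?_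
    simp only [zero_add]
    rw [gaussMoment_zero, RCLike.re_to_complex, re_mul_ofReal]
    congr 1
    have : I * x * t = ((x * t : ℝ) : ℂ) * I := by push_cast; ring
    rw [this, exp_ofReal_mul_I_re]
  have h2 : ∫ t : ℝ, Real.cos (x * t) * rexp (-t ^ 2 / 2)
      = 2 * ∫ t : ℝ in Ioi 0, Real.cos (x * t) * rexp (-t ^ 2 / 2) := by
    rw [← integral_comp_abs]
    refine integral_congr_fun fun t => ?_
    rcases abs_choice t with h | h <;> simp [h]
  have h3 : ∫ t : ℝ, Real.cos (x * t) * rexp (-t ^ 2 / 2)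
      = √(2 * π) * rexp (-x ^ 2 / 2) := by
    have hg := fourierIntegral_gaussian (b := 1 / 2) (by norm_num) x
    have hcast : ((2 * π : ℝ) : ℂ) ^ (1 / 2 : ℂ) = (√(2 * π) : ℂ) := by
      rw [Real.sqrt_eq_rpow, ofReal_cpow (by positivity)]
      norm_num
    have hr : (π / (1 / 2 : ℂ)) ^ (1 / 2 : ℂ) * cexp (-(x : ℂ) ^ 2 / (4 * (1 / 2)))
        = ((√(2 * π) * rexp (-x ^ 2 / 2) : ℝ) : ℂ) := by
      have e1 : (π / (1 / 2 : ℂ)) = ((2 * π : ℝ) : ℂ) := by push_cast; ring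
      rw [e1, hcast]
      push_cast
      congr 2
      ring
    rw [hr] at hg
    have hgi : Integrable fun t : ℝ => cexp (I * x * t) * cexp (-(1 / 2 : ℂ) * (t : ℂ) ^ 2) := by
      by_contra hni
      rw [integral_undef hni] at hg
      have hpos : 0 < √(2 * π) * rexp (-x ^ 2 / 2) := by positivity
      have := ofReal_eq_zero.1 hg.symm
      linarith
    have := congrArg Complex.re hg
    rw [← RCLike.re_to_complex, ← integral_re hgi, ofReal_re] at this
    rw [← this]
    refine integral_congr_fun fun t => ?_
    have e1 : cexp (-(1 / 2 : ℂ) * (t : ℂ) ^ 2) = (rexp (-t ^ 2 / 2) : ℂ) := by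
      push_cast; congr 1; ring
    rw [e1, RCLike.re_to_complex, re_mul_ofReal]
    congr 1
    have : I * x * t = ((x * t : ℝ) : ℂ) * I := by push_cast; ring
    rw [this, exp_ofReal_mul_I_re]
  have h4 : √(2 * π) * √(2 * π) = 2 * π :=
    Real.mul_self_sqrt (by positivity)
  have h5 : √(2 * π) ≠ 0 := by positivity
  rw [h1]
  rw [h3] at h2
  have h6 : ∫ t : ℝ in Ioi 0, Real.cos (x * t) * rexp (-t ^ 2 / 2)
      = √(2 * π) * rexp (-x ^ 2 / 2) / 2 := by linarith
  rw [h6]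
  field_simp
  linear_combination h4

/-! ### The dispersion function `1 + α ⟨p / (p - z)⟩` -/

/-- `1 + α ⟨p / (p - z)⟩`. -/
def gaussEps (α : ℝ) (z : ℂ) : ℂ := 1 + α * gaussK z

lemma gaussEps_ne_zero (hα : 0 ≤ α) (hz : 0 ≤ z.im) : gaussEps α z ≠ 0 := by
  intro h0
  rcases hz.eq_or_lt with hz0 | hz
  · obtain ⟨x, rfl⟩ : ∃ x : ℝ, z = x := ⟨z.re, by apply Complex.ext <;> simp [← hz0]⟩
    rcases eq_or_ne x 0 with rfl | hx
    · have := congrArg Complex.re h0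
      simp [gaussEps, gaussK] at this
      linarith
    · have him := congrArg Complex.im h0
      simp only [gaussEps, gaussK, add_im, one_im, im_ofReal_mul, zero_add, zero_im,
        gaussJ_ofReal_im] at him
      have hα0 : α = 0 := by
        have : x * (π * ((√(2 * π))⁻¹ * rexp (-x ^ 2 / 2))) ≠ 0 := by
          positivity
        exact (mul_eq_zero.1 him).resolve_right this
      simp [gaussEps, hα0] at h0
  · -- an eigenvector `u = -α p / (p - z)` with `⟨u⟩ = 1` contradicts self-adjointness
    set u : ℝ → ℂ := fun p => -α * (p / (p - z)) with hu
    have hne := sub_ne_zero_of_im_pos hz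
    have hcu : Continuous u := by
      rw [hu]; fun_prop (disch := exact hne _)
    have hform : ∀ p : ℝ, (p : ℂ) / (p - z) = 1 + z * ((p : ℂ) - z)⁻¹ := by
      intro p; have := hne p; field_simp; ring
    have hub : ∀ p, ‖u p‖ ≤ α * (1 + ‖z‖ * z.im⁻¹) := by
      intro p
      rw [hu]
      simp only [norm_mul, norm_neg, norm_real, Real.norm_of_nonneg hα, hform]
      refine mul_le_mul_of_nonneg_left ((norm_add_le _ _).trans ?_) hα
      rw [norm_one, norm_mul]
      gcongr
      exact norm_inv_sub_le hz p
    have hui : Integrable u stdNormal :=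
      Integrable.of_bound hcu.aestronglyMeasurable _ (ae_of_all _ hub)
    have hu2i : Integrable (fun p => u p * conj (u p)) stdNormal := by
      refine Integrable.of_bound (C := (α * (1 + ‖z‖ * z.im⁻¹)) * (α * (1 + ‖z‖ * z.im⁻¹)))
        (by fun_prop) (ae_of_all _ fun p => ?_)
      rw [norm_mul, RCLike.norm_conj]
      exact mul_le_mul (hub p) (hub p) (norm_nonneg _) ((norm_nonneg _).trans (hub p))
    have hmean : ∫ p, u p ∂stdNormal = 1 := by
      rw [hu, integral_const_mul, integral_div_sub hz]
      have : 1 + α * gaussK z = 0 := h0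
      linear_combination -this
    have hpt : ∀ p : ℝ, (p : ℂ) * ((u p + α) * conj (u p + α))
        = z * (u p * conj (u p) + α * u p) := by
      intro p
      have h1 : (p : ℂ) * (u p + α) = z * u p := by
        have := hne p
        simp only [hu]; field_simp; ring
      rw [map_add, conj_ofReal]
      linear_combination (conj (u p) + α) * h1
    have hR : ∫ p : ℝ, (p : ℂ) * ((u p + α) * conj (u p + α)) ∂stdNormal
        = ((∫ p : ℝ, p * normSq (u p + α) ∂stdNormal : ℝ) : ℂ) := by
      rw [← integral_complex_ofReal]
      refine integral_congr_fun fun p => ?_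
      simp only [mul_conj, ofReal_mul]
    have hS : ∫ p : ℝ, u p * conj (u p) ∂stdNormal
        = ((∫ p : ℝ, normSq (u p) ∂stdNormal : ℝ) : ℂ) := by
      rw [← integral_complex_ofReal]
      refine integral_congr_fun fun p => ?_
      simp only [mul_conj]
    have hmain : ((∫ p : ℝ, p * normSq (u p + α) ∂stdNormal : ℝ) : ℂ)
        = z * ((∫ p : ℝ, normSq (u p) ∂stdNormal : ℝ) + α) := by
      rw [← hR, integral_congr_ae (ae_of_all _ hpt), integral_const_mul,
        integral_add hu2i (hui.const_mul _), integral_const_mul, hmean, hS, mul_one]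
    have him := congrArg Complex.im hmain
    rw [ofReal_im, ← ofReal_add, im_mul_ofReal] at him
    have hnn : 0 ≤ ∫ p : ℝ, normSq (u p) ∂stdNormal := integral_nonneg fun p => normSq_nonneg _
    have hα0 : α = 0 := by
      rcases mul_eq_zero.1 him.symm with h | h <;> linarith
    simp [gaussEps, hα0] at h0

lemma exists_le_norm_gaussEps (A : ℝ) :
    ∃ c : ℝ, 0 < c ∧ ∀ α : ℝ, 0 ≤ α → α ≤ A → ∀ z : ℂ, 0 ≤ z.im → c ≤ ‖gaussEps α z‖ := by
  set R : ℝ := 40 * (|A| + 1) with hR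
  have hRpos : 0 < R := by positivity
  set S : Set (ℝ × ℂ) := Icc 0 |A| ×ˢ (Metric.closedBall 0 R ∩ {z : ℂ | 0 ≤ z.im}) with hS
  have hcl : IsClosed {z : ℂ | 0 ≤ z.im} := isClosed_le continuous_const continuous_im
  have hcomp : IsCompact S := isCompact_Icc.prod ((isCompact_closedBall 0 R).inter_right hcl)
  have hcont : ContinuousOn (fun q : ℝ × ℂ => ‖gaussEps q.1 q.2‖) S := by
    have h1 : ContinuousOn (fun q : ℝ × ℂ => gaussK q.2) S :=
      continuousOn_gaussK.comp continuousOn_snd fun q hq => hq.2.2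
    exact (continuousOn_const.add ((continuous_ofReal.comp continuous_fst).continuousOn.mul h1)).norm
  have hne : S.Nonempty := ⟨(0, 0), by simp [hS, hRpos.le]⟩
  obtain ⟨q, hq, hmin⟩ := hcomp.exists_isMinOn hne hcont
  have hqpos : 0 < ‖gaussEps q.1 q.2‖ := norm_pos_iff.2 (gaussEps_ne_zero hq.1.1 hq.2.2)
  refine ⟨min ‖gaussEps q.1 q.2‖ (1 / 2), by positivity, fun α h0 hA z hz => ?_⟩
  by_cases hzR : ‖z‖ ≤ R
  · have : (α, z) ∈ S := ⟨⟨h0, hA.trans (le_abs_self A)⟩, by simpa using hzR, hz⟩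
    exact (min_le_left _ _).trans (hmin this)
  · refine (min_le_right _ _).trans ?_
    push Not at hzR
    have h1 := norm_mul_gaussK_le hz
    have h2 : α * ‖gaussK z‖ ≤ 1 / 2 := by
      have hK := norm_nonneg (gaussK z)
      have h3 : R * ‖gaussK z‖ ≤ 20 := (mul_le_mul_of_nonneg_right hzR.le hK).trans h1
      have h4 : α * ‖gaussK z‖ ≤ |A| * ‖gaussK z‖ :=
        mul_le_mul_of_nonneg_right (hA.trans (le_abs_self A)) hK
      rw [hR] at h3
      nlinarith
    have h3 : ‖(α : ℂ) * gaussK z‖ ≤ 1 / 2 := by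
      rwa [norm_mul, norm_real, Real.norm_of_nonneg h0]
    have h4 := norm_sub_norm_le (1 : ℂ) (-(α * gaussK z))
    rw [sub_neg_eq_add, norm_neg, norm_one] at h4
    rw [gaussEps]
    linarith

/-! ### The linearized Vlasov evolution of the constant density -/

lemma integral_exp_neg_mul_sub_le {c : ℝ} (hc : 0 < c) (t : ℝ) :
    ∫ s in 0..t, rexp (-c * (t - s)) ≤ c⁻¹ := by
  have hd : ∀ s ∈ uIcc 0 t, HasDerivAt (fun s => c⁻¹ * rexp (-c * (t - s)))
      (rexp (-c * (t - s))) s := by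
    intro s _
    have h1 : HasDerivAt (fun s => -c * (t - s)) c s :=
      (((hasDerivAt_id s).const_sub t).const_mul (-c)).congr_deriv (by simp)
    exact (h1.exp.const_mul c⁻¹).congr_deriv (by field_simp)
  rw [intervalIntegral.integral_eq_sub_of_hasDerivAt hd
    (Continuous.intervalIntegrable (by fun_prop) _ _)]
  simp only [sub_self, mul_zero, Real.exp_zero, mul_one, sub_zero]
  have : 0 ≤ c⁻¹ * rexp (-c * t) := by positivity
  linarith

lemma exists_volterra (hα : 0 ≤ α) : ∃ r : ℝ → ℂ, Continuous r ∧ ∀ t, 0 ≤ t →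
    r t = gaussMoment 0 t - I * α * ∫ s in 0..t, gaussMoment 1 (t - s) * r s := by
  set c : ℝ := 40 * α + 1 with hc
  have hcpos : 0 < c := by positivity
  set k : (ℝ → ℂ) → ℝ → ℂ := fun y t =>
    ∫ s in 0..max t 0, (rexp (-c * (max t 0 - s)) : ℂ) * gaussMoment 1 (max t 0 - s) * y s
    with hk
  have hkbound : ∀ (y : ℝ → ℂ) (D : ℝ), Continuous y → (∀ t, ‖y t‖ ≤ D) →
      ∀ t, ‖k y t‖ ≤ 20 * D * c⁻¹ := by
    intro y D hy hD t
    have hD0 := (norm_nonneg _).trans (hD 0)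
    calc ‖k y t‖ ≤ ∫ s in 0..max t 0, 20 * D * rexp (-c * (max t 0 - s)) := by
          refine intervalIntegral.norm_integral_le_of_norm_le (le_max_right _ _) (ae_of_all _ fun s
              hs => ?_)
            (Continuous.intervalIntegrable (by fun_prop) _ _)
          have hs' : 0 ≤ max t 0 - s := by linarith [hs.2]
          have h1 := norm_gaussMoment_le (j := 1) (by norm_num) hs'
          have h2 : rexp (-(max t 0 - s)) ≤ 1 := Real.exp_le_one_iff.2 (by linarith)
          rw [norm_mul, norm_mul, norm_real, Real.norm_of_nonneg (Real.exp_pos (-c * (max t 0 -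
              s))).le]
          calc _ ≤ rexp (-c * (max t 0 - s)) * 20 * D := by
                gcongr
                · linarith
                · exact hD s
            _ = _ := by ring
      _ = 20 * D * ∫ s in 0..max t 0, rexp (-c * (max t 0 - s)) := by
          rw [intervalIntegral.integral_const_mul]
      _ ≤ _ := mul_le_mul_of_nonneg_left (integral_exp_neg_mul_sub_le hcpos _) (by positivity)
  set a : ℝ → ℂ := fun t => (rexp (-c * max t 0) : ℂ) * gaussMoment 0 (max t 0) with ha
  have habound : ∀ t, ‖a t‖ ≤ 20 := by
    intro t
    have h0 : (0 : ℝ) ≤ max t 0 := le_max_right _ _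
    have h1 := norm_gaussMoment_le (j := 0) (by norm_num) h0
    have h2 : rexp (-(max t 0)) ≤ 1 := Real.exp_le_one_iff.2 (by linarith)
    have h3 : rexp (-c * max t 0) ≤ 1 := Real.exp_le_one_iff.2 (by nlinarith)
    rw [ha]
    simp only [norm_mul, norm_real, Real.norm_of_nonneg (Real.exp_pos _).le]
    have h4 := Real.exp_pos (-c * max t 0)
    nlinarith
  let T : BoundedContinuousFunction ℝ ℂ → BoundedContinuousFunction ℝ ℂ := fun y =>
    BoundedContinuousFunction.ofNormedAddCommGroup (fun t => a t - I * α * k y t)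
      ((by rw [ha]; fun_prop : Continuous a).sub (continuous_const.mul ((by fun_prop : ∀ y : ℝ → ℂ,
          Continuous y → Continuous (k y)) y y.continuous)))
          (20 + α * (20 * ‖y‖ * c⁻¹)) (by
        refine fun t => (norm_sub_le _ _).trans (add_le_add (habound t) ?_)
        rw [norm_mul, norm_mul, norm_I, one_mul, norm_real, Real.norm_of_nonneg hα]
        exact mul_le_mul_of_nonneg_left
          (hkbound y ‖y‖ y.continuous (fun t => y.norm_coe_le_norm t) t) hα)
  have hT : ContractingWith (1 / 2) T := by
    refine ⟨by rw [← NNReal.coe_lt_coe]; norm_num, LipschitzWith.of_dist_le_mul fun y y' => ?_⟩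
    rw [BoundedContinuousFunction.dist_le (by positivity)]
    intro t
    have hsub : k y t - k y' t = k (fun s => y s - y' s) t := by
      rw [← intervalIntegral.integral_sub]
      · refine intervalIntegral.integral_congr fun s _ => ?_
        ring
      · exact Continuous.intervalIntegrable (by fun_prop) _ _
      · exact Continuous.intervalIntegrable (by fun_prop) _ _
    rw [dist_eq_norm]
    change ‖(a t - I * α * k y t) - (a t - I * α * k y' t)‖ ≤ _
    have : (a t - I * α * k y t) - (a t - I * α * k y' t) = -(I * α * (k y t - k y' t)) := by ring
    rw [this, hsub, norm_neg, norm_mul, norm_mul, norm_I, one_mul, norm_real, Real.norm_of_nonneg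
        hα]
    have h1 : α * c⁻¹ * 20 ≤ 1 / 2 := by
      rw [mul_assoc, mul_comm, mul_assoc, inv_mul_le_iff₀ hcpos, hc]; linarith
    calc _ ≤ α * (20 * dist y y' * c⁻¹) := mul_le_mul_of_nonneg_left (hkbound (fun s => y s - y' s)
        (dist y y') (by fun_prop) (fun s => by rw [← dist_eq_norm]; exact
        BoundedContinuousFunction.dist_coe_le_dist s) t) hα
      _ = (α * c⁻¹ * 20) * dist y y' := by ring
      _ ≤ (1 / 2) * dist y y' := mul_le_mul_of_nonneg_right h1 dist_nonneg
      _ = _ := by simp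
  set y := hT.fixedPoint T with hy
  refine ⟨fun t => (rexp (c * t) : ℂ) * y t, by fun_prop, fun t ht => ?_⟩
  simp only
  have e1 : (rexp (c * t) : ℂ) * a t = gaussMoment 0 t := by
    rw [ha]
    simp only [max_eq_left ht]
    rw [← mul_assoc, ← ofReal_mul, ← Real.exp_add]
    simp
  have e2 : (rexp (c * t) : ℂ) * k y t
      = ∫ s in 0..t, gaussMoment 1 (t - s) * ((rexp (c * s) : ℂ) * y s) := by
    rw [hk]
    simp only [max_eq_left ht]
    rw [← intervalIntegral.integral_const_mul]
    refine intervalIntegral.integral_congr fun s _ => ?_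
    have : rexp (c * s) = rexp (c * t) * rexp (-c * (t - s)) := by rw [← Real.exp_add]; ring_nf
    simp only [this, ofReal_mul]
    ring
  rw [(fun t => by exact (congrArg (fun f => f t) hT.fixedPoint_isFixedPt).symm : ∀ t, y t = a t -
      I * α * k y t) t, mul_sub, e1, ← e2]
  ring

open Classical in
/-- The mean `⟨h⟩` of the solution `h` of the linearized Vlasov equation
`∂_t h + i p (h + α ⟨h⟩) = 0` with initial datum `1`. -/
def respMean (α : ℝ) : ℝ → ℂ := if h : 0 ≤ α then (exists_volterra h).choose else 0

@[fun_prop] lemma continuous_respMean (α : ℝ) : Continuous (respMean α) := by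
  unfold respMean
  split_ifs with h
  · exact (exists_volterra h).choose_spec.1
  · exact continuous_const

lemma respMean_eq (hα : 0 ≤ α) {t : ℝ} (ht : 0 ≤ t) : respMean α t
    = gaussMoment 0 t - I * α * ∫ s in 0..t, gaussMoment 1 (t - s) * respMean α s := by
  have h := (exists_volterra hα).choose_spec.2 t ht
  unfold respMean
  bound

/-- The solution `h` of `∂_t h + i p (h + α ⟨h⟩) = 0` with initial datum `1`. -/
def resp (α t p : ℝ) : ℂ :=
  cexp (-(I * p * t)) * (1 - I * α * p * ∫ s in 0..t, cexp (I * p * s) * respMean α s)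

lemma resp_eq (α t p : ℝ) : resp α t p = cexp (-(I * p * t))
    - I * α * p * ∫ s in 0..t, cexp (-(I * p * (t - s : ℝ))) * respMean α s := by
  have : ∫ s in 0..t, cexp (-(I * p * (t - s : ℝ))) * respMean α s
      = cexp (-(I * p * t)) * ∫ s in 0..t, cexp (I * p * s) * respMean α s := by
    rw [← intervalIntegral.integral_const_mul]
    refine intervalIntegral.integral_congr fun s _ => ?_
    rw [← mul_assoc, ← Complex.exp_add]
    congr 2
    push_cast; ring
  rw [this, resp]
  ring

lemma continuous_resp (α : ℝ) : Continuous fun q : ℝ × ℝ => resp α q.1 q.2 := by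
  unfold resp
  fun_prop

@[fun_prop] lemma Continuous.resp {X : Type*} [TopologicalSpace X] {f g : X → ℝ} (α : ℝ) (hf : Continuous f)
    (hg : Continuous g) : Continuous fun x => resp α (f x) (g x) :=
  (continuous_resp α).comp₂ hf hg

lemma resp_zero (α p : ℝ) : resp α 0 p = 1 := by simp [resp]

lemma respMean_zero (hα : 0 ≤ α) : respMean α 0 = 1 := by
  rw [respMean_eq hα le_rfl, gaussMoment_zero]; simp

lemma hasDerivAt_resp (α t p : ℝ) :
    HasDerivAt (fun t => resp α t p) (-I * p * (resp α t p + α * respMean α t)) t := by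
  have h1 : HasDerivAt (fun t : ℝ => -(I * p * (t : ℂ))) (-(I * p * 1)) t :=
    ((hasDerivAt_id t).ofReal_comp.const_mul (I * p)).neg
  have h2 : HasDerivAt (fun t => ∫ s in 0..t, cexp (I * p * s) * respMean α s)
      (cexp (I * p * t) * respMean α t) t := by
    have hc : Continuous fun s : ℝ => cexp (I * p * s) * respMean α s := by fun_prop
    exact intervalIntegral.integral_hasDerivAt_right (hc.intervalIntegrable _ _)
      (hc.stronglyMeasurableAtFilter _ _) hc.continuousAt
  refine (h1.cexp.mul ((h2.const_mul (I * α * p)).const_sub 1)).congr_deriv ?_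
  have h4 : cexp (-(I * p * t)) * cexp (I * p * t) = 1 := by rw [← Complex.exp_add]; simp
  rw [resp]
  grind

lemma exists_norm_resp_le (α T : ℝ) : ∃ B : ℝ, 0 ≤ B ∧ ∀ t, |t| ≤ T → ‖respMean α t‖ ≤ B ∧
    ∀ p, ‖resp α t p‖ ≤ B * (1 + |p|) := by
  obtain ⟨D, hD⟩ := (isCompact_Icc).exists_bound_of_continuousOn
    (continuous_respMean α).continuousOn
  refine ⟨max 1 (max |D| (|α| * (|D| * |T|))), by positivity, fun t ht => (⟨((fun s hs => (hD s
      (abs_le.1 hs)).trans (le_abs_self _)) t ht).trans ((le_max_left _ _).trans (le_max_right _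
      _)), fun p => ?_⟩)⟩
  have h1 : ‖∫ s in 0..t, cexp (I * p * s) * respMean α s‖ ≤ |D| * |t - 0| := by
    refine intervalIntegral.norm_integral_le_of_norm_le_const fun s hs => ?_
    rw [norm_mul, (by rw [norm_exp]; simp : ‖cexp (I * p * s)‖ = 1), one_mul]
    grind
  rw [sub_zero] at h1
  have hT := ht.trans (le_abs_self _)
  have h3 : ‖I * α * p * ∫ s in 0..t, cexp (I * p * s) * respMean α s‖
      ≤ |α| * (|D| * |T|) * |p| := by
    rw [norm_mul, norm_mul, norm_mul, norm_I, norm_real, norm_real, Real.norm_eq_abs,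
      Real.norm_eq_abs, one_mul]
    calc _ ≤ |α| * |p| * (|D| * |T|) := by gcongr; exact h1.trans (by gcongr)
      _ = _ := by ring
  rw [resp, norm_mul, norm_cexp_neg_I_mul, one_mul]
  refine (norm_sub_le _ _).trans ?_
  rw [norm_one, mul_add, mul_one]
  refine add_le_add (le_max_left _ _) (h3.trans ?_)
  gcongr
  exact (le_max_right _ _).trans (le_max_right _ _)

lemma integrable_one_add_abs_pow (n : ℕ) : Integrable (fun p : ℝ => (1 + |p|) ^ n) stdNormal := by
  have h : MemLp (fun p => 1 + |p|) (n : ENNReal) stdNormal :=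
    (memLp_const (1 : ℝ)).add ((memLp_id_gaussianReal' (n : ENNReal) (by simp)).norm)
  refine (h.integrable_norm_pow').congr (ae_of_all _ fun p => ?_)
  simp only [Real.norm_eq_abs]
  grind

lemma integrable_of_le_poly {f : ℝ → ℂ} (hf : AEStronglyMeasurable f stdNormal) {c : ℝ} (h : ∀ p, ‖f p‖ ≤ c * (1 + |p|) ^ n) : Integrable f stdNormal :=
  ((integrable_one_add_abs_pow n).const_mul c).mono' hf (ae_of_all _ h)

lemma continuous_resp_right (α t : ℝ) : Continuous (resp α t) :=
  (continuous_resp α).comp (Continuous.prodMk_right t)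

/-- Differentiation of weighted means of `h`. -/
lemma hasDerivAt_integral_resp (α t : ℝ) {w : ℝ → ℂ} (hw : AEStronglyMeasurable w stdNormal) {c : ℝ}
    (hc : ∀ p, ‖w p‖ ≤ c) :
    HasDerivAt (fun t => ∫ p, resp α t p * w p ∂stdNormal)
      (∫ p : ℝ, -I * p * (resp α t p + α * respMean α t) * w p ∂stdNormal) t := by
  obtain ⟨B, hB0, hB⟩ := exists_norm_resp_le α (|t| + 1)
  have hmem : ∀ x ∈ Metric.ball t 1, |x| ≤ |t| + 1 := by
    intro x hx
    rw [Metric.mem_ball, Real.dist_eq] at hx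
    grind
  refine (hasDerivAt_integral_of_dominated_loc_of_deriv_le

    (F' := fun t p => -I * p * (resp α t p + α * respMean α t) * w p)
    (bound := fun p => (B + |α| * B) * c * (1 + |p|) ^ 2)
    (Metric.ball_mem_nhds t one_pos) ?_ ?_ ?_ ?_ ?_ ?_).2
  · exact Eventually.of_forall fun x => (continuous_resp_right α x).aestronglyMeasurable.mul hw
  · refine integrable_of_le_poly ((continuous_resp_right α t).aestronglyMeasurable.mul hw)
      (c := B * c) (n := 1) fun p => ?_
    rw [norm_mul, pow_one]
    have := (hB t (by linarith)).2 p
    calc _ ≤ B * (1 + |p|) * c := mul_le_mul this (hc p) (norm_nonneg _) (by positivity)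
      _ = _ := by ring
  · fun_prop
  · refine ae_of_all _ fun p x hx => ?_
    obtain ⟨h1, h2⟩ := hB x (hmem x hx)
    rw [norm_mul, norm_mul, norm_mul, norm_neg, norm_I, one_mul, norm_real, Real.norm_eq_abs]
    have h3 : ‖resp α x p + α * respMean α x‖ ≤ (B + |α| * B) * (1 + |p|) := by
      refine (norm_add_le _ _).trans ?_
      rw [norm_mul, norm_real, Real.norm_eq_abs, add_mul]
      refine add_le_add (h2 p) ?_
      have : 0 ≤ |α| * B * |p| := by positivity
      nlinarith [mul_le_mul_of_nonneg_left h1 (abs_nonneg α)]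
    calc |p| * ‖resp α x p + α * respMean α x‖ * ‖w p‖
        ≤ (1 + |p|) * ((B + |α| * B) * (1 + |p|)) * c := by
          gcongr
          · linarith
          · exact hc p
      _ = _ := by ring
  · exact (integrable_one_add_abs_pow 2).const_mul _
  · exact ae_of_all _ fun p x _ => (hasDerivAt_resp α x p).mul_const (w p)

/-- Weighted means of `h`. -/
lemma integral_resp_mul (α : ℝ) {t : ℝ} (ht : 0 ≤ t) (j : ℕ) {w : ℝ → ℂ}
    (hw : AEStronglyMeasurable w stdNormal) {c : ℝ} (hc : ∀ p, ‖w p‖ ≤ c) :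
    ∫ p : ℝ, (p : ℂ) ^ j * resp α t p * w p ∂stdNormal
      = ∫ p : ℝ, (p : ℂ) ^ j * cexp (-(I * p * t)) * w p ∂stdNormal - I * α * ∫ s in 0..t,
          (∫ p : ℝ, (p : ℂ) ^ (j + 1) * cexp (-(I * p * (t - s : ℝ))) * w p ∂stdNormal)
            * respMean α s := by
  obtain ⟨B, hB0, hB⟩ := exists_norm_resp_le α t
  have hint : Integrable (uncurry fun (p s : ℝ) =>
      (p : ℂ) ^ (j + 1) * cexp (-(I * p * (t - s : ℝ))) * w p * respMean α s)
      (stdNormal.prod (volume.restrict (Ioc 0 t))) := by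
    refine ((integrable_abs_pow_stdNormal (j + 1)).mul_prod (integrable_const (c * B))).mono' ?_ ?_
    · have hw' : AEStronglyMeasurable (fun x => w x.1)
        (stdNormal.prod (volume.restrict (Ioc 0 t))) := hw.comp_fst
      refine AEStronglyMeasurable.mul (AEStronglyMeasurable.mul ?_ hw') ?_
      · fun_prop
      · fun_prop
    · have : ∀ᵐ x : ℝ × ℝ ∂(stdNormal.prod (volume.restrict (Ioc 0 t))), x.2 ∈ Ioc 0 t :=
        Measure.quasiMeasurePreserving_snd.ae (ae_restrict_mem measurableSet_Ioc)
      filter_upwards [this] with x hx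
      simp only [uncurry]
      rw [norm_mul, norm_mul, norm_mul, norm_cexp_neg_I_mul, norm_pow, norm_real, Real.norm_eq_abs,
        mul_one, mul_assoc]
      exact mul_le_mul_of_nonneg_left (mul_le_mul (hc _) (hB _ (by rw [abs_of_pos hx.1]; exact
          hx.2)).1 (norm_nonneg _) ((norm_nonneg _).trans (hc 0))) (by positivity)
  have h0 : Integrable (fun p : ℝ => (p : ℂ) ^ j * cexp (-(I * p * t)) * w p) stdNormal := by
    simp_rw [mul_assoc]
    refine integrable_pow_mul_stdNormal j
      (((by fun_prop : Continuous _).aestronglyMeasurable).mul hw) (c := c) fun p => ?_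
    rw [norm_mul, ← mul_assoc, norm_cexp_neg_I_mul, one_mul]
    exact hc p
  have h1 : Integrable (fun p : ℝ => I * α * ∫ s in Ioc 0 t, (p : ℂ) ^ (j + 1)
      * cexp (-(I * p * (t - s : ℝ))) * w p * respMean α s) stdNormal :=
    (hint.integral_prod_left).const_mul _
  have heq : ∀ p : ℝ, (p : ℂ) ^ j * resp α t p * w p = (p : ℂ) ^ j * cexp (-(I * p * t)) * w p
      - I * α * ∫ s in Ioc 0 t, (p : ℂ) ^ (j + 1)
        * cexp (-(I * p * (t - s : ℝ))) * w p * respMean α s := by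
    intro p
    rw [resp_eq, intervalIntegral.integral_of_le ht]
    have : ∀ s : ℝ, (p : ℂ) ^ (j + 1) * cexp (-(I * p * (t - s : ℝ))) * w p * respMean α s
        = (p : ℂ) ^ (j + 1) * w p * (cexp (-(I * p * (t - s : ℝ))) * respMean α s) := by
      intro s; ring
    simp_rw [this]
    rw [integral_const_mul]
    ring
  rw [integral_congr_ae (ae_of_all _ heq), integral_sub h0 h1, integral_const_mul,
    integral_integral_swap hint, intervalIntegral.integral_of_le ht]
  congr 2
  refine integral_congr_fun fun s => ?_
  rw [integral_mul_const]

lemma integral_resp (hα : 0 ≤ α) {t : ℝ} (ht : 0 ≤ t) :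
    ∫ p, resp α t p ∂stdNormal = respMean α t := by
  have h := integral_resp_mul α ht 0 (w := fun _ => 1) aestronglyMeasurable_const (c := 1)
    (fun p => by simp)
  simp only [pow_zero, one_mul, mul_one, zero_add] at h
  simp [h, respMean_eq hα ht, gaussMoment]

lemma integral_mul_resp (α : ℝ) {t : ℝ} (ht : 0 ≤ t) : ∫ p : ℝ, (p : ℂ) * resp α t p ∂stdNormal
      = gaussMoment 1 t - I * α * ∫ s in 0..t, gaussMoment 2 (t - s) * respMean α s := by
  have h := integral_resp_mul α ht 1 (w := fun _ => 1) aestronglyMeasurable_const (c := 1)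
    (fun p => by simp)
  simp only [pow_one, mul_one] at h
  simp [h, gaussMoment]

lemma integral_stdNormal_id : ∫ p : ℝ, (p : ℂ) ∂stdNormal = 0 := by
  have := gaussMoment_one 0
  simpa [gaussMoment] using this

lemma integrable_pow_mul_resp (α t : ℝ) (j : ℕ) :
    Integrable (fun p : ℝ => (p : ℂ) ^ j * resp α t p) stdNormal := by
  obtain ⟨B, hB0, hB⟩ := exists_norm_resp_le α |t|
  refine integrable_of_le_poly (by fun_prop) (c := B) (n := j + 1) fun p => ?_
  have := (hB t le_rfl).2 p
  rw [norm_mul, norm_pow, norm_real, Real.norm_eq_abs, pow_succ]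
  calc _ ≤ (1 + |p|) ^ j * (B * (1 + |p|)) := by bound
    _ = _ := by ring

lemma hasDerivAt_integral_resp_one (α t : ℝ) : HasDerivAt (fun t => ∫ p, resp α t p ∂stdNormal)
      (-I * ∫ p : ℝ, (p : ℂ) * resp α t p ∂stdNormal) t := by
  have h := hasDerivAt_integral_resp α t (w := fun _ => 1) aestronglyMeasurable_const (c := 1)
    (fun p => by simp)
  simp only [mul_one] at h
  refine h.congr_deriv ?_
  have h1 := integrable_pow_mul_resp α t 1
  simp only [pow_one] at h1
  have : ∀ p : ℝ, -I * p * (resp α t p + α * respMean α t)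
      = -I * (p * resp α t p) + (-I * α * respMean α t) * p := by intro p; ring
  simp_rw [this]
  rw [integral_add (h1.const_mul _) ((by simpa using integrable_gaussMoment 1 0 : Integrable (fun p
      : ℝ => (p : ℂ)) stdNormal).const_mul _), integral_const_mul, integral_const_mul,
    integral_stdNormal_id]
  ring

lemma integrable_resp_mul_conj (α t : ℝ) :
    Integrable (fun p => resp α t p * conj (resp α t p)) stdNormal := by
  obtain ⟨B, hB0, hB⟩ := exists_norm_resp_le α |t|
  refine integrable_of_le_poly (by fun_prop) (c := B ^ 2) (n := 2) fun p => ?_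
  have := (hB t le_rfl).2 p
  rw [norm_mul, RCLike.norm_conj]
  nlinarith [norm_nonneg (resp α t p)]

/-- Conservation of the linearized Vlasov energy. -/
lemma resp_energy (hα : 0 ≤ α) {t : ℝ} (ht : 0 ≤ t) :
    ∫ p, ‖resp α t p‖ ^ 2 ∂stdNormal + α * ‖respMean α t‖ ^ 2 = 1 + α := by
  set P : ℝ → ℂ := fun t => ∫ p : ℝ, (p : ℂ) * resp α t p ∂stdNormal with hP
  set m : ℝ → ℂ := fun t => ∫ p, resp α t p ∂stdNormal with hm
  set E : ℝ → ℂ := fun t => ∫ p, resp α t p * conj (resp α t p) ∂stdNormal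
    + α * (m t * conj (m t)) with hE
  have hderiv : ∀ t, 0 ≤ t → HasDerivAt E 0 t := by
    intro t ht
    obtain ⟨B, hB0, hB⟩ := exists_norm_resp_le α (|t| + 1)
    have hmem : ∀ x ∈ Metric.ball t 1, |x| ≤ |t| + 1 := by
      intro x hx
      rw [Metric.mem_ball, Real.dist_eq] at hx
      grind
    have hd1 := (hasDerivAt_integral_of_dominated_loc_of_deriv_le

      (F' := fun t p => -I * α * respMean α t * (p * conj (resp α t p))
        + I * α * conj (respMean α t) * (p * resp α t p))
      (bound := fun p => (2 * |α| * B ^ 2) * (1 + |p|) ^ 2)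
      (Metric.ball_mem_nhds t one_pos)
      (Eventually.of_forall fun x => (integrable_resp_mul_conj α x).1)
      (integrable_resp_mul_conj α t) (by fun_prop) (by
        refine ae_of_all _ fun p x hx => ?_
        obtain ⟨h1, h2⟩ := hB x (hmem x hx)
        refine (norm_add_le _ _).trans ?_
        simp only [norm_mul, norm_neg, norm_I, one_mul, norm_real, Real.norm_eq_abs,
          RCLike.norm_conj]
        nlinarith [mul_le_mul_of_nonneg_left (by bound : ‖respMean α x‖ * (|p| * ‖resp α x p‖) ≤ B
            * ((1 + |p|) * (B * (1 + |p|)))) (abs_nonneg α)])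
      ((integrable_one_add_abs_pow 2).const_mul _) (by
        refine ae_of_all _ fun p x _ => ?_
        have h1 := hasDerivAt_resp α x p
        refine (h1.mul h1.star).congr_deriv ?_
        simp only [RCLike.star_def, map_mul, map_neg, map_add, conj_I, conj_ofReal]
        ring)).2
    have hd2 := hasDerivAt_integral_resp_one α t
    refine (hd1.add ((hd2.mul hd2.star).const_mul (α : ℂ))).congr_deriv ?_
    have i1 := integrable_pow_mul_resp α t 1
    simp only [pow_one] at i1
    have i2 : Integrable (fun p : ℝ => (p : ℂ) * conj (resp α t p)) stdNormal := by
      obtain ⟨D, hD0, hD⟩ := exists_norm_resp_le α |t|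
      refine i1.mono (by fun_prop) (ae_of_all _ fun p => ?_)
      simp
    have hconj : ∫ p : ℝ, (p : ℂ) * conj (resp α t p) ∂stdNormal = conj (P t) := by
      rw [hP, ← integral_conj]
      refine integral_congr_fun fun p => ?_
      simp
    rw [integral_add (i2.const_mul _) (i1.const_mul _), integral_const_mul, integral_const_mul,
      hconj]
    simp only [RCLike.star_def, map_mul, map_neg, conj_I, integral_resp hα ht]
    rw [hP]
    ring
  have hconst := constant_of_has_deriv_right_zero
    (fun x hx => (hderiv x hx.1).continuousAt.continuousWithinAt)
    (fun x hx => (hderiv x hx.1).hasDerivWithinAt) t ⟨ht, le_rfl⟩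
  have hm0 : ∀ s, 0 ≤ s → m s = respMean α s := fun s hs => integral_resp hα hs
  have hEeq : ∀ s, 0 ≤ s → E s
      = ((∫ p, ‖resp α s p‖ ^ 2 ∂stdNormal + α * ‖respMean α s‖ ^ 2 : ℝ) : ℂ) := by
    intro s hs
    rw [hE]
    simp only [hm0 s hs, mul_conj, normSq_eq_norm_sq]
    push_cast
    rw [← integral_complex_ofReal]
    push_cast
    rfl
  rw [hEeq t ht, hEeq 0 le_rfl] at hconst
  have := ofReal_injective hconst
  simp [this, resp_zero, respMean_zero hα]

lemma integrable_norm_resp_sq (α t : ℝ) : Integrable (fun p => ‖resp α t p‖ ^ 2) stdNormal := by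
  refine (integrable_resp_mul_conj α t).norm.congr (ae_of_all _ fun p => ?_)
  simp [sq]

lemma integral_norm_resp_sq_le (hα : 0 ≤ α) {t : ℝ} (ht : 0 ≤ t) :
    ∫ p, ‖resp α t p‖ ^ 2 ∂stdNormal ≤ 1 + α := by
  have := resp_energy hα ht
  nlinarith

lemma norm_respMean_le (hα : 0 ≤ α) {t : ℝ} (ht : 0 ≤ t) : ‖respMean α t‖ ≤ 1 := by
  have h1 := resp_energy hα ht
  have hi := integrable_pow_mul_resp α t 0
  simp only [pow_zero, one_mul] at hi
  have h2 : ‖respMean α t‖ ≤ ∫ p, ‖resp α t p‖ ∂stdNormal := by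
    rw [← integral_resp hα ht]; exact norm_integral_le_integral_norm _
  have h3 : 2 * (∫ p, ‖resp α t p‖ ∂stdNormal) * ‖respMean α t‖ ≤
      ∫ p, ‖resp α t p‖ ^ 2 ∂stdNormal + ‖respMean α t‖ ^ 2 := by
    have : ∫ p, ‖resp α t p‖ ^ 2 ∂stdNormal + ‖respMean α t‖ ^ 2
        = ∫ p, (‖resp α t p‖ ^ 2 + ‖respMean α t‖ ^ 2) ∂stdNormal := by
      rw [integral_add (integrable_norm_resp_sq α t) (integrable_const _)]; simp
    rw [this, ← integral_const_mul, ← integral_mul_const]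
    refine integral_mono ((hi.norm.const_mul 2).mul_const _)
      ((integrable_norm_resp_sq α t).add (integrable_const _)) fun p => ?_
    nlinarith [sq_nonneg (‖resp α t p‖ - ‖respMean α t‖)]
  have h4 := norm_nonneg (respMean α t)
  have h5 : ‖respMean α t‖ ^ 2 ≤ ∫ p, ‖resp α t p‖ ^ 2 ∂stdNormal := by nlinarith
  have h7 := le_of_mul_le_mul_left (by linarith : (1 + α) * ‖respMean α t‖ ^ 2 ≤ (1 + α) * 1) (by
      linarith)
  simp_all

lemma norm_resp_le (hα : 0 ≤ α) {t : ℝ} (ht : 0 ≤ t) (p : ℝ) :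
    ‖resp α t p‖ ≤ 1 + α * |p| * t := by
  have h1 : ‖∫ s in 0..t, cexp (I * p * s) * respMean α s‖ ≤ 1 * |t - 0| := by
    refine intervalIntegral.norm_integral_le_of_norm_le_const fun s hs => ?_
    rw [norm_mul, (by rw [norm_exp]; simp : ‖cexp (I * p * s)‖ = 1), one_mul]
    rw [uIoc_of_le ht] at hs
    exact norm_respMean_le hα hs.1.le
  rw [sub_zero, one_mul, abs_of_nonneg ht] at h1
  rw [resp, norm_mul, norm_cexp_neg_I_mul, one_mul]
  refine (norm_sub_le _ _).trans ?_
  rw [norm_one, norm_mul, norm_mul, norm_mul, norm_I, norm_real, norm_real, Real.norm_eq_abs,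
      Real.norm_eq_abs, one_mul, abs_of_nonneg hα]
  gcongr

/-! ### Plancherel's theorem on `L¹ ∩ L²` -/

lemma fourier_toLp_ae_eq {f : ℝ → ℂ} (hf : Integrable f) (hf2 : MemLp f 2) :
    (𝓕 (hf2.toLp f) : Lp ℂ 2 (volume : Measure ℝ)) =ᵐ[volume] 𝓕 f := by
  refine ae_eq_of_integral_contDiff_smul_eq ((Lp.memLp _).locallyIntegrable (by norm_num))
    (VectorFourier.fourierIntegral_continuous Real.continuous_fourierChar (by fun_prop)
        hf).locallyIntegrable fun g g_smooth g_cpt => ?_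
  set G : 𝓢(ℝ, ℂ) := (g_cpt.comp_left rfl : HasCompactSupport (ofRealCLM ∘ g)).toSchwartzMap (by
      fun_prop) with hG
  have h1 : ((𝓕 (hf2.toLp f) : Lp ℂ 2 (volume : Measure ℝ)) : 𝓢'(ℝ, ℂ)) G
      = ((hf2.toLp f : Lp ℂ 2 (volume : Measure ℝ)) : 𝓢'(ℝ, ℂ)) (𝓕 G) := by
    rw [← Lp.fourier_toTemperedDistribution_eq]
    rfl
  rw [Lp.toTemperedDistribution_apply, Lp.toTemperedDistribution_apply] at h1
  rw [(by bound : ∫ x, g x • (𝓕 (hf2.toLp f) : Lp ℂ 2 (volume : Measure ℝ)) x = ∫ x, G x • (𝓕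
      (hf2.toLp f) : Lp ℂ 2 (volume : Measure ℝ)) x), h1]
  have h3 : ∫ x, (𝓕 G) x • (hf2.toLp f : Lp ℂ 2 (volume : Measure ℝ)) x
      = ∫ x, (𝓕 (G : ℝ → ℂ)) x • f x := by
    refine integral_congr_ae ?_
    filter_upwards [hf2.coeFn_toLp] with x hx
    aesop
  rw [h3]
  have h4 : ∫ ξ, (𝓕 (G : ℝ → ℂ)) ξ • f ξ = ∫ x, G x • (𝓕 f) x := by
    have := VectorFourier.integral_fourierIntegral_smul_eq_flip (L := innerₗ ℝ)
      (μ := (volume : Measure ℝ))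
      Real.continuous_fourierChar continuous_inner G.integrable hf
    simpa using! this
  bound

lemma eLpNorm_fourier {f : ℝ → ℂ} (hf : Integrable f) (hf2 : MemLp f 2) :
    eLpNorm (𝓕 f) 2 volume = eLpNorm f 2 volume := by
  have h := Lp.norm_fourier_eq (hf2.toLp f)
  rw [← eLpNorm_congr_ae (fourier_toLp_ae_eq hf hf2), ← eLpNorm_congr_ae hf2.coeFn_toLp]
  rw [Lp.norm_def, Lp.norm_def] at h
  exact (ENNReal.toReal_eq_toReal_iff' (Lp.eLpNorm_ne_top _) (Lp.eLpNorm_ne_top _)).1 h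

lemma eLpNorm_le_of_fourier_le {f g : ℝ → ℂ} (hf : Integrable f) (hf2 : MemLp f 2)
    (hg : Integrable g) (hg2 : MemLp g 2) {C : ℝ} (h : ∀ ξ, ‖𝓕 f ξ‖ ≤ C * ‖𝓕 g ξ‖) :
    eLpNorm f 2 volume ≤ ENNReal.ofReal C * eLpNorm g 2 volume := by
  rw [← eLpNorm_fourier hf hf2, ← eLpNorm_fourier hg hg2]
  exact eLpNorm_le_mul_eLpNorm_of_ae_le_mul (ae_of_all _ h) 2

lemma integral_sq_le_of_fourier_le {f g : ℝ → ℂ} (hf : Integrable f) (hf2 : MemLp f 2)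
    (hg : Integrable g) (hg2 : MemLp g 2) {C : ℝ} (hC : 0 ≤ C)
    (h : ∀ ξ, ‖𝓕 f ξ‖ ≤ C * ‖𝓕 g ξ‖) :
    ∫ t, ‖f t‖ ^ 2 ≤ C ^ 2 * ∫ t, ‖g t‖ ^ 2 := by
  have e : ∀ {u : ℝ → ℂ}, MemLp u 2 → ∫ t, ‖u t‖ ^ 2 = (eLpNorm u 2 volume).toReal ^ 2 := by
    intro u hu
    rw [MemLp.eLpNorm_eq_integral_rpow_norm (by norm_num) (by norm_num) hu]
    rw [ENNReal.toReal_ofReal (by positivity), ← Real.rpow_natCast, ← Real.rpow_mul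
        (integral_nonneg fun t => by positivity)]
    simp
  rw [e hf2, e hg2, ← mul_pow]
  have h2 := ENNReal.toReal_mono (ENNReal.mul_ne_top ENNReal.ofReal_ne_top hg2.eLpNorm_ne_top)
      (eLpNorm_le_of_fourier_le hf hf2 hg hg2 h)
  rw [ENNReal.toReal_mul, ENNReal.toReal_ofReal hC] at h2
  gcongr

/-! ### Laplace transform and square integrability of `⟨h⟩` -/

lemma integrableOn_exp_mul_respMean (hα : 0 ≤ α) (hz : 0 < z.im) :
    IntegrableOn (fun t : ℝ => cexp (I * z * t) * respMean α t) (Ioi 0) := by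
  refine (exp_neg_integrableOn_Ioi 0 hz).mono' (by fun_prop) (ae_restrict_of_forall_mem
      measurableSet_Ioi fun t ht => ?_)
  rw [norm_mul, norm_cexp_I_mul]
  have := norm_respMean_le hα (le_of_lt ht)
  bound

lemma laplace_respMean (hα : 0 ≤ α) (hz : 0 < z.im) :
    gaussEps α z * ∫ t : ℝ in Ioi 0, cexp (I * z * t) * respMean α t
      = ∫ t : ℝ in Ioi 0, cexp (I * z * t) * gaussMoment 0 t := by
  have i1 : IntegrableOn (fun t : ℝ => cexp (I * z * t) * gaussMoment 1 t) (Ioi 0) := by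
    simpa using integrableOn_gaussCauchy (by norm_num) hz.le le_rfl
  have i2 := integrableOn_exp_mul_respMean hα hz
  have hconv := integral_posConvolution i2 i1 (ContinuousLinearMap.mul ℝ ℂ)
  simp only [ContinuousLinearMap.mul_apply'] at hconv
  have hpt : ∀ t ∈ Ioi (0 : ℝ), cexp (I * z * t) * gaussMoment 0 t
      = cexp (I * z * t) * respMean α t + I * α * ∫ s in 0..t, (cexp (I * z * s) * respMean α s) *
          (cexp (I * z * (t - s : ℝ)) * gaussMoment 1 (t - s)) := by
    intro t ht
    have : ∫ s in 0..t, (cexp (I * z * s) * respMean α s) *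
          (cexp (I * z * (t - s : ℝ)) * gaussMoment 1 (t - s))
        = cexp (I * z * t) * ∫ s in 0..t, gaussMoment 1 (t - s) * respMean α s := by
      rw [← intervalIntegral.integral_const_mul]
      refine intervalIntegral.integral_congr fun s _ => ?_
      have : cexp (I * z * t) = cexp (I * z * s) * cexp (I * z * (t - s : ℝ)) := by
        rw [← Complex.exp_add]; congr 1; push_cast; ring
      grind
    rw [this, respMean_eq hα (le_of_lt ht)]
    ring
  have i3 : IntegrableOn (fun t => ∫ s in 0..t, (cexp (I * z * s) * respMean α s) *
      (cexp (I * z * (t - s : ℝ)) * gaussMoment 1 (t - s))) (Ioi 0) := by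
    refine ((integrable_posConvolution i2 i1 (ContinuousLinearMap.mul ℝ ℂ)).integrableOn).congr
        (ae_restrict_of_forall_mem measurableSet_Ioi fun t ht => ?_)
    simp only [posConvolution, indicator_of_mem ht, ContinuousLinearMap.mul_apply']
  rw [setIntegral_congr_fun measurableSet_Ioi hpt, integral_add i2 (i3.const_mul _),
    integral_const_mul, hconv, gaussEps, (by rw [gaussK_eq hz.le, gaussCauchy]; simp : gaussK z = I
        * ∫ t : ℝ in Ioi 0, cexp (I * z * t) * gaussMoment 1 t)]
  ring

lemma integral_exp_mul_sq_respMean_le {c : ℝ} (hα : 0 ≤ α) (hc : 0 < c)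
    (hcε : ∀ z : ℂ, 0 ≤ z.im → c ≤ ‖gaussEps α z‖) {η : ℝ} (hη : 0 < η) :
    ∫ t : ℝ in Ioi 0, rexp (-η * t) * ‖respMean α t‖ ^ 2 ≤ 400 * c⁻¹ ^ 2 := by
  set f : ℝ → ℂ := (Ioi (0 : ℝ)).indicator fun t => (rexp (-(η / 2) * t) : ℂ) * respMean α t with hf
  set g : ℝ → ℂ := (Ioi (0 : ℝ)).indicator fun t => (rexp (-(η / 2) * t) : ℂ) * gaussMoment 0 t
    with hg
  have key : ∀ (u : ℝ → ℂ), Continuous u → (∀ t, 0 < t → ‖u t‖ ≤ 20) →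
      Integrable ((Ioi (0 : ℝ)).indicator fun t => (rexp (-(η / 2) * t) : ℂ) * u t) ∧
      MemLp ((Ioi (0 : ℝ)).indicator fun t => (rexp (-(η / 2) * t) : ℂ) * u t) 2 := by
    intro u hu hb
    have hmeas : AEStronglyMeasurable (fun t => (rexp (-(η / 2) * t) : ℂ) * u t)
      (volume.restrict (Ioi 0)) := (by fun_prop)
    constructor
    · rw [integrable_indicator_iff measurableSet_Ioi]
      refine ((exp_neg_integrableOn_Ioi 0 (by positivity : 0 < η / 2)).const_mul 20).mono' hmeas
          (ae_restrict_of_forall_mem measurableSet_Ioi fun t ht => ?_)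
      rw [norm_mul, norm_real, Real.norm_of_nonneg (Real.exp_pos _).le, mul_comm]
      bound
    · rw [memLp_indicator_iff_restrict measurableSet_Ioi, memLp_two_iff_integrable_sq_norm hmeas]
      refine ((exp_neg_integrableOn_Ioi 0 hη).const_mul 400).mono' (hmeas.norm.pow 2)
          (ae_restrict_of_forall_mem measurableSet_Ioi fun t ht => ?_)
      rw [norm_mul, norm_real, Real.norm_eq_abs (rexp _), abs_of_pos (Real.exp_pos _), mul_pow,
        (by rw [← Real.exp_nat_mul]; congr 1; push_cast; ring : rexp (-(η / 2) * t) ^ 2 = rexp (-η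
            * t)), Real.norm_of_nonneg (by positivity), mul_comm]
      exact mul_le_mul_of_nonneg_right (by nlinarith [hb t ht, norm_nonneg (u t)]) (Real.exp_pos
          _).le
  obtain ⟨hf1, hf2⟩ := key (respMean α) (continuous_respMean α) fun t ht =>
    (norm_respMean_le hα ht.le).trans (by norm_num)
  obtain ⟨hg1, hg2⟩ := key (gaussMoment 0) (continuous_gaussMoment 0) fun t ht => by
    have := norm_gaussMoment_le (j := 0) (by norm_num) ht.le
    have h2 : rexp (-t) ≤ 1 := Real.exp_le_one_iff.2 (by linarith)
    linarith
  have hfour : ∀ (u : ℝ → ℂ) (ξ : ℝ),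
      𝓕 ((Ioi (0 : ℝ)).indicator fun t => (rexp (-(η / 2) * t) : ℂ) * u t) ξ
      = ∫ t : ℝ in Ioi 0, cexp (I * ((-2 * π * ξ : ℝ) + (η / 2 : ℝ) * I) * t) * u t := by
    intro u ξ
    rw [Real.fourier_real_eq_integral_exp_smul, ← integral_indicator measurableSet_Ioi]
    refine integral_congr_fun fun t => ?_
    by_cases ht : t ∈ Ioi (0 : ℝ)
    · simp only [indicator_of_mem ht, smul_eq_mul]
      rw [ofReal_exp, ← mul_assoc, ← Complex.exp_add]
      congr 2
      push_cast
      linear_combination (-(η / 2 * t : ℂ)) * I_sq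
    · simp only [indicator_of_notMem ht, smul_zero]
  have hle : ∀ ξ, ‖𝓕 f ξ‖ ≤ c⁻¹ * ‖𝓕 g ξ‖ := by
    intro ξ
    rw [hf, hg, hfour, hfour]
    have him : 0 < (((-2 * π * ξ : ℝ) : ℂ) + (η / 2 : ℝ) * I).im := by simpa using hη
    rw [← laplace_respMean hα him, norm_mul, ← mul_assoc]
    have h1 := hcε _ him.le
    exact le_mul_of_one_le_left (norm_nonneg _) (by rw [inv_mul_eq_div, le_div_iff₀ hc]; linarith)
  have hmain := integral_sq_le_of_fourier_le hf1 hf2 hg1 hg2 (inv_nonneg.2 hc.le) hle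
  have hind : ∀ (u : ℝ → ℂ), ∫ t, ‖(Ioi (0 : ℝ)).indicator
      (fun t => (rexp (-(η / 2) * t) : ℂ) * u t) t‖ ^ 2
      = ∫ t : ℝ in Ioi 0, rexp (-η * t) * ‖u t‖ ^ 2 := by
    intro u
    rw [← integral_indicator measurableSet_Ioi]
    refine integral_congr_fun fun t => ?_
    by_cases ht : t ∈ Ioi (0 : ℝ)
    · simp only [indicator_of_mem ht]
      rw [norm_mul, norm_real, Real.norm_of_nonneg (Real.exp_pos _).le, mul_pow, ← Real.exp_nat_mul]
      congr 2
      push_cast; ring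
    · simp [indicator_of_notMem ht]
  rw [hind, hind] at hmain
  refine hmain.trans ?_
  rw [mul_comm]
  refine mul_le_mul_of_nonneg_right ?_ (by positivity)
  rw [(by rw [integral_const_mul, integral_exp_neg_Ioi_zero, mul_one] : (400 : ℝ) = ∫ t : ℝ in Ioi
      0, 400 * rexp (-t))]
  refine integral_mono_of_nonneg (ae_of_all _ fun t => by positivity) ((integrableOn_exp_neg_Ioi
      0).const_mul 400) (ae_restrict_of_forall_mem measurableSet_Ioi fun t ht => ?_)
  have ht : 0 < t := ht
  have h1 := norm_gaussMoment_le (j := 0) (by norm_num) ht.le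
  have h2 : rexp (-t) ≤ 1 := Real.exp_le_one_iff.2 (by linarith)
  have h3 : rexp (-η * t) ≤ 1 := Real.exp_le_one_iff.2 (by nlinarith)
  have h4 : ‖gaussMoment 0 t‖ ^ 2 ≤ 400 * rexp (-t) := by
    nlinarith [norm_nonneg (gaussMoment 0 t), Real.exp_pos (-t)]
  nlinarith [ Real.exp_pos (-η * t)]

/-! ### Majorants, and the weighted means entering the collision kernel -/

/-- A majorant of the weighted means of `h`, up to constants. -/
def respMaj (α t : ℝ) : ℝ :=
  20 * (rexp (-t) + α * ∫ s in 0..t, rexp (-(t - s)) * ‖respMean α s‖)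
    + ‖respMean α t‖

@[fun_prop] lemma continuous_respMaj (α : ℝ) : Continuous (respMaj α) := by
  have hr := continuous_respMean α
  have : Continuous fun t : ℝ => ∫ s in 0..t, rexp (-(t - s)) * ‖respMean α s‖ := by
    refine intervalIntegral.continuous_parametric_intervalIntegral_of_continuous ?_ continuous_id
    unfold uncurry
    fun_prop
  unfold respMaj
  fun_prop

lemma integral_exp_conv_nonneg {t : ℝ} (ht : 0 ≤ t) :
    0 ≤ ∫ s in 0..t, rexp (-(t - s)) * ‖respMean α s‖ :=
  intervalIntegral.integral_nonneg ht fun s _ => by positivity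

lemma integral_exp_conv_le {t : ℝ} (hα : 0 ≤ α) (ht : 0 ≤ t) :
    ∫ s in 0..t, rexp (-(t - s)) * ‖respMean α s‖ ≤ 1 := by
  have h := integral_exp_neg_mul_sub_le one_pos t
  simp only [neg_mul, one_mul, inv_one] at h
  refine le_trans (intervalIntegral.integral_mono_on ht ?_ ?_ fun s hs => ?_) h
  · exact Continuous.intervalIntegrable (by fun_prop) _ _
  · exact Continuous.intervalIntegrable (by fun_prop) _ _
  · exact mul_le_of_le_one_right (Real.exp_pos _).le (norm_respMean_le hα hs.1)

lemma respMaj_nonneg {t : ℝ} (hα : 0 ≤ α) (ht : 0 ≤ t) : 0 ≤ respMaj α t := by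
  have := integral_exp_conv_nonneg (α := α) ht
  unfold respMaj
  positivity

lemma respMaj_le {t : ℝ} (hα : 0 ≤ α) (ht : 0 ≤ t) : respMaj α t ≤ 21 + 20 * α := by
  have h1 := integral_exp_conv_le hα ht
  have h2 := norm_respMean_le hα ht
  have h3 : rexp (-t) ≤ 1 := Real.exp_le_one_iff.2 (by linarith)
  unfold respMaj
  nlinarith

lemma norm_le_respMaj {t : ℝ} (hα : 0 ≤ α) (ht : 0 ≤ t) : ‖respMean α t‖ ≤ respMaj α t := by
  have h1 := integral_exp_conv_nonneg (α := α) ht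
  have h3 := Real.exp_pos (-t)
  unfold respMaj
  nlinarith

/-- Convolution form of the weighted means is dominated by `respMaj`. -/
lemma norm_sub_conv_le_respMaj {t : ℝ} (hα : 0 ≤ α) (ht : 0 ≤ t) {a b : ℝ → ℂ}
    (ha : ∀ s, 0 ≤ s → ‖a s‖ ≤ 20 * rexp (-s)) (hb : ∀ s, 0 ≤ s → ‖b s‖ ≤ 20 * rexp (-s)) :
    ‖a t - I * α * ∫ s in 0..t, b (t - s) * respMean α s‖ ≤ respMaj α t := by
  have h1 : ‖∫ s in 0..t, b (t - s) * respMean α s‖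
      ≤ ∫ s in 0..t, 20 * (rexp (-(t - s)) * ‖respMean α s‖) := by
    refine intervalIntegral.norm_integral_le_of_norm_le ht (ae_of_all _ fun s hs => ?_)
      (Continuous.intervalIntegrable (by fun_prop) _ _)
    rw [norm_mul, ← mul_assoc]
    exact mul_le_mul_of_nonneg_right (hb _ (by linarith [hs.2])) (norm_nonneg _)
  rw [intervalIntegral.integral_const_mul] at h1
  refine (norm_sub_le _ _).trans ?_
  rw [norm_mul, norm_mul, norm_I, one_mul, norm_real, Real.norm_of_nonneg hα]
  have h2 := mul_le_mul_of_nonneg_left h1 hα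
  have h3 := ha t ht
  unfold respMaj
  linarith [norm_nonneg (respMean α t)]

lemma sq_integral_exp_conv_le {u : ℝ → ℝ} (hu : Continuous u) {t : ℝ} (ht : 0 ≤ t) :
    (∫ s in 0..t, rexp (-(t - s)) * u s) ^ 2 ≤ ∫ s in 0..t, rexp (-(t - s)) * u s ^ 2 := by
  set c := ∫ s in 0..t, rexp (-(t - s)) * u s with hc
  have hk := integral_exp_neg_mul_sub_le one_pos t
  simp only [neg_mul, one_mul, inv_one] at hk
  have i1 : IntervalIntegrable (fun s => rexp (-(t - s)) * u s ^ 2) volume 0 t :=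
    Continuous.intervalIntegrable (by fun_prop) _ _
  have i2 : IntervalIntegrable (fun s => rexp (-(t - s)) * u s) volume 0 t :=
    Continuous.intervalIntegrable (by fun_prop) _ _
  have h : 0 ≤ ∫ s in 0..t, rexp (-(t - s)) * (u s - c) ^ 2 :=
    intervalIntegral.integral_nonneg ht fun s _ => by positivity
  have e : ∫ s in 0..t, rexp (-(t - s)) * (u s - c) ^ 2
      = (∫ s in 0..t, rexp (-(t - s)) * u s ^ 2) - 2 * c * c
        + c ^ 2 * ∫ s in 0..t, rexp (-(t - s)) := by
    have : ∀ s : ℝ, rexp (-(t - s)) * (u s - c) ^ 2 = rexp (-(t - s)) * u s ^ 2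
        - 2 * c * (rexp (-(t - s)) * u s) + c ^ 2 * rexp (-(t - s)) := by intro s; ring
    simp_rw [this]
    rw [intervalIntegral.integral_add (i1.sub (i2.const_mul _)) ((Continuous.intervalIntegrable (by
        fun_prop) _ _).const_mul _),
      intervalIntegral.integral_sub i1 (i2.const_mul _), intervalIntegral.integral_const_mul,
      intervalIntegral.integral_const_mul]
  nlinarith

lemma exists_integral_respMaj_sq_le (A : ℝ) : ∃ C : ℝ, 0 ≤ C ∧ ∀ α, 0 ≤ α → α ≤ A → ∀ η, 0 < η →
    ∫ t : ℝ in Ioi 0, rexp (-η * t) * respMaj α t ^ 2 ≤ C := by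
  obtain ⟨c, hc, hcε⟩ := exists_le_norm_gaussEps A
  set D : ℝ := 400 * c⁻¹ ^ 2 with hD
  refine ⟨1200 + 1200 * A ^ 2 * D + 3 * D, by positivity, fun α hα hA η hη => ?_⟩
  have hr := continuous_respMean α
  have hrL2 := integral_exp_mul_sq_respMean_le hα hc (hcε α hα hA) hη
  have iρ : IntegrableOn (fun t => rexp (-η * t) * ‖respMean α t‖ ^ 2) (Ioi 0) := by
    refine (exp_neg_integrableOn_Ioi 0 hη).mono' (by fun_prop) (ae_restrict_of_forall_mem
        measurableSet_Ioi fun t ht => ?_)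
    have := norm_respMean_le hα (le_of_lt ht)
    rw [Real.norm_of_nonneg (by positivity)]
    bound
  have ie := integrableOn_exp_neg_Ioi 0
  have hconv := integral_posConvolution (μ := (volume : Measure ℝ))
    iρ ie (ContinuousLinearMap.mul ℝ ℝ)
  simp only [ContinuousLinearMap.mul_apply', integral_exp_neg_Ioi_zero, mul_one] at hconv
  have i3 : IntegrableOn (fun t => ∫ s in 0..t, (rexp (-η * s) * ‖respMean α s‖ ^ 2) *
      rexp (-(t - s))) (Ioi 0) := by
    refine ((integrable_posConvolution iρ ie (ContinuousLinearMap.mul ℝ ℝ)).integrableOn).congr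
        (ae_restrict_of_forall_mem measurableSet_Ioi fun t ht => ?_)
    simp only [posConvolution, indicator_of_mem ht, ContinuousLinearMap.mul_apply']
  have hpt : ∀ t ∈ Ioi (0 : ℝ), rexp (-η * t) * respMaj α t ^ 2 ≤ 1200 * rexp (-t)
      + 1200 * A ^ 2 * (∫ s in 0..t, (rexp (-η * s) * ‖respMean α s‖ ^ 2) *
        rexp (-(t - s))) + 3 * (rexp (-η * t) * ‖respMean α t‖ ^ 2) := by
    intro t ht
    have ht : 0 < t := ht
    set B := ∫ s in 0..t, rexp (-(t - s)) * ‖respMean α s‖ with hB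
    have h2 : rexp (-t) ≤ 1 := Real.exp_le_one_iff.2 (by linarith)
    have hBsq : rexp (-η * t) * B ^ 2 ≤ ∫ s in 0..t,
        (rexp (-η * s) * ‖respMean α s‖ ^ 2) * rexp (-(t - s)) := by
      calc _ ≤ rexp (-η * t) * ∫ s in 0..t, rexp (-(t - s)) * ‖respMean α s‖ ^ 2 :=
            mul_le_mul_of_nonneg_left (sq_integral_exp_conv_le hr.norm ht.le) (Real.exp_pos _).le
        _ ≤ _ := by
            rw [← intervalIntegral.integral_const_mul]
            refine intervalIntegral.integral_mono_on ht.le ?_ ?_ fun s hs => ?_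
            · exact Continuous.intervalIntegrable (by fun_prop) _ _
            · exact Continuous.intervalIntegrable (by fun_prop) _ _
            · have h4 : rexp (-η * t) ≤ rexp (-η * s) := Real.exp_le_exp.2 (by nlinarith [hs.2])
              have h5 : 0 ≤ rexp (-(t - s)) * ‖respMean α s‖ ^ 2 := by positivity
              nlinarith
    have h6 : respMaj α t ^ 2 ≤ 3 * (400 * rexp (-t)) + 3 * (400 * (A ^ 2 * B ^ 2))
        + 3 * ‖respMean α t‖ ^ 2 := by
      have h7 : (α * B) ^ 2 ≤ A ^ 2 * B ^ 2 := by
        rw [mul_pow]; exact mul_le_mul_of_nonneg_right (pow_le_pow_left₀ hα hA 2) (sq_nonneg B)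
      have h8 : rexp (-t) ^ 2 ≤ rexp (-t) := by nlinarith [Real.exp_pos (-t)]
      rw [(by rw [respMaj, hB]; ring : respMaj α t = 20 * rexp (-t) + 20 * (α * B) + ‖respMean α
          t‖)]
      nlinarith [
        sq_nonneg (20 * rexp (-t) - ‖respMean α t‖), sq_nonneg (20 * (α * B) - ‖respMean α t‖)]
    have h9 := mul_le_mul_of_nonneg_left h6 (Real.exp_pos (-η * t)).le
    have h10 : rexp (-η * t) * rexp (-t) ≤ rexp (-t) :=
      mul_le_of_le_one_left (Real.exp_pos _).le (Real.exp_le_one_iff.2 (by nlinarith))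
    nlinarith
  have imaj2 : IntegrableOn (fun t => 1200 * rexp (-t)
      + 1200 * A ^ 2 * (∫ s in 0..t, (rexp (-η * s) * ‖respMean α s‖ ^ 2) *
        rexp (-(t - s)))) (Ioi 0) := (ie.const_mul 1200).add (i3.const_mul (1200 * A ^ 2))
  calc _ ≤ ∫ t : ℝ in Ioi 0, (1200 * rexp (-t)
      + 1200 * A ^ 2 * (∫ s in 0..t, (rexp (-η * s) * ‖respMean α s‖ ^ 2) *
        rexp (-(t - s))) + 3 * (rexp (-η * t) * ‖respMean α t‖ ^ 2)) := by
        exact integral_mono_of_nonneg (ae_of_all _ fun t => by positivity) (imaj2.add (iρ.const_mul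
            3)) ((ae_restrict_iff' measurableSet_Ioi).2 (ae_of_all _ hpt))
    _ = 1200 + 1200 * A ^ 2 * (∫ t : ℝ in Ioi 0, rexp (-η * t) * ‖respMean α t‖ ^ 2)
        + 3 * ∫ t : ℝ in Ioi 0, rexp (-η * t) * ‖respMean α t‖ ^ 2 := by
        rw [integral_add imaj2 (iρ.const_mul 3),
          integral_add (ie.const_mul 1200) (i3.const_mul (1200 * A ^ 2)), integral_const_mul,
          integral_const_mul, integral_const_mul, integral_exp_neg_Ioi_zero, hconv, mul_one]
    _ ≤ _ := by gcongr

lemma norm_integral_mul_le_of_respMaj {C : ℝ} (hα : 0 ≤ α) (hz : 0 < z.im)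
    (hC : ∫ t : ℝ in Ioi 0, rexp (-z.im * t) * respMaj α t ^ 2 ≤ C) {u v : ℝ → ℂ} {a b : ℝ}
    (ha : 0 ≤ a) (hb : 0 ≤ b) (hu : ∀ t, 0 < t → ‖u t‖ ≤ a * respMaj α t)
    (hv : ∀ t, 0 < t → ‖v t‖ ≤ b * respMaj α t) :
    ‖∫ t : ℝ in Ioi 0, cexp (I * z * t) * (u t * v t)‖ ≤ a * b * C := by
  have hint : IntegrableOn (fun t => rexp (-z.im * t) * respMaj α t ^ 2) (Ioi 0) := by
    refine ((exp_neg_integrableOn_Ioi 0 hz).mul_const ((21 + 20 * α) ^ 2)).mono' (by fun_prop)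
        (ae_restrict_of_forall_mem measurableSet_Ioi fun t ht => ?_)
    rw [Real.norm_of_nonneg (by positivity)]
    exact mul_le_mul_of_nonneg_left (pow_le_pow_left₀ (respMaj_nonneg hα (le_of_lt ht))
      (respMaj_le hα (le_of_lt ht)) 2) (Real.exp_pos _).le
  refine (norm_integral_le_of_norm_le (hint.const_mul (a * b)) ?_).trans ?_
  · refine ae_restrict_of_forall_mem measurableSet_Ioi fun t ht => ?_
    rw [norm_mul, norm_mul, norm_cexp_I_mul]
    have h0 := respMaj_nonneg hα (le_of_lt ht)
    calc _ ≤ rexp (-z.im * t) * ((a * respMaj α t) * (b * respMaj α t)) := by bound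
      _ = _ := by ring
  · rw [integral_const_mul]
    gcongr

lemma integrableOn_one_add_mul_exp {a η : ℝ} (ha : 0 ≤ a) (hη : 0 < η) :
    IntegrableOn (fun t : ℝ => (1 + a * t) * rexp (-η * t)) (Ioi 0) := by
  refine ((exp_neg_integrableOn_Ioi 0 (by positivity : 0 < η / 2)).const_mul (1 + 2 * a / η)).mono'
      (by fun_prop) (ae_restrict_of_forall_mem measurableSet_Ioi fun t ht => ?_)
  have ht : 0 < t := ht
  rw [Real.norm_of_nonneg (by positivity), (by rw [← Real.exp_add]; ring_nf : rexp (-(η / 2) * t) =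
      rexp (η / 2 * t) * rexp (-η * t)), ← mul_assoc]
  refine mul_le_mul_of_nonneg_right ?_ (Real.exp_pos _).le
  have h1 : η / 2 * t + 1 ≤ rexp (η / 2 * t) := Real.add_one_le_exp _
  have h2 : a * t = 2 * a / η * (η / 2 * t) := by field_simp
  have h3 : 0 ≤ 2 * a / η := by positivity
  nlinarith

lemma integrable_resp_prod (hα : 0 ≤ α) (hz : 0 < z.im) {v w : ℝ → ℂ}
    (hv : Continuous v) {a c : ℝ} (ha : ∀ t, 0 < t → ‖v t‖ ≤ a)
    (hw : AEStronglyMeasurable w stdNormal) (hc : ∀ p, ‖w p‖ ≤ c) :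
    Integrable (uncurry fun (p t : ℝ) => cexp (I * z * t) * (resp α t p * v t) * w p)
      (stdNormal.prod (volume.restrict (Ioi 0))) := by
  have ha0 := (norm_nonneg _).trans (ha 1 one_pos)
  refine (((integrable_one_add_abs_pow 1).const_mul (c * a)).mul_prod (integrableOn_one_add_mul_exp
      hα hz)).mono' ?_ ?_
  · have hw' : AEStronglyMeasurable (fun x : ℝ × ℝ => w x.1)
        (stdNormal.prod (volume.restrict (Ioi 0))) := hw.comp_fst
    exact AEStronglyMeasurable.mul (by fun_prop) hw'
  · have : ∀ᵐ x : ℝ × ℝ ∂(stdNormal.prod (volume.restrict (Ioi 0))), x.2 ∈ Ioi (0 : ℝ) :=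
      Measure.quasiMeasurePreserving_snd.ae (ae_restrict_mem measurableSet_Ioi)
    filter_upwards [this] with x hx
    have hx : 0 < x.2 := hx
    simp only [uncurry]
    rw [norm_mul, norm_mul, norm_mul, norm_cexp_I_mul, pow_one]
    calc _ ≤ rexp (-z.im * x.2) * (((1 + |x.1|) * (1 + α * x.2)) * a) * c := by
          gcongr
          · exact (norm_resp_le hα hx.le x.1).trans (by nlinarith [abs_nonneg x.1])
          · exact ha _ hx
          · exact hc _
      _ = _ := by ring

/-- The normalized two-point correlation `1 + iϖ ∫₀^∞ e^{iϖt} h(t,p₁) h(t,-p₂) dt`, averaged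
over `p₂`. -/
def corrMean (α : ℝ) (z : ℂ) (p : ℝ) : ℂ :=
  1 + I * z * ∫ t : ℝ in Ioi 0, cexp (I * z * t) * (resp α t p * respMean α t)

lemma integral_corrMean_mul (hα : 0 ≤ α) (hz : 0 < z.im) {w : ℝ → ℂ} {c : ℝ}
    (hw : AEStronglyMeasurable w stdNormal) (hc : ∀ p, ‖w p‖ ≤ c) :
    ∫ p, corrMean α z p * w p ∂stdNormal = ∫ p, w p ∂stdNormal
      + I * z * ∫ t : ℝ in Ioi 0, cexp (I * z * t) *
        ((∫ p, resp α t p * w p ∂stdNormal) * respMean α t) := by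
  have hint := integrable_resp_prod hα hz (continuous_respMean α)
    (fun t ht => norm_respMean_le hα ht.le) hw hc
  have h1 : Integrable (fun p => I * z * ∫ t : ℝ in Ioi 0,
    cexp (I * z * t) * (resp α t p * respMean α t) * w p) stdNormal :=
    hint.integral_prod_left.const_mul _
  have e : ∀ p, corrMean α z p * w p = w p + I * z * ∫ t : ℝ in Ioi 0,
      cexp (I * z * t) * (resp α t p * respMean α t) * w p := by
    intro p
    rw [integral_mul_const, corrMean]
    ring
  simp_rw [e]
  rw [integral_add (Integrable.of_bound hw c (ae_of_all _ hc)) h1, integral_const_mul,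
      integral_integral_swap hint]
  congr 2
  refine integral_congr_fun fun t => ?_
  rw [← integral_mul_const, ← integral_const_mul]
  grind

lemma aestronglyMeasurable_inv_sub (hζ : 0 < ζ.im) :
    AEStronglyMeasurable (fun p : ℝ => ((p : ℂ) - ζ)⁻¹) stdNormal := by fun_prop

lemma integral_resp_inv_sub (α : ℝ) (hζ : 0 < ζ.im) (j : ℕ) {t : ℝ} (ht : 0 ≤ t) :
    ∫ p : ℝ, (p : ℂ) ^ j * resp α t p * ((p : ℂ) - ζ)⁻¹ ∂stdNormal = gaussCauchy j ζ t
      - I * α * ∫ s in 0..t, gaussCauchy (j + 1) ζ (t - s) * respMean α s := by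
  rw [integral_resp_mul α ht j (aestronglyMeasurable_inv_sub hζ) (norm_inv_sub_le hζ)]
  simp_rw [← integral_moment_div hζ, div_eq_mul_inv]

/-- The bounds on `⟨F / (p - ζ)⟩` for `F = corrMean α z`, uniform in the position of `z` and `ζ` in
the upper half-plane. -/
lemma exists_norm_integral_corrMean_le (A : ℝ) : ∃ C : ℝ, 0 ≤ C ∧ ∀ α, 0 ≤ α → α ≤ A →
    ∀ z ζ : ℂ, 0 < z.im → 0 < ζ.im →
      ‖(∫ p : ℝ, corrMean α z p * ((p : ℂ) - ζ)⁻¹ ∂stdNormal) - gaussJ ζ‖ ≤ C * ‖z‖ ∧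
      ‖∫ p : ℝ, corrMean α z p * ((p : ℂ) - ζ)⁻¹ ∂stdNormal‖ ≤ C := by
  obtain ⟨D, hD0, hD⟩ := exists_integral_respMaj_sq_le A
  refine ⟨(2 + 20 * |A|) * D, by positivity, fun α hα hA z ζ hz hζ => ?_⟩
  have hDz := hD α hα hA z.im hz
  set w : ℝ → ℂ := fun p => ((p : ℂ) - ζ)⁻¹ with hw
  have hwm := aestronglyMeasurable_inv_sub hζ
  have hwb := norm_inv_sub_le hζ
  set W : ℝ → ℂ := fun t => ∫ p, resp α t p * w p ∂stdNormal with hW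
  set W' : ℝ → ℂ := fun t => ∫ p : ℝ, -I * p * (resp α t p + α * respMean α t) * w p ∂stdNormal
    with hW'
  have hWd : ∀ t, HasDerivAt W (W' t) t := fun t => hasDerivAt_integral_resp α t hwm hwb
  have hWc := continuous_iff_continuousAt.2 fun t => (hWd t).continuousAt
  have hQ : ∫ p, corrMean α z p * w p ∂stdNormal
      = gaussJ ζ + I * z * ∫ t : ℝ in Ioi 0, cexp (I * z * t) * (W t * respMean α t) := by
    rw [integral_corrMean_mul hα hz hwm hwb, integral_inv_sub hζ]
  have hWle : ∀ t, 0 ≤ t → ‖W t‖ ≤ respMaj α t := by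
    intro t ht
    have h := integral_resp_inv_sub α hζ 0 ht
    simp only [pow_zero, one_mul, zero_add] at h
    rw [hW]
    simp only [hw]
    rw [h]
    exact norm_sub_conv_le_respMaj hα ht (fun s hs => norm_gaussCauchy_le (by norm_num) hζ.le hs)
      (fun s hs => norm_gaussCauchy_le (by norm_num) hζ.le hs)
  constructor
  · rw [hQ, add_sub_cancel_left, norm_mul, norm_mul, norm_I, one_mul, mul_comm]
    have := norm_integral_mul_le_of_respMaj hα hz hDz zero_le_one zero_le_one
      (fun t ht => by rw [one_mul]; exact hWle t ht.le)
      (fun t ht => by rw [one_mul]; exact norm_le_respMaj hα ht.le)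
    refine mul_le_mul_of_nonneg_right (this.trans ?_) (norm_nonneg _)
    nlinarith [mul_nonneg (abs_nonneg A) hD0]
  -- integrate by parts in time
  set m' : ℝ → ℂ := fun t => -I * ∫ p : ℝ, (p : ℂ) * resp α t p ∂stdNormal with hm'
  set m : ℝ → ℂ := fun t => ∫ p, resp α t p ∂stdNormal with hm
  have hmd : ∀ t, HasDerivAt m (m' t) t := fun t => hasDerivAt_integral_resp_one α t
  have hmr : ∀ t, 0 ≤ t → m t = respMean α t := fun t ht => integral_resp hα ht
  have hm'le : ∀ t, 0 ≤ t → ‖m' t‖ ≤ respMaj α t := by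
    intro t ht
    simp only [hm', norm_mul, norm_neg, norm_I, one_mul]
    rw [integral_mul_resp α ht]
    exact norm_sub_conv_le_respMaj hα ht (fun s hs => norm_gaussMoment_le (by norm_num) hs)
      (fun s hs => norm_gaussMoment_le (by norm_num) hs)
  have hW'le : ∀ t, 0 ≤ t → ‖W' t‖ ≤ (1 + 20 * |A|) * respMaj α t := by
    intro t ht
    have i1 := (integrable_pow_mul_resp α t 1).mul_bdd hwm (ae_of_all _ hwb)
    have e : W' t = -I * (∫ p : ℝ, (p : ℂ) ^ 1 * resp α t p * w p ∂stdNormal)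
        + -I * α * respMean α t * gaussK ζ := by
      rw [(by rw [← integral_div_sub hζ]; simp_rw [div_eq_mul_inv, hw] : gaussK ζ = ∫ p : ℝ, (p :
          ℂ) * w p ∂stdNormal), ← integral_const_mul, ← integral_const_mul, ← integral_add
        (i1.const_mul _) ((by simpa using integrable_pow_mul_stdNormal 1 hwm hwb : Integrable (fun
            p : ℝ => (p : ℂ) * w p) stdNormal).const_mul _)]
      refine integral_congr_fun fun p => ?_
      ring
    rw [e, add_mul, one_mul]
    refine (norm_add_le _ _).trans (add_le_add ?_ ?_)
    · rw [norm_mul, norm_neg, norm_I, one_mul, integral_resp_inv_sub α hζ 1 ht]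
      exact norm_sub_conv_le_respMaj hα ht (fun s hs => norm_gaussCauchy_le (by norm_num) hζ.le hs)
        (fun s hs => norm_gaussCauchy_le (by norm_num) hζ.le hs)
    · rw [norm_mul, norm_mul, norm_mul, norm_neg, norm_I, one_mul, norm_real, Real.norm_of_nonneg
          hα]
      have h1 := norm_le_respMaj hα ht
      have h2 := norm_gaussK_le hζ.le
      have h3 := hA.trans (le_abs_self A)
      have h0 := respMaj_nonneg hα ht
      calc _ ≤ |A| * respMaj α t * 20 := by gcongr
        _ = _ := by ring
  have hu1 : ∀ t, 0 < t → ‖W t‖ ≤ 1 * respMaj α t := fun t ht => by rw [one_mul]; exact hWle t ht.le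
  have hv1 : ∀ t, 0 < t → ‖m t‖ ≤ 1 * respMaj α t := fun t ht => by
    rw [one_mul, hmr t ht.le]; exact norm_le_respMaj hα ht.le
  have hv2 : ∀ t, 0 < t → ‖m' t‖ ≤ 1 * respMaj α t := fun t ht => by
    rw [one_mul]; exact hm'le t ht.le
  have hu2 : ∀ t, 0 < t → ‖W' t‖ ≤ (1 + 20 * |A|) * respMaj α t := fun t ht => hW'le t ht.le
  have hmc := continuous_iff_continuousAt.2 fun t => (hmd t).continuousAt
  have hW'm : Measurable W' := by
    have : W' = deriv W := funext fun t => (hWd t).deriv.symm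
    rw [this]; exact measurable_deriv W
  have hm'm : Measurable m' := by
    have : m' = deriv m := funext fun t => (hmd t).deriv.symm
    rw [this]; exact measurable_deriv m
  have hMb : ∀ t, 0 < t → respMaj α t ≤ 21 + 20 * α := fun t ht => respMaj_le hα ht.le
  have hint : ∀ (u v : ℝ → ℂ) (a b : ℝ), 0 ≤ a → 0 ≤ b → AEStronglyMeasurable u →
      AEStronglyMeasurable v →
      (∀ t, 0 < t → ‖u t‖ ≤ a * respMaj α t) → (∀ t, 0 < t → ‖v t‖ ≤ b * respMaj α t) →
      IntegrableOn (fun t : ℝ => cexp (I * z * t) * (u t * v t)) (Ioi 0) := by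
    refine fun u v a b ha hb hum hvm hu hv => ((exp_neg_integrableOn_Ioi 0 hz).mul_const ((a * (21
        + 20 * α)) * (b * (21 + 20 * α)))).mono' ?_ ?_
    · exact ((by fun_prop : Continuous fun t : ℝ => cexp (I * z * t)).aestronglyMeasurable.mul
        (hum.mul hvm)).restrict
    · refine ae_restrict_of_forall_mem measurableSet_Ioi fun t ht => ?_
      have ht := ht
      rw [norm_mul, norm_mul, norm_cexp_I_mul]
      have h1 := hMb t ht
      gcongr
      · exact (hu t ht).trans (by gcongr)
      · exact (hv t ht).trans (by gcongr)
  have iWm := hint W m 1 1 zero_le_one zero_le_one hWc.aestronglyMeasurable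
    hmc.aestronglyMeasurable hu1 hv1
  have iW'm := hint W' m _ 1 (by positivity) zero_le_one hW'm.aestronglyMeasurable
    hmc.aestronglyMeasurable hu2 hv1
  have iWm' := hint W m' 1 1 zero_le_one zero_le_one hWc.aestronglyMeasurable
    hm'm.aestronglyMeasurable hu1 hv2
  have hd : ∀ t ∈ Ici (0 : ℝ), HasDerivAt (fun t : ℝ => cexp (I * z * t) * (W t * m t))
      (I * z * (cexp (I * z * t) * (W t * m t)) + (cexp (I * z * t) * (W' t * m t)
        + cexp (I * z * t) * (W t * m' t))) t := by
    intro t _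
    have e1 : HasDerivAt (fun t : ℝ => I * z * (t : ℂ)) (I * z * 1) t :=
      (hasDerivAt_id t).ofReal_comp.const_mul (I * z)
    exact (e1.cexp.mul ((hWd t).mul (hmd t))).congr_deriv (by simp only [Pi.mul_apply]; ring)
  have hlim : Tendsto (fun t : ℝ => cexp (I * z * t) * (W t * m t)) atTop (𝓝 0) := by
    have hl : Tendsto (fun t => rexp (-z.im * t) * (21 + 20 * α) ^ 2) atTop (𝓝 0) := by
      simpa using (Real.tendsto_exp_atBot.comp (tendsto_id.const_mul_atTop_of_neg (by linarith) :
          Tendsto (fun t => -z.im * t) atTop atBot)).mul_const ((21 + 20 * α) ^ 2)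
    refine squeeze_zero_norm' ?_ hl
    filter_upwards [eventually_gt_atTop 0] with t ht
    rw [norm_mul, norm_mul, norm_cexp_I_mul, sq]
    have h1 := hMb t ht
    have h2 := hu1 t ht
    have h3 := hv1 t ht
    rw [one_mul] at h2 h3
    gcongr <;> linarith
  have isum : IntegrableOn (fun t : ℝ => cexp (I * z * t) * (W' t * m t)
      + cexp (I * z * t) * (W t * m' t)) (Ioi 0) := iW'm.add iWm'
  have hibp := integral_Ioi_of_hasDerivAt_of_tendsto' hd ((iWm.const_mul (I * z)).add isum) hlim
  rw [integral_add (iWm.const_mul (I * z)) isum, integral_const_mul, integral_add iW'm iWm'] at hibp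
  rw [(by rw [hW]; simp only [resp_zero, one_mul]; exact integral_inv_sub hζ : W 0 = gaussJ ζ), (by
      rw [hmr 0 le_rfl, respMean_zero hα] : m 0 = 1)] at hibp
  simp only [ofReal_zero, mul_zero, Complex.exp_zero, one_mul, mul_one, zero_sub] at hibp
  have hfin : ∫ p, corrMean α z p * w p ∂stdNormal
      = -((∫ t : ℝ in Ioi 0, cexp (I * z * t) * (W' t * m t))
        + ∫ t : ℝ in Ioi 0, cexp (I * z * t) * (W t * m' t)) := by
    rw [hQ, (setIntegral_congr_fun measurableSet_Ioi fun t ht => by simp only [hmr t (le_of_lt ht)]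
        : ∫ t : ℝ in Ioi 0, cexp (I * z * t) * (W t * respMean α t) = ∫ t : ℝ in Ioi 0, cexp (I * z
        * t) * (W t * m t))]
    linear_combination hibp
  have b1 := norm_integral_mul_le_of_respMaj hα hz hDz (by positivity) zero_le_one hu2 hv1
  have b2 := norm_integral_mul_le_of_respMaj hα hz hDz zero_le_one zero_le_one hu1 hv2
  rw [hfin, norm_neg]
  refine (norm_add_le _ _).trans ?_
  nlinarith

/-! ### Minkowski's integral inequality in `L²` -/

lemma eLpNorm_two_sq {X : Type*} [MeasurableSpace X] (μ : Measure X) (f : X → ℂ) :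
    eLpNorm f 2 μ ^ 2 = ∫⁻ x, ‖f x‖ₑ ^ 2 ∂μ := by
  have h := eLpNorm_nnreal_pow_eq_lintegral (μ := μ) (f := f) (p := 2) (by norm_num)
  simp_all

lemma sq_lintegral_le {X : Type*} [MeasurableSpace X] (μ : Measure X) {f φ : X → ENNReal}
    (hf : AEMeasurable f μ) (hφ : AEMeasurable φ μ) (h0 : ∀ x, φ x ≠ 0) (h1 : ∀ x, φ x ≠ ⊤) :
    (∫⁻ x, f x ∂μ) ^ 2 ≤ (∫⁻ x, φ x ∂μ) * ∫⁻ x, f x ^ 2 / φ x ∂μ := by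
  have h := ENNReal.lintegral_mul_le_Lp_mul_Lq μ Real.HolderConjugate.two_two (f := fun x => φ x ^
      (1 / 2 : ℝ))
    (g := fun x => f x / φ x ^ (1 / 2 : ℝ)) (hφ.pow_const _) (hf.div (hφ.pow_const _))
  have e1 : ∀ x, ((fun x => φ x ^ (1 / 2 : ℝ)) * fun x => f x / φ x ^ (1 / 2 : ℝ)) x = f x := by
    refine fun x => ENNReal.mul_div_cancel ?_ ?_
    · simp_all
    simp_all
  have e2 : ∀ y : ENNReal, (y ^ (1 / 2 : ℝ)) ^ (2 : ℝ) = y := fun y => by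
    rw [← ENNReal.rpow_mul]; norm_num
  have e3 : ∀ x, (f x / φ x ^ (1 / 2 : ℝ)) ^ (2 : ℝ) = f x ^ 2 / φ x := fun x => by
    rw [ENNReal.div_rpow_of_nonneg _ _ (by norm_num), e2]
    norm_num
  simp_rw [e1, e2, e3] at h
  calc _ ≤ ((∫⁻ x, φ x ∂μ) ^ (1 / 2 : ℝ) * (∫⁻ x, f x ^ 2 / φ x ∂μ) ^ (1 / 2 : ℝ)) ^ 2 :=
        pow_le_pow_left₀ (zero_le) h 2
    _ = _ := by
        rw [mul_pow, ← ENNReal.rpow_natCast, ← ENNReal.rpow_natCast]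
        simp_all

lemma eLpNorm_integral_le {X Y : Type*} [MeasurableSpace X] [MeasurableSpace Y] {μ : Measure X}
    {ν : Measure Y} [SFinite μ] [SFinite ν] {f : Y → X → ℂ}
    (hf : AEStronglyMeasurable (uncurry f) (ν.prod μ)) {φ : X → ENNReal}
    (hφ : Measurable φ) (h0 : ∀ x, φ x ≠ 0) (h1 : ∀ x, φ x ≠ ⊤)
    (hle : ∀ᵐ x ∂μ, eLpNorm (fun y => f y x) 2 ν ≤ φ x) :
    eLpNorm (fun y => ∫ x, f y x ∂μ) 2 ν ≤ ∫⁻ x, φ x ∂μ := by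
  have hsq : eLpNorm (fun y => ∫ x, f y x ∂μ) 2 ν ^ 2 ≤ (∫⁻ x, φ x ∂μ) ^ 2 := by
    rw [eLpNorm_two_sq]
    have hm : AEMeasurable (fun q => ‖f q.1 q.2‖ₑ ^ 2 / φ q.2) (ν.prod μ) :=
      (hf.enorm.pow_const 2).div (hφ.comp measurable_snd).aemeasurable
    calc _ ≤ ∫⁻ y, (∫⁻ x, φ x ∂μ) * ∫⁻ x, ‖f y x‖ₑ ^ 2 / φ x ∂μ ∂ν := by
          refine lintegral_mono_ae ?_
          filter_upwards [hf.prodMk_left] with y hy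
          exact (pow_le_pow_left₀ (zero_le) (enorm_integral_le_lintegral_enorm _) 2).trans
            (sq_lintegral_le μ hy.enorm hφ.aemeasurable h0 h1)
      _ = (∫⁻ x, φ x ∂μ) * ∫⁻ x, ∫⁻ y, ‖f y x‖ₑ ^ 2 / φ x ∂ν ∂μ := by
          rw [lintegral_const_mul'' _ hm.lintegral_prod_right', lintegral_lintegral_swap hm]
      _ ≤ (∫⁻ x, φ x ∂μ) * ∫⁻ x, φ x ∂μ := by
          refine mul_le_mul' le_rfl (lintegral_mono_ae ?_)
          filter_upwards [hle] with x hx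
          simp_rw [div_eq_mul_inv]
          rw [lintegral_mul_const' _ _ (ENNReal.inv_ne_top.2 (h0 x)), ← eLpNorm_two_sq,
            ← div_eq_mul_inv]
          refine ENNReal.div_le_of_le_mul ?_
          rw [← sq]
          gcongr
      _ = _ := (sq _).symm
  exact (ENNReal.pow_le_pow_left_iff (by norm_num)).1 hsq

lemma eLpNorm_integral_le_exp {Y : Type*} [MeasurableSpace Y]
    {ν : Measure Y} [SFinite ν] {f : Y → ℝ → ℂ}
    (hf : AEStronglyMeasurable (uncurry f) (ν.prod (volume.restrict (Ioi 0)))) {a δ : ℝ}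
    (ha : 0 < a) (hδ : 0 < δ)
    (hle : ∀ t, 0 < t → eLpNorm (fun y => f y t) 2 ν ≤ ENNReal.ofReal (a * rexp (-δ * t))) :
    eLpNorm (fun y => ∫ t : ℝ in Ioi 0, f y t) 2 ν ≤ ENNReal.ofReal (a / δ) := by
  refine (eLpNorm_integral_le hf (by fun_prop) (fun t => ?_) (fun t => ENNReal.ofReal_ne_top)
    ((ae_restrict_iff' measurableSet_Ioi).2 (ae_of_all _ hle))).trans ?_
  · positivity
  · rw [← ofReal_integral_eq_lintegral_ofReal ((exp_neg_integrableOn_Ioi 0 hδ).const_mul a)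
      (ae_of_all _ fun t => by positivity), integral_const_mul]
    refine ENNReal.ofReal_le_ofReal (le_of_eq ?_)
    rw [integral_exp_mul_Ioi (by linarith)]
    simp
    field_simp

/-! ### Velocity derivative of `h` -/

lemma eLpNorm_le_of_integral_sq_le {f : ℝ → ℂ} {c : ℝ} (hc : 0 ≤ c)
    (hi : Integrable (fun p => ‖f p‖ ^ 2) stdNormal) (h : ∫ p, ‖f p‖ ^ 2 ∂stdNormal ≤ c ^ 2) :
    eLpNorm f 2 stdNormal ≤ ENNReal.ofReal c := by
  have hsq : eLpNorm f 2 stdNormal ^ 2 ≤ ENNReal.ofReal c ^ 2 := by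
    rw [eLpNorm_two_sq, ← ENNReal.ofReal_pow hc]
    simp_rw [(fun p => by simp : ∀ p, ‖f p‖ₑ ^ 2 = ENNReal.ofReal (‖f p‖ ^ 2))]
    rw [← ofReal_integral_eq_lintegral_ofReal hi (ae_of_all _ fun p => by positivity)]
    gcongr
  exact (ENNReal.pow_le_pow_left_iff (by norm_num)).1 hsq

lemma eLpNorm_resp_le (hα : 0 ≤ α) {t : ℝ} (ht : 0 ≤ t) :
    eLpNorm (resp α t) 2 stdNormal ≤ ENNReal.ofReal (1 + α) :=
  eLpNorm_le_of_integral_sq_le (by positivity)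
    (integrable_norm_resp_sq α t) ((integral_norm_resp_sq_le hα ht).trans (by nlinarith))

/-- The derivative `∂_p h`, by Duhamel's formula. -/
def respDeriv (α t p : ℝ) : ℂ :=
  -I * ∫ s in 0..t, cexp (-(I * p * (t - s : ℝ))) * (resp α s p + α * respMean α s)

lemma respDeriv_eq (α t p : ℝ) {g : ℝ → ℂ} (hgcont : Continuous g)
    (hg : ∀ t : ℝ, g t = ∫ s in 0..t, cexp (I * p * s) * respMean α s) :
    respDeriv α t p = cexp (-(I * p * t)) * (-I * (t - I * α * p * (∫ s in 0..t, g s)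
      + α * g t)) := by
  have hpt : ∀ s : ℝ, cexp (-(I * p * (t - s : ℝ))) * (resp α s p + α * respMean α s)
      = cexp (-(I * p * t)) * ((1 - I * α * p * g s) + α * (cexp (I * p * s) * respMean α s)) := by
    intro s
    have h2 : cexp (I * p * s) * cexp (-(I * p * s)) = 1 := by rw [← Complex.exp_add]; simp
    rw [(by rw [← Complex.exp_add]; congr 1; push_cast; ring : cexp (-(I * p * (t - s : ℝ))) = cexp
        (-(I * p * t)) * cexp (I * p * s)), resp, ← hg s]
    grind
  rw [respDeriv]
  simp_rw [hpt]
  rw [intervalIntegral.integral_const_mul, intervalIntegral.integral_add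
      (Continuous.intervalIntegrable (by fun_prop) _ _)
      (Continuous.intervalIntegrable (by fun_prop) _ _),
    intervalIntegral.integral_sub (continuous_const.intervalIntegrable _ _)
        (Continuous.intervalIntegrable (by fun_prop) _ _),
    intervalIntegral.integral_const_mul, intervalIntegral.integral_const_mul, ← hg t]
  simp only [intervalIntegral.integral_const, sub_zero, real_smul, mul_one]
  ring

lemma integral_id_mul_exp_mul_respMean (α t p : ℝ) {g : ℝ → ℂ}
    (hg : ∀ t : ℝ, g t = ∫ s in 0..t, cexp (I * p * s) * respMean α s) :
    ∫ s in 0..t, I * s * (cexp (I * p * s) * respMean α s) = I * (g t * t - ∫ s in 0..t, g s) := by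
  have hgc : Continuous fun s : ℝ => cexp (I * p * s) * respMean α s := by fun_prop
  have hgd : ∀ t : ℝ, HasDerivAt g (cexp (I * p * t) * respMean α t) t := fun t => by
    rw [funext hg]
    exact intervalIntegral.integral_hasDerivAt_right (hgc.intervalIntegrable _ _)
      (hgc.stronglyMeasurableAtFilter _ _) hgc.continuousAt
  have hparts := intervalIntegral.integral_mul_deriv_eq_deriv_mul (a := 0) (b := t)
    (v := fun s => (s : ℂ)) (u' := fun s => cexp (I * p * s) * respMean α s)
    (v' := fun _ => 1) (fun x _ => hgd x) (fun x _ => (hasDerivAt_id x).ofReal_comp)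
    (hgc.intervalIntegrable _ _) (continuous_const.intervalIntegrable _ _)
  rw [show (fun s : ℝ => I * s * (cexp (I * p * s) * respMean α s))
      = fun s : ℝ => I * (cexp (I * p * s) * respMean α s * s) from funext fun s => by ring,
    intervalIntegral.integral_const_mul]
  simp_all

lemma hasDerivAt_integral_exp_mul_respMean (α t p : ℝ) :
    HasDerivAt (fun p : ℝ => ∫ s in 0..t, cexp (I * p * s) * respMean α s)
      (∫ s in 0..t, I * s * (cexp (I * p * s) * respMean α s)) p := by
  refine (intervalIntegral.hasDerivAt_integral_of_dominated_loc_of_deriv_le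
    (F' := fun (p s : ℝ) => I * s * (cexp (I * p * s) * respMean α s))
    (bound := fun s => |s| * ‖respMean α s‖) univ_mem ?_ ?_ ?_ ?_ ?_ ?_).2
  · exact Eventually.of_forall fun x => (by fun_prop)
  · exact Continuous.intervalIntegrable (by fun_prop) _ _
  · fun_prop
  · refine ae_of_all _ fun s _ x _ => ?_
    have : ‖cexp (I * x * s)‖ = 1 := by rw [norm_exp]; simp
    simp_all
  · exact Continuous.intervalIntegrable (by fun_prop) _ _
  · refine ae_of_all _ fun s _ x _ => ?_
    have e : HasDerivAt (fun x : ℝ => I * (x : ℂ) * s) (I * 1 * s) x :=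
      ((hasDerivAt_id x).ofReal_comp.const_mul I).mul_const (s : ℂ)
    exact (e.cexp.mul_const (respMean α s)).congr_deriv (by ring)

lemma hasDerivAt_resp_right (α t p : ℝ) : HasDerivAt (resp α t) (respDeriv α t p) p := by
  have e1 : HasDerivAt (fun p : ℝ => -(I * (p : ℂ) * t)) (-(I * 1 * t)) p :=
    (((hasDerivAt_id p).ofReal_comp.const_mul I).mul_const (t : ℂ)).neg
  have e2 : HasDerivAt (fun p : ℝ => I * α * (p : ℂ)) (I * α * 1) p :=
    (hasDerivAt_id p).ofReal_comp.const_mul (I * α)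
  refine (e1.cexp.mul ((e2.mul (hasDerivAt_integral_exp_mul_respMean α t p)).const_sub
      1)).congr_deriv ?_
  rw [respDeriv_eq α t p (intervalIntegral.continuous_primitive (fun a b =>
      Continuous.intervalIntegrable (by fun_prop) _ _) 0) fun _ => rfl,
    integral_id_mul_exp_mul_respMean α t p fun _ => rfl]
  simp only [Pi.mul_apply]
  ring_nf

@[fun_prop] lemma continuous_respDeriv_comp {X : Type*} [TopologicalSpace X] {f g : X → ℝ} (α : ℝ)
    (hf : Continuous f) (hg : Continuous g) : Continuous fun x => respDeriv α (f x) (g x) := by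
  have hr := continuous_respMean α
  refine continuous_const.mul
    (intervalIntegral.continuous_parametric_intervalIntegral_of_continuous ?_ hf)
  have hR : Continuous fun q : X × ℝ => resp α q.2 (g q.1) :=
    Continuous.resp α continuous_snd (hg.comp continuous_fst)
  unfold uncurry
  fun_prop

lemma norm_respDeriv_le (hα : 0 ≤ α) {t : ℝ} (ht : 0 ≤ t) (p : ℝ) :
    ‖respDeriv α t p‖ ≤ (1 + α + α * |p| * t) * t := by
  rw [respDeriv, norm_mul, norm_neg, norm_I, one_mul]
  have h : ‖∫ s in 0..t, cexp (-(I * p * (t - s : ℝ))) * (resp α s p + α * respMean α s)‖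
      ≤ (1 + α + α * |p| * t) * |t - 0| := by
    refine intervalIntegral.norm_integral_le_of_norm_le_const fun s hs => ?_
    rw [uIoc_of_le ht] at hs
    rw [norm_mul, norm_cexp_neg_I_mul, one_mul]
    refine (norm_add_le _ _).trans ?_
    rw [norm_mul, norm_real, Real.norm_of_nonneg hα]
    have h1 := norm_resp_le hα hs.1.le p
    have h2 := norm_respMean_le hα hs.1.le
    have h3 : α * |p| * s ≤ α * |p| * t := mul_le_mul_of_nonneg_left hs.2 (by positivity)
    nlinarith
  rwa [sub_zero, abs_of_nonneg ht] at h

lemma eLpNorm_respDeriv_le (hα : 0 ≤ α) {t : ℝ} (ht : 0 ≤ t) :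
    eLpNorm (respDeriv α t) 2 stdNormal ≤ ENNReal.ofReal ((1 + 2 * α) * t) := by
  have h := eLpNorm_integral_le (μ := volume.restrict (Ioc 0 t)) (ν := stdNormal)
    (f := fun p s => cexp (-(I * p * (t - s : ℝ))) * (resp α s p + α * respMean α s))
    (φ := fun _ => ENNReal.ofReal (1 + 2 * α))
    (by fun_prop)
    measurable_const (fun _ => by positivity)
    (fun _ => ENNReal.ofReal_ne_top) (by
      refine (ae_restrict_iff' measurableSet_Ioc).2 (ae_of_all _ fun s hs => ?_)
      have e : eLpNorm (fun p : ℝ => cexp (-(I * p * (t - s : ℝ))) *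
          (resp α s p + α * respMean α s)) 2 stdNormal
          = eLpNorm (fun p => resp α s p + α * respMean α s) 2 stdNormal := by
        refine eLpNorm_congr_norm_ae (ae_of_all _ fun p => ?_)
        rw [norm_mul, norm_cexp_neg_I_mul, one_mul]
      rw [e]
      refine (eLpNorm_add_le (continuous_resp_right α s).aestronglyMeasurable
        aestronglyMeasurable_const (by norm_num)).trans ?_
      rw [(by ring : (1 + 2 * α) = (1 + α) + α), ENNReal.ofReal_add (by positivity) hα]
      refine add_le_add (eLpNorm_resp_le hα hs.1.le) ((eLpNorm_le_of_integral_sq_le hα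
          (integrable_const _) ?_))
      simp only [integral_const, probReal_univ, one_smul]
      refine pow_le_pow_left₀ (norm_nonneg _) ?_ 2
      rw [norm_mul, norm_real, Real.norm_of_nonneg hα]
      exact mul_le_of_le_one_right hα (norm_respMean_le hα hs.1.le))
  rw [lintegral_const, Measure.restrict_apply_univ, Real.volume_Ioc, sub_zero,
    ← ENNReal.ofReal_mul (by positivity)] at h
  refine le_trans (le_of_eq (eLpNorm_congr_norm_ae (ae_of_all _ fun p => ?_))) h
  rw [respDeriv, norm_mul, norm_neg, norm_I, one_mul, intervalIntegral.integral_of_le ht]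

/-! ### The two-particle correlation kernel -/

lemma exists_one_add_mul_pow_mul_exp_le (n : ℕ) (a : ℝ) {η : ℝ} (ha : 0 ≤ a) (hη : 0 < η) :
    ∃ C : ℝ, ∀ t, 0 ≤ t → (1 + a * t) ^ n * rexp (-η * t) ≤ C * rexp (-(η / 2) * t) := by
  set δ : ℝ := η / (2 * (a + 1)) with hδ
  have hδa : δ * a ≤ η / 2 := by
    rw [hδ, div_mul_eq_mul_div, div_le_div_iff₀ (by positivity) (by norm_num)]
    nlinarith
  refine ⟨n.factorial / δ ^ n * rexp δ, fun t ht => ?_⟩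
  have h1 := Real.pow_div_factorial_le_exp (δ * (1 + a * t)) (by positivity) n
  rw [div_le_iff₀ (by positivity), mul_pow] at h1
  have h2 : (1 + a * t) ^ n ≤ n.factorial / δ ^ n * rexp (δ * (1 + a * t)) := by
    rw [div_mul_eq_mul_div, le_div_iff₀ (by positivity)]
    linarith
  calc _ ≤ n.factorial / δ ^ n * rexp (δ * (1 + a * t)) * rexp (-η * t) := by gcongr
    _ = n.factorial / δ ^ n * rexp (δ * (1 + a * t) + -η * t) := by rw [mul_assoc, ← Real.exp_add]
    _ ≤ n.factorial / δ ^ n * rexp (δ + -(η / 2) * t) :=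
        mul_le_mul_of_nonneg_left (Real.exp_le_exp.2 (by nlinarith)) (by positivity)
    _ = _ := by rw [Real.exp_add]; ring

lemma norm_exp_mul_resp_mul_resp_le (hα : 0 ≤ α) {t : ℝ} (ht : 0 ≤ t) (p q : ℝ) :
    ‖cexp (I * z * t) * (resp α t p * resp α t (-q))‖
      ≤ (1 + α * (|p| + |q|) * t) ^ 2 * rexp (-z.im * t) := by
  rw [norm_mul, norm_mul, norm_cexp_I_mul, mul_comm]
  gcongr
  have h1 := norm_resp_le hα ht p
  have h2 := norm_resp_le hα ht (-q)
  rw [abs_neg] at h2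
  have e1 : 1 + α * |p| * t ≤ 1 + α * (|p| + |q|) * t := by gcongr; simp
  have e2 : 1 + α * |q| * t ≤ 1 + α * (|p| + |q|) * t := by gcongr; simp
  rw [sq]
  bound

/-- `1 + i z ∫_0^∞ e^{izt} h(t, p) h(t, -q) dt`. -/
def corrKernel (α : ℝ) (z : ℂ) (p q : ℝ) : ℂ :=
  1 + I * z * ∫ t : ℝ in Ioi 0, cexp (I * z * t) * (resp α t p * resp α t (-q))

lemma integrableOn_exp_mul_resp_mul_resp (hα : 0 ≤ α) (hz : 0 < z.im) (p q : ℝ) :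
    IntegrableOn (fun t : ℝ => cexp (I * z * t) * (resp α t p * resp α t (-q))) (Ioi 0) := by
  obtain ⟨C, hC⟩ := exists_one_add_mul_pow_mul_exp_le 2 (α * (|p| + |q|)) (by positivity) hz
  exact ((exp_neg_integrableOn_Ioi 0 (half_pos hz)).const_mul C).mono' (by fun_prop)
      (ae_restrict_of_forall_mem measurableSet_Ioi (fun t ht => (norm_exp_mul_resp_mul_resp_le hα
      (le_of_lt ht) p q).trans (hC t (le_of_lt ht))))

lemma integrableOn_exp_mul_resp_mul_respMean (hα : 0 ≤ α) (hz : 0 < z.im) (p : ℝ) :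
    IntegrableOn (fun t : ℝ => cexp (I * z * t) * (resp α t p * respMean α t)) (Ioi 0) := by
  refine (integrableOn_one_add_mul_exp (a := α * |p|) (by positivity) hz).mono' (by fun_prop)
      (ae_restrict_of_forall_mem measurableSet_Ioi fun t ht => ?_)
  have ht := ht
  rw [norm_mul, norm_mul, norm_cexp_I_mul, mul_comm]
  gcongr
  exact (mul_le_of_le_one_right (norm_nonneg _) (norm_respMean_le hα ht.le)).trans
    (norm_resp_le hα ht.le p)

lemma tendsto_exp_mul_resp_mul_resp (hα : 0 ≤ α) (hz : 0 < z.im) (p q : ℝ) :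
    Tendsto (fun t : ℝ => cexp (I * z * t) * (resp α t p * resp α t (-q))) atTop (𝓝 0) := by
  obtain ⟨C, hC⟩ := exists_one_add_mul_pow_mul_exp_le 2 (α * (|p| + |q|)) (by positivity) hz
  have h0 : Tendsto (fun t => C * rexp (-(z.im / 2) * t)) atTop (𝓝 (C * 0)) :=
    (Real.tendsto_exp_atBot.comp (tendsto_id.const_mul_atTop_of_neg (by linarith))).const_mul C
  rw [mul_zero] at h0
  refine squeeze_zero_norm' ?_ h0
  filter_upwards [eventually_ge_atTop 0] with t ht
  exact (norm_exp_mul_resp_mul_resp_le hα ht p q).trans (hC t ht)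

lemma corrKernel_equation (hα : 0 ≤ α) (hz : 0 < z.im) (p q : ℝ) :
    (p - q - z) * corrKernel α z p q + α * (p * corrMean α z (-q) - q * corrMean α z p)
      = (1 + α) * (p - q) := by
  have hd : ∀ t : ℝ, HasDerivAt (fun t : ℝ => cexp (I * z * t) * (resp α t p * resp α t (-q)))
      (I * (z - (p - q)) * (cexp (I * z * t) * (resp α t p * resp α t (-q)))
        - I * α * p * (cexp (I * z * t) * (resp α t (-q) * respMean α t))
        + I * α * q * (cexp (I * z * t) * (resp α t p * respMean α t))) t := by
    intro t
    have e1 : HasDerivAt (fun t : ℝ => I * z * (t : ℂ)) (I * z * 1) t :=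
      (hasDerivAt_id t).ofReal_comp.const_mul (I * z)
    refine (e1.cexp.mul ((hasDerivAt_resp α t p).mul (hasDerivAt_resp α t (-q)))).congr_deriv ?_
    simp only [Pi.mul_apply]
    push_cast
    ring
  have j0 := (integrableOn_exp_mul_resp_mul_resp hα hz p q).const_mul (I * (z - (p - q)))
  have j1 := (integrableOn_exp_mul_resp_mul_respMean hα hz p).const_mul (I * α * q)
  have j2 := (integrableOn_exp_mul_resp_mul_respMean hα hz (-q)).const_mul (I * α * p)
  have h := integral_Ioi_of_hasDerivAt_of_tendsto' (fun t _ => hd t)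
    ((j0.sub j2).add j1) (tendsto_exp_mul_resp_mul_resp hα hz p q)
  have j3 : IntegrableOn (fun t : ℝ => I * (z - (p - q)) * (cexp (I * z * t) * (resp α t p *
      resp α t (-q))) - I * α * p * (cexp (I * z * t) * (resp α t (-q) * respMean α t))) (Ioi 0) :=
    j0.sub j2
  rw [integral_add j3 j1, integral_sub j0 j2, integral_const_mul, integral_const_mul,
    integral_const_mul] at h
  simp only [ofReal_zero, mul_zero, Complex.exp_zero, resp_zero, one_mul, zero_sub] at h
  unfold corrKernel corrMean
  grind

lemma corrKernel_symm (α : ℝ) (z : ℂ) (p q : ℝ) : corrKernel α z (-q) (-p) = corrKernel α z p q := by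
  unfold corrKernel
  simp_rw [neg_neg, mul_comm (resp α _ (-q))]

lemma measurePreserving_neg_stdNormal : MeasurePreserving (fun p : ℝ => -p) stdNormal stdNormal := by
  refine ⟨measurable_neg, ?_⟩
  have := gaussianReal_map_neg (μ := 0) (v := 1)
  simp_all

lemma integral_stdNormal_neg (f : ℝ → ℂ) : ∫ p, f (-p) ∂stdNormal = ∫ p, f p ∂stdNormal :=
  measurePreserving_neg_stdNormal.integral_comp (Homeomorph.neg ℝ).measurableEmbedding f

lemma eLpNorm_resp_neg_le (hα : 0 ≤ α) {t : ℝ} (ht : 0 ≤ t) :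
    eLpNorm (fun q => resp α t (-q)) 2 stdNormal ≤ ENNReal.ofReal (1 + α) := (le_of_eq
        (eLpNorm_comp_measurePreserving (p := 2) (continuous_resp_right α
      t).aestronglyMeasurable measurePreserving_neg_stdNormal)).trans (eLpNorm_resp_le hα ht)

lemma integrable_exp_resp_resp (hα : 0 ≤ α) (hz : 0 < z.im) (p : ℝ) :
    Integrable (uncurry fun (q t : ℝ) => cexp (I * z * t) * (resp α t q * resp α t p))
      (stdNormal.prod (volume.restrict (Ioi 0))) := by
  obtain ⟨C, hC⟩ := exists_one_add_mul_pow_mul_exp_le 1 (α * |p|) (by positivity)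
    (show 0 < z.im / 2 by positivity)
  have h := integrable_resp_prod hα (z := z / 2) (by simpa using hz)
    (v := fun t => cexp (I * (z / 2) * t) * resp α t p) (by fun_prop) (fun t ht => by
      rw [norm_mul, norm_cexp_I_mul, mul_comm]
      have h1 := norm_resp_le hα ht.le p
      have h2 := hC t ht.le
      rw [pow_one] at h2
      rw [(by simp : (z / 2).im = z.im / 2)]
      calc _ ≤ (1 + α * |p| * t) * rexp (-(z.im / 2) * t) := by gcongr
        _ ≤ _ := h2
        _ ≤ |C| * 1 := mul_le_mul (le_abs_self C) (Real.exp_le_one_iff.2 (by nlinarith))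
            (Real.exp_pos _).le (abs_nonneg _)
        _ = _ := mul_one _)
    (w := fun _ => 1) aestronglyMeasurable_const (c := 1) (fun _ => by simp)
  refine h.congr (ae_of_all _ fun x => ?_)
  simp only [uncurry]
  rw [(by rw [← Complex.exp_add]; congr 1; ring : cexp (I * z * x.2) = cexp (I * (z / 2) * x.2) *
      cexp (I * (z / 2) * x.2))]; ring

lemma integral_corrKernel_left (hα : 0 ≤ α) (hz : 0 < z.im) (q : ℝ) :
    ∫ p, corrKernel α z p q ∂stdNormal = corrMean α z (-q) := by
  have h := integrable_exp_resp_resp hα hz (-q)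
  have h1 : Integrable (fun p => I * z * ∫ t : ℝ in Ioi 0, cexp (I * z * t) *
      (resp α t p * resp α t (-q))) stdNormal := h.integral_prod_left.const_mul (I * z)
  unfold corrKernel corrMean
  rw [integral_add (integrable_const _) h1, integral_const_mul, integral_integral_swap h]
  simp only [integral_const, probReal_univ, one_smul]
  congr 2
  refine setIntegral_congr_fun measurableSet_Ioi fun t ht => ?_
  rw [integral_const_mul, integral_mul_const, integral_resp hα (le_of_lt ht), mul_comm (respMean α t)]

lemma integral_corrKernel_right (hα : 0 ≤ α) (hz : 0 < z.im) (p : ℝ) :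
    ∫ q, corrKernel α z p q ∂stdNormal = corrMean α z p := by
  have h := integral_corrKernel_left hα hz (-p)
  rw [neg_neg, ← integral_stdNormal_neg] at h
  rw [← h]
  exact integral_congr_fun fun q => (corrKernel_symm α z p q).symm

lemma stronglyMeasurable_corrKernel (α : ℝ) (z : ℂ) :
    StronglyMeasurable (uncurry (corrKernel α z)) := stronglyMeasurable_const.add
        (stronglyMeasurable_const.mul
    (by fun_prop : Continuous fun x : (ℝ × ℝ) × ℝ => cexp (I * z * x.2) * (resp α x.2 x.1.1 * resp
        α x.2 (-x.1.2))).stronglyMeasurable.integral_prod_right)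

lemma stronglyMeasurable_corrMean (α : ℝ) (z : ℂ) : StronglyMeasurable (corrMean α z) :=
    stronglyMeasurable_const.add (stronglyMeasurable_const.mul
    (by fun_prop : Continuous fun x : ℝ × ℝ => cexp (I * z * x.2) * (resp α x.2 x.1 * respMean α
        x.2)).stronglyMeasurable.integral_prod_right)

/-! ### `L²` bounds -/

lemma eLpNorm_laplace_le {Y : Type*} [MeasurableSpace Y] {ν : Measure Y} [SFinite ν]
    {f : Y → ℝ → ℂ} (hf : AEStronglyMeasurable (uncurry f)
      (ν.prod (volume.restrict (Ioi 0)))) {D : ℝ} (hD : 0 < D) (hz : 0 < z.im)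
    (hle : ∀ t, 0 < t → eLpNorm (fun y => f y t) 2 ν ≤ ENNReal.ofReal D) :
    eLpNorm (fun y => I * z * ∫ t : ℝ in Ioi 0, cexp (I * z * t) * f y t) 2 ν
      ≤ ENNReal.ofReal (D * (‖z‖ / z.im)) := by
  have hm : AEStronglyMeasurable (uncurry fun y (t : ℝ) => cexp (I * z * t) * f y t)
      (ν.prod (volume.restrict (Ioi 0))) :=
    ((by fun_prop : Continuous fun t : ℝ => cexp (I * z * t)).measurable.comp
      measurable_snd).aestronglyMeasurable.mul hf
  have h := eLpNorm_integral_le_exp hm hD hz fun t ht => by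
    refine (eLpNorm_const_smul_le (c := cexp (I * z * t))).trans ?_
    rw [← ofReal_norm, norm_cexp_I_mul, mul_comm D, ENNReal.ofReal_mul (Real.exp_pos _).le]
    bound
  refine (eLpNorm_const_smul_le (c := I * z) ).trans ?_
  rw [← ofReal_norm, norm_mul, norm_I, one_mul]
  refine (mul_le_mul' le_rfl h).trans ?_
  rw [← ENNReal.ofReal_mul (norm_nonneg _)]
  grind

lemma eLpNorm_laplace_le_of_linear {Y : Type*} [MeasurableSpace Y] {ν : Measure Y} [SFinite ν]
    {f : Y → ℝ → ℂ} (hf : AEStronglyMeasurable (uncurry f)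
      (ν.prod (volume.restrict (Ioi 0)))) {D : ℝ} (hD : 0 < D) (hz : 0 < z.im)
    (hle : ∀ t, 0 < t → eLpNorm (fun y => f y t) 2 ν ≤ ENNReal.ofReal (D * (1 + t))) :
    eLpNorm (fun y => I * z * ∫ t : ℝ in Ioi 0, cexp (I * z * t) * f y t) 2 ν
      ≤ ENNReal.ofReal (4 * D * (‖z‖ / z.im + ‖z‖ / z.im ^ 2)) := by
  have hm : AEStronglyMeasurable (uncurry fun y (t : ℝ) => cexp (I * z * t) * f y t)
      (ν.prod (volume.restrict (Ioi 0))) :=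
    ((by fun_prop : Continuous fun t : ℝ => cexp (I * z * t)).measurable.comp
      measurable_snd).aestronglyMeasurable.mul hf
  have h := eLpNorm_integral_le_exp hm (a := D * (1 + 2 / z.im)) (δ := z.im / 2) (by positivity)
    (by positivity) fun t ht => by
    refine (eLpNorm_const_smul_le (c := cexp (I * z * t))).trans ?_
    rw [← ofReal_norm, norm_cexp_I_mul]
    refine (mul_le_mul' le_rfl (hle t ht)).trans ?_
    rw [← ENNReal.ofReal_mul (Real.exp_pos _).le]
    refine ENNReal.ofReal_le_ofReal ?_
    have e1 : rexp (-(z.im / 2 * t)) * rexp (z.im / 2 * t) = 1 := by rw [← Real.exp_add]; simp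
    have e2 := Real.add_one_le_exp (z.im / 2 * t)
    have e3 : rexp (-(z.im / 2 * t)) ≤ 1 :=
      Real.exp_le_one_iff.2 (by have := mul_pos hz ht; linarith)
    have e4 : t * rexp (-(z.im / 2 * t)) ≤ 2 / z.im := by
      rw [le_div_iff₀ hz]
      nlinarith [Real.exp_pos (-(z.im / 2 * t))]
    rw [(by rw [← Real.exp_add]; congr 1; ring : rexp (-z.im * t) = rexp (-(z.im / 2) * t) * rexp
        (-(z.im / 2 * t)))]
    have e5 : (1 + t) * rexp (-(z.im / 2 * t)) ≤ 1 + 2 / z.im := by linarith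
    calc _ = D * ((1 + t) * rexp (-(z.im / 2 * t))) * rexp (-(z.im / 2) * t) := by ring
      _ ≤ _ := by gcongr
  refine (eLpNorm_const_smul_le (c := I * z) ).trans ?_
  rw [← ofReal_norm, norm_mul, norm_I, one_mul]
  refine (mul_le_mul' le_rfl h).trans ?_
  rw [← ENNReal.ofReal_mul (norm_nonneg _)]
  refine ENNReal.ofReal_le_ofReal ?_
  have : ‖z‖ * (D * (1 + 2 / z.im) / (z.im / 2))
      = 2 * D * (‖z‖ / z.im) + 4 * D * (‖z‖ / z.im ^ 2) := by field_simp; ring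
  rw [this]
  have : 0 ≤ D * (‖z‖ / z.im) := by positivity
  linarith

lemma eLpNorm_mul_prod {X Y : Type*} [MeasurableSpace X] [MeasurableSpace Y] {μ : Measure X}
    {ν : Measure Y} [SFinite ν] {f : X → ℂ} {g : Y → ℂ} (hf : AEStronglyMeasurable f μ)
    (hg : AEStronglyMeasurable g ν) :
    eLpNorm (fun x : X × Y => f x.1 * g x.2) 2 (μ.prod ν) = eLpNorm f 2 μ * eLpNorm g 2 ν := by
  have h : eLpNorm (fun x => f x.1 * g x.2) 2 (μ.prod ν) ^ 2
      = (eLpNorm f 2 μ * eLpNorm g 2 ν) ^ 2 := by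
    rw [mul_pow, eLpNorm_two_sq, eLpNorm_two_sq, eLpNorm_two_sq,
      ← lintegral_prod_mul (hf.enorm.pow_const 2) (hg.enorm.pow_const 2)]
    simp_rw [enorm_mul, mul_pow]
  exact le_antisymm ((ENNReal.pow_le_pow_left_iff two_ne_zero).1 h.le)
    ((ENNReal.pow_le_pow_left_iff two_ne_zero).1 h.ge)

lemma eLpNorm_corrKernel_le (hα : 0 ≤ α) (hz : 0 < z.im) :
    eLpNorm (fun x : ℝ × ℝ => corrKernel α z x.1 x.2) 2 (stdNormal.prod stdNormal)
      ≤ ENNReal.ofReal (1 + (1 + α) ^ 2 * (‖z‖ / z.im)) := by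
  have h := eLpNorm_laplace_le (f := fun (x : ℝ × ℝ) (t : ℝ) => resp α t x.1 * resp α t (-x.2))
    (by unfold uncurry; exact ((Continuous.resp α continuous_snd (by fun_prop)).mul
        (Continuous.resp α continuous_snd (by
        fun_prop))).aestronglyMeasurable) (D := (1 + α) ^ 2)
    (by positivity) hz fun t ht => by
      rw [eLpNorm_mul_prod (continuous_resp_right α t).aestronglyMeasurable (Continuous.resp α
          continuous_const continuous_neg).aestronglyMeasurable
          (μ := stdNormal) (ν := stdNormal), sq, ENNReal.ofReal_mul (by positivity)]
      exact mul_le_mul' (eLpNorm_resp_le hα ht.le) (eLpNorm_resp_neg_le hα ht.le)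
  refine (eLpNorm_add_le aestronglyMeasurable_const ?_ (by norm_num)).trans ?_
  · have := (stronglyMeasurable_corrKernel α z).sub (stronglyMeasurable_const (b := (1 : ℂ)))
    refine this.aestronglyMeasurable.congr (ae_of_all _ fun x => ?_)
    simp [uncurry, corrKernel]
  · rw [ENNReal.ofReal_add (by norm_num) (by positivity)]
    refine add_le_add ?_ h
    rw [eLpNorm_const' _ (by norm_num) (by norm_num)]
    simp

lemma memLp_pow_stdNormal (j : ℕ) : MemLp (fun p : ℝ => (p : ℂ) ^ j) 2 stdNormal := by
  refine (memLp_two_iff_integrable_sq_norm (by fun_prop : Continuous fun p : ℝ => (p : ℂ) ^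
      j).aestronglyMeasurable).2 ((integrable_abs_pow_stdNormal (j * 2)).congr (ae_of_all _ fun p
      => ?_))
  simp [pow_mul]

lemma exists_eLpNorm_mul_resp_le (A : ℝ) : ∃ D : ℝ, 0 < D ∧
    eLpNorm (fun p : ℝ => (p : ℂ)) 2 stdNormal ≤ ENNReal.ofReal D ∧ ∀ α, 0 ≤ α → α ≤ A → ∀ t, 0 < t
        →
      eLpNorm (fun p : ℝ => (p : ℂ) * resp α t p) 2 stdNormal ≤ ENNReal.ofReal (D * (1 + t)) := by
  set D : ℝ := (eLpNorm (fun p : ℝ => (p : ℂ) ^ 1) 2 stdNormal).toReal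
    + (eLpNorm (fun p : ℝ => (p : ℂ) ^ 2) 2 stdNormal).toReal + 1 with hD
  have hD1 : eLpNorm (fun p : ℝ => (p : ℂ) ^ 1) 2 stdNormal ≤ ENNReal.ofReal D := by
    rw [← ENNReal.ofReal_toReal (memLp_pow_stdNormal 1).2.ne]
    exact ENNReal.ofReal_le_ofReal (by rw [hD, add_assoc]; simp; positivity)
  have hD2 : eLpNorm (fun p : ℝ => (p : ℂ) ^ 2) 2 stdNormal ≤ ENNReal.ofReal D := by
    rw [← ENNReal.ofReal_toReal (memLp_pow_stdNormal 2).2.ne]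
    refine ENNReal.ofReal_le_ofReal ?_
    have : 0 ≤ (eLpNorm (fun p : ℝ => (p : ℂ) ^ 1) 2 stdNormal).toReal := by positivity
    rw [hD]; linarith
  have hD0 : 0 < D := by positivity
  refine ⟨(1 + |A|) * D, by positivity, ?_, fun α hα hA t ht => ?_⟩
  · simp only [pow_one] at hD1
    exact hD1.trans (ENNReal.ofReal_le_ofReal (by simp_all))
  have e : (fun p : ℝ => (p : ℂ) * resp α t p) = fun p : ℝ => (cexp (-(I * p * t)) * (p : ℂ) ^ 1)
      - I * α * ∫ s in Ioc 0 t, cexp (-(I * p * (t - s : ℝ))) * (p : ℂ) ^ 2 * respMean α s := by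
    funext p
    rw [resp_eq, ← intervalIntegral.integral_of_le ht.le,
      show (fun s : ℝ => cexp (-(I * p * (t - s : ℝ))) * (p : ℂ) ^ 2 * respMean α s)
        = fun s : ℝ => (p : ℂ) ^ 2 * (cexp (-(I * p * (t - s : ℝ))) * respMean α s) from
        funext fun s => by ring, intervalIntegral.integral_const_mul]
    ring
  have h := eLpNorm_integral_le (μ := volume.restrict (Ioc 0 t)) (ν := stdNormal)
    (f := fun p s => cexp (-(I * p * (t - s : ℝ))) * (p : ℂ) ^ 2 * respMean α s)
    (φ := fun _ => ENNReal.ofReal D)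
    (by unfold uncurry; exact (by fun_prop))
    measurable_const (fun _ => by rw [Ne, ENNReal.ofReal_eq_zero, not_le]; positivity)
    (fun _ => ENNReal.ofReal_ne_top) (by
      refine (ae_restrict_iff' measurableSet_Ioc).2 (ae_of_all _ fun s hs => ((eLpNorm_mono fun p
          => ?_).trans hD2))
      rw [norm_mul, norm_mul, norm_cexp_neg_I_mul, one_mul]
      exact mul_le_of_le_one_right (norm_nonneg _) (norm_respMean_le hα hs.1.le))
  rw [lintegral_const, Measure.restrict_apply_univ, Real.volume_Ioc, sub_zero,
    ← ENNReal.ofReal_mul (by positivity)] at h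
  have hF : Continuous fun p : ℝ => ∫ s in Ioc 0 t,
      cexp (-(I * p * (t - s : ℝ))) * (p : ℂ) ^ 2 * respMean α s := by
    simp_rw [← intervalIntegral.integral_of_le ht.le]
    refine intervalIntegral.continuous_parametric_intervalIntegral_of_continuous ?_ continuous_const
    fun_prop
  rw [e]
  refine (eLpNorm_sub_le (by fun_prop : Continuous fun p : ℝ => cexp (-(I * p * t)) * (p : ℂ) ^
      1).aestronglyMeasurable
    (continuous_const.mul hF).aestronglyMeasurable (by norm_num)).trans ?_
  have b1 : eLpNorm (fun p : ℝ => cexp (-(I * p * t)) * (p : ℂ) ^ 1) 2 stdNormal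
      ≤ ENNReal.ofReal D := by
    refine (eLpNorm_mono fun p => ?_).trans hD1
    rw [norm_mul, norm_cexp_neg_I_mul, one_mul]
  have b2 : eLpNorm (fun p : ℝ => I * α * ∫ s in Ioc 0 t,
      cexp (-(I * p * (t - s : ℝ))) * (p : ℂ) ^ 2 * respMean α s) 2 stdNormal
      ≤ ENNReal.ofReal (α * (D * t)) := by
    refine (eLpNorm_const_smul_le (c := I * (α : ℂ)) (f := fun p : ℝ => ∫ s in Ioc 0 t,
      cexp (-(I * p * (t - s : ℝ))) * (p : ℂ) ^ 2 * respMean α s)).trans ?_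
    rw [← ofReal_norm, norm_mul, norm_I, one_mul, norm_real, Real.norm_of_nonneg hα,
      ENNReal.ofReal_mul hα]
    exact mul_le_mul' le_rfl h
  refine (add_le_add b1 b2).trans ?_
  rw [← ENNReal.ofReal_add (by positivity) (by positivity)]
  refine ENNReal.ofReal_le_ofReal ?_
  have h1 : α * (D * t) ≤ |A| * (D * t) := by gcongr; exact hA.trans (le_abs_self A)
  nlinarith [mul_pos hD0 ht]

/-- The derivative of `corrMean`. -/
def corrMeanDeriv (α : ℝ) (z : ℂ) (p : ℝ) : ℂ :=
  I * z * ∫ t : ℝ in Ioi 0, cexp (I * z * t) * (respDeriv α t p * respMean α t)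

lemma stronglyMeasurable_corrMeanDeriv (α : ℝ) (z : ℂ) : StronglyMeasurable (corrMeanDeriv α z) :=
    by
  exact stronglyMeasurable_const.mul (by fun_prop : Continuous fun x : ℝ × ℝ => cexp (I * z * x.2)
      * (respDeriv α x.2 x.1 * respMean α x.2)).stronglyMeasurable.integral_prod_right

lemma hasDerivAt_corrMean (hα : 0 ≤ α) (hz : 0 < z.im) (p : ℝ) :
    HasDerivAt (corrMean α z) (corrMeanDeriv α z p) p := by
  set a : ℝ := 1 + α + α * (|p| + 1) with ha
  obtain ⟨C, hC⟩ := exists_one_add_mul_pow_mul_exp_le 2 a (by positivity) hz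
  have hcont : ∀ x : ℝ, Continuous fun t : ℝ => cexp (I * z * t) * (resp α t x * respMean α t) :=
    fun x => by fun_prop
  have hcont' : Continuous fun t : ℝ => cexp (I * z * t) * (respDeriv α t p * respMean α t) := by
      fun_prop
  have h := (hasDerivAt_integral_of_dominated_loc_of_deriv_le

    (F' := fun x t => cexp (I * z * t) * (respDeriv α t x * respMean α t))
    (Metric.ball_mem_nhds p one_pos)
    (Eventually.of_forall fun x => (hcont x).aestronglyMeasurable)
    (integrableOn_exp_mul_resp_mul_respMean hα hz p) hcont'.aestronglyMeasurable
    (ae_restrict_of_forall_mem measurableSet_Ioi (fun t ht x hx => by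
      have ht : 0 < t := ht
      rw [Metric.mem_ball, Real.dist_eq] at hx
      have hx' : |x| ≤ |p| + 1 := by grind
      refine le_trans ?_ (hC t ht.le)
      rw [norm_mul, norm_mul, norm_cexp_I_mul, mul_comm]
      refine mul_le_mul_of_nonneg_right ((mul_le_of_le_one_right (norm_nonneg _) (norm_respMean_le
          hα ht.le)).trans ((norm_respDeriv_le hα ht.le x).trans ?_)) (Real.exp_pos _).le
      have h1 : α * |x| * t ≤ α * (|p| + 1) * t := by gcongr
      have h3 : 1 + α ≤ a := by rw [ha]; nlinarith [mul_nonneg hα (by positivity : 0 ≤ |p| + 1)]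
      calc (1 + α + α * |x| * t) * t ≤ (a + a * t) * t := by
            refine mul_le_mul_of_nonneg_right ?_ ht.le
            nlinarith
        _ ≤ (1 + a * t) ^ 2 := by nlinarith [ mul_pos (mul_pos ht ht) (by linarith : 0 < a)]))
    ((exp_neg_integrableOn_Ioi 0 (half_pos hz)).const_mul C)
    (ae_of_all _ fun t x _ =>
      (((hasDerivAt_resp_right α t x).mul_const (respMean α t)).const_mul (cexp (I * z * t))))).2
  exact (h.const_mul (I * z)).const_add 1

/-- Bounds on the correlation kernel, on its mean, and on the latter's derivative. -/
lemma exists_corr_bounds (A : ℝ) : ∃ C : ℝ, 0 ≤ C ∧ ∀ α, 0 ≤ α → α ≤ A → ∀ z : ℂ, 0 < z.im →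
    eLpNorm (fun x : ℝ × ℝ => corrKernel α z x.1 x.2) 2 (stdNormal.prod stdNormal)
      ≤ ENNReal.ofReal (C * (1 + ‖z‖ / z.im)) ∧
    eLpNorm (corrMean α z) 2 stdNormal ≤ ENNReal.ofReal (C * (1 + ‖z‖ / z.im)) ∧
    eLpNorm (fun p : ℝ => (p : ℂ) * corrMean α z p) 2 stdNormal
      ≤ ENNReal.ofReal (C * (1 + ‖z‖ / z.im + ‖z‖ / z.im ^ 2)) ∧
    eLpNorm (corrMeanDeriv α z) 2 stdNormal
      ≤ ENNReal.ofReal (C * (1 + ‖z‖ / z.im + ‖z‖ / z.im ^ 2)) := by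
  obtain ⟨D, hD0, hD1, hD⟩ := exists_eLpNorm_mul_resp_le A
  set C : ℝ := (1 + |A|) ^ 2 + 4 * D + 4 * (1 + 2 * |A|) with hC
  refine ⟨C, by positivity, fun α hα hA z hz => ?_⟩
  have hA' := hA.trans (le_abs_self A)
  have hq : 0 ≤ ‖z‖ / z.im := by positivity
  have hq2 : 0 ≤ ‖z‖ / z.im ^ 2 := by positivity
  refine ⟨(eLpNorm_corrKernel_le hα hz).trans (ENNReal.ofReal_le_ofReal ?_), ?_, ?_, ?_⟩
  · have : (1 + α) ^ 2 ≤ C := by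
      have : (1 + α) ^ 2 ≤ (1 + |A|) ^ 2 := by gcongr
      rw [hC]; linarith
    nlinarith
  · have h := eLpNorm_laplace_le (f := fun p t => resp α t p * respMean α t)
      (by unfold uncurry; exact (by fun_prop))
      (by positivity) hz fun t ht => (eLpNorm_mono fun p => by
        rw [norm_mul]
        exact mul_le_of_le_one_right (norm_nonneg _) (norm_respMean_le hα ht.le)).trans
        (eLpNorm_resp_le hα ht.le)
    refine (eLpNorm_add_le aestronglyMeasurable_const ?_ (by norm_num)).trans ?_
    · refine ((stronglyMeasurable_corrMean α z).sub
        (stronglyMeasurable_const (b := (1 : ℂ)))).aestronglyMeasurable.congr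
        (ae_of_all _ fun x => ?_)
      simp [corrMean]
    · rw [eLpNorm_const' _ (by norm_num) (by norm_num)]
      refine (add_le_add (le_refl _) h).trans ?_
      simp only [enorm_one, measure_univ, ENNReal.one_rpow, mul_one]
      rw [← ENNReal.ofReal_one, ← ENNReal.ofReal_add (by norm_num) (by positivity)]
      refine ENNReal.ofReal_le_ofReal ?_
      nlinarith
  · have h := eLpNorm_laplace_le_of_linear (ν := stdNormal)
      (f := fun p t => (p : ℂ) * resp α t p * respMean α t)
      (by unfold uncurry; exact (by fun_prop))
      hD0 hz fun t ht => (eLpNorm_mono fun p => by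
        rw [norm_mul]
        exact mul_le_of_le_one_right (norm_nonneg _) (norm_respMean_le hα ht.le)).trans
        (hD α hα hA t ht)
    have e : (fun p : ℝ => (p : ℂ) * corrMean α z p) = fun p : ℝ => (p : ℂ) +
        I * z * ∫ t : ℝ in Ioi 0, cexp (I * z * t) * ((p : ℂ) * resp α t p * respMean α t) := by
      funext p
      rw [corrMean, show (fun t : ℝ => cexp (I * z * t) * ((p : ℂ) * resp α t p * respMean α t))
        = fun t : ℝ => (p : ℂ) * (cexp (I * z * t) * (resp α t p * respMean α t)) from
        funext fun t => by ring, integral_const_mul]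
      ring
    have hid : Continuous fun p : ℝ => (p : ℂ) := by fun_prop
    rw [e]
    refine (eLpNorm_add_le hid.aestronglyMeasurable ?_ (by norm_num)).trans ?_
    · refine ((hid.aestronglyMeasurable.mul (stronglyMeasurable_corrMean α z).aestronglyMeasurable
          (μ := stdNormal)).sub hid.aestronglyMeasurable).congr (ae_of_all _ fun p => ?_)
      have := congrFun e p
      simp only [Pi.sub_apply, Pi.mul_apply]
      rw [this]; ring
    · refine (add_le_add hD1 h).trans ?_
      rw [← ENNReal.ofReal_add hD0.le (by positivity)]
      refine ENNReal.ofReal_le_ofReal ?_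
      nlinarith
  · have h := eLpNorm_laplace_le_of_linear (f := fun p t => respDeriv α t p * respMean α t)
      (by unfold uncurry; exact (by fun_prop))
      (D := 1 + 2 * α) (by positivity) hz fun t ht => (eLpNorm_mono fun p => by
        rw [norm_mul]
        exact mul_le_of_le_one_right (norm_nonneg _) (norm_respMean_le hα ht.le)).trans
        ((eLpNorm_respDeriv_le hα ht.le).trans (ENNReal.ofReal_le_ofReal (by nlinarith)))
    refine h.trans (ENNReal.ofReal_le_ofReal ?_)
    nlinarith

/-! ### Uniqueness for the two-slot Vlasov resolvent equation -/

variable {U W : Type*} [MeasurableSpace U] [MeasurableSpace W]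

lemma memLp_integral_right {μ : Measure U} {ν : Measure W} [SFinite μ] [IsProbabilityMeasure ν]
    {B : U × W → ℂ} (hB : MemLp B 2 (μ.prod ν)) : MemLp (fun u => ∫ w, B (u, w) ∂ν) 2 μ := by
  refine ⟨hB.1.integral_prod_right', ?_⟩
  have h : eLpNorm (fun u => ∫ w, B (u, w) ∂ν) 2 μ ^ 2 ≤ eLpNorm B 2 (μ.prod ν) ^ 2 := by
    rw [eLpNorm_two_sq, eLpNorm_two_sq, lintegral_prod _ (hB.1.enorm.pow_const 2)]
    refine lintegral_mono_ae ?_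
    filter_upwards [hB.1.prodMk_left] with u hu
    refine (pow_le_pow_left₀ (zero_le) (enorm_integral_le_lintegral_enorm _) 2).trans ?_
    refine (sq_lintegral_le ν hu.enorm (φ := fun _ => 1) aemeasurable_const (by simp)
      (by simp)).trans ?_
    simp
  exact ((ENNReal.pow_le_pow_left_iff two_ne_zero).1 h).trans_lt hB.2

lemma memLp_integral_left {μ : Measure U} {ν : Measure W} [IsProbabilityMeasure μ] [SFinite ν]
    {B : U × W → ℂ} (hB : MemLp B 2 (μ.prod ν)) : MemLp (fun w => ∫ u, B (u, w) ∂μ) 2 ν :=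
  memLp_integral_right (B := fun x : W × U => B (x.2, x.1))
    (hB.comp_measurePreserving Measure.measurePreserving_swap)

lemma memLp_mul_prod {μ : Measure U} {ν : Measure W} [SFinite ν] {f : U → ℂ} {g : W → ℂ}
    (hf : MemLp f 2 μ) (hg : MemLp g 2 ν) :
    MemLp (fun x : U × W => f x.1 * g x.2) 2 (μ.prod ν) := by
  refine ⟨hf.1.comp_fst.mul hg.1.comp_snd, ?_⟩
  rw [eLpNorm_mul_prod hf.1 hg.1]
  exact ENNReal.mul_lt_top hf.2 hg.2

lemma integrable_mul_conj {X : Type*} [MeasurableSpace X] {μ : Measure X} {f g : X → ℂ}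
    (hf : MemLp f 2 μ) (hg : MemLp g 2 μ) :
    Integrable (fun x => f x * conj (g x)) μ :=
  hf.integrable_mul hg.star

lemma integral_mul_snd {μ : Measure U} {ν : Measure W} [SFinite μ] [SFinite ν] {B : U × W → ℂ}
    {f : W → ℂ} (h : Integrable (fun x => B x * f x.2) (μ.prod ν)) :
    ∫ x, B x * f x.2 ∂μ.prod ν = ∫ w, (∫ u, B (u, w) ∂μ) * f w ∂ν := by
  rw [integral_prod_symm _ h]
  simp_rw [integral_mul_const]

lemma integral_mul_fst {μ : Measure U} {ν : Measure W} [SFinite μ] [SFinite ν] {B : U × W → ℂ}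
    {f : U → ℂ} (h : Integrable (fun x => B x * f x.1) (μ.prod ν)) :
    ∫ x, B x * f x.1 ∂μ.prod ν = ∫ u, (∫ w, B (u, w) ∂ν) * f u ∂μ := by
  rw [integral_prod _ h]
  simp_rw [integral_mul_const]

lemma im_integral_eq_zero {X : Type*} [MeasurableSpace X] {μ : Measure X} {f : X → ℂ}
    (h : ∀ x, (f x).im = 0) : (∫ x, f x ∂μ).im = 0 := by
  have e : f = fun x => (((f x).re : ℝ) : ℂ) := funext fun x => Complex.ext rfl (by simp [h x])
  rw [e, integral_complex_ofReal, ofReal_im]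

lemma im_pairing_eq_zero {μ : Measure U} {ν : Measure W} [IsProbabilityMeasure μ]
    [IsProbabilityMeasure ν] {a : U → ℝ} {b : W → ℝ} (ha : MemLp (fun u => (a u : ℂ)) 2 μ)
    {B : U × W → ℂ} (hB : MemLp B 2 (μ.prod ν))
    (hE : MemLp (fun x => ((a x.1 : ℂ) + b x.2) * B x) 2 (μ.prod ν)) :
    (∫ x, ((a x.1 : ℂ) + b x.2) * B x * conj (∫ u, B (u, x.2) ∂μ) ∂μ.prod ν
      + ∫ x, (a x.1 : ℂ) * (∫ u, B (u, x.2) ∂μ) * conj (B x) ∂μ.prod ν).im = 0 := by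
  have hb1 := memLp_integral_left hB
  set b1 : W → ℂ := fun w => ∫ u, B (u, w) ∂μ with hb1d
  have hA : MemLp (fun x : U × W => (a x.1 : ℂ) * b1 x.2) 2 (μ.prod ν) := memLp_mul_prod ha hb1
  have i0 := integrable_mul_conj hE (hb1.comp_snd μ)
  have i1 := integrable_mul_conj hA hB
  have i2 : Integrable (fun x : U × W => B x * conj (a x.1 * b1 x.2)) (μ.prod ν) :=
    integrable_mul_conj hB hA
  have i3 : Integrable (fun x : U × W => B x * ((b x.2 : ℂ) * conj (b1 x.2)))
      (μ.prod ν) := by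
    refine (i0.sub i2).congr (ae_of_all _ fun x => ?_)
    simp only [Pi.sub_apply, map_mul, conj_ofReal]
    ring
  have e0 : ∫ x : U × W, ((a x.1 : ℂ) + b x.2) * B x * conj (b1 x.2) ∂μ.prod ν
      = ∫ x, B x * conj (a x.1 * b1 x.2) ∂μ.prod ν
        + ∫ w, b1 w * ((b w : ℂ) * conj (b1 w)) ∂ν := by
    rw [← integral_mul_snd (f := fun w => (b w : ℂ) * conj (b1 w)) i3,
      ← integral_add i2 i3]
    refine integral_congr_fun fun x => ?_
    simp only [map_mul, conj_ofReal]
    ring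
  have e1 : ∫ x, B x * conj (a x.1 * b1 x.2) ∂μ.prod ν
      = conj (∫ x, (a x.1 : ℂ) * b1 x.2 * conj (B x) ∂μ.prod ν) := by
    rw [← integral_conj]
    refine integral_congr_fun fun x => ?_
    simp only [map_mul, conj_ofReal, conj_conj]
    ring
  have e2 : (∫ w, b1 w * ((b w : ℂ) * conj (b1 w)) ∂ν).im = 0 :=
    im_integral_eq_zero fun w => by
      rw [mul_left_comm, mul_conj]
      simp [← ofReal_mul]
  rw [e0, e1, add_im, add_im, e2, conj_im]
  ring

lemma integral_mul_conj_expand {X : Type*} [MeasurableSpace X] {μ : Measure X}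
    [IsProbabilityMeasure μ] {F B c₁ c₂ : X → ℂ} (hF : MemLp F 2 μ) (hB : MemLp B 2 μ)
    (h₁ : MemLp c₁ 2 μ) (h₂ : MemLp c₂ 2 μ) (α₁ α₂ : ℝ) (n : ℂ) :
    ∫ x, F x * conj (B x + α₁ * c₁ x + α₂ * c₂ x + α₁ * α₂ * n) ∂μ
      = ∫ x, F x * conj (B x) ∂μ + α₁ * ∫ x, F x * conj (c₁ x) ∂μ
        + α₂ * ∫ x, F x * conj (c₂ x) ∂μ
        + α₁ * α₂ * conj n * ∫ x, F x ∂μ := by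
  have i1 := integrable_mul_conj hF hB
  have i2 := (integrable_mul_conj hF h₁).const_mul (α₁ : ℂ)
  have i3 := (integrable_mul_conj hF h₂).const_mul (α₂ : ℂ)
  have i4 := (hF.integrable (q := 2) (by norm_num)).const_mul (α₁ * α₂ * conj n)
  have i12 : Integrable (fun x => F x * conj (B x)
      + α₁ * (F x * conj (c₁ x))) μ := i1.add i2
  have i123 : Integrable (fun x => F x * conj (B x)
      + α₁ * (F x * conj (c₁ x)) + α₂ * (F x * conj (c₂ x))) μ := i12.add i3
  rw [← integral_const_mul, ← integral_const_mul, ← integral_const_mul, ← integral_add i1 i2,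
    ← integral_add i12 i3, ← integral_add i123 i4]
  refine integral_congr_fun fun x => ?_
  simp only [map_add, map_mul, conj_ofReal]
  ring

/-- The two-slot homogeneous Vlasov resolvent equation has no nonzero square-integrable solution. -/
theorem two_slot_unique {μ : Measure U} {ν : Measure W} [IsProbabilityMeasure μ]
    [IsProbabilityMeasure ν] {a : U → ℝ} {b : W → ℝ} (ha : MemLp (fun u => (a u : ℂ)) 2 μ)
    (hb : MemLp (fun w => (b w : ℂ)) 2 ν) {α₁ α₂ : ℝ} (h₁ : 0 ≤ α₁) (h₂ : 0 ≤ α₂) (hω : 0 < ω.im) {B : U × W → ℂ} (hB : MemLp B 2 (μ.prod ν))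
    (heq : ∀ᵐ x ∂μ.prod ν, ((a x.1 : ℂ) + b x.2 - ω) * B x + α₁ * a x.1 * ∫ u, B (u, x.2) ∂μ
      + α₂ * b x.2 * ∫ w, B (x.1, w) ∂ν = 0) : B =ᵐ[μ.prod ν] 0 := by
  have hb1 := memLp_integral_left hB
  have hb2 := memLp_integral_right hB
  set b1 : W → ℂ := fun w => ∫ u, B (u, w) ∂μ with hb1d
  set b2 : U → ℂ := fun u => ∫ w, B (u, w) ∂ν with hb2d
  set n : ℂ := ∫ x, B x ∂μ.prod ν with hn
  have hBi : Integrable B (μ.prod ν) := hB.integrable (by norm_num)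
  have hn1 : ∫ w, b1 w ∂ν = n := (integral_prod_symm _ hBi).symm
  have hn2 : ∫ u, b2 u ∂μ = n := (integral_prod _ hBi).symm
  have hA1 : MemLp (fun x : U × W => (a x.1 : ℂ) * b1 x.2) 2 (μ.prod ν) := memLp_mul_prod ha hb1
  have hA2 : MemLp (fun x : U × W => (b x.2 : ℂ) * b2 x.1) 2 (μ.prod ν) := by
    refine (memLp_mul_prod hb2 hb).ae_eq (ae_of_all _ fun x => mul_comm _ _)
  have hE : MemLp (fun x : U × W => ((a x.1 : ℂ) + b x.2) * B x) 2 (μ.prod ν) := by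
    refine (((hB.const_mul ω).sub (hA1.const_mul (α₁ : ℂ))).sub (hA2.const_mul (α₂ : ℂ))).ae_eq ?_
    filter_upwards [heq] with x hx
    simp only [Pi.sub_apply]
    linear_combination -hx
  have hc1 := hb1.comp_snd μ
  have hc2 := hb2.comp_fst ν
  have m1 := integrable_mul_conj hB hB
  have m2 := integrable_mul_conj hB hc1
  have m3 := integrable_mul_conj hB hc2
  have key : ∫ x : U × W, ω * B x * conj (B x + α₁ * b1 x.2 + α₂ * b2 x.1 + α₁ * α₂ * n)
        ∂μ.prod ν
      = ∫ x : U × W, (((a x.1 : ℂ) + b x.2) * B x + α₁ * (a x.1 * b1 x.2) + α₂ * (b x.2 * b2 x.1))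
        * conj (B x + α₁ * b1 x.2 + α₂ * b2 x.1 + α₁ * α₂ * n) ∂μ.prod ν := by
    refine integral_congr_ae ?_
    filter_upwards [heq] with x hx
    congr 1
    linear_combination -hx
  have hr1 := im_pairing_eq_zero (b := b) ha hB hE
  have hr2 : (∫ x : U × W, ((a x.1 : ℂ) + b x.2) * B x * conj (b2 x.1) ∂μ.prod ν
      + ∫ x : U × W, (b x.2 : ℂ) * b2 x.1 * conj (B x) ∂μ.prod ν).im = 0 := by
    have hsw : MeasurePreserving Prod.swap (ν.prod μ) (μ.prod ν) :=
      Measure.measurePreserving_swap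
    have hE' : MemLp (fun x : W × U => ((b x.1 : ℂ) + a x.2) * B (x.2, x.1)) 2 (ν.prod μ) :=
      (hE.comp_measurePreserving hsw).ae_eq (ae_of_all _ fun x => by
        simp only [Function.comp, Prod.swap]; ring)
    have h := im_pairing_eq_zero (a := b) (b := a) hb (B := fun x : W × U => B (x.2, x.1))
      (hB.comp_measurePreserving hsw) hE'
    rw [← h]
    congr 2
    · rw [← integral_prod_swap]
      refine integral_congr_fun fun x => ?_
      simp only [Prod.swap, hb2d]
      ring
    · rw [← integral_prod_swap]
      rfl
  have hr3 : (∫ x : U × W, ((a x.1 : ℂ) + b x.2) * B x * conj (B x) ∂μ.prod ν).im = 0 :=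
    im_integral_eq_zero fun x => by rw [mul_assoc, mul_conj, ← ofReal_add, ← ofReal_mul, ofReal_im]
  have hr4 : (∫ x : U × W, (a x.1 : ℂ) * b1 x.2 * conj (b1 x.2) ∂μ.prod ν).im = 0 :=
    im_integral_eq_zero fun x => by rw [mul_assoc, mul_conj, ← ofReal_mul, ofReal_im]
  have hr5 : (∫ x : U × W, (b x.2 : ℂ) * b2 x.1 * conj (b2 x.1) ∂μ.prod ν).im = 0 :=
    im_integral_eq_zero fun x => by rw [mul_assoc, mul_conj, ← ofReal_mul, ofReal_im]
  have v1 : ∫ x : U × W, (a x.1 : ℂ) * b1 x.2 ∂μ.prod ν = (∫ u, (a u : ℂ) ∂μ) * n := by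
    rw [integral_prod_mul (fun u => (a u : ℂ)) b1, hn1]
  have v2 : ∫ x : U × W, (b x.2 : ℂ) * b2 x.1 ∂μ.prod ν = n * ∫ w, (b w : ℂ) ∂ν := by
    simp_rw [mul_comm ((b _ : ℂ)) (b2 _)]
    rw [integral_prod_mul b2 (fun w => (b w : ℂ)), hn2]
  have v3 : ∫ x : U × W, (a x.1 : ℂ) * b1 x.2 * conj (b2 x.1) ∂μ.prod ν
      = (∫ u, (a u : ℂ) * conj (b2 u) ∂μ) * n := by
    rw [← hn1, ← integral_prod_mul (fun u => (a u : ℂ) * conj (b2 u)) b1]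
    exact integral_congr_ae (ae_of_all _ fun x => by ring)
  have v4 : ∫ x : U × W, (b x.2 : ℂ) * b2 x.1 * conj (b1 x.2) ∂μ.prod ν
      = n * ∫ w, (b w : ℂ) * conj (b1 w) ∂ν := by
    rw [← hn2, ← integral_prod_mul b2 (fun w => (b w : ℂ) * conj (b1 w))]
    exact integral_congr_ae (ae_of_all _ fun x => by ring)
  have v5 : ∫ x : U × W, ((a x.1 : ℂ) + b x.2) * B x ∂μ.prod ν
      = (∫ u, b2 u * (a u : ℂ) ∂μ) + ∫ w, b1 w * (b w : ℂ) ∂ν := by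
    have p1 : Integrable (fun x : U × W => B x * (a x.1 : ℂ)) (μ.prod ν) :=
      hB.integrable_mul (ha.comp_fst ν)
    have p2 : Integrable (fun x : U × W => B x * (b x.2 : ℂ)) (μ.prod ν) :=
      hB.integrable_mul (hb.comp_snd μ)
    rw [← integral_mul_fst p1, ← integral_mul_snd p2, ← integral_add p1 p2]
    exact integral_congr_ae (ae_of_all _ fun x => by ring)
  have c1 : ∫ u, (a u : ℂ) * conj (b2 u) ∂μ
      = conj (∫ u, b2 u * (a u : ℂ) ∂μ) := by
    rw [← integral_conj]
    exact integral_congr_ae (ae_of_all _ fun x => by simp [mul_comm])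
  have c2 : ∫ w, (b w : ℂ) * conj (b1 w) ∂ν
      = conj (∫ w, b1 w * (b w : ℂ) ∂ν) := by
    rw [← integral_conj]
    exact integral_congr_ae (ae_of_all _ fun x => by simp [mul_comm])
  have w1 : ∫ x : U × W, B x * conj (B x) ∂μ.prod ν = ((∫ x, ‖B x‖ ^ 2 ∂μ.prod ν : ℝ) : ℂ) := by
    rw [← integral_complex_ofReal]
    refine integral_congr_fun fun x => ?_
    rw [mul_conj, normSq_eq_norm_sq]
  have w2 : ∫ x : U × W, B x * conj (b1 x.2) ∂μ.prod ν = ((∫ w, ‖b1 w‖ ^ 2 ∂ν : ℝ) : ℂ) := by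
    rw [integral_mul_snd (f := fun w => conj (b1 w)) m2, ← integral_complex_ofReal]
    refine integral_congr_fun fun x => ?_
    rw [mul_conj, normSq_eq_norm_sq]
  have w3 : ∫ x : U × W, B x * conj (b2 x.1) ∂μ.prod ν = ((∫ u, ‖b2 u‖ ^ 2 ∂μ : ℝ) : ℂ) := by
    rw [integral_mul_fst (f := fun u => conj (b2 u)) m3, ← integral_complex_ofReal]
    refine integral_congr_fun fun x => ?_
    rw [mul_conj, normSq_eq_norm_sq]
  have ra : (∫ u, (a u : ℂ) ∂μ) = ((∫ u, a u ∂μ : ℝ) : ℂ) := integral_complex_ofReal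
  have rb : (∫ w, (b w : ℂ) ∂ν) = ((∫ w, b w ∂ν : ℝ) : ℂ) := integral_complex_ofReal
  have hD : MemLp (fun x : U × W => B x + α₁ * b1 x.2 + α₂ * b2 x.1 + α₁ * α₂ * n) 2 (μ.prod ν) :=
    ((hB.add (hc1.const_mul _)).add (hc2.const_mul _)).add (memLp_const _)
  have x1 := integral_mul_conj_expand hB hB hc1 hc2 α₁ α₂ n
  have x2 := integral_mul_conj_expand hE hB hc1 hc2 α₁ α₂ n
  have x3 := integral_mul_conj_expand hA1 hB hc1 hc2 α₁ α₂ n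
  have x4 := integral_mul_conj_expand hA2 hB hc1 hc2 α₁ α₂ n
  have q2 := integrable_mul_conj hE hD
  have q3 := (integrable_mul_conj hA1 hD).const_mul (α₁ : ℂ)
  have q4 := (integrable_mul_conj hA2 hD).const_mul (α₂ : ℂ)
  have hL : ∫ x : U × W, ω * B x * conj (B x + α₁ * b1 x.2 + α₂ * b2 x.1 + α₁ * α₂ * n)
      ∂μ.prod ν = ω * ∫ x : U × W, B x * conj
        (B x + α₁ * b1 x.2 + α₂ * b2 x.1 + α₁ * α₂ * n) ∂μ.prod ν := by
    simp_rw [mul_assoc ω]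
    rw [integral_const_mul]
  set D : U × W → ℂ := fun x => B x + α₁ * b1 x.2 + α₂ * b2 x.1 + α₁ * α₂ * n with hDd
  have hR : ∫ x : U × W, (((a x.1 : ℂ) + b x.2) * B x + α₁ * (a x.1 * b1 x.2)
      + α₂ * (b x.2 * b2 x.1)) * conj (D x) ∂μ.prod ν
      = ∫ x : U × W, (((a x.1 : ℂ) + b x.2) * B x) * conj (D x) ∂μ.prod ν
        + α₁ * ∫ x : U × W, ((a x.1 : ℂ) * b1 x.2) * conj (D x) ∂μ.prod ν
        + α₂ * ∫ x : U × W, ((b x.2 : ℂ) * b2 x.1) * conj (D x) ∂μ.prod ν := by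
    have q23 : Integrable (fun x : U × W => (((a x.1 : ℂ) + b x.2) * B x) * conj (D x)
        + α₁ * (((a x.1 : ℂ) * b1 x.2) * conj (D x))) (μ.prod ν) := q2.add q3
    rw [← integral_const_mul, ← integral_const_mul, ← integral_add q2 q3, ← integral_add q23 q4]
    refine integral_congr_fun fun x => ?_
    ring
  rw [hDd] at hR
  rw [hL, hR, x1, x2, x3, x4, w1, w2, w3, v1, v2, v3, v4, v5, c1, c2, ra, rb, ← hn] at key
  clear_value n
  generalize hS1 : (∫ x, ‖B x‖ ^ 2 ∂μ.prod ν) = s1 at key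
  generalize hS2 : (∫ w, ‖b1 w‖ ^ 2 ∂ν) = s2 at key
  generalize hS3 : (∫ u, ‖b2 u‖ ^ 2 ∂μ) = s3 at key
  generalize (∫ u, b2 u * (a u : ℂ) ∂μ) = y1 at key
  generalize (∫ w, b1 w * (b w : ℂ) ∂ν) = y2 at key
  have him := congrArg Complex.im key
  have hs2 : 0 ≤ s2 := hS2 ▸ integral_nonneg fun _ => by positivity
  have hs3 : 0 ≤ s3 := hS3 ▸ integral_nonneg fun _ => by positivity
  have hs1 : s1 ≤ 0 := by
    simp only [add_im, mul_im, ofReal_im, ofReal_re, conj_im, conj_re, mul_re, add_re, hr3,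
      hr4, hr5] at him hr1 hr2
    have hfin : ω.im * (s1 + α₁ * s2 + α₂ * s3 + α₁ * α₂ * (n.re ^ 2 + n.im ^ 2)) = 0 := by
      linear_combination him + α₁ * hr1 + α₂ * hr2
    have h0 := (mul_eq_zero.1 hfin).resolve_left hω.ne'
    have : 0 ≤ α₁ * α₂ * (n.re ^ 2 + n.im ^ 2) := by positivity
    nlinarith [mul_nonneg h₁ hs2, mul_nonneg h₂ hs3]
  have hint : Integrable (fun x => ‖B x‖ ^ 2) (μ.prod ν) :=
    (memLp_two_iff_integrable_sq_norm hB.1).1 hB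
  have hz := (integral_eq_zero_iff_of_nonneg (fun x => by positivity) hint).1
    (le_antisymm (hS1.trans_le hs1) (integral_nonneg fun x => by positivity))
  filter_upwards [hz] with x hx
  simpa using hx

local notation "⟪" k "," v "⟫" => (inner ℝ (waveVec k) v : ℝ)

/-! ### The Maxwellian -/

lemma maxwellDensity_pos (hβ : 0 < β) (v : Vel d) : 0 < maxwellDensity β v := by
  unfold maxwellDensity; positivity

@[fun_prop] lemma continuous_maxwellDensity (β : ℝ) : Continuous (maxwellDensity (d := d) β) := by
  unfold maxwellDensity; fun_prop

lemma integral_maxwell (hβ : 0 < β) {E : Type*} [NormedAddCommGroup E]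
    [NormedSpace ℝ E] (f : Vel d → E) :
    ∫ v, f v ∂ℳ = ∫ v, maxwellDensity β v • f v := by
  rw [maxwell, integral_withDensity_eq_integral_toReal_smul
    (continuous_maxwellDensity β).measurable.ennreal_ofReal (ae_of_all _ fun _ => ENNReal.ofReal_lt_top)]
  simp_rw [ENNReal.toReal_ofReal (maxwellDensity_pos hβ _).le]

lemma integral_maxwellDensity_mul_exp (hβ : 0 < β) (c : ℂ) (w : Vel d) :
    ∫ v : Vel d, (maxwellDensity β v : ℂ) * cexp (c * (inner ℝ w v : ℝ))
      = cexp (c ^ 2 * ‖w‖ ^ 2 / (2 * β)) := by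
  have h := GaussianFourier.integral_cexp_neg_mul_sq_norm_add (V := Vel d) (b := ((β / 2 : ℝ) : ℂ))
    (by simpa using hβ) c w
  have e : ∀ v : Vel d, (maxwellDensity β v : ℂ) * cexp (c * (inner ℝ w v : ℝ))
      = ((β / (2 * π)) ^ ((d : ℝ) / 2) : ℝ)
        * cexp (-((β / 2 : ℝ) : ℂ) * ‖v‖ ^ 2 + c * (inner ℝ w v : ℝ)) := by
    intro v
    rw [maxwellDensity, ofReal_mul, ofReal_exp, mul_assoc, ← Complex.exp_add]
    congr 2
    push_cast
    ring
  simp_rw [e]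
  rw [integral_const_mul, h, ← mul_assoc]
  have e2 : (((β / (2 * π)) ^ ((d : ℝ) / 2) : ℝ) : ℂ) *
      ((π : ℂ) / ((β / 2 : ℝ) : ℂ)) ^ ((Module.finrank ℝ (Vel d) : ℂ) / 2) = 1 := by
    have e3 : ((π : ℂ) / ((β / 2 : ℝ) : ℂ)) ^ ((Module.finrank ℝ (Vel d) : ℂ) / 2)
        = (((π / (β / 2)) ^ ((d : ℝ) / 2) : ℝ) : ℂ) := by
      rw [ofReal_cpow (by positivity)]
      simp
    rw [e3, ← ofReal_mul, ← Real.mul_rpow (by positivity) (by positivity)]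
    have : β / (2 * π) * (π / (β / 2)) = 1 := by
      field_simp
    rw [this, Real.one_rpow, ofReal_one]
  rw [e2, one_mul]
  congr 1
  push_cast
  field_simp
  ring

lemma isProbabilityMeasure_maxwell (hβ : 0 < β) :
    IsProbabilityMeasure ℳ := by
  have h := integral_maxwellDensity_mul_exp (d := d) hβ 0 0
  simp only [zero_mul, Complex.exp_zero, mul_one, ne_eq, OfNat.ofNat_ne_zero, not_false_eq_true,
    zero_pow, zero_div] at h
  rw [integral_complex_ofReal] at h
  have h1 : ∫ v : Vel d, maxwellDensity β v = 1 := by exact_mod_cast h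
  have hi : Integrable (maxwellDensity (d := d) β) := by
    by_contra hn
    rw [integral_undef hn] at h1
    exact zero_ne_one h1
  constructor
  rw [maxwell, withDensity_apply _ MeasurableSet.univ, Measure.restrict_univ,
    ← ofReal_integral_eq_lintegral_ofReal hi (ae_of_all _ fun v => (maxwellDensity_pos hβ v).le),
    h1, ENNReal.ofReal_one]

lemma map_inner_maxwell (hβ : 0 < β) {w : Vel d} (hw : ‖w‖ ^ 2 = β) :
    (ℳ).map (fun v => inner ℝ w v) = stdNormal := by
  have := isProbabilityMeasure_maxwell (d := d) hβ
  have hm : Measurable fun v : Vel d => (inner ℝ w v : ℝ) := by fun_prop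
  have : IsProbabilityMeasure ((ℳ).map fun v => (inner ℝ w v : ℝ)) :=
    Measure.isProbabilityMeasure_map hm.aemeasurable
  refine Measure.ext_of_charFun ?_
  funext t
  rw [charFun_gaussianReal, charFun_apply_real, integral_map hm.aemeasurable
    (by fun_prop : Continuous fun x : ℝ => cexp (t * x * I)).aestronglyMeasurable,
    integral_maxwell hβ]
  have h := integral_maxwellDensity_mul_exp hβ (t * I) w
  simp_rw [real_smul]
  calc _ = ∫ v : Vel d, (maxwellDensity β v : ℂ) * cexp (t * I * (inner ℝ w v : ℝ)) := by
        refine integral_congr_fun fun v => ?_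
        congr 2; ring
    _ = _ := by
        rw [h, mul_pow, I_sq, ← ofReal_pow, ← ofReal_pow, hw]
        congr 1
        have : (β : ℂ) ≠ 0 := by exact_mod_cast hβ.ne'
        push_cast
        field_simp
        ring

/-! ### Velocities along a wave vector -/

lemma waveVec_ne_zero {n : ℤᵈ} (hn : n ≠ 0) : waveVec n ≠ 0 := by
  obtain ⟨i, hi⟩ := ne_iff.1 hn
  intro h
  have := congrArg (fun v : Vel d => v i) h
  simp [waveVec, Real.pi_ne_zero] at this
  exact hi this

lemma waveVec_neg (n : ℤᵈ) : waveVec (-n) = -waveVec n := by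
  ext i; simp [waveVec]

lemma waveVec_zero : waveVec (0 : ℤᵈ) = 0 := by
  ext i; simp [waveVec]

/-- The standard deviation of `k · v` under the Maxwellian, at `k = 2πn`. -/
def modeScale {d : ℕ} (β : ℝ) (n : Fin d → ℤ) : ℝ := ‖waveVec n‖ / √β

/-- The component of `v` along `k = 2πn`, normalized to unit variance. -/
def modeVel {d : ℕ} (β : ℝ) (n : Fin d → ℤ) (v : Vel d) : ℝ :=
  ⟪n, v⟫ / modeScale β n

lemma modeScale_pos (hβ : 0 < β) {n : ℤᵈ} (hn : n ≠ 0) :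
    0 < modeScale β n :=
  div_pos (norm_pos_iff.2 (waveVec_ne_zero hn)) (Real.sqrt_pos.2 hβ)

lemma modeScale_neg (β : ℝ) (n : ℤᵈ) : modeScale β (-n) = modeScale β n := by
  rw [modeScale, waveVec_neg, norm_neg, modeScale]

lemma modeVel_neg (β : ℝ) (n : ℤᵈ) (v : Vel d) :
    modeVel β (-n) v = -modeVel β n v := by
  rw [modeVel, modeScale_neg, waveVec_neg, inner_neg_left, neg_div, modeVel]

lemma modeScale_mul_modeVel (hβ : 0 < β) {n : ℤᵈ} (hn : n ≠ 0) (v : Vel d) :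
    modeScale β n * modeVel β n v = ⟪n, v⟫ :=
  mul_div_cancel₀ _ (modeScale_pos hβ hn).ne'

@[fun_prop] lemma continuous_modeVel (β : ℝ) (n : ℤᵈ) : Continuous (modeVel β n) := by
  unfold modeVel; fun_prop

lemma norm_waveVec_sq (hβ : 0 < β) (n : ℤᵈ) :
    ‖waveVec n‖ ^ 2 = β * modeScale β n ^ 2 := by
  rw [modeScale, div_pow, Real.sq_sqrt hβ.le]
  field_simp

lemma measurePreserving_modeVel (hβ : 0 < β) {n : ℤᵈ} (hn : n ≠ 0) :
    MeasurePreserving (modeVel β n) ℳ stdNormal := by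
  have hc := modeScale_pos hβ hn
  refine ⟨(continuous_modeVel β n).measurable, ?_⟩
  have h := map_inner_maxwell hβ (w := (modeScale β n)⁻¹ • waveVec n) (by
    rw [norm_smul, mul_pow, norm_waveVec_sq hβ n, Real.norm_eq_abs, sq_abs]
    field_simp)
  rw [← h]
  congr 1
  funext v
  rw [inner_smul_left, modeVel, div_eq_inv_mul]
  simp

lemma integral_modeVel (hβ : 0 < β) {n : ℤᵈ} (hn : n ≠ 0) {f : ℝ → ℂ}
    (hf : AEStronglyMeasurable f stdNormal) :
    ∫ v, f (modeVel β n v) ∂ℳ = ∫ p, f p ∂stdNormal := by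
  have h := measurePreserving_modeVel hβ hn
  rw [← h.map_eq, integral_map h.measurable.aemeasurable (by rwa [h.map_eq])]

/-! ### The dispersion function and the averaged Dirac mass -/

lemma dispersion_eq {m : ℕ} (hβ : 0 < β) (V : Torus d → ℝ) {n : ℤᵈ}
    (hn : n ≠ 0) (hω : 0 < ω.im) : dispersion N m β V n ω
      = gaussEps ((((N : ℝ) + 1 - m) / N) * β * potHat V n) (ω / modeScale β n) := by
  have hc := modeScale_pos hβ hn
  have hc' : (modeScale β n : ℂ) ≠ 0 := by exact_mod_cast hc.ne'
  have him : 0 < (ω / modeScale β n).im := by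
    rw [div_ofReal_im]; positivity
  rw [dispersion, gaussEps, ← integral_div_sub him]
  congr 2
  have hm : AEStronglyMeasurable (fun p : ℝ => (p : ℂ) / (p - ω / modeScale β n)) stdNormal := by
    have h := sub_ne_zero_of_im_pos him
    exact (by fun_prop (disch := exact h _) : Continuous fun p : ℝ =>
      (p : ℂ) / (p - ω / modeScale β n)).aestronglyMeasurable
  rw [← integral_modeVel hβ hn hm]
  refine integral_congr_fun fun v => ?_
  rw [← modeScale_mul_modeVel hβ hn v, ofReal_mul,
    ← mul_div_mul_left (modeVel β n v : ℂ) _ hc', mul_sub, mul_div_cancel₀ _ hc']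

lemma tendsto_dispersion {m : ℕ} (hβ : 0 < β) (V : Torus d → ℝ) {n : ℤᵈ}
    (hn : n ≠ 0) (r : ℝ) :
    Tendsto (fun η : ℝ => dispersion N m β V n ((r : ℂ) + (η : ℂ) * I)) (𝓝[>] 0)
      (𝓝 (gaussEps ((((N : ℝ) + 1 - m) / N) * β * potHat V n) ((r / modeScale β n : ℝ) : ℂ))) := by
  have hc := modeScale_pos hβ hn
  have h1 : ContinuousOn (gaussEps ((((N : ℝ) + 1 - m) / N) * β * potHat V n)) {z | 0 ≤ z.im} :=
    continuousOn_const.add (continuousOn_const.mul continuousOn_gaussK)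
  have h2 : Tendsto (fun η : ℝ => ((r : ℂ) + (η : ℂ) * I) / modeScale β n) (𝓝[>] 0)
      (𝓝[{z | 0 ≤ z.im}] ((r / modeScale β n : ℝ) : ℂ)) := by
    refine tendsto_nhdsWithin_iff.2 ⟨?_, ?_⟩
    · have : Continuous fun η : ℝ => ((r : ℂ) + (η : ℂ) * I) / modeScale β n := by fun_prop
      have h := (this.tendsto 0).mono_left (nhdsWithin_le_nhds (s := Ioi (0 : ℝ)))
      simpa using h
    · filter_upwards [self_mem_nhdsWithin] with η hη
      have hη : 0 < η := hη
      show 0 ≤ (((r : ℂ) + (η : ℂ) * I) / modeScale β n).im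
      rw [div_ofReal_im]
      simp
      positivity
  refine ((h1 _ (by simp)).tendsto.comp h2).congr' ?_
  filter_upwards [self_mem_nhdsWithin] with η hη
  have hη : 0 < η := hη
  rw [dispersion_eq hβ V hn (by simpa using hη)]
  rfl

lemma dispersionBdry_eq {m : ℕ} (hβ : 0 < β) (V : Torus d → ℝ) {n : ℤᵈ}
    (hn : n ≠ 0) (r : ℝ) : dispersionBdry N m β V n r
      = gaussEps ((((N : ℝ) + 1 - m) / N) * β * potHat V n) ((r / modeScale β n : ℝ) : ℂ) :=
  (tendsto_dispersion hβ V hn r).limUnder_eq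

lemma tendsto_deltaApprox (hβ : 0 < β) {n : ℤᵈ} (hn : n ≠ 0) (v : Vel d) :
    Tendsto (deltaApprox β (waveVec n) v) (𝓝[>] 0)
      (𝓝 ((modeScale β n)⁻¹ * gaussianPDFReal 0 1 (modeVel β n v))) := by
  have hc := modeScale_pos hβ hn
  set c := modeScale β n
  set p := modeVel β n v with hp
  set ρ : ℝ → ℝ := gaussianPDFReal 0 1 with hρ
  have hρc : Continuous ρ := by
    rw [hρ]; unfold gaussianPDFReal; fun_prop
  have hd : ∀ x, HasDerivAt (fun x => ∫ t in 0..x, ρ t) (ρ x) x := fun x =>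
    intervalIntegral.integral_hasDerivAt_right (hρc.intervalIntegrable _ _)
      (hρc.stronglyMeasurableAtFilter _ _) hρc.continuousAt
  have hd2 : HasDerivAt (fun η : ℝ => (∫ t in 0..(p + η / c), ρ t)
      - ∫ t in 0..(p - η / c), ρ t) (ρ p * (1 / c) - ρ p * (-(1 / c))) 0 := by
    have a1 : HasDerivAt (fun η : ℝ => p + η / c) (1 / c) 0 :=
      ((hasDerivAt_id (0 : ℝ)).div_const c).const_add p
    have a2 : HasDerivAt (fun η : ℝ => p - η / c) (-(1 / c)) 0 :=
      ((hasDerivAt_id (0 : ℝ)).div_const c).const_sub p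
    refine HasDerivAt.sub ?_ ?_
    · exact HasDerivAt.comp (h₂ := fun x => ∫ t in 0..x, ρ t) 0 (by simpa using hd p) a1
    · exact HasDerivAt.comp (h₂ := fun x => ∫ t in 0..x, ρ t) 0 (by simpa using hd p) a2
  have hs := hd2.tendsto_slope_zero_right
  have hs2 := hs.const_mul (1 / 2)
  have e0 : 1 / 2 * (ρ p * (1 / c) - ρ p * (-(1 / c))) = c⁻¹ * ρ p := by ring
  rw [e0] at hs2
  refine hs2.congr' ?_
  filter_upwards [self_mem_nhdsWithin] with η hη
  have hη : 0 < η := hη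
  have hmeas : (ℳ).real {w | |⟪n, w - v⟫| < η}
      = ∫ t in (p - η / c)..(p + η / c), ρ t := by
    have hset : {w : Vel d | |⟪n, w - v⟫| < η}
        = modeVel β n ⁻¹' Ioo (p - η / c) (p + η / c) := by
      ext w
      rw [mem_ofPred_eq, inner_sub_right, ← modeScale_mul_modeVel hβ hn,
        ← modeScale_mul_modeVel hβ hn, ← mul_sub, abs_mul, abs_of_pos hc, mem_preimage, mem_Ioo,
        ← lt_div_iff₀' hc, abs_lt]
      constructor <;> rintro ⟨h1, h2⟩ <;> constructor <;> linarith
    have hle : p - η / c ≤ p + η / c := by have : 0 < η / c := by positivity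
                                           linarith
    rw [hset, measureReal_def, (measurePreserving_modeVel hβ hn).measure_preimage
      measurableSet_Ioo.nullMeasurableSet, gaussianReal_apply_eq_integral _ one_ne_zero,
      ENNReal.toReal_ofReal (integral_nonneg fun _ => gaussianPDFReal_nonneg _ _ _),
      intervalIntegral.integral_of_le hle, integral_Ioc_eq_integral_Ioo]
  rw [deltaApprox, hmeas]
  simp only [zero_add, zero_div, add_zero, sub_zero, sub_self, smul_eq_mul]
  rw [intervalIntegral.integral_interval_sub_left (hρc.intervalIntegrable _ _)
    (hρc.intervalIntegrable _ _), mul_inv]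
  ring

lemma deltaAvg_eq (hβ : 0 < β) {n : ℤᵈ} (hn : n ≠ 0) (v : Vel d) :
    π * deltaAvg β (waveVec n) v = (modeScale β n)⁻¹ * (gaussJ (modeVel β n v)).im := by
  rw [deltaAvg, (tendsto_deltaApprox hβ hn v).limUnder_eq, gaussJ_ofReal_im, gaussianPDFReal]
  simp
  ring_nf

/-! ### Fourier analysis on the torus -/

instance isProbabilityMeasure_torusMeasure (d : ℕ) : IsProbabilityMeasure (torusMeasure d) := by
  unfold torusMeasure; infer_instance

instance isAddLeftInvariant_torusMeasure (d : ℕ) : (torusMeasure d).IsAddLeftInvariant := by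
  unfold torusMeasure; infer_instance

instance isNegInvariant_torusMeasure (d : ℕ) : (torusMeasure d).IsNegInvariant := by
  have : (AddCircle.haarAddCircle : Measure UnitAddCircle).IsNegInvariant := by
    unfold AddCircle.haarAddCircle; infer_instance
  unfold torusMeasure; infer_instance

open UnitAddTorus

lemma norm_mFourier_apply {ι : Type*} [Fintype ι] (n : ι → ℤ) (x : UnitAddTorus ι) :
    ‖mFourier n x‖ = 1 := by
  simp [mFourier, fourier_apply, norm_prod, Circle.norm_coe]

lemma mFourier_apply_add {ι : Type*} [Fintype ι] (n : ι → ℤ) (x y : UnitAddTorus ι) :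
    mFourier n (x + y) = mFourier n x * mFourier n y := by
  simp [mFourier, fourier_apply, ← Finset.prod_mul_distrib, smul_add, AddCircle.toCircle_add]

lemma mFourier_apply_neg {ι : Type*} [Fintype ι] (n : ι → ℤ) (x : UnitAddTorus ι) :
    mFourier n (-x) = mFourier (-n) x := by
  simp [mFourier, fourier_apply]

lemma mFourier_neg_mul_self {ι : Type*} [Fintype ι] (n : ι → ℤ) (x : UnitAddTorus ι) :
    mFourier (-n) x * mFourier n x = 1 := by
  rw [← mFourier_add]; simp [mFourier_zero]

lemma mFourier_toTorus (n : ℤᵈ) (y : Vel d) :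
    mFourier n (toTorus y) = cexp (I * ⟪n, y⟫) := by
  simp only [mFourier, toTorus, ContinuousMap.coe_mk, fourier_coe_apply]
  rw [← Complex.exp_sum]
  congr 1
  simp only [waveVec, PiLp.inner_apply, RCLike.inner_apply, conj_trivial, ofReal_sum,
    mul_sum, ofReal_mul, ofReal_one, div_one, ofReal_intCast, ofReal_ofNat]
  refine sum_congr rfl fun i _ => ?_
  ring

lemma contDiff_mFourier_toTorus (n : ℤᵈ) :
    ContDiff ℝ (⊤ : ℕ∞) fun y : Vel d => mFourier n (toTorus y) := by
  simp_rw [mFourier_toTorus]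
  have h1 : ContDiff ℝ (⊤ : ℕ∞) fun y : Vel d => (⟪n, y⟫ : ℂ) :=
    Complex.ofRealCLM.contDiff.comp (contDiff_const.inner ℝ contDiff_id)
  fun_prop

lemma toTorus_add (y y' : Vel d) : toTorus (y + y') = toTorus y + toTorus y' := by
  funext i; simp [toTorus]

lemma toTorus_zero : toTorus (0 : Vel d) = 0 := by
  funext i; simp [toTorus]

@[fun_prop] lemma continuous_toTorus : Continuous (toTorus (d := d)) := by
  unfold toTorus
  exact continuous_pi fun i => (AddCircle.continuous_mk' 1).comp (by fun_prop)

lemma hasSum_sq_mFourierCoeff_of_memLp {ι : Type*} [Fintype ι] {f : UnitAddTorus ι → ℂ}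
    (hf : MemLp f 2 (Measure.pi fun _ : ι => (AddCircle.haarAddCircle : Measure UnitAddCircle))) :
    HasSum (fun n => ‖mFourierCoeff f n‖ ^ 2)
      (∫ x, ‖f x‖ ^ 2 ∂(Measure.pi fun _ : ι => (AddCircle.haarAddCircle : Measure UnitAddCircle))) := by
  have h := hasSum_sq_mFourierCoeff (hf.toLp f)
  have h1 : ∀ n, mFourierCoeff (hf.toLp f) n = mFourierCoeff f n := fun n => by
    refine integral_congr_ae ?_
    filter_upwards [hf.coeFn_toLp] with x hx
    rw [hx]
  simp_rw [h1] at h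
  have h2 : ∫ x, ‖hf.toLp f x‖ ^ 2
        ∂(Measure.pi fun _ : ι => (AddCircle.haarAddCircle : Measure UnitAddCircle))
      = ∫ x, ‖f x‖ ^ 2
        ∂(Measure.pi fun _ : ι => (AddCircle.haarAddCircle : Measure UnitAddCircle)) := by
    refine integral_congr_ae ?_
    filter_upwards [hf.coeFn_toLp] with x hx
    rw [hx]
  rw [← h2]
  exact h

/-! ### The potential and its gradient -/

/-- The complex Fourier coefficient of the potential is the real number `potHat V n`. -/
lemma mFourierCoeff_potential (heven : ∀ᵐ x ∂𝔗, V (-x) = V x) (n : ℤᵈ) :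
    ∫ x, mFourier (-n) x * (V x : ℂ) ∂𝔗 = potHat V n := by
  have h : conj (∫ x, mFourier (-n) x * (V x : ℂ) ∂𝔗)
      = ∫ x, mFourier (-n) x * (V x : ℂ) ∂𝔗 := by
    rw [← integral_conj, ← integral_neg_eq_self]
    refine integral_congr_ae ?_
    filter_upwards [heven] with x hx
    rw [map_mul, conj_ofReal, hx, mFourier_apply_neg, neg_neg, mFourier_neg]
  rw [potHat, ← conj_eq_iff_re.1 h]
  rfl

lemma potHat_neg (heven : ∀ᵐ x ∂𝔗, V (-x) = V x)
    (n : ℤᵈ) : potHat V (-n) = potHat V n := by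
  have h : ((potHat V (-n) : ℝ) : ℂ) = potHat V n := by
    rw [← mFourierCoeff_potential heven, ← mFourierCoeff_potential heven, ← integral_neg_eq_self]
    refine integral_congr_ae ?_
    filter_upwards [heven] with x hx
    rw [hx, mFourier_apply_neg]
    simp
  exact_mod_cast h

lemma IsW1Infty.nonneg (h : IsW1Infty V DV K) : 0 ≤ K := by
  obtain ⟨x, hx⟩ := h.bound.exists
  exact (abs_nonneg _).trans hx

lemma abs_potHat_le (h : IsW1Infty V DV K) (n : ℤᵈ) : |potHat V n| ≤ K := by
  refine (abs_re_le_norm _).trans ?_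
  have hb := norm_integral_le_of_norm_le_const (μ := 𝔗)
    (f := fun x => mFourier (-n) x * (V x : ℂ)) (C := K) (by
      filter_upwards [h.bound] with x hx
      rwa [norm_mul, norm_mFourier_apply, one_mul, norm_real])
  rw [probReal_univ, mul_one] at hb
  exact hb

lemma integrable_mFourier_mul {f : Torus d → ℝ} (hf : Integrable f 𝔗)
    (n : ℤᵈ) : Integrable (fun x => mFourier n x * (f x : ℂ)) 𝔗 :=
  hf.ofReal.bdd_mul (map_continuous _).aestronglyMeasurable
    (ae_of_all _ fun x => (norm_mFourier_apply n x).le)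

lemma IsW1Infty.integrable (h : IsW1Infty V DV K) : Integrable V 𝔗 :=
  Integrable.of_bound h.meas K h.bound

lemma IsW1Infty.aestronglyMeasurable_apply (h : IsW1Infty V DV K) (i : Fin d) :
    AEStronglyMeasurable (fun x => DV x i) 𝔗 :=
  (by fun_prop : Continuous fun v : Vel d => v i).comp_aestronglyMeasurable h.meas_grad

lemma IsW1Infty.abs_apply_le (h : IsW1Infty V DV K) (i : Fin d) :
    ∀ᵐ x ∂𝔗, |DV x i| ≤ K := by
  filter_upwards [h.bound_grad] with x hx
  exact (PiLp.norm_apply_le (DV x) i).trans hx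

lemma IsW1Infty.integrable_apply (h : IsW1Infty V DV K) (i : Fin d) :
    Integrable (fun x => DV x i) 𝔗 :=
  Integrable.of_bound (h.aestronglyMeasurable_apply i) K (h.abs_apply_le i)

lemma mFourier_add_toTorus_single (n : ℤᵈ) (x : Torus d) (i : Fin d) (t : ℝ) :
    mFourier n (x + toTorus (EuclideanSpace.single i t))
      = mFourier n x * cexp (I * (waveVec n i * t : ℝ)) := by
  rw [mFourier_apply_add, mFourier_toTorus]
  congr 4
  rw [EuclideanSpace.inner_single_right]
  simp [mul_comm]

lemma hasDerivAt_mFourier_add (n : ℤᵈ) (x : Torus d) (i : Fin d) :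
    HasDerivAt (fun t : ℝ => mFourier n (x + toTorus (EuclideanSpace.single i t)))
      (mFourier n x * (I * waveVec n i)) 0 := by
  simp_rw [mFourier_add_toTorus_single]
  have e : HasDerivAt (fun t : ℝ => I * ((waveVec n i * t : ℝ) : ℂ)) (I * (waveVec n i : ℝ)) 0 := by
    have := ((hasDerivAt_id (0 : ℝ)).const_mul (waveVec n i)).ofReal_comp.const_mul I
    simpa using this
  refine (e.cexp.const_mul (mFourier n x)).congr_deriv ?_
  simp

/-- The Fourier coefficients of `∇V`. -/
lemma integral_mFourier_mul_grad (h : IsW1Infty V DV K)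
    (heven : ∀ᵐ x ∂𝔗, V (-x) = V x) (n : ℤᵈ) (i : Fin d) :
    ∫ x, mFourier (-n) x * (DV x i : ℂ) ∂𝔗 = I * waveVec n i * potHat V n := by
  have hsm := contDiff_mFourier_toTorus (-n)
  have hder := fun x => hasDerivAt_mFourier_add (-n) x i
  have iV := integrable_mFourier_mul h.integrable (-n)
  have iD := integrable_mFourier_mul (h.integrable_apply i) (-n)
  have hre := h.weak_grad (fun x => (mFourier (-n) x).re)
    (Complex.reCLM.contDiff.comp hsm) i
  have him := h.weak_grad (fun x => (mFourier (-n) x).im)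
    (Complex.imCLM.contDiff.comp hsm) i
  have dre : ∀ x, deriv (fun t : ℝ => (mFourier (-n) (x + toTorus (EuclideanSpace.single i t))).re) 0
      = (mFourier (-n) x * (I * waveVec (-n) i)).re := fun x =>
    (Complex.reCLM.hasFDerivAt.comp_hasDerivAt (0 : ℝ) (hder x)).deriv
  have dim : ∀ x, deriv (fun t : ℝ => (mFourier (-n) (x + toTorus (EuclideanSpace.single i t))).im) 0
      = (mFourier (-n) x * (I * waveVec (-n) i)).im := fun x =>
    (Complex.imCLM.hasFDerivAt.comp_hasDerivAt (0 : ℝ) (hder x)).deriv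
  simp_rw [dre] at hre
  simp_rw [dim] at him
  have key : ∫ x, (mFourier (-n) x * (V x : ℂ)) * (I * waveVec (-n) i) ∂𝔗
      = -∫ x, mFourier (-n) x * (DV x i : ℂ) ∂𝔗 := by
    apply Complex.ext
    · rw [neg_re, ← RCLike.re_to_complex, ← integral_re (iV.mul_const _), ← RCLike.re_to_complex,
        ← integral_re iD]
      calc _ = ∫ x, V x * (mFourier (-n) x * (I * waveVec (-n) i)).re ∂𝔗 := by
            refine integral_congr_fun fun x => ?_
            simp only [RCLike.re_to_complex]
            rw [← re_ofReal_mul]; congr 1; ring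
        _ = _ := by
            rw [hre]; congr 1
            refine integral_congr_fun fun x => ?_
            simp only [RCLike.re_to_complex]
            rw [← re_ofReal_mul, mul_comm]
    · rw [neg_im, ← RCLike.im_to_complex, ← integral_im (iV.mul_const _), ← RCLike.im_to_complex,
        ← integral_im iD]
      calc _ = ∫ x, V x * (mFourier (-n) x * (I * waveVec (-n) i)).im ∂𝔗 := by
            refine integral_congr_fun fun x => ?_
            simp only [RCLike.im_to_complex]
            rw [← im_ofReal_mul]; congr 1; ring
        _ = _ := by
            rw [him]; congr 1
            refine integral_congr_fun fun x => ?_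
            simp only [RCLike.im_to_complex]
            rw [← im_ofReal_mul, mul_comm]
  rw [integral_mul_const, mFourierCoeff_potential heven, waveVec_neg] at key
  simp only [PiLp.neg_apply, ofReal_neg] at key
  linear_combination key

/-- Bessel's inequality for `∇V`. -/
lemma summable_sq_waveVec_mul_potHat (h : IsW1Infty V DV K)
    (heven : ∀ᵐ x ∂𝔗, V (-x) = V x) :
    Summable (fun n : ℤᵈ => ‖waveVec n‖ ^ 2 * potHat V n ^ 2) ∧
      ∑' n : ℤᵈ, ‖waveVec n‖ ^ 2 * potHat V n ^ 2 ≤ d * K ^ 2 := by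
  have hK := h.nonneg
  have hm : ∀ i : Fin d, MemLp (fun x => (DV x i : ℂ)) 2 𝔗 := fun i =>
    MemLp.of_bound (continuous_ofReal.comp_aestronglyMeasurable (h.aestronglyMeasurable_apply i)) K (by
      filter_upwards [h.abs_apply_le i] with x hx
      rwa [norm_real])
  have hs := hasSum_sum (s := Finset.univ) fun (i : Fin d) _ => hasSum_sq_mFourierCoeff_of_memLp (hm i)
  have e : ∀ n : ℤᵈ, ∑ i : Fin d, ‖mFourierCoeff (fun x => (DV x i : ℂ)) n‖ ^ 2
      = ‖waveVec n‖ ^ 2 * potHat V n ^ 2 := by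
    intro n
    have : ∀ i : Fin d, mFourierCoeff (fun x => (DV x i : ℂ)) n = I * waveVec n i * potHat V n :=
      fun i => integral_mFourier_mul_grad h heven n i
    simp_rw [this, norm_mul, norm_I, one_mul, norm_real, mul_pow]
    rw [← sum_mul, EuclideanSpace.norm_sq_eq]
    simp
  simp_rw [e] at hs
  refine ⟨hs.summable, ?_⟩
  rw [hs.tsum_eq]
  calc _ ≤ ∑ i : Fin d, K ^ 2 := by
        refine sum_le_sum fun i _ => ?_
        have hb := norm_integral_le_of_norm_le_const (μ := 𝔗)
          (f := fun x => ‖(DV x i : ℂ)‖ ^ 2) (C := K ^ 2) (by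
            filter_upwards [h.abs_apply_le i] with x hx
            rw [norm_real, Real.norm_of_nonneg (by positivity), Real.norm_eq_abs]
            exact pow_le_pow_left₀ (abs_nonneg _) hx 2)
        rw [probReal_univ, mul_one] at hb
        exact (le_abs_self _).trans hb
    _ = _ := by simp

/-! ### Product measures -/

instance isProbabilityMeasure_maxwell_of_fact {d : ℕ} {β : ℝ} [h : Fact (0 < β)] :
    IsProbabilityMeasure (maxwell d β) := isProbabilityMeasure_maxwell h.out

instance isProbabilityMeasure_phaseMeasure {d : ℕ} {β : ℝ} [Fact (0 < β)] :
    IsProbabilityMeasure (phaseMeasure d β) := by unfold phaseMeasure; infer_instance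

instance isProbabilityMeasure_phaseMeasureN {d : ℕ} {β : ℝ} [Fact (0 < β)] {n : ℕ} :
    IsProbabilityMeasure (phaseMeasureN d β n) := by unfold phaseMeasureN; infer_instance

variable {X : Type*} [MeasurableSpace X] {n : ℕ}

/-- Exchanging the value in the slot `j` with an additional variable preserves the product
measure. -/
lemma measurePreserving_swap_update (μ : Measure X) [IsProbabilityMeasure μ] (j : Fin n) :
    MeasurePreserving (fun q : (Fin n → X) × X => (update q.1 j q.2, q.1 j))
      ((Measure.pi fun _ : Fin n => μ).prod μ) ((Measure.pi fun _ : Fin n => μ).prod μ) := by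
  have hm : Measurable fun q : (Fin n → X) × X => (update q.1 j q.2, q.1 j) := by
    refine Measurable.prodMk ?_ ((measurable_pi_apply j).comp measurable_fst)
    refine measurable_pi_lambda _ fun i => ?_
    by_cases h : i = j
    · subst h; simpa using measurable_snd
    · simp only [update_of_ne h]
      exact (measurable_pi_apply i).comp measurable_fst
  refine ⟨hm, ?_⟩
  symm
  set C : Set (Set (Fin n → X)) := Set.pi univ '' Set.pi univ fun _ => {s | MeasurableSet s}
  refine Measure.prod_eq_generateFrom (C := C) (D := {s | MeasurableSet s}) generateFrom_pi
    MeasurableSpace.generateFrom_measurableSet isPiSystem_pi MeasurableSpace.isPiSystem_measurableSet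
    ⟨fun _ => univ, fun _ => ⟨fun _ => univ, by simp, by simp⟩, fun _ => measure_lt_top _ _,
      iUnion_const _⟩
    ⟨fun _ => univ, fun _ => MeasurableSet.univ, fun _ => measure_lt_top _ _, iUnion_const _⟩ ?_
  rintro _ ⟨s, hs, rfl⟩ t ht
  simp only [Set.mem_pi, mem_univ, forall_true_left] at hs
  have ht' : MeasurableSet t := ht
  rw [Measure.map_apply hm ((MeasurableSet.univ_pi hs).prod ht')]
  have e : (fun q : (Fin n → X) × X => (update q.1 j q.2, q.1 j)) ⁻¹' (Set.pi univ s ×ˢ t)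
      = (Set.pi univ (update s j t)) ×ˢ s j := by
    ext q
    simp only [mem_preimage, mem_prod, Set.mem_pi, mem_univ, forall_true_left]
    constructor
    · rintro ⟨h1, h2⟩
      refine ⟨fun i => ?_, by simpa using h1 j⟩
      by_cases h : i = j
      · subst h; simpa using h2
      · simpa [update_of_ne h] using h1 i
    · rintro ⟨h1, h2⟩
      refine ⟨fun i => ?_, by simpa using h1 j⟩
      by_cases h : i = j
      · subst h; simpa using h2
      · simpa [update_of_ne h] using h1 i
  rw [e, Measure.prod_prod, Measure.pi_pi, Measure.pi_pi,
    ← Finset.mul_prod_erase _ _ (mem_univ j), ← Finset.mul_prod_erase _ _ (mem_univ j)]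
  simp only [update_self]
  rw [mul_right_comm, mul_comm (μ t), mul_assoc, mul_comm (μ t), ← mul_assoc]
  congr 2
  refine Finset.prod_congr rfl fun i hi => ?_
  rw [update_of_ne (Finset.ne_of_mem_erase hi)]

lemma measurePreserving_update (μ : Measure X) [IsProbabilityMeasure μ] (j : Fin n) :
    MeasurePreserving (fun q : (Fin n → X) × X => update q.1 j q.2)
      ((Measure.pi fun _ : Fin n => μ).prod μ) (Measure.pi fun _ : Fin n => μ) :=
  measurePreserving_fst.comp (measurePreserving_swap_update μ j)

/-- Integrating out the slot `j` first. -/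
lemma integral_pi_update {E : Type*} [NormedAddCommGroup E] [NormedSpace ℝ E] (μ : Measure X)
    [IsProbabilityMeasure μ] (j : Fin n) {f : (Fin n → X) → E}
    (hf : Integrable f (Measure.pi fun _ : Fin n => μ)) :
    ∫ z, f z ∂(Measure.pi fun _ : Fin n => μ)
      = ∫ z, ∫ s, f (update z j s) ∂μ ∂(Measure.pi fun _ : Fin n => μ) := by
  have h := measurePreserving_update μ j
  rw [← integral_prod (fun q : (Fin n → X) × X => f (update q.1 j q.2))
    (h.integrable_comp_of_integrable hf)]
  conv_lhs => rw [← h.map_eq]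
  rw [integral_map h.measurable.aemeasurable (by rw [h.map_eq]; exact hf.1)]

/-- Exchanging the slot `j` with the additional variable under the integral. -/
lemma integral_swap_update {E : Type*} [NormedAddCommGroup E] [NormedSpace ℝ E] (μ : Measure X)
    [IsProbabilityMeasure μ] (j : Fin n) {f : (Fin n → X) × X → E}
    (hf : Integrable f ((Measure.pi fun _ : Fin n => μ).prod μ)) :
    ∫ z, ∫ s, f (z, s) ∂μ ∂(Measure.pi fun _ : Fin n => μ)
      = ∫ z, ∫ s, f (update z j s, z j) ∂μ ∂(Measure.pi fun _ : Fin n => μ) := by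
  have h := measurePreserving_swap_update μ j
  rw [← integral_prod f hf,
    ← integral_prod (fun q : (Fin n → X) × X => f (update q.1 j q.2, q.1 j))
      (h.integrable_comp_of_integrable hf)]
  conv_lhs => rw [← h.map_eq]
  rw [integral_map h.measurable.aemeasurable (by rw [h.map_eq]; exact hf.1)]

/-! ### Positions and velocities -/

/-- The measure `M_β^{⊗n} dv`. -/
abbrev velMeasureN (d : ℕ) (β : ℝ) (n : ℕ) : Measure (Fin n → Vel d) :=
  Measure.pi fun _ : Fin n => maxwell d β

/-- The Lebesgue measure on `(𝕋ᵈ)ⁿ`. -/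
abbrev torusMeasureN (d n : ℕ) : Measure (Fin n → Torus d) :=
  Measure.pi fun _ : Fin n => torusMeasure d

/-- The positions. -/
def posOf (z : Fin n → Phase d) : Fin n → Torus d := fun j => (z j).1

/-- The velocities. -/
def velOf (z : Fin n → Phase d) : Fin n → Vel d := fun j => (z j).2

@[fun_prop] lemma continuous_posOf : Continuous (posOf (d := d) (n := n)) := by unfold posOf; fun_prop

@[fun_prop] lemma continuous_velOf : Continuous (velOf (d := d) (n := n)) := by unfold velOf; fun_prop

lemma measurePreserving_split (d : ℕ) (β : ℝ) [Fact (0 < β)] (n : ℕ) :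
    MeasurePreserving (fun z : Fin n → Phase d => (posOf z, velOf z)) (phaseMeasureN d β n)
      ((torusMeasureN d n).prod (velMeasureN d β n)) :=
  measurePreserving_arrowProdEquivProdArrow (Torus d) (Vel d) (Fin n) (fun _ => torusMeasure d)
    (fun _ => maxwell d β)

lemma measurePreserving_velOf (d : ℕ) (β : ℝ) [Fact (0 < β)] (n : ℕ) :
    MeasurePreserving (velOf (d := d)) (phaseMeasureN d β n) (velMeasureN d β n) :=
  measurePreserving_snd.comp (measurePreserving_split d β n)

lemma measurePreserving_join (d : ℕ) (β : ℝ) [Fact (0 < β)] (n : ℕ) :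
    MeasurePreserving (fun q : (Fin n → Torus d) × (Fin n → Vel d) => fun j => (q.1 j, q.2 j))
      ((torusMeasureN d n).prod (velMeasureN d β n)) (phaseMeasureN d β n) :=
  (measurePreserving_arrowProdEquivProdArrow (Torus d) (Vel d) (Fin n) (fun _ => torusMeasure d)
    (fun _ => maxwell d β)).symm

lemma measurePreserving_eval_phase (d : ℕ) (β : ℝ) [Fact (0 < β)] (n : ℕ) (j : Fin n) :
    MeasurePreserving (fun z : Fin n → Phase d => z j) (phaseMeasureN d β n) (phaseMeasure d β) :=
  measurePreserving_eval (fun _ : Fin n => phaseMeasure d β) j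

/-- The character `∏_j e^{i k_j · x_j}`, with `k_j = 2πκ_j`. -/
def torusChar (κ : Fin n → ℤᵈ) (x : Fin n → Torus d) : ℂ := ∏ j, mFourier (κ j) (x j)

@[fun_prop] lemma continuous_torusChar (κ : Fin n → ℤᵈ) : Continuous (torusChar κ) := by
  unfold torusChar; fun_prop

lemma norm_torusChar (κ : Fin n → ℤᵈ) (x : Fin n → Torus d) : ‖torusChar κ x‖ = 1 := by
  simp [torusChar, norm_prod, norm_mFourier_apply]

lemma torusChar_mul (κ κ' : Fin n → ℤᵈ) (x : Fin n → Torus d) :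
    torusChar κ x * torusChar κ' x = torusChar (κ + κ') x := by
  simp [torusChar, ← Finset.prod_mul_distrib, mFourier_add]

lemma torusChar_zero (x : Fin n → Torus d) : torusChar 0 x = 1 := by
  simp [torusChar, mFourier_zero]

lemma torusChar_neg (κ : Fin n → ℤᵈ) (x : Fin n → Torus d) :
    torusChar (-κ) x = conj (torusChar κ x) := by
  simp [torusChar, mFourier_neg]

lemma torusChar_update (κ : Fin n → ℤᵈ) (x : Fin n → Torus d) (j : Fin n) (y : Torus d) :
    torusChar κ (update x j y)
      = torusChar κ x * mFourier (-κ j) (x j) * mFourier (κ j) y := by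
  have h1 := Finset.mul_prod_erase Finset.univ (fun i => mFourier (κ i) (update x j y i))
    (mem_univ j)
  have h2 := Finset.mul_prod_erase Finset.univ (fun i => mFourier (κ i) (x i)) (mem_univ j)
  have h3 : ∏ i ∈ Finset.univ.erase j, mFourier (κ i) (update x j y i)
      = ∏ i ∈ Finset.univ.erase j, mFourier (κ i) (x i) :=
    Finset.prod_congr rfl fun i hi => by rw [update_of_ne (Finset.ne_of_mem_erase hi)]
  rw [torusChar, torusChar, ← h1, ← h2, h3]
  simp only [update_self]
  linear_combination (-(mFourier (κ j) y) * ∏ i ∈ Finset.univ.erase j, mFourier (κ i) (x i))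
    * mFourier_neg_mul_self (κ j) (x j)

lemma integral_mFourier {n : ℤᵈ} (hn : n ≠ 0) : ∫ x, mFourier n x ∂𝔗 = 0 := by
  have h := (orthonormal_iff_ite.1 (orthonormal_mFourier (d := Fin d))) 0 n
  rw [if_neg hn.symm] at h
  rw [ContinuousMap.inner_toLp] at h
  rw [← h]
  refine integral_congr_fun fun x => ?_
  simp [mFourier_zero]

lemma integral_torusChar {κ : Fin n → ℤᵈ} (hκ : κ ≠ 0) :
    ∫ x, torusChar κ x ∂torusMeasureN d n = 0 := by
  obtain ⟨j, hj⟩ := ne_iff.1 hκ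
  unfold torusChar
  rw [integral_fintype_prod_eq_prod (fun (j : Fin n) (y : Torus d) => mFourier (κ j) y)]
  exact Finset.prod_eq_zero (mem_univ j) (integral_mFourier hj)

lemma measurePreserving_curry (d n : ℕ) :
    MeasurePreserving (fun (x : Fin n × Fin d → UnitAddCircle) (j : Fin n) (i : Fin d) => x (j, i))
      (Measure.pi fun _ : Fin n × Fin d => (AddCircle.haarAddCircle : Measure UnitAddCircle))
      (torusMeasureN d n) := by
  have hm : Measurable fun (x : Fin n × Fin d → UnitAddCircle) (j : Fin n) (i : Fin d) => x (j, i) :=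
    measurable_pi_lambda _ fun j => measurable_pi_lambda _ fun i => measurable_pi_apply _
  refine (MeasurePreserving.symm (MeasurableEquiv.curry (Fin n) (Fin d) UnitAddCircle).symm
    ⟨(MeasurableEquiv.curry (Fin n) (Fin d) UnitAddCircle).symm.measurable, ?_⟩)
  symm
  refine Measure.pi_eq fun s hs => ?_
  rw [Measure.map_apply (MeasurableEquiv.measurable _) (MeasurableSet.univ_pi hs)]
  have e : (MeasurableEquiv.curry (Fin n) (Fin d) UnitAddCircle).symm ⁻¹' (Set.pi univ s)
      = Set.pi univ fun j => Set.pi univ fun i => s (j, i) := by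
    ext x
    simp [MeasurableEquiv.coe_curry_symm, uncurry]
  rw [e, Measure.pi_pi, Fintype.prod_prod_type]
  refine Finset.prod_congr rfl fun j _ => ?_
  rw [torusMeasure, Measure.pi_pi]

/-- Completeness of the characters. -/
lemma ae_eq_zero_of_torusChar {f : (Fin n → Torus d) → ℂ} (hf : MemLp f 2 (torusMeasureN d n))
    (h : ∀ κ : Fin n → ℤᵈ, ∫ x, torusChar κ x * f x ∂torusMeasureN d n = 0) :
    f =ᵐ[torusMeasureN d n] 0 := by
  have hmp := measurePreserving_curry d n
  set c := fun (x : Fin n × Fin d → UnitAddCircle) (j : Fin n) (i : Fin d) => x (j, i) with hc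
  have hf' := hf.comp_measurePreserving hmp
  have hs := hasSum_sq_mFourierCoeff_of_memLp hf'
  have h0 : ∀ m : Fin n × Fin d → ℤ, mFourierCoeff (f ∘ c) m = 0 := by
    intro m
    have hm := h fun j i => -m (j, i)
    rw [← hmp.map_eq, integral_map hmp.measurable.aemeasurable] at hm
    · rw [← hm]
      refine integral_congr_fun fun x => ?_
      simp only [Function.comp, smul_eq_mul, torusChar]
      congr 1
      simp only [mFourier, ContinuousMap.coe_mk]
      rw [Fintype.prod_prod_type]
      rfl
    · rw [hmp.map_eq]
      exact (continuous_torusChar fun j i => -m (j, i)).aestronglyMeasurable.mul hf.1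
  simp_rw [h0] at hs
  have h00 : HasSum (fun _ : Fin n × Fin d → ℤ => ‖(0 : ℂ)‖ ^ 2) 0 := by
    simp
  have hz := hs.unique h00
  have hz' : ∫ x, ‖f x‖ ^ 2 ∂torusMeasureN d n = 0 := by
    rw [← hz, ← hmp.map_eq, integral_map hmp.measurable.aemeasurable]
    · rfl
    · rw [hmp.map_eq]; exact hf.1.norm.pow 2
  have hi : Integrable (fun x => ‖f x‖ ^ 2) (torusMeasureN d n) :=
    (memLp_two_iff_integrable_sq_norm hf.1).1 hf
  filter_upwards [(integral_eq_zero_iff_of_nonneg (fun x => by positivity) hi).1 hz'] with x hx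
  simpa using hx

local notation "𝔙" => velMeasureN d β

/-! ### Test functions on phase space -/

/-- A measurable choice of lifts of the points of phase space. -/
def phaseLift (z : Fin n → Phase d) : Fin n → Vel d × Vel d :=
  fun j => (WithLp.toLp 2 fun i => ((AddCircle.equivIoc 1 0 ((z j).1 i)).1 : ℝ), (z j).2)

/-- The projection of the lifts to phase space. -/
def phaseProj (y : Fin n → Vel d × Vel d) : Fin n → Phase d := fun j => (toTorus (y j).1, (y j).2)

lemma phaseProj_phaseLift (z : Fin n → Phase d) : phaseProj (phaseLift z) = z := by
  funext j
  refine Prod.ext ?_ rfl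
  funext i
  exact AddCircle.coe_equivIoc

@[fun_prop] lemma measurable_phaseLift : Measurable (phaseLift (d := d) (n := n)) := by
  refine measurable_pi_lambda _ fun j => Measurable.prodMk ?_ (by fun_prop)
  refine (WithLp.measurable_toLp 2 _).comp (measurable_pi_lambda _ fun i => ?_)
  exact measurable_subtype_coe.comp ((AddCircle.measurableEquivIoc 1 0).measurable.comp
    ((measurable_pi_apply i).comp (measurable_fst.comp (measurable_pi_apply j))))

@[fun_prop] lemma continuous_phaseProj : Continuous (phaseProj (d := d) (n := n)) := by
  unfold phaseProj
  exact continuous_pi fun j => (continuous_toTorus.comp (by fun_prop)).prodMk (by fun_prop)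

lemma phaseProj_add_periodic {y τ : Fin n → Vel d × Vel d}
    (hτ : ∀ j, toTorus (τ j).1 = 0 ∧ (τ j).2 = 0) : phaseProj (y + τ) = phaseProj y := by
  funext j
  simp [phaseProj, toTorus_add, hτ j]

lemma exists_norm_phaseLift_le (ρ : ℝ) : ∃ r : ℝ, ∀ z : Fin n → Phase d,
    (∀ j, ‖(z j).2‖ ≤ ρ) → ‖phaseLift z‖ ≤ r := by
  refine ⟨max |ρ| (√d), fun z hz => ?_⟩
  refine (pi_norm_le_iff_of_nonneg (by positivity)).2 fun j => ?_
  refine (norm_prod_le_iff).2 ⟨?_, ((hz j).trans (le_abs_self ρ)).trans (le_max_left _ _)⟩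
  refine le_trans ?_ (le_max_right _ _)
  rw [EuclideanSpace.norm_eq]
  refine Real.sqrt_le_sqrt ?_
  calc _ ≤ ∑ i : Fin d, (1 : ℝ) := by
        refine sum_le_sum fun i _ => ?_
        have h := (AddCircle.equivIoc (1 : ℝ) 0 ((z j).1 i)).2
        have h1 : |((AddCircle.equivIoc (1 : ℝ) 0 ((z j).1 i)).1 : ℝ)| ≤ 1 := by
          rw [abs_le]; constructor <;> linarith [h.1, h.2]
        exact pow_le_one₀ (norm_nonneg _) h1
    _ = _ := by simp

/-- Bounded measurable functions vanishing at large velocities. -/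
structure IsBddTest (f : (Fin n → Phase d) → ℂ) : Prop where
  meas : Measurable f
  bound : ∃ C : ℝ, ∀ z, ‖f z‖ ≤ C
  supp : ∃ ρ : ℝ, ∀ z j, ρ < ‖(z j).2‖ → f z = 0

lemma isBddTest_of_lift {F : (Fin n → Vel d × Vel d) → ℂ} (hF : Continuous F) {ρ : ℝ}
    (hρ : ∀ y j, ρ < ‖(y j).2‖ → F y = 0) : IsBddTest fun z => F (phaseLift z) := by
  refine ⟨hF.measurable.comp measurable_phaseLift, ?_, ρ, fun z j hz => hρ (phaseLift z) j hz⟩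
  obtain ⟨r, hr⟩ := exists_norm_phaseLift_le (d := d) (n := n) ρ
  obtain ⟨C, hC⟩ := (isCompact_closedBall (0 : Fin n → Vel d × Vel d) r).exists_bound_of_continuousOn
    hF.continuousOn
  have hC' : ∀ y : Fin n → Vel d × Vel d, ‖y‖ ≤ r → ‖F y‖ ≤ |C| := fun y hy =>
    (hC y (mem_closedBall_zero_iff.2 hy)).trans (le_abs_self C)
  refine ⟨|C|, fun z => ?_⟩
  by_cases h : ∀ j, ‖(z j).2‖ ≤ ρ
  · exact hC' (phaseLift z) (hr z h)
  · push Not at h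
    obtain ⟨j, hj⟩ := h
    rw [hρ (phaseLift z) j hj, norm_zero]
    exact abs_nonneg _

lemma IsBddTest.mul_bdd {f g : (Fin n → Phase d) → ℂ} (hf : IsBddTest f) (hg : Measurable g)
    (hb : ∀ ρ : ℝ, ∃ C : ℝ, ∀ z, (∀ j, ‖(z j).2‖ ≤ ρ) → ‖g z‖ ≤ C) :
    IsBddTest fun z => g z * f z := by
  obtain ⟨C, hC⟩ := hf.bound
  obtain ⟨ρ, hρ⟩ := hf.supp
  obtain ⟨D, hD⟩ := hb ρ
  refine ⟨hg.mul hf.meas, ⟨|D| * |C|, fun z => ?_⟩, ρ, fun z j hz => by rw [hρ z j hz, mul_zero]⟩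
  by_cases h : ∀ j, ‖(z j).2‖ ≤ ρ
  · rw [norm_mul]
    exact mul_le_mul ((hD z h).trans (le_abs_self D)) ((hC z).trans (le_abs_self C)) (norm_nonneg _)
      (abs_nonneg _)
  · push Not at h
    obtain ⟨j, hj⟩ := h
    rw [hρ z j hj, mul_zero, norm_zero]
    positivity

lemma IsBddTest.vel_mul {f : (Fin n → Phase d) → ℂ} (hf : IsBddTest f) (j : Fin n) (i : Fin d) :
    IsBddTest fun z => (((z j).2 i : ℝ) : ℂ) * f z :=
  hf.mul_bdd (by fun_prop) fun ρ => ⟨ρ, fun z hz => by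
    rw [norm_real]; exact (PiLp.norm_apply_le _ i).trans (hz j)⟩

lemma IsBddTest.add {f g : (Fin n → Phase d) → ℂ} (hf : IsBddTest f) (hg : IsBddTest g) :
    IsBddTest fun z => f z + g z := by
  obtain ⟨C, hC⟩ := hf.bound
  obtain ⟨D, hD⟩ := hg.bound
  obtain ⟨ρ, hρ⟩ := hf.supp
  obtain ⟨σ, hσ⟩ := hg.supp
  exact ⟨hf.meas.add hg.meas, ⟨C + D, fun z => (norm_add_le _ _).trans (add_le_add (hC z) (hD z))⟩,
    max ρ σ, fun z j hz => by
      rw [hρ z j ((le_max_left _ _).trans_lt hz), hσ z j ((le_max_right _ _).trans_lt hz), add_zero]⟩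

lemma isBddTest_zero : IsBddTest fun _ : Fin n → Phase d => (0 : ℂ) :=
  ⟨measurable_const, ⟨0, fun _ => by simp⟩, 0, fun _ _ _ => rfl⟩

lemma IsBddTest.sum {ι : Type*} (s : Finset ι) {f : ι → (Fin n → Phase d) → ℂ}
    (hf : ∀ i ∈ s, IsBddTest (f i)) : IsBddTest fun z => ∑ i ∈ s, f i z := by
  classical
  induction s using Finset.induction_on with
  | empty => simpa using isBddTest_zero
  | insert a s ha ih =>
    simp_rw [Finset.sum_insert ha]
    exact (hf a (Finset.mem_insert_self a s)).add
      (ih fun i hi => hf i (Finset.mem_insert_of_mem hi))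

/-- The lift of a function on phase space. -/
def testLift (φ : (Fin n → Phase d) → ℂ) (y : Fin n → Vel d × Vel d) : ℂ := φ (phaseProj y)

lemma testLift_phaseLift (φ : (Fin n → Phase d) → ℂ) (z : Fin n → Phase d) :
    testLift φ (phaseLift z) = φ z := by rw [testLift, phaseProj_phaseLift]

variable {φ : (Fin n → Phase d) → ℂ}

lemma IsPhaseTest.contDiff_lift (h : IsPhaseTest φ) : ContDiff ℝ (⊤ : ℕ∞) (testLift φ) := h.1

lemma IsPhaseTest.exists_supp (h : IsPhaseTest φ) :
    ∃ ρ : ℝ, ∀ z j, ρ < ‖(z j).2‖ → φ z = 0 := by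
  have hc : Continuous fun z : Fin n → Phase d => ∑ j, ‖(z j).2‖ := by fun_prop
  obtain ⟨ρ, hρ⟩ := h.2.isCompact.exists_bound_of_continuousOn hc.continuousOn
  refine ⟨ρ, fun z j hz => ?_⟩
  by_contra hne
  have h1 := hρ z (subset_tsupport _ hne)
  have h2 : ‖(z j).2‖ ≤ ∑ j, ‖(z j).2‖ :=
    Finset.single_le_sum (f := fun j => ‖(z j).2‖) (fun _ _ => norm_nonneg _) (mem_univ j)
  rw [Real.norm_of_nonneg (Finset.sum_nonneg fun _ _ => norm_nonneg _)] at h1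
  linarith

lemma IsPhaseTest.fderiv_lift_eq_zero {ρ : ℝ} (hρ : ∀ z j, ρ < ‖(z j).2‖ → φ z = 0)
    {y : Fin n → Vel d × Vel d} {j : Fin n} (hy : ρ < ‖(y j).2‖) : fderiv ℝ (testLift φ) y = 0 := by
  have hev : testLift φ =ᶠ[𝓝 y] fun _ => 0 := by
    have ho : IsOpen {y : Fin n → Vel d × Vel d | ρ < ‖(y j).2‖} :=
      isOpen_lt continuous_const (by fun_prop)
    filter_upwards [ho.mem_nhds hy] with y' hy'
    exact hρ _ j hy'
  rw [hev.fderiv_eq]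
  simp

lemma IsPhaseTest.isBddTest (h : IsPhaseTest φ) : IsBddTest φ := by
  obtain ⟨ρ, hρ⟩ := h.exists_supp
  have := isBddTest_of_lift h.contDiff_lift.continuous (ρ := ρ) fun y j hy => hρ _ j hy
  simpa only [testLift_phaseLift] using this

/-- The derivative of a test function in a fixed direction of the lifted phase space. -/
def liftDeriv (φ : (Fin n → Phase d) → ℂ) (u : Fin n → Vel d × Vel d) (z : Fin n → Phase d) : ℂ :=
  fderiv ℝ (testLift φ) (phaseLift z) u

lemma IsPhaseTest.isBddTest_liftDeriv (h : IsPhaseTest φ) (u : Fin n → Vel d × Vel d) :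
    IsBddTest (liftDeriv φ u) := by
  obtain ⟨ρ, hρ⟩ := h.exists_supp
  refine isBddTest_of_lift (F := fun y => fderiv ℝ (testLift φ) y u) (ρ := ρ) ?_ fun y j hy => ?_
  · exact (h.contDiff_lift.continuous_fderiv (by simp)).clm_apply continuous_const
  · rw [IsPhaseTest.fderiv_lift_eq_zero hρ hy, zero_apply]

lemma fderiv_testLift (φ : (Fin n → Phase d) → ℂ) (y u : Fin n → Vel d × Vel d) :
    fderiv ℝ (testLift φ) y u = liftDeriv φ u (phaseProj y) := by
  set τ := y - phaseLift (phaseProj y) with hτ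
  have hy : y = phaseLift (phaseProj y) + τ := by rw [hτ]; abel
  have hp : phaseProj (phaseLift (phaseProj y)) = phaseProj y := phaseProj_phaseLift _
  have hτ0 : ∀ j, toTorus (τ j).1 = 0 ∧ (τ j).2 = 0 := by
    intro j
    have h1 := congrFun hp j
    rw [hy] at h1
    have h2 := congrArg Prod.fst h1
    refine ⟨?_, by simp [hτ, phaseLift, phaseProj]⟩
    simp only [phaseProj, Pi.add_apply, Prod.fst_add, toTorus_add] at h2
    have h3 : phaseProj (phaseLift (phaseProj y)) j = phaseProj y j := congrFun hp j
    have h4 := congrArg Prod.fst h3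
    have h5 : (phaseProj y j).1 = toTorus ((phaseLift (phaseProj y) j).1) + toTorus (τ j).1 := by
      conv_lhs => rw [hy]
      simp only [phaseProj, Pi.add_apply, Prod.fst_add, toTorus_add]
    have h6 : (phaseProj (phaseLift (phaseProj y)) j).1 = toTorus ((phaseLift (phaseProj y) j).1) :=
      rfl
    rw [← h4, h6] at h5
    simpa using h5.symm
  have hper : (fun y' => testLift φ (y' + τ)) = testLift φ := by
    funext y'
    rw [testLift, phaseProj_add_periodic hτ0, testLift]
  conv_lhs => rw [hy]
  rw [← fderiv_comp_add_right, hper, liftDeriv]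

lemma IsPhaseTest.hasDerivAt_line (h : IsPhaseTest φ) (y u : Fin n → Vel d × Vel d) (t : ℝ) :
    HasDerivAt (fun t : ℝ => testLift φ (y + t • u)) (liftDeriv φ u (phaseProj (y + t • u))) t := by
  rw [← fderiv_testLift]
  have h1 : HasDerivAt (fun t : ℝ => y + t • u) u t := by
    simpa using ((hasDerivAt_id t).smul_const u).const_add y
  exact ((h.contDiff_lift.differentiable (by simp)) _).hasFDerivAt.comp_hasDerivAt t h1

lemma liftDeriv_sum (φ : (Fin n → Phase d) → ℂ) {ι : Type*} (s : Finset ι) (c : ι → ℝ)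
    (u : ι → Fin n → Vel d × Vel d) (z : Fin n → Phase d) :
    liftDeriv φ (∑ i ∈ s, c i • u i) z = ∑ i ∈ s, (c i : ℂ) * liftDeriv φ (u i) z := by
  simp [liftDeriv, map_sum, map_smul]

/-- The direction of the `i`-th coordinate of the position in the slot `j`. -/
def posDir (j : Fin n) (i : Fin d) : Fin n → Vel d × Vel d :=
  Pi.single j (EuclideanSpace.single i 1, 0)

/-- The direction of the `i`-th coordinate of the velocity in the slot `j`. -/
def velDir (j : Fin n) (i : Fin d) : Fin n → Vel d × Vel d :=
  Pi.single j (0, EuclideanSpace.single i 1)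

lemma sum_smul_single (w : Vel d) : ∑ i : Fin d, w i • EuclideanSpace.single i (1 : ℝ) = w := by
  ext l
  simp [Finset.sum_apply, Pi.single_apply]

lemma sum_smul_posDir (j : Fin n) (w : Vel d) :
    ∑ i : Fin d, w i • posDir j i = Pi.single j (w, (0 : Vel d)) := by
  funext l
  by_cases h : l = j
  · subst h
    simp only [posDir, Finset.sum_apply, Pi.smul_apply, Pi.single_eq_same, Prod.smul_mk, smul_zero]
    refine Prod.ext ?_ ?_
    · rw [Prod.fst_sum]; exact sum_smul_single w
    · rw [Prod.snd_sum]; simp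
  · simp [posDir, Finset.sum_apply, h]

lemma sum_smul_velDir (j : Fin n) (w : Vel d) :
    ∑ i : Fin d, w i • velDir j i = Pi.single j ((0 : Vel d), w) := by
  funext l
  by_cases h : l = j
  · subst h
    simp only [velDir, Finset.sum_apply, Pi.smul_apply, Pi.single_eq_same, Prod.smul_mk, smul_zero]
    refine Prod.ext ?_ ?_
    · rw [Prod.fst_sum]; simp
    · rw [Prod.snd_sum]; exact sum_smul_single w
  · simp [velDir, Finset.sum_apply, h]

lemma phaseProj_line_pos (z : Fin n → Phase d) (j : Fin n) (w : Vel d) (t : ℝ) :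
    phaseProj (phaseLift z + t • (Pi.single j (w, (0 : Vel d)) : Fin n → Vel d × Vel d))
      = update z j ((z j).1 + toTorus (t • w), (z j).2) := by
  funext l
  have h := congrFun (phaseProj_phaseLift z) l
  by_cases hl : l = j
  · subst hl
    simp only [phaseProj, Pi.add_apply, Pi.smul_apply, Pi.single_eq_same, Prod.smul_mk, smul_zero,
      Prod.fst_add, Prod.snd_add, toTorus_add, update_self, add_zero] at h ⊢
    rw [← h]
  · rw [update_of_ne hl, ← h]
    simp [phaseProj, hl]

lemma phaseProj_line_vel (z : Fin n → Phase d) (j : Fin n) (w : Vel d) (t : ℝ) :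
    phaseProj (phaseLift z + t • (Pi.single j ((0 : Vel d), w) : Fin n → Vel d × Vel d))
      = update z j ((z j).1, (z j).2 + t • w) := by
  funext l
  have h := congrFun (phaseProj_phaseLift z) l
  by_cases hl : l = j
  · subst hl
    simp only [phaseProj, Pi.add_apply, Pi.smul_apply, Pi.single_eq_same, Prod.smul_mk, smul_zero,
      Prod.fst_add, Prod.snd_add, update_self, add_zero] at h ⊢
    rw [← h]
  · rw [update_of_ne hl, ← h]
    simp [phaseProj, hl]

lemma IsPhaseTest.hasDerivAt_pos (h : IsPhaseTest φ) (z : Fin n → Phase d) (j : Fin n) (w : Vel d)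
    (t : ℝ) : HasDerivAt
      (fun t : ℝ => φ (update z j ((z j).1 + toTorus (t • w), (z j).2)))
      (∑ i, (w i : ℂ) * liftDeriv φ (posDir j i)
        (update z j ((z j).1 + toTorus (t • w), (z j).2))) t := by
  have := h.hasDerivAt_line (phaseLift z) (Pi.single j (w, (0 : Vel d))) t
  rw [phaseProj_line_pos, ← sum_smul_posDir, liftDeriv_sum] at this
  simp only [testLift, sum_smul_posDir, phaseProj_line_pos] at this
  exact this

lemma IsPhaseTest.hasDerivAt_vel (h : IsPhaseTest φ) (z : Fin n → Phase d) (j : Fin n) (w : Vel d)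
    (t : ℝ) : HasDerivAt
      (fun t : ℝ => φ (update z j ((z j).1, (z j).2 + t • w)))
      (∑ i, (w i : ℂ) * liftDeriv φ (velDir j i)
        (update z j ((z j).1, (z j).2 + t • w))) t := by
  have := h.hasDerivAt_line (phaseLift z) (Pi.single j ((0 : Vel d), w)) t
  rw [phaseProj_line_vel, ← sum_smul_velDir, liftDeriv_sum] at this
  simp only [testLift, sum_smul_velDir, phaseProj_line_vel] at this
  exact this

lemma IsPhaseTest.transportDeriv_eq (h : IsPhaseTest φ) (z : Fin n → Phase d) (j : Fin n) :
    transportDeriv j φ z = ∑ i, (((z j).2 i : ℝ) : ℂ) * liftDeriv φ (posDir j i) z := by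
  have := (h.hasDerivAt_pos z j (z j).2 0).deriv
  simp only [zero_smul, toTorus_zero, add_zero, Prod.mk.eta, update_eq_self] at this
  exact this

lemma IsPhaseTest.velDeriv_eq (h : IsPhaseTest φ) (z : Fin n → Phase d) (j : Fin n) (w : Vel d) :
    velDeriv j w φ z = ∑ i, (w i : ℂ) * liftDeriv φ (velDir j i) z := by
  have := (h.hasDerivAt_vel z j w 0).deriv
  simp only [zero_smul, add_zero, Prod.mk.eta, update_eq_self] at this
  exact this

lemma IsPhaseTest.isBddTest_transportDeriv (h : IsPhaseTest φ) (j : Fin n) :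
    IsBddTest (transportDeriv j φ) := by
  have e : transportDeriv j φ = fun z => ∑ i, (((z j).2 i : ℝ) : ℂ) * liftDeriv φ (posDir j i) z :=
    funext fun z => h.transportDeriv_eq z j
  rw [e]
  exact IsBddTest.sum _ fun i _ => (h.isBddTest_liftDeriv _).vel_mul j i

/-- Integrals of square-integrable functions against bounded test functions. -/
lemma IsBddTest.integrable_mul [Fact (0 < β)] {f G : (Fin n → Phase d) → ℂ}
    (hf : IsBddTest f) (hG : Integrable G (𝔓 n)) :
    Integrable (fun z => G z * f z) (𝔓 n) := by
  obtain ⟨C, hC⟩ := hf.bound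
  exact hG.mul_bdd hf.meas.aestronglyMeasurable (ae_of_all _ hC)

lemma IsBddTest.memLp [Fact (0 < β)] {f : (Fin n → Phase d) → ℂ}
    (hf : IsBddTest f) : MemLp f 2 (𝔓 n) := by
  obtain ⟨C, hC⟩ := hf.bound
  exact MemLp.of_bound hf.meas.aestronglyMeasurable C (ae_of_all _ hC)

/-! ### The Vlasov operator in duality with test functions -/

variable [Fact (0 < β)]

lemma abs_inner_waveVec_le {n : ℤᵈ} {v : Vel d} {ρ : ℝ} (h : ‖v‖ ≤ ρ) :
    ‖(⟪n, v⟫ : ℂ)‖ ≤ ‖waveVec n‖ * ρ := by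
  rw [norm_real]
  exact (norm_inner_le_norm _ _).trans (by gcongr)

/-- The kernel of the mean-field force in the slot `j`. -/
def forceKernel (β : ℝ) (DV : Torus d → Vel d) (j : Fin n) (φ : (Fin n → Phase d) → ℂ)
    (q : (Fin n → Phase d) × Phase d) : ℂ :=
  ((β * inner ℝ (q.1 j).2 (DV ((q.1 j).1 - q.2.1)) : ℝ) : ℂ) * φ q.1

/-- The adjoint of the mean-field force in the slot `j`. -/
def forceAdj (β : ℝ) (DV : Torus d → Vel d) (j : Fin n) (φ : (Fin n → Phase d) → ℂ)
    (z : Fin n → Phase d) : ℂ :=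
  ∫ s, forceKernel β DV j φ (update z j s, z j) ∂phaseMeasure d β

lemma measurable_forceKernel (hDm : Measurable DV) (j : Fin n) {φ : (Fin n → Phase d) → ℂ}
    (hφ : Measurable φ) : Measurable (forceKernel β DV j φ) := by
  have h1 : Measurable fun q : (Fin n → Phase d) × Phase d => (q.1 j).1 - q.2.1 := by
    have a1 : Measurable fun q : (Fin n → Phase d) × Phase d => (q.1 j).1 := by fun_prop
    have a2 : Measurable fun q : (Fin n → Phase d) × Phase d => q.2.1 := by fun_prop
    exact measurable_pi_lambda _ fun i =>
      ((measurable_pi_apply i).comp a1).sub ((measurable_pi_apply i).comp a2)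
  have h2 : Measurable fun q : (Fin n → Phase d) × Phase d => DV ((q.1 j).1 - q.2.1) := hDm.comp h1
  have h3 : Measurable fun q : (Fin n → Phase d) × Phase d => (q.1 j).2 := by fun_prop
  exact ((h3.inner h2).const_mul β).complex_ofReal.mul (hφ.comp measurable_fst)

lemma exists_norm_forceKernel_le (hDb : ∀ x, ‖DV x‖ ≤ K) (j : Fin n)
    {φ : (Fin n → Phase d) → ℂ} (hφ : IsBddTest φ) :
    ∃ C : ℝ, ∀ q, ‖forceKernel β DV j φ q‖ ≤ C := by
  obtain ⟨C, hC⟩ := hφ.bound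
  obtain ⟨ρ, hρ⟩ := hφ.supp
  refine ⟨|β| * (|ρ| * |K|) * |C|, fun q => ?_⟩
  rw [forceKernel, norm_mul, norm_real, Real.norm_eq_abs, abs_mul]
  by_cases h : ρ < ‖(q.1 j).2‖
  · rw [hρ _ j h, norm_zero, mul_zero]; positivity
  · push Not at h
    have h1 : |inner ℝ (q.1 j).2 (DV ((q.1 j).1 - q.2.1))| ≤ |ρ| * |K| :=
      (abs_real_inner_le_norm _ _).trans (mul_le_mul (h.trans (le_abs_self ρ))
        ((hDb _).trans (le_abs_self K)) (norm_nonneg _) (abs_nonneg _))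
    have h2 := (hC q.1).trans (le_abs_self C)
    gcongr

lemma measurable_forceAdj (hDm : Measurable DV) (j : Fin n) {φ : (Fin n → Phase d) → ℂ}
    (hφ : Measurable φ) : Measurable (forceAdj β DV j φ) := by
  have h := (measurable_forceKernel (β := β) hDm j hφ).comp
    (measurePreserving_swap_update ℨ j).measurable
  exact (StronglyMeasurable.integral_prod_right' (ν := ℨ)
    (f := fun q : (Fin n → Phase d) × Phase d =>
      forceKernel β DV j φ (update q.1 j q.2, q.1 j)) h.stronglyMeasurable).measurable

lemma exists_norm_forceAdj_le (hDb : ∀ x, ‖DV x‖ ≤ K) (j : Fin n)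
    {φ : (Fin n → Phase d) → ℂ} (hφ : IsBddTest φ) : ∃ C : ℝ, ∀ z, ‖forceAdj β DV j φ z‖ ≤ C := by
  obtain ⟨C, hC⟩ := exists_norm_forceKernel_le (β := β) hDb j hφ
  refine ⟨C, fun z => ?_⟩
  have := norm_integral_le_of_norm_le_const (μ := ℨ)
    (f := fun s => forceKernel β DV j φ (update z j s, z j)) (C := C)
    (ae_of_all _ fun s => hC _)
  rwa [probReal_univ, mul_one] at this

lemma integral_force_eq (hDm : Measurable DV) (hDb : ∀ x, ‖DV x‖ ≤ K) (j : Fin n)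
    {φ G : (Fin n → Phase d) → ℂ} (hφ : IsBddTest φ) (hG : Integrable G (𝔓 n)) :
    ∫ z, (∫ zs, ((β * inner ℝ (z j).2 (DV ((z j).1 - zs.1)) : ℝ) : ℂ) *
        G (update z j zs) ∂ℨ) * φ z ∂𝔓 n
      = ∫ z, G z * forceAdj β DV j φ z ∂𝔓 n := by
  obtain ⟨C, hC⟩ := exists_norm_forceKernel_le (β := β) hDb j hφ
  have hGu := (measurePreserving_update ℨ j).integrable_comp_of_integrable hG
  have hint : Integrable (fun q : (Fin n → Phase d) × Phase d =>
      forceKernel β DV j φ q * G (update q.1 j q.2))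
      ((Measure.pi fun _ : Fin n => ℨ).prod ℨ) :=
    hGu.bdd_mul (measurable_forceKernel hDm j hφ.meas).aestronglyMeasurable (ae_of_all _ hC)
  have h := integral_swap_update ℨ j hint
  calc _ = ∫ z, ∫ s, forceKernel β DV j φ (z, s) * G (update z j s) ∂ℨ
        ∂𝔓 n := by
        refine integral_congr_fun fun z => ?_
        rw [← integral_mul_const]
        refine integral_congr_fun fun s => ?_
        simp only [forceKernel]
        ring
    _ = _ := h.trans (by
        refine integral_congr_fun fun z => ?_
        simp only [update_idem, update_eq_self]
        rw [integral_mul_const, mul_comm]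
        rfl)

/-- The adjoint of `i L_{m+1}` on test functions. -/
def vlasovAdj (N m : ℕ) (β : ℝ) (DV : Torus d → Vel d) (φ : (Fin (m + 1) → Phase d) → ℂ)
    (z : Fin (m + 1) → Phase d) : ℂ :=
  ∑ j : Fin (m + 1), (-transportDeriv j φ z + if j = 0 then 0 else
    ((((N : ℝ) + 1 - m) / N : ℝ) : ℂ) * forceAdj β DV j φ z)

lemma measurable_vlasovAdj (N : ℕ) {m : ℕ} (hDm : Measurable DV) {φ : (Fin (m + 1) → Phase d) → ℂ}
    (hφ : IsPhaseTest φ) : Measurable (vlasovAdj N m β DV φ) := by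
  refine Finset.measurable_sum _ fun j _ => ?_
  refine (hφ.isBddTest_transportDeriv j).meas.neg.add ?_
  split_ifs
  · exact measurable_const
  · exact (measurable_forceAdj hDm j hφ.isBddTest.meas).const_mul _

lemma exists_norm_vlasovAdj_le (N : ℕ) {m : ℕ} (hDb : ∀ x, ‖DV x‖ ≤ K)
    {φ : (Fin (m + 1) → Phase d) → ℂ} (hφ : IsPhaseTest φ) :
    ∃ C : ℝ, ∀ z, ‖vlasovAdj N m β DV φ z‖ ≤ C := by
  have h1 := fun j => (hφ.isBddTest_transportDeriv j).bound
  have h2 := fun j => exists_norm_forceAdj_le (β := β) hDb j hφ.isBddTest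
  choose C hC using h1
  choose D hD using h2
  refine ⟨∑ j, (C j + ‖((((N : ℝ) + 1 - m) / N : ℝ) : ℂ)‖ * |D j|), fun z => ?_⟩
  refine (norm_sum_le _ _).trans (sum_le_sum fun j _ => ?_)
  refine (norm_add_le _ _).trans (add_le_add (by rw [norm_neg]; exact hC j z) ?_)
  split_ifs
  · rw [norm_zero]; positivity
  · rw [norm_mul]
    gcongr
    exact (hD j z).trans (le_abs_self _)

lemma vlasovPair_eq (N : ℕ) {m : ℕ} (hDm : Measurable DV) (hDb : ∀ x, ‖DV x‖ ≤ K)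
    {φ G : (Fin (m + 1) → Phase d) → ℂ} (hφ : IsPhaseTest φ)
    (hG : Integrable G (𝔓 (m + 1))) :
    vlasovPair N m β DV G φ = ∫ z, G z * vlasovAdj N m β DV φ z ∂𝔓 (m + 1) := by
  have i1 : ∀ j, Integrable (fun z => G z * transportDeriv j φ z) (𝔓 (m + 1)) :=
    fun j => (hφ.isBddTest_transportDeriv j).integrable_mul hG
  have i2 : ∀ j, Integrable (fun z => G z * forceAdj β DV j φ z) (𝔓 (m + 1)) :=
    fun j => by
      obtain ⟨C, hC⟩ := exists_norm_forceAdj_le (β := β) hDb j hφ.isBddTest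
      exact hG.mul_bdd (measurable_forceAdj hDm j hφ.isBddTest.meas).aestronglyMeasurable
        (ae_of_all _ hC)
  have i3 : ∀ j, Integrable (fun z => G z * (-transportDeriv j φ z + if j = 0 then 0 else
      ((((N : ℝ) + 1 - m) / N : ℝ) : ℂ) * forceAdj β DV j φ z)) (𝔓 (m + 1)) := by
    intro j
    split_ifs
    · simpa using (i1 j).neg
    · refine ((i1 j).neg.add ((i2 j).const_mul ((((N : ℝ) + 1 - m) / N : ℝ) : ℂ))).congr
        (ae_of_all _ fun z => ?_)
      simp only [Pi.add_apply, Pi.neg_apply]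
      ring
  unfold vlasovPair vlasovAdj
  simp_rw [mul_sum]
  rw [integral_finsetSum _ fun j _ => i3 j]
  refine sum_congr rfl fun j _ => ?_
  split_ifs with hj
  · simp [integral_neg]
  · rw [integral_force_eq hDm hDb j hφ.isBddTest hG, ← integral_const_mul, ← integral_neg]
    have := integral_add (i1 j).neg ((i2 j).const_mul ((((N : ℝ) + 1 - m) / N : ℝ) : ℂ))
    simp only [Pi.neg_apply] at this
    rw [← this]
    refine integral_congr_fun fun z => ?_
    ring

/-! ### Free transport and Fourier modes -/

/-- Free transport of the slot `j`. -/
def freeFlow (j : Fin n) (t : ℝ) (z : Fin n → Phase d) : Fin n → Phase d :=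
  update z j ((z j).1 + toTorus (t • (z j).2), (z j).2)

lemma velOf_freeFlow (j : Fin n) (t : ℝ) (z : Fin n → Phase d) :
    velOf (freeFlow j t z) = velOf z := by
  funext i
  by_cases h : i = j
  · subst h; simp [velOf, freeFlow]
  · simp [velOf, freeFlow, h]

lemma posOf_freeFlow (j : Fin n) (t : ℝ) (z : Fin n → Phase d) :
    posOf (freeFlow j t z) = update (posOf z) j ((z j).1 + toTorus (t • (z j).2)) := by
  funext i
  by_cases h : i = j
  · subst h; simp [posOf, freeFlow]
  · simp [posOf, freeFlow, h]

lemma freeFlow_neg (j : Fin n) (t : ℝ) (z : Fin n → Phase d) :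
    freeFlow j t (freeFlow j (-t) z) = z := by
  simp only [freeFlow, update_self, update_idem, add_assoc, ← toTorus_add,
    ← add_smul, neg_add_cancel, zero_smul, toTorus_zero, add_zero, Prod.mk.eta,
    update_eq_self]

lemma torusChar_freeFlow (κ : Fin n → ℤᵈ) (j : Fin n) (t : ℝ) (z : Fin n → Phase d) :
    torusChar κ (posOf (freeFlow j t z))
      = torusChar κ (posOf z) * cexp (I * ⟪κ j, (z j).2⟫ * t) := by
  rw [posOf_freeFlow, torusChar_update, mFourier_apply_add, mFourier_toTorus, inner_smul_right]
  have h := mFourier_neg_mul_self (κ j) (z j).1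
  have e : posOf z j = (z j).1 := rfl
  rw [e]
  push_cast
  rw [show I * ((t : ℂ) * ⟪κ j, (z j).2⟫)
    = I * ⟪κ j, (z j).2⟫ * t by ring]
  linear_combination (torusChar κ (posOf z) *
    cexp (I * ⟪κ j, (z j).2⟫ * t)) * h

lemma measurePreserving_freeFlow (β : ℝ) [Fact (0 < β)] (j : Fin n) (t : ℝ) :
    MeasurePreserving (freeFlow (d := d) j t) (phaseMeasureN d β n) (phaseMeasureN d β n) := by
  have hsh : MeasurePreserving (fun z : Phase d => (z.1 + toTorus (t • z.2), z.2))
      (phaseMeasure d β) (phaseMeasure d β) := by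
    have hsk : MeasurePreserving (fun q : Vel d × Torus d => (q.1, q.2 + toTorus (t • q.1)))
        ((maxwell d β).prod 𝔗) ((maxwell d β).prod 𝔗) := by
      refine (MeasurePreserving.id _).skew_product (g := fun v x => x + toTorus (t • v)) ?_ ?_
      · have h1 : Continuous fun q : Vel d × Torus d => toTorus (t • q.1) :=
          continuous_toTorus.comp (by fun_prop)
        exact measurable_pi_lambda _ fun i =>
          ((by fun_prop : Measurable fun q : Vel d × Torus d => q.2 i)).add
            ((measurable_pi_apply i).comp h1.measurable)
      · exact ae_of_all _ fun v => map_add_right_eq_self _ _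
    exact (Measure.measurePreserving_swap.comp hsk).comp Measure.measurePreserving_swap
  have h := measurePreserving_pi (fun _ : Fin n => phaseMeasure d β) (fun _ => phaseMeasure d β)
    (f := fun i z => if i = j then (z.1 + toTorus (t • z.2), z.2) else z) fun i => by
      by_cases hi : i = j
      · simpa [hi] using hsh
      · simp only [hi, if_false]
        exact MeasurePreserving.id _
  have e : (freeFlow (d := d) j t) = fun z i =>
      if i = j then ((z i).1 + toTorus (t • (z i).2), (z i).2) else z i := by
    funext z i
    by_cases hi : i = j
    · subst hi; simp [freeFlow]
    · simp [freeFlow, hi]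
  rw [e]
  exact h

/-- A Fourier mode in the positions. -/
def modeFun (κ : Fin n → ℤᵈ) (B : (Fin n → Vel d) → ℂ) (z : Fin n → Phase d) : ℂ :=
  torusChar κ (posOf z) * B (velOf z)

lemma memLp_modeFun (κ : Fin n → ℤᵈ) {B : (Fin n → Vel d) → ℂ}
    (hB : MemLp B 2 (𝔙 n)) : MemLp (modeFun κ B) 2 (𝔓 n) := by
  have h := hB.comp_measurePreserving (measurePreserving_velOf d β n)
  refine h.of_le (((continuous_torusChar κ).comp continuous_posOf).aestronglyMeasurable.mul h.1)
    (ae_of_all _ fun z => ?_)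
  rw [modeFun, norm_mul, norm_torusChar, one_mul]
  rfl

lemma integral_mode_mul_transportDeriv (κ : Fin n → ℤᵈ) {B : (Fin n → Vel d) → ℂ}
    (hB : MemLp B 2 (𝔙 n)) {φ : (Fin n → Phase d) → ℂ} (hφ : IsPhaseTest φ)
    (j : Fin n) :
    -∫ z, modeFun κ B z * transportDeriv j φ z ∂𝔓 n
      = ∫ z, modeFun κ B z * (I * ⟪κ j, (z j).2⟫) * φ z
          ∂𝔓 n := by
  have hG := memLp_modeFun (β := β) κ hB
  have hGi : Integrable (modeFun κ B) (𝔓 n) := hG.integrable (by norm_num)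
  have hbd := hφ.isBddTest
  have hkv : IsBddTest fun z => (⟪κ j, (z j).2⟫ : ℂ) * φ z :=
    hbd.mul_bdd (by fun_prop) fun ρ => ⟨‖waveVec (κ j)‖ * ρ, fun z hz => abs_inner_waveVec_le (hz j)⟩
  obtain ⟨C, hC⟩ := (hφ.isBddTest_transportDeriv j).bound
  obtain ⟨D, hD⟩ := hkv.bound
  have hflow := fun t => measurePreserving_freeFlow (d := d) β j t
  have hvel : ∀ (z : Fin n → Phase d) (t : ℝ), (freeFlow j t z j).2 = (z j).2 := fun z t => by simp [freeFlow]
  -- both sides are derivatives at time zero of the same function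
  have h1 : HasDerivAt (fun t : ℝ => ∫ z, modeFun κ B z * φ (freeFlow j t z) ∂𝔓 n)
      (∫ z, modeFun κ B z * transportDeriv j φ (freeFlow j 0 z) ∂𝔓 n) 0 := by
    refine (hasDerivAt_integral_of_dominated_loc_of_deriv_le
      (F := fun t z => modeFun κ B z * φ (freeFlow j t z))
      (F' := fun t z => modeFun κ B z * transportDeriv j φ (freeFlow j t z))
      (bound := fun z => ‖modeFun κ B z‖ * C) univ_mem ?_ ?_ ?_ ?_ ?_ ?_).2
    · exact Eventually.of_forall fun t =>
        hGi.1.mul (hbd.meas.comp (hflow t).measurable).aestronglyMeasurable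
    · have e0 : ∀ z : Fin n → Phase d, freeFlow j 0 z = z := fun z => by simp [freeFlow, toTorus_zero]
      simp_rw [e0]
      exact hbd.integrable_mul hGi
    · exact hGi.1.mul (((hφ.isBddTest_transportDeriv j).meas.comp
        (hflow 0).measurable).aestronglyMeasurable)
    · refine ae_of_all _ fun z t _ => ?_
      rw [norm_mul]
      gcongr
      exact hC _
    · exact hGi.norm.mul_const C
    · refine ae_of_all _ fun z t _ => ?_
      refine HasDerivAt.const_mul _ ?_
      refine (hφ.hasDerivAt_pos z j (z j).2 t).congr_deriv ?_
      rw [hφ.transportDeriv_eq, hvel]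
      rfl
  have h2 : HasDerivAt (fun t : ℝ => ∫ z, modeFun κ B z * (cexp (-(I *
      ⟪κ j, (z j).2⟫ * t)) * φ z) ∂𝔓 n)
      (∫ z, modeFun κ B z * (-(I * ⟪κ j, (z j).2⟫) * (cexp (-(I *
      ⟪κ j, (z j).2⟫ * (0 : ℝ))) * φ z)) ∂𝔓 n) 0 := by
    refine (hasDerivAt_integral_of_dominated_loc_of_deriv_le
      (F := fun (t : ℝ) z => modeFun κ B z * (cexp (-(I *
        ⟪κ j, (z j).2⟫ * t)) * φ z))
      (F' := fun (t : ℝ) z => modeFun κ B z * (-(I * ⟪κ j, (z j).2⟫) *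
        (cexp (-(I * ⟪κ j, (z j).2⟫ * t)) * φ z)))
      (bound := fun z => ‖modeFun κ B z‖ * D) univ_mem ?_ ?_ ?_ ?_ ?_ ?_).2
    · refine Eventually.of_forall fun t => hGi.1.mul ?_
      refine AEStronglyMeasurable.mul ?_ hbd.meas.aestronglyMeasurable
      exact (by fun_prop : Continuous fun z : Fin n → Phase d =>
        cexp (-(I * ⟪κ j, (z j).2⟫ * t))).aestronglyMeasurable
    · simp only [ofReal_zero, mul_zero, neg_zero, Complex.exp_zero, one_mul]
      exact hbd.integrable_mul hGi
    · refine hGi.1.mul ?_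
      have hc : Continuous fun z : Fin n → Phase d => -(I * ⟪κ j, (z j).2⟫) :=
        by fun_prop
      simp only [ofReal_zero, mul_zero, neg_zero, Complex.exp_zero, one_mul]
      exact hc.aestronglyMeasurable.mul hbd.meas.aestronglyMeasurable
    · refine ae_of_all _ fun z t _ => ?_
      have e1 : ‖cexp (-(I * ⟪κ j, (z j).2⟫ * t))‖ = 1 := by
        rw [norm_exp]; simp
      rw [norm_mul, norm_mul, norm_mul, e1, one_mul, norm_neg, norm_mul, norm_I, one_mul]
      have := hD z
      rw [norm_mul] at this
      gcongr
    · exact hGi.norm.mul_const D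
    · refine ae_of_all _ fun z t _ => ?_
      refine HasDerivAt.const_mul _ ?_
      have e1 : HasDerivAt (fun t : ℝ => -(I * ⟪κ j, (z j).2⟫ * (t : ℂ)))
          (-(I * ⟪κ j, (z j).2⟫ * 1)) t :=
        ((hasDerivAt_id t).ofReal_comp.const_mul _).neg
      exact (e1.cexp.mul_const (φ z)).congr_deriv (by ring)
  have heq : (fun t : ℝ => ∫ z, modeFun κ B z * φ (freeFlow j t z) ∂𝔓 n)
      = fun t : ℝ => ∫ z, modeFun κ B z * (cexp (-(I *
        ⟪κ j, (z j).2⟫ * t)) * φ z) ∂𝔓 n := by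
    funext t
    conv_lhs => rw [← (hflow (-t)).map_eq]
    rw [integral_map (hflow (-t)).measurable.aemeasurable (by
      rw [(hflow (-t)).map_eq]
      exact hGi.1.mul (hbd.meas.comp (hflow t).measurable).aestronglyMeasurable)]
    refine integral_congr_fun fun z => ?_
    rw [freeFlow_neg, modeFun, torusChar_freeFlow, velOf_freeFlow, modeFun]
    push_cast
    rw [mul_neg]
    ring
  rw [heq] at h1
  have hfin := h1.unique h2
  have e0 : ∀ z : Fin n → Phase d, freeFlow j 0 z = z := fun z => by simp [freeFlow, toTorus_zero]
  simp only [e0, ofReal_zero, mul_zero, neg_zero, Complex.exp_zero, one_mul] at hfin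
  rw [hfin, ← integral_neg]
  refine integral_congr_fun fun z => ?_
  ring

/-- An interaction potential as in `IsW1Infty` that is even and of positive type, together with a
bounded measurable version of its gradient. -/
structure IsPotential {d : ℕ} (V : Torus d → ℝ) (DV : Torus d → Vel d) (K : ℝ) : Prop
    extends IsW1Infty V DV K where
  even : ∀ᵐ x ∂torusMeasure d, V (-x) = V x
  pos : ∀ n, 0 ≤ potHat V n
  measurable : Measurable DV
  le : ∀ x, ‖DV x‖ ≤ K

/-! ### The Vlasov operator on Fourier modes -/

lemma inner_eq_sum_mul (w v : Vel d) : (inner ℝ w v : ℝ) = ∑ i, v i * w i := by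
  simp [PiLp.inner_apply]

lemma integral_inner_grad_mul_mFourier (hV : IsPotential V DV K) (l : ℤᵈ) (w : Vel d) :
    ∫ x, ((inner ℝ w (DV x) : ℝ) : ℂ) * mFourier (-l) x ∂𝔗
      = I * ⟪l, w⟫ * potHat V l := by
  have e : ∀ x, ((inner ℝ w (DV x) : ℝ) : ℂ) * mFourier (-l) x
      = ∑ i, (w i : ℂ) * (mFourier (-l) x * (DV x i : ℂ)) := by
    intro x
    rw [inner_eq_sum_mul, ofReal_sum, sum_mul]
    refine sum_congr rfl fun i _ => ?_
    push_cast
    ring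
  simp_rw [e]
  rw [integral_finsetSum _ fun i _ =>
    (integrable_mFourier_mul (hV.integrable_apply i) (-l)).const_mul _]
  simp_rw [integral_const_mul, integral_mFourier_mul_grad hV.1 hV.even]
  rw [inner_eq_sum_mul]
  push_cast
  simp_rw [mul_sum, sum_mul]
  refine sum_congr rfl fun i _ => ?_
  ring

lemma integral_grad_mul_mFourier (hV : IsPotential V DV K) (l : ℤᵈ) (w : Vel d) (y : Torus d) :
    ∫ x, ((inner ℝ w (DV (y - x)) : ℝ) : ℂ) * mFourier l x ∂𝔗
      = mFourier l y * (I * ⟪l, w⟫ * potHat V l) := by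
  have h1 := integral_sub_left_eq_self (μ := 𝔗)
    (fun x => ((inner ℝ w (DV x) : ℝ) : ℂ) * mFourier l (y - x)) y
  simp only [sub_sub_cancel] at h1
  rw [h1, ← integral_inner_grad_mul_mFourier hV, ← integral_const_mul]
  refine integral_congr_fun fun x => ?_
  rw [sub_eq_add_neg, mFourier_apply_add, mFourier_apply_neg]
  ring

lemma integral_grad_sub_mul_mFourier (hV : IsPotential V DV K) (l : ℤᵈ) (w : Vel d) (y : Torus d) :
    ∫ x, ((inner ℝ w (DV (x - y)) : ℝ) : ℂ) * mFourier (-l) x ∂𝔗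
      = mFourier (-l) y * (I * ⟪l, w⟫ * potHat V l) := by
  have h1 := integral_add_right_eq_self (μ := 𝔗)
    (fun x => ((inner ℝ w (DV (x - y)) : ℝ) : ℂ) * mFourier (-l) x) y
  simp only [add_sub_cancel_right] at h1
  rw [← h1, ← integral_inner_grad_mul_mFourier hV, ← integral_const_mul]
  refine integral_congr_fun fun x => ?_
  rw [mFourier_apply_add]
  ring

lemma posOf_update (z : Fin n → Phase d) (j : Fin n) (s : Phase d) :
    posOf (update z j s) = update (posOf z) j s.1 := by
  funext i
  by_cases h : i = j
  · subst h; simp [posOf]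
  · simp [posOf, h]

lemma velOf_update (z : Fin n → Phase d) (j : Fin n) (s : Phase d) :
    velOf (update z j s) = update (velOf z) j s.2 := by
  funext i
  by_cases h : i = j
  · subst h; simp [velOf]
  · simp [velOf, h]

lemma integral_force_modeFun [Fact (0 < β)] (hV : IsPotential V DV K) (κ : Fin n → ℤᵈ)
    (B : (Fin n → Vel d) → ℂ) (j : Fin n) (z : Fin n → Phase d) :
    ∫ zs, ((β * inner ℝ (z j).2 (DV ((z j).1 - zs.1)) : ℝ) : ℂ) *
        modeFun κ B (update z j zs) ∂ℨ
      = torusChar κ (posOf z) * (I * ⟪κ j, (z j).2⟫ *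
          (β * potHat V (κ j) : ℝ) * ∫ s, B (update (velOf z) j s) ∂ℳ) := by
  have e : ∀ zs : Phase d, ((β * inner ℝ (z j).2 (DV ((z j).1 - zs.1)) : ℝ) : ℂ) *
        modeFun κ B (update z j zs)
      = (β * torusChar κ (posOf z) * mFourier (-κ j) (z j).1 *
          (((inner ℝ (z j).2 (DV ((z j).1 - zs.1)) : ℝ) : ℂ) * mFourier (κ j) zs.1)) *
        B (update (velOf z) j zs.2) := by
    intro zs
    rw [modeFun, posOf_update, velOf_update, torusChar_update]
    push_cast
    simp only [posOf]
    ring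
  simp_rw [e]
  rw [phaseMeasure, integral_prod_mul (fun x : Torus d => (β * torusChar κ (posOf z) *
    mFourier (-κ j) (z j).1 * (((inner ℝ (z j).2 (DV ((z j).1 - x)) : ℝ) : ℂ) * mFourier (κ j) x)))
    (fun s : Vel d => B (update (velOf z) j s)), integral_const_mul,
    integral_grad_mul_mFourier hV]
  push_cast
  linear_combination (β * torusChar κ (posOf z) * (I * ⟪κ j, (z j).2⟫ *
    potHat V (κ j)) * ∫ s, B (update (velOf z) j s) ∂ℳ) *
    mFourier_neg_mul_self (κ j) (z j).1

/-- The action of `L_{m+1}` on the Fourier mode `κ`. -/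
def modeOp {m : ℕ} (N : ℕ) (β : ℝ) (V : Torus d → ℝ) (κ : Fin (m + 1) → ℤᵈ)
    (B : (Fin (m + 1) → Vel d) → ℂ) (v : Fin (m + 1) → Vel d) : ℂ :=
  ∑ j, ⟪κ j, v j⟫ * (B v + if j = 0 then 0 else
    (((N : ℝ) + 1 - m) / N * (β * potHat V (κ j)) : ℝ) *
      ∫ s, B (update v j s) ∂maxwell d β)

lemma integrable_modeFun_mul [Fact (0 < β)] (κ : Fin n → ℤᵈ) {B : (Fin n → Vel d) → ℂ}
    (hB : MemLp B 2 (𝔙 n)) {φ : (Fin n → Phase d) → ℂ} (hφ : IsBddTest φ) :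
    Integrable (fun z => modeFun κ B z * φ z) (𝔓 n) :=
  hφ.integrable_mul ((memLp_modeFun κ hB).integrable (by norm_num))

lemma memLp_integral_update [Fact (0 < β)] {B : (Fin n → Vel d) → ℂ}
    (hB : MemLp B 2 (𝔙 n)) (j : Fin n) :
    MemLp (fun v => ∫ s, B (update v j s) ∂ℳ) 2 (𝔙 n) :=
  memLp_integral_right (hB.comp_measurePreserving (measurePreserving_update ℳ j))

lemma vlasovPair_modeFun [Fact (0 < β)] {m : ℕ} (N : ℕ) (hV : IsPotential V DV K)
    (κ : Fin (m + 1) → ℤᵈ) {B : (Fin (m + 1) → Vel d) → ℂ}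
    (hB : MemLp B 2 (𝔙 (m + 1))) {φ : (Fin (m + 1) → Phase d) → ℂ}
    (hφ : IsPhaseTest φ) :
    vlasovPair N m β DV (modeFun κ B) φ
      = ∫ z, I * modeFun κ (modeOp N β V κ B) z * φ z ∂𝔓 (m + 1) := by
  have hkv : ∀ j, IsBddTest fun z => (⟪κ j, (z j).2⟫ : ℂ) * φ z := fun j =>
    hφ.isBddTest.mul_bdd (by fun_prop)
      fun ρ => ⟨‖waveVec (κ j)‖ * ρ, fun z hz => abs_inner_waveVec_le (hz j)⟩
  have i1 : ∀ j, Integrable (fun z => modeFun κ B z * (I * ⟪κ j, (z j).2⟫) *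
      φ z) (𝔓 (m + 1)) := fun j =>
    ((integrable_modeFun_mul κ hB (hkv j)).const_mul I).congr (ae_of_all _ fun z => by ring)
  have i2 : ∀ j, Integrable (fun z => torusChar κ (posOf z) * (I * (⟪κ j, (z j).2⟫
      : ℝ) * (β * potHat V (κ j) : ℝ) * ∫ s, B (update (velOf z) j s) ∂ℳ) *
      φ z) (𝔓 (m + 1)) := fun j =>
    ((integrable_modeFun_mul κ (memLp_integral_update hB j) (hkv j)).const_mul
      (I * (β * potHat V (κ j) : ℝ))).congr (ae_of_all _ fun z => by simp only [modeFun]; ring)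
  have e : ∀ z, I * modeFun κ (modeOp N β V κ B) z * φ z
      = ∑ j, (modeFun κ B z * (I * ⟪κ j, (z j).2⟫) * φ z +
        (if j = 0 then 0 else ((((N : ℝ) + 1 - m) / N : ℝ) : ℂ)) *
        (torusChar κ (posOf z) * (I * ⟪κ j, (z j).2⟫ *
        (β * potHat V (κ j) : ℝ) * ∫ s, B (update (velOf z) j s) ∂ℳ) * φ z)) := by
    intro z
    simp only [modeFun, modeOp, mul_sum, sum_mul]
    refine sum_congr rfl fun j _ => ?_
    split_ifs
    · simp only [velOf]; ring
    · simp only [velOf]; push_cast; ring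
  simp_rw [e]
  have i12 : ∀ j : Fin (m + 1), Integrable (fun z => modeFun κ B z *
      (I * ⟪κ j, (z j).2⟫) * φ z +
      (if j = 0 then 0 else ((((N : ℝ) + 1 - m) / N : ℝ) : ℂ)) *
      (torusChar κ (posOf z) * (I * ⟪κ j, (z j).2⟫ *
      (β * potHat V (κ j) : ℝ) * ∫ s, B (update (velOf z) j s) ∂ℳ) * φ z))
      (𝔓 (m + 1)) := fun j => (i1 j).add ((i2 j).const_mul _)
  rw [integral_finsetSum _ fun j _ => i12 j, vlasovPair]
  refine sum_congr rfl fun j _ => ?_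
  rw [integral_add (i1 j) ((i2 j).const_mul _), integral_mode_mul_transportDeriv κ hB hφ j,
    integral_const_mul]
  simp_rw [integral_force_modeFun hV]
  congr 1
  split_ifs
  · rw [zero_mul]
  · rfl

/-! ### Superposition of modes -/

lemma integral_conj_modeFun_mul [Fact (0 < β)] {κ κ' : Fin n → ℤᵈ} (h : κ ≠ κ')
    (B B' : (Fin n → Vel d) → ℂ) :
    ∫ z, conj (modeFun κ B z) * modeFun κ' B' z ∂𝔓 n = 0 := by
  have hs := measurePreserving_split d β n
  have he : MeasurableEmbedding (fun z : Fin n → Phase d => (posOf z, velOf z)) :=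
    (MeasurableEquiv.arrowProdEquivProdArrow (Torus d) (Vel d) (Fin n)).measurableEmbedding
  have h1 := hs.integral_comp he (fun q : (Fin n → Torus d) × (Fin n → Vel d) =>
    torusChar (κ' - κ) q.1 * (conj (B q.2) * B' q.2))
  rw [integral_prod_mul (torusChar (κ' - κ)) fun v => conj (B v) * B' v,
    integral_torusChar (sub_ne_zero.2 h.symm), zero_mul] at h1
  rw [← h1]
  refine integral_congr_fun fun z => ?_
  simp only [modeFun]
  rw [map_mul, ← torusChar_neg, sub_eq_add_neg, ← torusChar_mul]
  ring

lemma eLpNorm_modeFun [Fact (0 < β)] (κ : Fin n → ℤᵈ) {B : (Fin n → Vel d) → ℂ}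
    (hB : MemLp B 2 (𝔙 n)) :
    eLpNorm (modeFun κ B) 2 (𝔓 n) = eLpNorm B 2 (𝔙 n) := by
  rw [← eLpNorm_comp_measurePreserving hB.1 (measurePreserving_velOf d β n)]
  refine eLpNorm_congr_norm_ae (ae_of_all _ fun z => ?_)
  rw [modeFun, norm_mul, norm_torusChar, one_mul]
  rfl

/-- Convergent series in `L²` can be paired with functions of `L²`. -/
lemma hasSum_integral_mul_of_Lp {X ι : Type*} [MeasurableSpace X] {μ : Measure X} {f : ι → Lp ℂ 2 μ}
    {G : Lp ℂ 2 μ} (hG : HasSum f G) {W : X → ℂ} (hW : MemLp W 2 μ) :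
    HasSum (fun i => ∫ x, f i x * W x ∂μ) (∫ x, G x * W x ∂μ) := by
  have hW' : MemLp (fun z => conj (W z)) 2 μ := hW.star
  have h := (innerSL ℂ (hW'.toLp _)).hasSum hG
  have key : ∀ u : Lp ℂ 2 μ, innerSL ℂ (hW'.toLp _) u = ∫ x, u x * W x ∂μ := by
    intro u
    rw [innerSL_apply_apply, L2.inner_def]
    refine integral_congr_ae ?_
    filter_upwards [hW'.coeFn_toLp] with z hz
    rw [RCLike.inner_apply, hz]
    simp
  simpa only [key] using h

/-- Square-summable superpositions of distinct Fourier modes. -/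
lemma exists_hasSum_modeFun [Fact (0 < β)] {ι : Type*} {κ : ι → Fin n → ℤᵈ}
    (hκ : Injective κ) {B : ι → (Fin n → Vel d) → ℂ}
    (hB : ∀ i, MemLp (B i) 2 (𝔙 n)) {c : ι → ℝ} (hc0 : ∀ i, 0 ≤ c i)
    (hc : ∀ i, eLpNorm (B i) 2 (𝔙 n) ≤ ENNReal.ofReal (c i))
    (hsum : Summable fun i => c i ^ 2) :
    ∃ G : (Fin n → Phase d) → ℂ, MemLp G 2 (𝔓 n) ∧
      ∀ W : (Fin n → Phase d) → ℂ, MemLp W 2 (𝔓 n) →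
        HasSum (fun i => ∫ z, modeFun (κ i) (B i) z * W z ∂𝔓 n)
          (∫ z, G z * W z ∂𝔓 n) := by
  classical
  set f : ι → Lp ℂ 2 (𝔓 n) := fun i => (memLp_modeFun (κ i) (hB i)).toLp _ with hf
  have hinner : ∀ i j, i ≠ j → inner ℂ (f i) (f j) = 0 := by
    intro i j hij
    rw [L2.inner_def, ← integral_conj_modeFun_mul (β := β) (hκ.ne hij) (B i) (B j)]
    refine integral_congr_ae ?_
    filter_upwards [(memLp_modeFun (β := β) (κ i) (hB i)).coeFn_toLp,
      (memLp_modeFun (β := β) (κ j) (hB j)).coeFn_toLp] with z h1 h2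
    rw [RCLike.inner_apply, hf, h1, h2, mul_comm]
  have hort : OrthogonalFamily ℂ (fun i => Submodule.span ℂ {f i})
      (fun i => (Submodule.span ℂ {f i}).subtypeₗᵢ) := by
    refine OrthogonalFamily.of_pairwise fun i j hij => ?_
    rw [onFun, Submodule.isOrtho_span]
    rintro u hu v hv
    rw [mem_singleton_iff] at hu hv
    rw [hu, hv]
    exact hinner i j hij
  have hs : Summable f := by
    have := hort.summable_iff_norm_sq_summable
      (fun i => ⟨f i, Submodule.mem_span_singleton_self (f i)⟩)
    refine this.2 (hsum.of_nonneg_of_le (fun i => by positivity) fun i => ?_)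
    refine pow_le_pow_left₀ (norm_nonneg _) ?_ 2
    simp only [Submodule.coe_norm, hf, Lp.norm_toLp]
    rw [eLpNorm_modeFun (κ i) (hB i)]
    exact ENNReal.toReal_le_of_le_ofReal (hc0 i) (hc i)
  obtain ⟨G, hG⟩ := hs
  refine ⟨G, Lp.memLp G, fun W hW => ?_⟩
  refine (hasSum_integral_mul_of_Lp hG hW).congr_fun fun i => integral_congr_ae ?_
  filter_upwards [(memLp_modeFun (β := β) (κ i) (hB i)).coeFn_toLp] with z hz
  rw [hf, hz]

/-! ### Projection to Fourier modes -/

/-- The coefficient of the mode `κ`. -/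
def modeProj (κ : Fin n → ℤᵈ) (H : (Fin n → Phase d) → ℂ) (v : Fin n → Vel d) : ℂ :=
  ∫ x, torusChar (-κ) x * H (fun j => (x j, v j)) ∂torusMeasureN d n

lemma memLp_modeProj [Fact (0 < β)] (κ : Fin n → ℤᵈ) {H : (Fin n → Phase d) → ℂ}
    (hH : MemLp H 2 (𝔓 n)) : MemLp (modeProj κ H) 2 (𝔙 n) := by
  have h := hH.comp_measurePreserving (measurePreserving_join d β n)
  refine memLp_integral_left (B := fun q : (Fin n → Torus d) × (Fin n → Vel d) =>
    torusChar (-κ) q.1 * H fun j => (q.1 j, q.2 j)) (h.of_le (AEStronglyMeasurable.mul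
      ((continuous_torusChar (-κ)).comp continuous_fst).aestronglyMeasurable h.1)
      (ae_of_all _ fun q => ?_))
  rw [norm_mul, norm_torusChar, one_mul]
  rfl

lemma integral_mul_modeFun [Fact (0 < β)] (κ : Fin n → ℤᵈ) {H : (Fin n → Phase d) → ℂ}
    (hH : MemLp H 2 (𝔓 n)) {ψ : (Fin n → Vel d) → ℂ}
    (hψ : MemLp ψ 2 (𝔙 n)) :
    ∫ z, H z * modeFun (-κ) ψ z ∂𝔓 n
      = ∫ v, modeProj κ H v * ψ v ∂𝔙 n := by
  have hj := measurePreserving_join d β n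
  have hi : Integrable (fun z => H z * modeFun (-κ) ψ z) (𝔓 n) :=
    hH.integrable_mul (memLp_modeFun (-κ) hψ)
  have hi' : Integrable (fun q : (Fin n → Torus d) × (Fin n → Vel d) =>
      H (fun j => (q.1 j, q.2 j)) * modeFun (-κ) ψ fun j => (q.1 j, q.2 j))
      ((torusMeasureN d n).prod (𝔙 n)) := hj.integrable_comp_of_integrable hi
  rw [← hj.map_eq, integral_map hj.measurable.aemeasurable (by rw [hj.map_eq]; exact hi.1),
    integral_prod_symm _ hi']
  refine integral_congr_fun fun v => ?_
  simp only [modeProj]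
  rw [← integral_mul_const]
  refine integral_congr_fun fun x => ?_
  have e1 : posOf (fun j => (x j, v j)) = x := rfl
  have e2 : velOf (fun j => (x j, v j)) = v := rfl
  simp only [modeFun, e1, e2]
  ring

/-- A function with vanishing Fourier coefficients vanishes. -/
lemma ae_eq_zero_of_modeProj [Fact (0 < β)] {H : (Fin n → Phase d) → ℂ}
    (hH : MemLp H 2 (𝔓 n))
    (h0 : ∀ κ, modeProj κ H =ᵐ[𝔙 n] 0) : H =ᵐ[𝔓 n] 0 := by
  have hj := measurePreserving_join d β n
  have h := hH.comp_measurePreserving hj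
  have hsw := h.comp_measurePreserving (Measure.measurePreserving_swap
    (μ := 𝔙 n) (ν := torusMeasureN d n))
  have hsq : Integrable (fun q : (Fin n → Vel d) × (Fin n → Torus d) =>
      ‖H fun j => (q.2 j, q.1 j)‖ ^ 2) ((𝔙 n).prod (torusMeasureN d n)) :=
    (memLp_two_iff_integrable_sq_norm hsw.1).1 hsw
  have hz : ∫ q, ‖H fun j => (q.2 j, q.1 j)‖ ^ 2
      ∂(𝔙 n).prod (torusMeasureN d n) = 0 := by
    rw [integral_prod _ hsq]
    refine integral_eq_zero_of_ae ?_
    filter_upwards [hsq.prod_right_ae, hsw.1.prodMk_left, ae_all_iff.2 h0] with v h1 h2 h3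
    refine integral_eq_zero_of_ae ?_
    have := ae_eq_zero_of_torusChar (f := fun x => H fun j => (x j, v j))
      ((memLp_two_iff_integrable_sq_norm h2).2 h1) fun κ => by
        have := h3 (-κ)
        simpa only [modeProj, neg_neg, Pi.zero_apply] using this
    filter_upwards [this] with x hx
    rw [hx]
    simp
  have hslice : ∀ᵐ q ∂(𝔙 n).prod (torusMeasureN d n),
      H (fun j => (q.2 j, q.1 j)) = 0 := by
    filter_upwards [(integral_eq_zero_iff_of_nonneg (fun q => by positivity) hsq).1 hz] with q hq
    simpa using hq
  have hs := measurePreserving_split d β n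
  have := ((Measure.measurePreserving_swap).comp hs).quasiMeasurePreserving.ae hslice
  exact this

lemma isPhaseTest_modeFun (κ : Fin n → ℤᵈ) {ψ : (Fin n → Vel d) → ℂ}
    (hψ : ContDiff ℝ (⊤ : ℕ∞) ψ) (hc : HasCompactSupport ψ) : IsPhaseTest (modeFun κ ψ) := by
  constructor
  · unfold modeFun torusChar
    refine ContDiff.mul ?_ ?_
    · refine contDiff_prod fun j _ => ?_
      exact (contDiff_mFourier_toTorus (κ j)).comp (by fun_prop)
    · exact hψ.comp (by unfold velOf; fun_prop)
  · refine HasCompactSupport.intro (K := (fun q : (Fin n → Torus d) × (Fin n → Vel d) =>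
      fun j => (q.1 j, q.2 j)) '' (univ ×ˢ tsupport ψ)) ?_ fun z hz => ?_
    · exact (isCompact_univ.prod hc.isCompact).image (by fun_prop)
    · have : velOf z ∉ tsupport ψ := fun hv =>
        hz ⟨(posOf z, velOf z), ⟨mem_univ _, hv⟩, rfl⟩
      rw [modeFun, image_eq_zero_of_notMem_tsupport this, mul_zero]

lemma memLp_of_compactSupport [Fact (0 < β)] {ψ : (Fin n → Vel d) → ℂ} (hψ : Continuous ψ)
    (hc : HasCompactSupport ψ) : MemLp ψ 2 (𝔙 n) := by
  obtain ⟨C, hC⟩ := hc.exists_bound_of_continuous hψ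
  exact MemLp.of_bound hψ.aestronglyMeasurable C (ae_of_all _ hC)

lemma ae_eq_zero_of_integral_smooth_mul [Fact (0 < β)] {f : (Fin n → Vel d) → ℂ}
    (hf : Integrable f (𝔙 n))
    (h : ∀ ψ : (Fin n → Vel d) → ℂ, ContDiff ℝ (⊤ : ℕ∞) ψ → HasCompactSupport ψ →
      ∫ v, f v * ψ v ∂𝔙 n = 0) : f =ᵐ[𝔙 n] 0 := by
  refine ae_eq_zero_of_integral_contDiff_smul_eq_zero hf.locallyIntegrable fun g hg hgc => ?_
  have := h (fun v => (g v : ℂ)) (ofRealCLM.contDiff.comp hg) (hgc.comp_left ofReal_zero)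
  rw [← this]
  refine integral_congr_fun fun v => ?_
  simp only [real_smul, mul_comm]

/-- Two square-integrable functions which define the same distribution coincide. -/
lemma ae_eq_of_forall_test [Fact (0 < β)] {H H' : (Fin n → Phase d) → ℂ}
    (hH : MemLp H 2 (𝔓 n)) (hH' : MemLp H' 2 (𝔓 n))
    (h : ∀ φ, IsPhaseTest φ → ∫ z, H z * φ z ∂𝔓 n
      = ∫ z, H' z * φ z ∂𝔓 n) : H =ᵐ[𝔓 n] H' := by
  have hD := hH.sub hH'
  have h0 := ae_eq_zero_of_modeProj hD fun κ =>
    ae_eq_zero_of_integral_smooth_mul ((memLp_modeProj κ hD).integrable (by norm_num))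
    fun ψ hψ hc => by
      have ht := isPhaseTest_modeFun (-κ) hψ hc
      rw [← integral_mul_modeFun κ hD (memLp_of_compactSupport hψ.continuous hc)]
      have i1 := ht.isBddTest.integrable_mul (hH.integrable (by norm_num))
      have i2 := ht.isBddTest.integrable_mul (hH'.integrable (by norm_num))
      simp only [Pi.sub_apply, sub_mul]
      rw [integral_sub i1 i2, h _ ht, sub_self]
  filter_upwards [h0] with z hz
  exact sub_eq_zero.1 hz

/-! ### The mode equation of a weak solution -/

lemma transportDeriv_modeFun (κ : Fin n → ℤᵈ) (ψ : (Fin n → Vel d) → ℂ) (j : Fin n)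
    (z : Fin n → Phase d) : transportDeriv j (modeFun κ ψ) z
      = I * ⟪κ j, (z j).2⟫ * modeFun κ ψ z := by
  have e : (fun t : ℝ => modeFun κ ψ (update z j ((z j).1 + toTorus (t • (z j).2), (z j).2)))
      = fun t : ℝ => modeFun κ ψ z * cexp (I * ⟪κ j, (z j).2⟫ * t) := by
    funext t
    have h1 := torusChar_freeFlow κ j t z
    have h2 := velOf_freeFlow j t z
    simp only [freeFlow] at h1 h2
    rw [modeFun, h1, h2, modeFun]
    ring
  have e1 : HasDerivAt (fun t : ℝ => I * ⟪κ j, (z j).2⟫ * (t : ℂ))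
      (I * ⟪κ j, (z j).2⟫ * 1) 0 := (hasDerivAt_id _).ofReal_comp.const_mul _
  rw [transportDeriv, e, (e1.cexp.const_mul (modeFun κ ψ z)).deriv]
  simp
  ring

lemma forceAdj_modeFun [Fact (0 < β)] (hV : IsPotential V DV K)
    (κ : Fin n → ℤᵈ) {ψ : (Fin n → Vel d) → ℂ} (hψ : IsPhaseTest (modeFun (-κ) ψ))
    (j : Fin n) (z : Fin n → Phase d) :
    forceAdj β DV j (modeFun (-κ) ψ) z
      = torusChar (-κ) (posOf z) * (I * (β * potHat V (κ j) : ℝ) *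
        ∫ s, ⟪κ j, s⟫ * ψ (update (velOf z) j s) ∂ℳ) := by
  have hm : Measurable fun s : Phase d =>
      forceKernel β DV j (modeFun (-κ) ψ) (update z j s, z j) :=
    (measurable_forceKernel hV.measurable j hψ.isBddTest.meas).comp
      ((measurable_update z).prodMk measurable_const)
  obtain ⟨C, hC⟩ := exists_norm_forceKernel_le (β := β) hV.le j hψ.isBddTest
  have hi : Integrable (fun s : Phase d =>
      forceKernel β DV j (modeFun (-κ) ψ) (update z j s, z j))
      ((𝔗).prod ℳ) :=
    Integrable.of_bound hm.aestronglyMeasurable C (ae_of_all _ fun s => hC _)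
  rw [forceAdj, phaseMeasure, integral_prod_symm _ hi, ← integral_const_mul, ← integral_const_mul]
  refine integral_congr_fun fun s => ?_
  have e : ∀ x : Torus d, forceKernel β DV j (modeFun (-κ) ψ) (update z j (x, s), z j)
      = β * torusChar (-κ) (posOf z) * mFourier (κ j) (z j).1 * ψ (update (velOf z) j s) *
        (((inner ℝ s (DV (x - (z j).1)) : ℝ) : ℂ) * mFourier (-κ j) x) := by
    intro x
    simp only [forceKernel, update_self, modeFun]
    rw [posOf_update, velOf_update, torusChar_update]
    simp only [Pi.neg_apply, neg_neg, posOf]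
    push_cast
    ring
  simp only [e]
  rw [integral_const_mul, integral_grad_sub_mul_mFourier hV]
  push_cast
  linear_combination (β * torusChar (-κ) (posOf z) * (I * ⟪κ j, s⟫ *
    potHat V (κ j)) * ψ (update (velOf z) j s)) * mFourier_neg_mul_self (κ j) (z j).1

lemma memLp_inner_maxwell [hβ : Fact (0 < β)] (n : ℤᵈ) :
    MemLp (fun v => (⟪n, v⟫ : ℂ)) 2 ℳ := by
  by_cases hn : n = 0
  · simp only [hn, waveVec_zero, inner_zero_left, ofReal_zero]
    exact MemLp.zero
  · have h := ((memLp_pow_stdNormal 1).comp_measurePreserving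
      (measurePreserving_modeVel (d := d) hβ.out hn)).const_mul (modeScale β n : ℂ)
    refine h.ae_eq (ae_of_all _ fun v => ?_)
    simp only [comp_apply, pow_one]
    rw [← ofReal_mul, modeScale_mul_modeVel hβ.out hn]

lemma memLp_inner_velMeasureN [Fact (0 < β)] (l : ℤᵈ) (j : Fin n) :
    MemLp (fun v : Fin n → Vel d => (⟪l, v j⟫ : ℂ)) 2 (𝔙 n) :=
  (memLp_inner_maxwell l).comp_measurePreserving
    (measurePreserving_eval (fun _ : Fin n => ℳ) j)

/-- The Fourier modes of a weak solution of the homogeneous resolvent equation. -/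
lemma modeOp_modeProj [Fact (0 < β)] {m : ℕ} (N : ℕ) (hV : IsPotential V DV K)
    {H : (Fin (m + 1) → Phase d) → ℂ} (hH : MemLp H 2 (𝔓 (m + 1)))
    (hw : ∀ φ, IsPhaseTest φ → vlasovPair N m β DV H φ
      = I * ω * ∫ z, H z * φ z ∂𝔓 (m + 1)) (κ : Fin (m + 1) → ℤᵈ) :
    modeOp N β V κ (modeProj κ H) =ᵐ[𝔙 (m + 1)] fun v => ω * modeProj κ H v := by
  set F := modeProj κ H with hFdef
  have hF : MemLp F 2 (𝔙 (m + 1)) := memLp_modeProj κ hH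
  have hFj := fun j => memLp_integral_update hF j
  have hkv := fun j => memLp_inner_velMeasureN (β := β) (n := m + 1) (κ j) j
  set c : Fin (m + 1) → ℝ := fun j => if j = 0 then 0 else
    (((N : ℝ) + 1 - m) / N * (β * potHat V (κ j))) with hcdef
  have hop : modeOp N β V κ F = fun v => ∑ j, (⟪κ j, v j⟫ * F v +
      c j * (⟪κ j, v j⟫ *
        ∫ s, F (update v j s) ∂ℳ)) := by
    funext v
    rw [modeOp]
    refine sum_congr rfl fun j _ => ?_
    simp only [hcdef]
    split_ifs
    · simp
    · ring
  have hopi : Integrable (modeOp N β V κ F) (𝔙 (m + 1)) := by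
    rw [hop]
    exact integrable_finsetSum _ fun j _ =>
      ((hkv j).integrable_mul hF).add (((hkv j).integrable_mul (hFj j)).const_mul _)
  have hi : Integrable (fun v => modeOp N β V κ F v - ω * F v) (𝔙 (m + 1)) :=
    hopi.sub ((hF.integrable (by norm_num)).const_mul ω)
  have h0 := ae_eq_zero_of_integral_smooth_mul hi fun ψ hψ hc => by
    have ht := isPhaseTest_modeFun (-κ) hψ hc
    set θ : Fin (m + 1) → (Fin (m + 1) → Vel d) → ℂ := fun j v =>
      ⟪κ j, v j⟫ * ψ v with hθ
    have hψ2 : MemLp ψ 2 (𝔙 (m + 1)) := memLp_of_compactSupport hψ.continuous hc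
    have hθ2 : ∀ j, MemLp (θ j) 2 (𝔙 (m + 1)) := fun j =>
      memLp_of_compactSupport (by fun_prop) (hc.mul_left)
    have hθj : ∀ j, MemLp (fun v => ∫ s, θ j (update v j s) ∂ℳ) 2
      (𝔙 (m + 1)) := fun j => memLp_integral_update (hθ2 j) j
    have hterm : ∀ j, MemLp (fun v => I * (θ j v + c j * ∫ s, θ j (update v j s)
        ∂ℳ)) 2 (𝔙 (m + 1)) := fun j =>
      ((hθ2 j).add ((hθj j).const_mul _)).const_mul I
    have hΨ : vlasovAdj N m β DV (modeFun (-κ) ψ) = modeFun (-κ) fun v =>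
        ∑ j, I * (θ j v + c j * ∫ s, θ j (update v j s) ∂ℳ) := by
      funext z
      rw [vlasovAdj, modeFun, mul_sum]
      refine sum_congr rfl fun j _ => ?_
      rw [transportDeriv_modeFun, forceAdj_modeFun hV κ ht, modeFun]
      simp only [hθ, hcdef, update_self, Pi.neg_apply, waveVec_neg, inner_neg_left,
        velOf]
      split_ifs
      · push_cast; ring
      · push_cast; ring
    have hp := hw _ ht
    rw [vlasovPair_eq N hV.measurable hV.le ht (hH.integrable (by norm_num)), hΨ,
      integral_mul_modeFun κ hH (memLp_finsetSum _ fun j _ => hterm j),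
      integral_mul_modeFun κ hH hψ2] at hp
    have hsw : ∀ j, ∫ v, F v * (∫ s, θ j (update v j s) ∂ℳ)
        ∂𝔙 (m + 1) = ∫ v, θ j v * (∫ s, F (update v j s) ∂ℳ)
        ∂𝔙 (m + 1) := by
      intro j
      have hi : Integrable (fun q : (Fin (m + 1) → Vel d) × Vel d =>
          F q.1 * θ j (update q.1 j q.2))
          ((𝔙 (m + 1)).prod ℳ) :=
        (hF.comp_fst ℳ).integrable_mul
          ((hθ2 j).comp_measurePreserving (measurePreserving_update ℳ j))
      have := integral_swap_update ℳ j hi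
      simp only [update_idem, update_eq_self] at this
      simp_rw [integral_const_mul, integral_mul_const] at this
      rw [this]
      refine integral_congr_fun fun v => ?_
      ring
    have j1 : ∀ j, Integrable (fun v => F v * θ j v) (𝔙 (m + 1)) := fun j =>
      hF.integrable_mul (hθ2 j)
    have j2 : ∀ j, Integrable (fun v => F v * ∫ s, θ j (update v j s) ∂ℳ)
      (𝔙 (m + 1)) := fun j => hF.integrable_mul (hθj j)
    have j3 : ∀ j, Integrable (fun v => θ j v * ∫ s, F (update v j s) ∂ℳ)
      (𝔙 (m + 1)) := fun j => (hθ2 j).integrable_mul (hFj j)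
    have e1 : ∫ v, F v * ∑ j, I * (θ j v + c j * ∫ s, θ j (update v j s) ∂ℳ)
        ∂𝔙 (m + 1) = I * ∫ v, modeOp N β V κ F v * ψ v ∂𝔙 (m + 1) := by
      have a1 : ∀ v, F v * ∑ j, I * (θ j v + c j * ∫ s, θ j (update v j s) ∂ℳ)
          = ∑ j, I * (F v * θ j v + c j * (F v * ∫ s, θ j (update v j s)
            ∂ℳ)) := fun v => by
        rw [mul_sum]
        exact sum_congr rfl fun j _ => by ring
      have a2 : ∀ v, modeOp N β V κ F v * ψ v = ∑ j, (F v * θ j v + c j * (θ j v *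
          ∫ s, F (update v j s) ∂ℳ)) := fun v => by
        rw [hop, sum_mul]
        exact sum_congr rfl fun j _ => by simp only [hθ]; ring
      have b1 : ∀ j, Integrable (fun v => I * (F v * θ j v + c j * (F v *
          ∫ s, θ j (update v j s) ∂ℳ))) (𝔙 (m + 1)) := fun j =>
        ((j1 j).add ((j2 j).const_mul _)).const_mul I
      have b2 : ∀ j, Integrable (fun v => F v * θ j v + c j * (θ j v *
          ∫ s, F (update v j s) ∂ℳ)) (𝔙 (m + 1)) := fun j =>
        (j1 j).add ((j3 j).const_mul _)
      simp_rw [a1, a2]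
      rw [integral_finsetSum _ fun j _ => b1 j, integral_finsetSum _ fun j _ => b2 j,
        mul_sum]
      refine sum_congr rfl fun j _ => ?_
      rw [integral_const_mul, integral_add (j1 j) ((j2 j).const_mul _),
        integral_add (j1 j) ((j3 j).const_mul _), integral_const_mul, integral_const_mul, hsw]
    rw [e1, mul_assoc] at hp
    have hp' := mul_left_cancel₀ I_ne_zero hp
    have k1 : Integrable (fun v => modeOp N β V κ F v * ψ v) (𝔙 (m + 1)) := by
      obtain ⟨C, hC⟩ := hc.exists_bound_of_continuous hψ.continuous
      exact hopi.mul_bdd hψ.continuous.aestronglyMeasurable (ae_of_all _ hC)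
    have k2 : Integrable (fun v => ω * (F v * ψ v)) (𝔙 (m + 1)) :=
      (hF.integrable_mul hψ2).const_mul ω
    simp_rw [sub_mul, mul_assoc]
    rw [integral_sub k1 k2, integral_const_mul, hp', sub_self]
  filter_upwards [h0] with v hv
  exact sub_eq_zero.1 hv

/-! ### Uniqueness for the resolvent equations -/

variable {X : Type*} [MeasurableSpace X]

lemma measurePreserving_vec_two (μ : Measure X) [IsProbabilityMeasure μ] :
    MeasurePreserving (fun q : X × X => (![q.1, q.2] : Fin 2 → X)) (μ.prod μ)
      (Measure.pi fun _ : Fin 2 => μ) := by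
  have h := (measurePreserving_finTwoArrow μ).symm
  have e : (fun q : X × X => (![q.1, q.2] : Fin 2 → X)) = MeasurableEquiv.finTwoArrow.symm := by
    funext q i
    fin_cases i <;> rfl
  rw [e]
  exact h

lemma measurePreserving_vec_three (μ : Measure X) [IsProbabilityMeasure μ] :
    MeasurePreserving (fun q : X × X × X => (![q.1, q.2.1, q.2.2] : Fin 3 → X))
      (μ.prod (μ.prod μ)) (Measure.pi fun _ : Fin 3 => μ) := by
  have h := (measurePreserving_piFinSuccAbove (fun _ : Fin 3 => μ) 0).symm
  have h2 := h.comp ((MeasurePreserving.id μ).prod (measurePreserving_vec_two μ))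
  have e : (fun q : X × X × X => (![q.1, q.2.1, q.2.2] : Fin 3 → X))
      = (MeasurableEquiv.piFinSuccAbove (fun _ : Fin 3 => X) 0).symm ∘
        (Prod.map id fun q : X × X => (![q.1, q.2] : Fin 2 → X)) := by
    funext q i
    fin_cases i <;> rfl
  rw [e]
  exact h2

lemma ae_eq_zero_of_comp {Y : Type*} [MeasurableSpace Y] {μ : Measure X} {ν : Measure Y}
    {e : X → Y} (he : MeasurePreserving e μ ν) {F : Y → ℂ} (hF : AEStronglyMeasurable F ν)
    (h : F ∘ e =ᵐ[μ] 0) : F =ᵐ[ν] 0 := by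
  have h1 := eLpNorm_comp_measurePreserving (p := 2) hF he
  rw [eLpNorm_congr_ae h, eLpNorm_zero] at h1
  exact (eLpNorm_eq_zero_iff hF two_ne_zero).1 h1.symm

variable [hβ : Fact (0 < β)]

lemma modeOp_two (hN : 1 ≤ N) (κ : Fin 2 → ℤᵈ) (F : (Fin 2 → Vel d) → ℂ)
    (v : Fin 2 → Vel d) : modeOp (m := 1) N β V κ F v
      = (⟪κ 0, v 0⟫ + ⟪κ 1, v 1⟫ : ℝ) * F v
        + (β * potHat V (κ 1) : ℝ) * ⟪κ 1, v 1⟫ *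
          ∫ s, F ![v 0, s] ∂ℳ := by
  have hN' : (N : ℝ) ≠ 0 := by positivity
  have hu : ∀ s : Vel d, update v 1 s = ![v 0, s] := by
    intro s; funext i; fin_cases i <;> simp
  rw [modeOp]
  refine (Fin.sum_univ_two _).trans ?_
  simp only [if_true, one_ne_zero, if_false, hu, Nat.cast_one, add_sub_cancel_right,
    div_self hN', one_mul, add_zero]
  push_cast
  ring

lemma modeOp_three (N : ℕ) (κ : Fin 3 → ℤᵈ) (F : (Fin 3 → Vel d) → ℂ)
    (v : Fin 3 → Vel d) : modeOp (m := 2) N β V κ F v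
      = (⟪κ 0, v 0⟫ + ⟪κ 1, v 1⟫
          + ⟪κ 2, v 2⟫ : ℝ) * F v
        + (((N : ℝ) - 1) / N * (β * potHat V (κ 1)) : ℝ) * ⟪κ 1, v 1⟫ *
          ∫ s, F ![v 0, s, v 2] ∂ℳ
        + (((N : ℝ) - 1) / N * (β * potHat V (κ 2)) : ℝ) * ⟪κ 2, v 2⟫ *
          ∫ s, F ![v 0, v 1, s] ∂ℳ := by
  have hu1 : ∀ s : Vel d, update v 1 s = ![v 0, s, v 2] := by
    intro s; funext i; fin_cases i <;> simp
  have hu2 : ∀ s : Vel d, update v 2 s = ![v 0, v 1, s] := by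
    intro s; funext i; fin_cases i <;> simp
  have e : (N : ℝ) + 1 - (2 : ℕ) = N - 1 := by push_cast; ring
  rw [modeOp]
  refine (Fin.sum_univ_three _).trans ?_
  simp only [if_true, one_ne_zero, if_false, hu1, hu2, add_zero, e, Fin.reduceEq]
  push_cast
  ring

lemma ae_eq_zero_of_modeOp_two (hN : 1 ≤ N) (hpos : ∀ n, 0 ≤ potHat V n) (hω : 0 < ω.im) {κ : Fin 2 → ℤᵈ} {F : (Fin 2 → Vel d) → ℂ}
    (hF : MemLp F 2 (𝔙 2))
    (heq : modeOp (m := 1) N β V κ F =ᵐ[𝔙 2] fun v => ω * F v) :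
    F =ᵐ[𝔙 2] 0 := by
  have hmp : MeasurePreserving (fun q : Vel d × Vel d => (![q.2, q.1] : Fin 2 → Vel d))
      ((ℳ).prod ℳ) (𝔙 2) :=
    (measurePreserving_vec_two ℳ).comp Measure.measurePreserving_swap
  refine ae_eq_zero_of_comp hmp hF.1 ?_
  have hB := hF.comp_measurePreserving hmp
  refine two_slot_unique (a := fun u => ⟪κ 1, u⟫)
    (b := fun w => ⟪κ 0, w⟫) (memLp_inner_maxwell _) (memLp_inner_maxwell _)
    (α₁ := β * potHat V (κ 1)) (α₂ := 0) (mul_nonneg hβ.out.le (hpos _)) le_rfl hω hB ?_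
  filter_upwards [hmp.quasiMeasurePreserving.ae heq] with q hq
  rw [modeOp_two hN] at hq
  simp only [Matrix.cons_val_zero, Matrix.cons_val_one] at hq
  push_cast at hq
  simp only [comp_apply, ofReal_zero, zero_mul, add_zero]
  push_cast
  linear_combination hq

lemma ae_eq_zero_of_modeOp_three (hN : 1 ≤ N) (hpos : ∀ n, 0 ≤ potHat V n) (hω : 0 < ω.im) {κ : Fin 3 → ℤᵈ} {F : (Fin 3 → Vel d) → ℂ}
    (hF : MemLp F 2 (𝔙 3))
    (heq : modeOp (m := 2) N β V κ F =ᵐ[𝔙 3] fun v => ω * F v) :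
    F =ᵐ[𝔙 3] 0 := by
  have hmp := measurePreserving_vec_three ℳ
  refine ae_eq_zero_of_comp hmp hF.1 ?_
  have hB := hF.comp_measurePreserving hmp
  have hsq : Integrable (fun q : Vel d × Vel d × Vel d => ‖F ![q.1, q.2.1, q.2.2]‖ ^ 2)
      ((ℳ).prod ((ℳ).prod ℳ)) :=
    (memLp_two_iff_integrable_sq_norm hB.1).1 hB
  have hN' : (1 : ℝ) ≤ N := by exact_mod_cast hN
  have hc : ∀ j, 0 ≤ ((N : ℝ) - 1) / N * (β * potHat V (κ j)) := fun j =>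
    mul_nonneg (div_nonneg (by linarith) (by linarith)) (mul_nonneg hβ.out.le (hpos _))
  have hslice := Measure.ae_ae_of_ae_prod (hmp.quasiMeasurePreserving.ae heq)
  have hz : ∫ q : Vel d × Vel d × Vel d, ‖F ![q.1, q.2.1, q.2.2]‖ ^ 2
      ∂(ℳ).prod ((ℳ).prod ℳ) = 0 := by
    rw [integral_prod _ hsq]
    refine integral_eq_zero_of_ae ?_
    filter_upwards [hsq.prod_right_ae, hB.1.prodMk_left, hslice] with v h1 h2 h3
    refine integral_eq_zero_of_ae ?_
    have := two_slot_unique (a := fun u => ⟪κ 1, u⟫)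
      (b := fun w => ⟪κ 2, w⟫) (memLp_inner_maxwell (β := β) _)
      (memLp_inner_maxwell (β := β) _) (hc 1) (hc 2) (ω := ω - ⟪κ 0, v⟫)
      (by simpa using hω) (B := fun q => F ![v, q.1, q.2])
      ((memLp_two_iff_integrable_sq_norm h2).2 h1) (by
        filter_upwards [h3] with q hq
        rw [modeOp_three] at hq
        simp only [Matrix.cons_val_zero, Matrix.cons_val_one, Matrix.cons_val] at hq
        push_cast at hq ⊢
        linear_combination hq)
    filter_upwards [this] with x hx
    rw [hx]
    simp
  filter_upwards [(integral_eq_zero_iff_of_nonneg (fun q => by positivity) hsq).1 hz] with q hq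
  simpa using hq

theorem IsResolvent.unique {m : ℕ} (hm : m = 1 ∨ m = 2) (hN : 1 ≤ N) (hV : IsPotential V DV K) (hω : 0 < ω.im)
    {R R' G G' : (Fin (m + 1) → Phase d) → ℂ} (hR : R =ᵐ[𝔓 (m + 1)] R')
    (h : IsResolvent N m β DV ω R G) (h' : IsResolvent N m β DV ω R' G') :
    G =ᵐ[𝔓 (m + 1)] G' := by
  have hH := h.1.1.sub h'.1.1
  have hw : ∀ φ, IsPhaseTest φ → vlasovPair N m β DV (G - G') φ
      = I * ω * ∫ z, (G - G') z * φ z ∂𝔓 (m + 1) := by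
    intro φ hφ
    have i1 := h.1.1.integrable (q := 2) (by norm_num)
    have i2 := h'.1.1.integrable (q := 2) (by norm_num)
    obtain ⟨C, hC⟩ := exists_norm_vlasovAdj_le (β := β) N hV.le hφ
    have hm := (measurable_vlasovAdj (β := β) N hV.measurable hφ).aestronglyMeasurable
      (μ := 𝔓 (m + 1))
    have j1 := i1.mul_bdd hm (ae_of_all _ hC)
    have j2 := i2.mul_bdd hm (ae_of_all _ hC)
    have k1 := hφ.isBddTest.integrable_mul i1
    have k2 := hφ.isBddTest.integrable_mul i2
    have e1 := h.2 φ hφ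
    have e2 := h'.2 φ hφ
    have e3 : ∫ z, R z * φ z ∂𝔓 (m + 1)
        = ∫ z, R' z * φ z ∂𝔓 (m + 1) :=
      integral_congr_ae (by filter_upwards [hR] with z hz; rw [hz])
    rw [vlasovPair_eq N hV.measurable hV.le hφ i1] at e1
    rw [vlasovPair_eq N hV.measurable hV.le hφ i2] at e2
    rw [vlasovPair_eq N hV.measurable hV.le hφ (i1.sub i2)]
    simp only [Pi.sub_apply, sub_mul]
    rw [integral_sub j1 j2, integral_sub k1 k2]
    linear_combination e1 - e2 + e3
  have h0 : (G - G') =ᵐ[𝔓 (m + 1)] 0 := by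
    refine ae_eq_zero_of_modeProj hH fun κ => ?_
    have he := modeOp_modeProj N hV hH hw κ
    rcases hm with rfl | rfl
    · exact ae_eq_zero_of_modeOp_two hN hV.pos hω (memLp_modeProj κ hH) he
    · exact ae_eq_zero_of_modeOp_three hN hV.pos hω (memLp_modeProj κ hH) he
  filter_upwards [h0] with z hz
  exact sub_eq_zero.1 hz

/-! ### The mean operator in duality with test functions -/

lemma measurePreserving_snoc {X : Type*} [MeasurableSpace X] (μ : Measure X)
    [IsProbabilityMeasure μ] (n : ℕ) :
    MeasurePreserving (fun q : (Fin n → X) × X => (Fin.snoc (α := fun _ => X) q.1 q.2 : Fin (n + 1) → X))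
      ((Measure.pi fun _ : Fin n => μ).prod μ) (Measure.pi fun _ : Fin (n + 1) => μ) := by
  have h := (measurePreserving_piFinSuccAbove (fun _ : Fin (n + 1) => μ) (Fin.last n)).symm
  have e : (fun q : (Fin n → X) × X => (Fin.snoc (α := fun _ => X) q.1 q.2 : Fin (n + 1) → X))
      = (MeasurableEquiv.piFinSuccAbove (fun _ : Fin (n + 1) => X) (Fin.last n)).symm ∘ Prod.swap := by
    funext q
    exact (Fin.insertNth_last' q.2 q.1).symm
  rw [e]
  exact h.comp Measure.measurePreserving_swap

variable {m : ℕ}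

/-- The adjoint of the mean operator on test functions. -/
def meanAdj (DV : Torus d → Vel d) (φ : (Fin (m + 1) → Phase d) → ℂ)
    (z : Fin (m + 1 + 1) → Phase d) : ℂ :=
  ∑ j : Fin (m + 1), ∑ i : Fin d, (DV ((z j.castSucc).1 - (z (Fin.last _)).1) i : ℂ) *
    liftDeriv φ (velDir j i) (fun l => z l.castSucc)

lemma measurable_meanAdj (hDm : Measurable DV) {φ : (Fin (m + 1) → Phase d) → ℂ}
    (hφ : IsPhaseTest φ) : Measurable (meanAdj DV φ) := by
  refine Finset.measurable_sum _ fun j _ => Finset.measurable_sum _ fun i _ => ?_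
  have h1 : Measurable fun z : Fin (m + 1 + 1) → Phase d =>
      (z j.castSucc).1 - (z (Fin.last _)).1 := by
    have a1 : Measurable fun z : Fin (m + 1 + 1) → Phase d => (z j.castSucc).1 := by fun_prop
    have a2 : Measurable fun z : Fin (m + 1 + 1) → Phase d => (z (Fin.last _)).1 := by fun_prop
    exact measurable_pi_lambda _ fun i =>
      ((measurable_pi_apply i).comp a1).sub ((measurable_pi_apply i).comp a2)
  have h2 : Measurable fun v : Vel d => v i := by fun_prop
  refine ((h2.comp (hDm.comp h1)).complex_ofReal).mul ((hφ.isBddTest_liftDeriv _).meas.comp ?_)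
  fun_prop

lemma exists_norm_meanAdj_le (hDb : ∀ x, ‖DV x‖ ≤ K) {φ : (Fin (m + 1) → Phase d) → ℂ}
    (hφ : IsPhaseTest φ) : ∃ C : ℝ, ∀ z, ‖meanAdj DV φ z‖ ≤ C := by
  have h := fun (j : Fin (m + 1)) (i : Fin d) => (hφ.isBddTest_liftDeriv (velDir j i)).bound
  choose C hC using h
  refine ⟨∑ j, ∑ i, K * C j i, fun z => ?_⟩
  refine (norm_sum_le _ _).trans (sum_le_sum fun j _ => (norm_sum_le _ _).trans
    (sum_le_sum fun i _ => ?_))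
  rw [norm_mul, norm_real]
  exact mul_le_mul ((PiLp.norm_apply_le _ i).trans (hDb _)) (hC j i _) (norm_nonneg _)
    ((norm_nonneg _).trans (hDb 0))

lemma meanPair_eq [Fact (0 < β)] (N : ℕ) (hDm : Measurable DV) (hDb : ∀ x, ‖DV x‖ ≤ K)
    {φ : (Fin (m + 1) → Phase d) → ℂ} (hφ : IsPhaseTest φ) {G : (Fin (m + 1 + 1) → Phase d) → ℂ}
    (hG : Integrable G (𝔓 (m + 1 + 1))) :
    meanPair N m β DV G φ = -((((N : ℝ) - m) / N : ℝ) : ℂ) *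
      ∫ z, G z * meanAdj DV φ z ∂𝔓 (m + 1 + 1) := by
  have hs := measurePreserving_snoc ℨ (m + 1)
  have hterm : ∀ j : Fin (m + 1), Integrable (fun q : (Fin (m + 1) → Phase d) × Phase d =>
      G (Fin.snoc (α := fun _ => Phase d) q.1 q.2) * velDeriv j (DV ((q.1 j).1 - q.2.1)) φ q.1)
      ((𝔓 (m + 1)).prod ℨ) := by
    intro j
    have hb := fun i : Fin d => (hφ.isBddTest_liftDeriv (velDir j i)).bound
    choose C hC using hb
    refine (hs.integrable_comp_of_integrable hG).mul_bdd (c := ∑ i, K * C i) ?_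
      (ae_of_all _ fun q => ?_)
    · simp_rw [hφ.velDeriv_eq]
      refine (Finset.measurable_sum _ fun i _ => ?_).aestronglyMeasurable
      have h1 : Measurable fun q : (Fin (m + 1) → Phase d) × Phase d => (q.1 j).1 - q.2.1 := by
        have a1 : Measurable fun q : (Fin (m + 1) → Phase d) × Phase d => (q.1 j).1 := by fun_prop
        have a2 : Measurable fun q : (Fin (m + 1) → Phase d) × Phase d => q.2.1 := by fun_prop
        exact measurable_pi_lambda _ fun i =>
          ((measurable_pi_apply i).comp a1).sub ((measurable_pi_apply i).comp a2)
      have h2 : Measurable fun v : Vel d => v i := by fun_prop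
      exact ((h2.comp (hDm.comp h1)).complex_ofReal).mul
        ((hφ.isBddTest_liftDeriv _).meas.comp measurable_fst)
    · rw [hφ.velDeriv_eq]
      refine (norm_sum_le _ _).trans (sum_le_sum fun i _ => ?_)
      rw [norm_mul, norm_real]
      exact mul_le_mul ((PiLp.norm_apply_le _ i).trans (hDb _)) (hC i _) (norm_nonneg _)
        ((norm_nonneg _).trans (hDb 0))
  obtain ⟨C, hC⟩ := exists_norm_meanAdj_le (m := m) hDb hφ
  have hi : Integrable (fun z => G z * meanAdj DV φ z) (𝔓 (m + 1 + 1)) :=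
    hG.mul_bdd (measurable_meanAdj hDm hφ).aestronglyMeasurable (ae_of_all _ hC)
  have e : ∫ z, G z * meanAdj DV φ z ∂𝔓 (m + 1 + 1)
      = ∑ j : Fin (m + 1), ∫ z, (∫ zs, G (Fin.snoc (α := fun _ => Phase d) z zs) *
        velDeriv j (DV ((z j).1 - zs.1)) φ z ∂ℨ) ∂𝔓 (m + 1) := by
    have hmap := integral_map (f := fun z => G z * meanAdj DV φ z) hs.measurable.aemeasurable (by
      rw [hs.map_eq]; exact hi.1)
    rw [hs.map_eq] at hmap
    refine hmap.trans ?_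
    simp_rw [← fun j => integral_prod _ (hterm j)]
    rw [← integral_finsetSum _ fun j _ => hterm j]
    refine integral_congr_fun fun q => ?_
    simp only [meanAdj, hφ.velDeriv_eq, Fin.snoc_castSucc, Fin.snoc_last, mul_sum]
  rw [meanPair, e]
  simp only [Finset.sum_neg_distrib]
  ring

lemma torusChar_single (j : Fin n) (l : ℤᵈ) (x : Fin n → Torus d) :
    torusChar (Pi.single j l) x = mFourier l (x j) := by
  rw [torusChar, Fintype.prod_eq_single j fun i hi => by
    rw [Pi.single_eq_of_ne hi, mFourier_zero]; rfl, Pi.single_eq_same]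

lemma integral_velDeriv_mul_mFourier (hV : IsPotential V DV K) {φ : (Fin n → Phase d) → ℂ}
    (hφ : IsPhaseTest φ) (j : Fin n) (z : Fin n → Phase d) (l : ℤᵈ) (y : Torus d) :
    ∫ x, mFourier l x * velDeriv j (DV (y - x)) φ z ∂𝔗
      = mFourier l y * (I * potHat V l) * velDeriv j (waveVec l) φ z := by
  have h := fun i : Fin d => integral_grad_mul_mFourier hV l (EuclideanSpace.single i 1) y
  simp only [EuclideanSpace.inner_single_left, EuclideanSpace.inner_single_right, map_one,
    one_mul] at h
  have hi : ∀ i : Fin d, Integrable (fun x => ((DV (y - x) i : ℝ) : ℂ) * mFourier l x)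
      𝔗 := by
    intro i
    refine (integrable_mFourier_mul ((hV.integrable_apply i).comp_sub_left y) l).congr
      (ae_of_all _ fun x => ?_)
    ring
  simp_rw [hφ.velDeriv_eq, mul_sum]
  have e : ∀ (x : Torus d) (i : Fin d), mFourier l x * (((DV (y - x) i : ℝ) : ℂ) *
      liftDeriv φ (velDir j i) z)
      = ((DV (y - x) i : ℝ) : ℂ) * mFourier l x * liftDeriv φ (velDir j i) z := fun x i => by ring
  simp_rw [e]
  rw [integral_finsetSum _ fun i _ => (hi i).mul_const _]
  refine sum_congr rfl fun i _ => ?_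
  rw [integral_mul_const, h i]
  simp
  ring

lemma meanPair_modeFun [Fact (0 < β)] (N : ℕ) (hV : IsPotential V DV K) (κ : Fin (m + 1 + 1) → ℤᵈ)
    (B : (Fin (m + 1 + 1) → Vel d) → ℂ) {φ : (Fin (m + 1) → Phase d) → ℂ} (hφ : IsPhaseTest φ) :
    meanPair N m β DV (modeFun κ B) φ = -((((N : ℝ) - m) / N : ℝ) : ℂ) *
      (I * potHat V (κ (Fin.last _))) * ∑ j : Fin (m + 1),
        ∫ z, modeFun ((fun l => κ l.castSucc) + Pi.single j (κ (Fin.last _)))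
          (fun v => ∫ s, B (Fin.snoc (α := fun _ => Vel d) v s) ∂ℳ) z *
          velDeriv j (waveVec (κ (Fin.last _))) φ z ∂𝔓 (m + 1) := by
  have e : ∀ (j : Fin (m + 1)) (z : Fin (m + 1) → Phase d),
      ∫ zs, modeFun κ B (Fin.snoc (α := fun _ => Phase d) z zs) *
        velDeriv j (DV ((z j).1 - zs.1)) φ z ∂ℨ
      = I * potHat V (κ (Fin.last _)) *
        (modeFun ((fun l => κ l.castSucc) + Pi.single j (κ (Fin.last _)))
          (fun v => ∫ s, B (Fin.snoc (α := fun _ => Vel d) v s) ∂ℳ) z *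
          velDeriv j (waveVec (κ (Fin.last _))) φ z) := by
    intro j z
    have e1 : ∀ zs : Phase d, modeFun κ B (Fin.snoc (α := fun _ => Phase d) z zs) *
        velDeriv j (DV ((z j).1 - zs.1)) φ z
        = (torusChar (fun l => κ l.castSucc) (posOf z) * (mFourier (κ (Fin.last _)) zs.1 *
          velDeriv j (DV ((z j).1 - zs.1)) φ z)) *
          B (Fin.snoc (α := fun _ => Vel d) (velOf z) zs.2) := by
      intro zs
      have a1 : torusChar κ (posOf (Fin.snoc (α := fun _ => Phase d) z zs))
          = torusChar (fun l => κ l.castSucc) (posOf z) * mFourier (κ (Fin.last _)) zs.1 := by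
        rw [torusChar, Fin.prod_univ_castSucc]
        simp [posOf, torusChar]
      have a2 : velOf (Fin.snoc (α := fun _ => Phase d) z zs)
          = Fin.snoc (α := fun _ => Vel d) (velOf z) zs.2 := by
        funext l
        refine Fin.lastCases ?_ (fun i => ?_) l <;> simp [velOf]
      rw [modeFun, a1, a2]
      ring
    simp_rw [e1]
    rw [phaseMeasure, integral_prod_mul (fun x : Torus d =>
      torusChar (fun l => κ l.castSucc) (posOf z) * (mFourier (κ (Fin.last _)) x *
          velDeriv j (DV ((z j).1 - x)) φ z))
      (fun s : Vel d => B (Fin.snoc (α := fun _ => Vel d) (velOf z) s)), integral_const_mul,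
      integral_velDeriv_mul_mFourier hV hφ, modeFun, ← torusChar_mul, torusChar_single]
    simp only [posOf]
    ring
  rw [meanPair]
  simp_rw [e, integral_const_mul, mul_sum]
  refine sum_congr rfl fun j _ => ?_
  ring

/-! ### Integration by parts in the velocities -/

/-- `(w · (∇_v - β v)) h = h'`, in duality with test functions. -/
def HasTwistedDeriv (β : ℝ) (w : Vel d) (h h' : Vel d → ℂ) : Prop :=
  ∀ ψ : Vel d → ℂ, IsVelTest ψ →
    ∫ v, h v * fderiv ℝ ψ v w ∂maxwell d β = -∫ v, h' v * ψ v ∂maxwell d β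

lemma contDiff_maxwellDensity (β : ℝ) : ContDiff ℝ (⊤ : ℕ∞) (maxwellDensity (d := d) β) := by
  unfold maxwellDensity
  exact contDiff_const.mul (contDiff_const.mul (contDiff_norm_sq ℝ)).exp

lemma hasFDerivAt_maxwellDensity (β : ℝ) (v : Vel d) :
    HasFDerivAt (maxwellDensity β) (-(β * maxwellDensity β v) • innerSL ℝ v) v := by
  have h := (((hasStrictFDerivAt_norm_sq v).hasFDerivAt.const_mul (-(β / 2))).exp).const_mul
    ((β / (2 * π)) ^ ((d : ℝ) / 2))
  refine h.congr_fderiv ?_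
  ext w
  simp [maxwellDensity]
  ring

lemma fderiv_maxwellDensity_mul (β : ℝ) {ψ : Vel d → ℂ} (hψ : Differentiable ℝ ψ) (v w : Vel d) :
    fderiv ℝ (fun v => (maxwellDensity β v : ℂ) * ψ v) v w
      = maxwellDensity β v * (fderiv ℝ ψ v w - β * (inner ℝ w v : ℝ) * ψ v) := by
  have h1 : HasFDerivAt (fun v => (maxwellDensity β v : ℂ))
      (ofRealCLM.comp (-(β * maxwellDensity β v) • innerSL ℝ v)) v :=
    ofRealCLM.hasFDerivAt.comp v (hasFDerivAt_maxwellDensity β v)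
  have h2 : HasFDerivAt (fun v => (maxwellDensity β v : ℂ) * ψ v) _ v :=
    h1.mul (hψ v).hasFDerivAt
  rw [h2.fderiv]
  simp [real_inner_comm]
  ring

lemma IsVelTest.maxwellDensity_mul (β : ℝ) {ψ : Vel d → ℂ} (hψ : IsVelTest ψ) :
    IsVelTest fun v => (maxwellDensity β v : ℂ) * ψ v :=
  ⟨(ofRealCLM.contDiff.comp (contDiff_maxwellDensity β)).mul hψ.1, hψ.2.mul_left⟩

lemma hasTwistedDeriv_of_weak [hβ : Fact (0 < β)] {w : Vel d} {h Dh : Vel d → ℂ}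
    (hh : MemLp h 2 (maxwell d β)) (hD : MemLp Dh 2 (maxwell d β))
    (hw : ∀ ψ : Vel d → ℂ, IsVelTest ψ →
      ∫ v, h v * fderiv ℝ (fun v => (maxwellDensity β v : ℂ) * ψ v) v w
        = -∫ v, Dh v * (maxwellDensity β v * ψ v)) :
    HasTwistedDeriv β w h fun v => Dh v - β * (inner ℝ w v : ℝ) * h v := by
  intro ψ hψ
  have hψd : Differentiable ℝ ψ := hψ.1.differentiable (by simp)
  have hc1 : Continuous fun v => fderiv ℝ ψ v w :=
    (hψ.1.continuous_fderiv (by simp)).clm_apply continuous_const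
  have hc2 : Continuous fun v => ((inner ℝ w v : ℝ) : ℂ) * ψ v := by
    have := hψ.1.continuous; fun_prop
  obtain ⟨C₀, hC₀⟩ := hψ.2.exists_bound_of_continuous hψ.1.continuous
  obtain ⟨C₁, hC₁⟩ := (hψ.2.fderiv_apply (𝕜 := ℝ) w).exists_bound_of_continuous hc1
  obtain ⟨C₂, hC₂⟩ := (hψ.2.mul_left (f := fun v => ((inner ℝ w v : ℝ) : ℂ))).exists_bound_of_continuous hc2
  have hi := hh.integrable (q := 2) (by norm_num)
  have i0 : Integrable (fun v => Dh v * ψ v) (maxwell d β) :=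
    (hD.integrable (by norm_num)).mul_bdd hψ.1.continuous.aestronglyMeasurable (ae_of_all _ hC₀)
  have i1 : Integrable (fun v => h v * fderiv ℝ ψ v w) (maxwell d β) :=
    hi.mul_bdd hc1.aestronglyMeasurable (ae_of_all _ hC₁)
  have i2 : Integrable (fun v => β * (h v * (((inner ℝ w v : ℝ) : ℂ) * ψ v))) (maxwell d β) :=
    (hi.mul_bdd hc2.aestronglyMeasurable (ae_of_all _ hC₂)).const_mul (β : ℂ)
  have key := hw ψ hψ
  have k1 : ∫ v, h v * fderiv ℝ (fun v => (maxwellDensity β v : ℂ) * ψ v) v w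
      = ∫ v, (h v * fderiv ℝ ψ v w - β * (h v * (((inner ℝ w v : ℝ) : ℂ) * ψ v))) ∂maxwell d β := by
    rw [integral_maxwell hβ.out]
    refine integral_congr_fun fun v => ?_
    simp only [fderiv_maxwellDensity_mul β hψd, real_smul]
    ring
  have k2 : ∫ v, Dh v * (maxwellDensity β v * ψ v) = ∫ v, Dh v * ψ v ∂maxwell d β := by
    rw [integral_maxwell hβ.out]
    refine integral_congr_fun fun v => ?_
    simp only [real_smul]
    ring
  rw [k1, k2, integral_sub i1 i2] at key
  have k3 : ∫ v, (Dh v - β * (inner ℝ w v : ℝ) * h v) * ψ v ∂maxwell d β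
      = ∫ v, Dh v * ψ v ∂maxwell d β
        - ∫ v, β * (h v * (((inner ℝ w v : ℝ) : ℂ) * ψ v)) ∂maxwell d β := by
    rw [← integral_sub i0 i2]
    refine integral_congr_fun fun v => ?_
    ring
  rw [k3]
  linear_combination key

lemma fderiv_apply_eq_sum (ψ : Vel d → ℂ) (v w : Vel d) :
    fderiv ℝ ψ v w = ∑ i, (w i : ℂ) * velPartial ψ i v := by
  conv_lhs => rw [← sum_smul_single w]
  simp [map_sum, velPartial]

lemma IsH1.memLp_grad_apply (hg : IsH1 β g Dg) (i : Fin d) :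
    MemLp (fun v => Dg v i) 2 ℳ :=
  hg.memLp_grad.of_le ((by fun_prop : Continuous fun u : ℂᵈ =>
    u i).comp_aestronglyMeasurable hg.memLp_grad.1) (ae_of_all _ fun v => PiLp.norm_apply_le _ i)

lemma IsH1.hasTwistedDeriv [hβ : Fact (0 < β)] (hg : IsH1 β g Dg) (htg : ∀ i, MemLp (fun v => twistedGrad β g Dg v i) 2 ℳ)
    (w : Vel d) :
    HasTwistedDeriv β w g fun v => ∑ i, (w i : ℂ) * twistedGrad β g Dg v i := by
  have h1 : ∀ i : Fin d, HasTwistedDeriv β (EuclideanSpace.single i 1) g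
      fun v => twistedGrad β g Dg v i := by
    intro i
    have h := hasTwistedDeriv_of_weak (w := EuclideanSpace.single i 1) hg.memLp
      (hg.memLp_grad_apply i) fun ψ hψ => hg.weak_grad _ (hψ.maxwellDensity_mul β) i
    simpa [twistedGrad, EuclideanSpace.inner_single_left] using h
  intro ψ hψ
  have i1 : ∀ i : Fin d, Integrable (fun v => g v * velPartial ψ i v) ℳ := by
    intro i
    have hc1 : Continuous (velPartial ψ i) :=
      (hψ.1.continuous_fderiv (by simp)).clm_apply continuous_const
    obtain ⟨C₁, hC₁⟩ := (hψ.2.fderiv_apply (𝕜 := ℝ)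
      (EuclideanSpace.single i 1)).exists_bound_of_continuous hc1
    exact (hg.memLp.integrable (by norm_num)).mul_bdd hc1.aestronglyMeasurable (ae_of_all _ hC₁)
  have i2 : ∀ i : Fin d, Integrable (fun v => twistedGrad β g Dg v i * ψ v) ℳ := by
    intro i
    obtain ⟨C₀, hC₀⟩ := hψ.2.exists_bound_of_continuous hψ.1.continuous
    exact ((htg i).integrable (by norm_num)).mul_bdd hψ.1.continuous.aestronglyMeasurable
      (ae_of_all _ hC₀)
  have e1 : ∀ v, g v * fderiv ℝ ψ v w = ∑ i, (w i : ℂ) * (g v * velPartial ψ i v) := fun v => by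
    rw [fderiv_apply_eq_sum, mul_sum]
    exact sum_congr rfl fun i _ => by ring
  have e2 : ∀ v, (∑ i, (w i : ℂ) * twistedGrad β g Dg v i) * ψ v
      = ∑ i, (w i : ℂ) * (twistedGrad β g Dg v i * ψ v) := fun v => by
    rw [sum_mul]
    exact sum_congr rfl fun i _ => by ring
  simp_rw [e1, e2]
  rw [integral_finsetSum _ fun i _ => (i1 i).const_mul _,
    integral_finsetSum _ fun i _ => (i2 i).const_mul _, ← Finset.sum_neg_distrib]
  refine sum_congr rfl fun i _ => ?_
  rw [integral_const_mul, integral_const_mul, ← mul_neg]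
  exact congrArg _ (h1 i ψ hψ)

lemma memLp_comp_modeVel [hβ : Fact (0 < β)] {n : ℤᵈ} (hn : n ≠ 0) {f : ℝ → ℂ}
    (hf : MemLp f 2 stdNormal) : MemLp (fun v => f (modeVel β n v)) 2 ℳ :=
  hf.comp_measurePreserving (measurePreserving_modeVel hβ.out hn)

/-- Functions of the velocity along `k = 2πn`. -/
lemma hasTwistedDeriv_modeVel [hβ : Fact (0 < β)] {n : ℤᵈ} (hn : n ≠ 0) {f f' : ℝ → ℂ}
    (hd : ∀ p, HasDerivAt f (f' p) p) (hf : MemLp f 2 stdNormal) (hf' : MemLp f' 2 stdNormal) :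
    HasTwistedDeriv β (waveVec n) (fun v => f (modeVel β n v)) fun v =>
      β * modeScale β n * (f' (modeVel β n v) - modeVel β n v * f (modeVel β n v)) := by
  have hc := modeScale_pos hβ.out hn
  have hF := hf.comp_measurePreserving (measurePreserving_modeVel (d := d) hβ.out hn)
  have hF' := (hf'.comp_measurePreserving (measurePreserving_modeVel (d := d) hβ.out hn)).const_mul
    (β * modeScale β n : ℂ)
  have hfd : ∀ v : Vel d, HasFDerivAt (fun v => f (modeVel β n v))
      (((modeScale β n)⁻¹ • innerSL ℝ (waveVec n)).smulRight (f' (modeVel β n v))) v := by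
    intro v
    have h1 : HasFDerivAt (modeVel β n) ((modeScale β n)⁻¹ • innerSL ℝ (waveVec n)) v := by
      have := ((modeScale β n)⁻¹ • innerSL ℝ (waveVec n)).hasFDerivAt (x := v)
      refine this.congr_of_eventuallyEq (Eventually.of_forall fun u => ?_)
      simp [modeVel, div_eq_inv_mul]
    have := (hd (modeVel β n v)).hasFDerivAt.comp v h1
    refine this.congr_fderiv ?_
    ext w
    simp [mul_assoc]
  have hfdk : ∀ v : Vel d, fderiv ℝ (fun v => f (modeVel β n v)) v (waveVec n)
      = β * modeScale β n * f' (modeVel β n v) := by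
    intro v
    rw [(hfd v).fderiv]
    have hs := norm_waveVec_sq hβ.out n
    have h2 : (modeScale β n)⁻¹ * ‖waveVec n‖ ^ 2 = β * modeScale β n := by
      rw [hs]; field_simp
    simp only [ContinuousLinearMap.smulRight_apply, smul_apply, innerSL_apply_apply,
      real_inner_self_eq_norm_sq, smul_eq_mul, h2, real_smul, ofReal_mul]
  have h := hasTwistedDeriv_of_weak (w := waveVec n) hF hF' fun ψ hψ => by
    have ht := hψ.maxwellDensity_mul β
    have hFc : Continuous fun v => f (modeVel β n v) :=
      continuous_iff_continuousAt.2 fun v => (hfd v).continuousAt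
    have hcd : Continuous fun v => fderiv ℝ (fun v => (maxwellDensity β v : ℂ) * ψ v) v (waveVec n) :=
      (ht.1.continuous_fderiv (by simp)).clm_apply continuous_const
    obtain ⟨C₀, hC₀⟩ := hψ.2.exists_bound_of_continuous hψ.1.continuous
    have j1 : Integrable (fun v => (β * modeScale β n * f' (modeVel β n v)) * ψ v)
        ℳ := (hF'.integrable (by norm_num)).mul_bdd
          hψ.1.continuous.aestronglyMeasurable (ae_of_all _ hC₀)
    have j2 : Integrable fun v => (β * modeScale β n * f' (modeVel β n v)) *
        ((maxwellDensity β v : ℂ) * ψ v) := by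
      rw [maxwell, integrable_withDensity_iff_integrable_smul'
        (continuous_maxwellDensity β).measurable.ennreal_ofReal
        (ae_of_all _ fun _ => ENNReal.ofReal_lt_top)] at j1
      refine j1.congr (ae_of_all _ fun v => ?_)
      simp only [ENNReal.toReal_ofReal (maxwellDensity_pos hβ.out v).le, real_smul]
      ring
    have key := integral_mul_fderiv_eq_neg_fderiv_mul_of_integrable (μ := volume)
      (f := fun v => f (modeVel β n v)) (g := fun v => (maxwellDensity β v : ℂ) * ψ v)
      (v := waveVec n) (by simp_rw [hfdk]; exact j2)
      ((hFc.mul hcd).integrable_of_hasCompactSupport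
        (ht.2.fderiv_apply (𝕜 := ℝ) (waveVec n)).mul_left)
      ((hFc.mul ht.1.continuous).integrable_of_hasCompactSupport ht.2.mul_left)
      (fun v _ => (hfd v).differentiableAt) (fun v _ => ht.1.differentiable (by simp) v)
    simp_rw [hfdk] at key
    exact key
  refine fun ψ hψ => (h ψ hψ).trans ?_
  congr 1
  refine integral_congr_fun fun v => ?_
  simp only [comp_apply]
  rw [← modeScale_mul_modeVel hβ.out hn v]
  push_cast
  ring

lemma IsPhaseTest.isVelTest_slice {φ : (Fin n → Phase d) → ℂ} (hφ : IsPhaseTest φ)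
    (x : Fin n → Torus d) (v : Fin n → Vel d) (j : Fin n) :
    IsVelTest fun s => φ fun l => (x l, update v j s l) := by
  have e : (fun s => φ fun l => (x l, update v j s l))
      = fun s => testLift φ fun l => ((phaseLift (fun l => (x l, v l)) l).1,
        update v j s l) := by
    funext s
    rw [testLift]
    congr 1
    funext l
    have := congrFun (phaseProj_phaseLift fun l => (x l, v l)) l
    refine Prod.ext ?_ rfl
    exact (congrArg Prod.fst this).symm
  constructor
  · rw [e]
    refine hφ.contDiff_lift.comp (contDiff_pi.2 fun l => contDiff_const.prodMk ?_)
    by_cases h : l = j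
    · subst h; simpa using contDiff_fun_id
    · simpa [h] using contDiff_const
  · obtain ⟨ρ, hρ⟩ := hφ.exists_supp
    refine HasCompactSupport.intro (isCompact_closedBall (0 : Vel d) ρ) fun s hs => ?_
    refine hρ _ j ?_
    simpa using hs

lemma IsPhaseTest.fderiv_slice {φ : (Fin n → Phase d) → ℂ} (hφ : IsPhaseTest φ)
    (x : Fin n → Torus d) (v : Fin n → Vel d) (j : Fin n) (s w : Vel d) :
    fderiv ℝ (fun s => φ fun l => (x l, update v j s l)) s w
      = velDeriv j w φ fun l => (x l, update v j s l) := by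
  have h := (hφ.isVelTest_slice x v j).1.differentiable (by simp) s
  have hl : HasDerivAt (fun t : ℝ => s + t • w) w 0 := by
    simpa using ((hasDerivAt_id (0 : ℝ)).smul_const w).const_add s
  have h2 : HasFDerivAt (fun s => φ fun l => (x l, update v j s l))
      (fderiv ℝ (fun s => φ fun l => (x l, update v j s l)) s) (s + (0 : ℝ) • w) := by
    rw [zero_smul, add_zero]
    exact h.hasFDerivAt
  have := (h2.comp_hasDerivAt (0 : ℝ) hl).deriv
  rw [← this, velDeriv]
  congr 1
  funext t
  simp only [comp_apply]
  congr 1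
  funext l
  by_cases h : l = j
  · subst h; simp
  · simp [h]

lemma isBddTest_velDeriv {φ : (Fin n → Phase d) → ℂ} (hφ : IsPhaseTest φ) (j : Fin n) (w : Vel d) :
    IsBddTest (velDeriv j w φ) := by
  have e : velDeriv j w φ = fun z => ∑ i, (w i : ℂ) * liftDeriv φ (velDir j i) z :=
    funext fun z => hφ.velDeriv_eq z j w
  rw [e]
  exact IsBddTest.sum _ fun i _ => (hφ.isBddTest_liftDeriv _).mul_bdd measurable_const
    fun ρ => ⟨‖(w i : ℂ)‖, fun z _ => le_rfl⟩

/-- Integrals over phase space, with the velocity in the slot `j` integrated first. -/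
lemma integral_phase_update_vel [Fact (0 < β)] (j : Fin n) {f : (Fin n → Phase d) → ℂ}
    (hf : Integrable f (𝔓 n)) :
    ∫ z, f z ∂𝔓 n = ∫ x, ∫ v, ∫ s, f (fun l => (x l, update v j s l))
      ∂ℳ ∂𝔙 n ∂torusMeasureN d n := by
  have hj := measurePreserving_join d β n
  have hi : Integrable (fun q : (Fin n → Torus d) × (Fin n → Vel d) => f fun l => (q.1 l, q.2 l))
      ((torusMeasureN d n).prod (𝔙 n)) := hj.integrable_comp_of_integrable hf
  rw [← hj.map_eq, integral_map hj.measurable.aemeasurable (by rw [hj.map_eq]; exact hf.1),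
    integral_prod _ hi]
  refine integral_congr_ae ?_
  filter_upwards [hi.prod_right_ae] with x hx
  exact integral_pi_update ℳ j hx

lemma integral_modeFun_mul_velDeriv [Fact (0 < β)] (κ : Fin n → ℤᵈ) (j : Fin n) {w : Vel d}
    {h h' : Vel d → ℂ} (hw : HasTwistedDeriv β w h h') {r : (Fin n → Vel d) → ℂ}
    (hr : ∀ v s, r (update v j s) = r v)
    (hB : MemLp (fun v => r v * h (v j)) 2 (𝔙 n))
    (hB' : MemLp (fun v => r v * h' (v j)) 2 (𝔙 n))
    {φ : (Fin n → Phase d) → ℂ} (hφ : IsPhaseTest φ) :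
    ∫ z, modeFun κ (fun v => r v * h (v j)) z * velDeriv j w φ z ∂𝔓 n
      = -∫ z, modeFun κ (fun v => r v * h' (v j)) z * φ z ∂𝔓 n := by
  rw [integral_phase_update_vel j (integrable_modeFun_mul κ hB (isBddTest_velDeriv hφ j w)),
    integral_phase_update_vel j (integrable_modeFun_mul κ hB' hφ.isBddTest), ← integral_neg]
  refine integral_congr_fun fun x => ?_
  rw [← integral_neg]
  refine integral_congr_fun fun v => ?_
  have hx : ∀ s, posOf (fun l => (x l, update v j s l)) = x := fun s => rfl
  have hv : ∀ s, velOf (fun l => (x l, update v j s l)) = update v j s :=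
    fun s => rfl
  simp only [modeFun, hx, hv, hr, update_self, ← hφ.fderiv_slice, mul_assoc]
  rw [integral_const_mul, integral_const_mul, integral_const_mul, integral_const_mul,
    hw _ (hφ.isVelTest_slice x v j)]
  ring

/-! ### Velocity moments of functions in `H¹` -/

variable [hβ : Fact (0 < β)]

lemma lintegral_maxwell {f : Vel d → ENNReal} (hf : AEMeasurable f volume) :
    ∫⁻ v, f v ∂ℳ = ∫⁻ v, ENNReal.ofReal (maxwellDensity β v) * f v := by
  rw [maxwell, lintegral_withDensity_eq_lintegral_mul₀
    (continuous_maxwellDensity β).measurable.ennreal_ofReal.aemeasurable hf]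
  rfl

lemma maxwellDensity_add_le {R ε : ℝ} (hε : β * (R * ε) ≤ 1 / 2) {v t : Vel d}
    (hv : ‖v‖ ≤ R) (ht : ‖t‖ ≤ ε) : maxwellDensity β (v + t) ≤ 2 * maxwellDensity β v := by
  have hb := hβ.out
  have h1 : ‖v‖ ^ 2 - 2 * (R * ε) ≤ ‖v + t‖ ^ 2 := by
    have h2 := norm_add_sq_real v t
    have h3 := (abs_le.1 (abs_real_inner_le_norm v t)).1
    have h4 := mul_le_mul hv ht (norm_nonneg _) ((norm_nonneg _).trans hv)
    nlinarith
  have h5 : rexp (-(β / 2) * ‖v + t‖ ^ 2) ≤ 2 * rexp (-(β / 2) * ‖v‖ ^ 2) := by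
    have h6 : rexp (1 / 2) ≤ 2 := by
      have := Real.exp_one_lt_d9
      have h7 : rexp (1 / 2) * rexp (1 / 2) = rexp 1 := by rw [← Real.exp_add]; norm_num
      nlinarith
    calc _ ≤ rexp (1 / 2 + -(β / 2) * ‖v‖ ^ 2) := by
          refine Real.exp_le_exp.2 ?_
          nlinarith
      _ ≤ _ := by
          rw [Real.exp_add]
          gcongr
  unfold maxwellDensity
  calc _ ≤ (β / (2 * π)) ^ ((d : ℝ) / 2) * (2 * rexp (-(β / 2) * ‖v‖ ^ 2)) := by gcongr
    _ = _ := by ring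

lemma eLpNorm_translate_le {R ε : ℝ} (hε : β * (R * ε) ≤ 1 / 2) {f : Vel d → ℂ}
    (hf : AEStronglyMeasurable f volume) (hR : ∀ v, R < ‖v‖ → f v = 0) {t : Vel d} (ht : ‖t‖ ≤ ε) :
    eLpNorm (fun v => f (v - t)) 2 ℳ ≤ 2 * eLpNorm f 2 ℳ := by
  have hft : AEStronglyMeasurable (fun v => f (v - t)) volume :=
    hf.comp_measurePreserving (measurePreserving_sub_right volume t)
  refine (ENNReal.pow_le_pow_left_iff two_ne_zero).1 ?_
  rw [mul_pow, eLpNorm_two_sq, eLpNorm_two_sq, lintegral_maxwell (hft.enorm.pow_const 2),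
    lintegral_maxwell (hf.enorm.pow_const 2), ← lintegral_add_right_eq_self _ t,
    ← lintegral_const_mul' _ _ (by norm_num)]
  refine lintegral_mono fun v => ?_
  simp only [add_sub_cancel_right]
  by_cases h : R < ‖v‖
  · simp [hR v h]
  · push Not at h
    rw [← mul_assoc]
    gcongr
    calc _ ≤ ENNReal.ofReal (2 * maxwellDensity β v) :=
          ENNReal.ofReal_le_ofReal (maxwellDensity_add_le hε h ht)
      _ = 2 * ENNReal.ofReal (maxwellDensity β v) := by simp
      _ ≤ _ := by bound

open ContinuousLinearMap in
/-- The mollification of `f` by a bump function. -/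
def mollify (b : ContDiffBump (0 : Vel d)) (f : Vel d → ℂ) : Vel d → ℂ :=
  convolution (b.normed volume) f (lsmul ℝ ℝ) volume

lemma mollify_apply (b : ContDiffBump (0 : Vel d)) (f : Vel d → ℂ) (x : Vel d) :
    mollify b f x = ∫ t, f t * (b.normed volume (x - t) : ℝ) := by
  rw [mollify, convolution_eq_swap]
  refine integral_congr_fun fun t => ?_
  simp [mul_comm]

lemma isVelTest_mollify (b : ContDiffBump (0 : Vel d)) {f : Vel d → ℂ}
    (hf : LocallyIntegrable f) (hc : HasCompactSupport f) : IsVelTest (mollify b f) :=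
  ⟨HasCompactSupport.contDiff_convolution_left _ b.hasCompactSupport_normed b.contDiff_normed hf,
    HasCompactSupport.convolution _ b.hasCompactSupport_normed hc⟩

lemma velPartial_mollify (b : ContDiffBump (0 : Vel d)) {f Df : Vel d → ℂ} {i : Fin d}
    (hf : LocallyIntegrable f)
    (hw : ∀ φ : Vel d → ℂ, IsVelTest φ → ∫ v, f v * velPartial φ i v = -∫ v, Df v * φ v) :
    velPartial (mollify b f) i = mollify b Df := by
  funext x
  have hs : ContDiff ℝ (⊤ : ℕ∞) (b.normed volume) := b.contDiff_normed
  have h := (b.hasCompactSupport_normed).hasFDerivAt_convolution_right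
    (ContinuousLinearMap.lsmul ℝ ℝ).flip hf (hs.of_le (by simp)) x
  rw [convolution_flip] at h
  rw [velPartial, mollify, h.fderiv, convolution_precompR_apply _ hf
    ((b.hasCompactSupport_normed).fderiv ℝ) (hs.continuous_fderiv (by simp)), convolution_def,
    mollify_apply]
  have h2 := hw _ (⟨ofRealCLM.contDiff.comp (hs.comp (contDiff_const.sub contDiff_id)),
      (b.hasCompactSupport_normed.comp_homeomorph (Homeomorph.subLeft x)).comp_left ofReal_zero⟩ :
      IsVelTest fun t => ((b.normed volume (x - t) : ℝ) : ℂ))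
  have h3 : ∀ t, velPartial (fun t => ((b.normed volume (x - t) : ℝ) : ℂ)) i t
      = -((fderiv ℝ (b.normed volume) (x - t) (EuclideanSpace.single i 1) : ℝ) : ℂ) := by
    intro t
    have h6 : HasFDerivAt (fun t => ((b.normed volume (x - t) : ℝ) : ℂ)) _ t :=
      ofRealCLM.hasFDerivAt.comp t (((hs.differentiable (by simp) (x - t)).hasFDerivAt).comp t
          ((hasFDerivAt_id t).const_sub x))
    simp [velPartial, h6.fderiv]
  simp_rw [h3, mul_neg] at h2
  rw [integral_neg, neg_inj] at h2
  rw [← h2]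
  refine integral_congr_fun fun t => ?_
  simp [mul_comm]

lemma eLpNorm_mollify_le (b : ContDiffBump (0 : Vel d)) {R : ℝ} (hε : β * (R * b.rOut) ≤ 1 / 2)
    {f : Vel d → ℂ} (hf : AEStronglyMeasurable f volume) (hR : ∀ v, R < ‖v‖ → f v = 0)
    {D : ENNReal} (hD0 : D ≠ 0) (hD1 : D ≠ ⊤) (hD : eLpNorm f 2 ℳ ≤ D) :
    eLpNorm (mollify b f) 2 ℳ ≤ 2 * D := by
  set P : Measure (Vel d) := volume.withDensity fun t => ENNReal.ofReal (b.normed volume t) with hP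
  have hm : Measurable fun t => ENNReal.ofReal (b.normed volume t) :=
    b.continuous_normed.measurable.ennreal_ofReal
  have e : mollify b f = fun v => ∫ t, f (v - t) ∂P := by
    funext v
    rw [mollify, convolution_def, hP, integral_withDensity_eq_integral_toReal_smul hm
      (ae_of_all _ fun _ => ENNReal.ofReal_lt_top)]
    refine integral_congr_fun fun t => ?_
    simp only [ENNReal.toReal_ofReal (b.nonneg_normed t)]
    rfl
  have hae : ∀ᵐ t ∂P, ‖t‖ ≤ b.rOut := by
    rw [hP, ae_withDensity_iff hm]
    refine ae_of_all _ fun t ht => ?_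
    have h1 : t ∈ support (b.normed volume) := fun h => ht (by rw [h]; simp)
    rw [b.support_normed_eq, mem_ball_zero_iff] at h1
    exact h1.le
  rw [e]
  refine (eLpNorm_integral_le ((hf.comp_quasiMeasurePreserving (quasiMeasurePreserving_sub volume
      volume)).mono_ac ((withDensity_absolutelyContinuous _ _).prod
      (withDensity_absolutelyContinuous _ _)) : AEStronglyMeasurable (uncurry fun v t : Vel d => f
      (v - t)) ((ℳ).prod P)) measurable_const
    (fun _ => mul_ne_zero two_ne_zero hD0) (fun _ => ENNReal.mul_ne_top (by norm_num) hD1)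
        ?_).trans ?_
  · filter_upwards [hae] with t ht
    exact (eLpNorm_translate_le hε hf hR ht).trans (by gcongr)
  · rw [lintegral_const, (by rw [hP, withDensity_apply _ MeasurableSet.univ, Measure.restrict_univ,
        ← ofReal_integral_eq_lintegral_ofReal b.integrable_normed (ae_of_all _ b.nonneg_normed),
        b.integral_normed, ENNReal.ofReal_one] : P univ = 1), mul_one]

lemma eLpNorm_two_le_ofReal {X : Type*} [MeasurableSpace X] {μ : Measure X} {f : X → ℂ} {A : ℝ}
    (hA : 0 ≤ A) (hf : Integrable (fun x => ‖f x‖ ^ 2) μ) :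
    eLpNorm f 2 μ ≤ ENNReal.ofReal A ↔ ∫ x, ‖f x‖ ^ 2 ∂μ ≤ A ^ 2 := by
  rw [← ENNReal.pow_le_pow_left_iff two_ne_zero, eLpNorm_two_sq, ← ENNReal.ofReal_pow hA]
  simp_rw [(fun p => by simp : ∀ p, ‖f p‖ₑ ^ 2 = ENNReal.ofReal (‖f p‖ ^ 2))]
  rw [← ofReal_integral_eq_lintegral_ofReal hf (ae_of_all _ fun p => by positivity),
    ENNReal.ofReal_le_ofReal_iff (by positivity)]

lemma integrable_maxwell_of_compactSupport {θ : Vel d → ℂ} (hθ : Continuous θ)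
    (hc : HasCompactSupport θ) : Integrable θ ℳ := by
  obtain ⟨C, hC⟩ := hc.exists_bound_of_continuous hθ
  exact Integrable.of_bound hθ.aestronglyMeasurable C (ae_of_all _ hC)

/-- The velocity moment inequality for test functions. -/
lemma integral_sq_mul_sq_le {u : Vel d → ℂ} (hu : IsVelTest u) (i : Fin d) :
    ∫ v, ‖((v i : ℝ) : ℂ) * u v‖ ^ 2 ∂ℳ ≤ 2 / β * ∫ v, ‖u v‖ ^ 2 ∂ℳ
        + (2 / β) ^ 2 * ∫ v, ‖velPartial u i v‖ ^ 2 ∂ℳ := by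
  have hb := hβ.out
  have huc := hu.1.continuous
  have hd : Continuous (velPartial u i) :=
    (hu.1.continuous_fderiv (by simp)).clm_apply continuous_const
  have h1 : HasTwistedDeriv β (EuclideanSpace.single i (1 : ℝ)) (fun _ => (1 : ℂ))
      fun v => 0 - β * (inner ℝ (EuclideanSpace.single i (1 : ℝ)) v : ℝ) * 1 := by
    refine hasTwistedDeriv_of_weak (memLp_const 1) MemLp.zero fun ψ hψ => ?_
    have hM := hψ.maxwellDensity_mul β
    have := integral_mul_fderiv_eq_neg_fderiv_mul_of_integrable (μ := volume)
      (f := fun _ => (1 : ℂ))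
      (by simp)
      (by simpa using ((hM.1.continuous_fderiv (by simp)).clm_apply continuous_const : Continuous
          fun v => fderiv ℝ (fun v => (maxwellDensity β v : ℂ) * ψ v) v (EuclideanSpace.single i (1
          : ℝ))).integrable_of_hasCompactSupport (hM.2.fderiv_apply (𝕜 := ℝ) _))
      (by simpa using hM.1.continuous.integrable_of_hasCompactSupport hM.2)
      (fun v _ => by fun_prop) (fun v _ => hM.1.differentiable (by simp) v)
    simpa using this
  have key := h1 _ (⟨(ContDiff.mul (ofRealCLM.contDiff.comp (EuclideanSpace.proj i : Vel d →L[ℝ]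
      ℝ).contDiff) (hu.1.mul (conjCLE.contDiff.comp hu.1)) : ContDiff ℝ (⊤ : ℕ∞) fun v => ((v i :
      ℝ) : ℂ) * (u v * conj (u v))), (hu.2.mul_right).mul_left⟩)
  have hder : ∀ v, fderiv ℝ (fun v => ((v i : ℝ) : ℂ) * (u v * conj (u v))) v
      (EuclideanSpace.single i 1) = u v * conj (u v) + (v i : ℝ) *
        (u v * conj (velPartial u i v) + velPartial u i v * conj (u v)) := by
    intro v
    have a0 := (hu.1.differentiable (by simp) v).hasFDerivAt
    have a3 : HasFDerivAt (fun v => ((v i : ℝ) : ℂ) * (u v * conj (u v))) _ v :=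
      (ofRealCLM.hasFDerivAt.comp v (EuclideanSpace.proj i : Vel d →L[ℝ] ℝ).hasFDerivAt).mul
          (a0.mul (conjCLE.hasFDerivAt.comp v a0))
    rw [a3.fderiv]
    simp [velPartial]
    ring
  simp only [hder, one_mul, mul_one, zero_sub, neg_mul, integral_neg, neg_neg,
    EuclideanSpace.inner_single_left, map_one] at key
  have i1 : Integrable (fun v => ‖u v‖ ^ 2) ℳ :=
    (memLp_two_iff_integrable_sq_norm huc.aestronglyMeasurable).1
      (MemLp.of_bound huc.aestronglyMeasurable _ (ae_of_all _
        (hu.2.exists_bound_of_continuous huc).choose_spec))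
  have hdc : HasCompactSupport (velPartial u i) := hu.2.fderiv_apply (𝕜 := ℝ) _
  have i2 : Integrable (fun v => ‖velPartial u i v‖ ^ 2) ℳ :=
    (memLp_two_iff_integrable_sq_norm hd.aestronglyMeasurable).1
      (MemLp.of_bound hd.aestronglyMeasurable _ (ae_of_all _
        (hdc.exists_bound_of_continuous hd).choose_spec))
  have hvc : Continuous fun v => ((v i : ℝ) : ℂ) * u v := by fun_prop
  have i3 : Integrable (fun v => ‖((v i : ℝ) : ℂ) * u v‖ ^ 2) ℳ :=
    (memLp_two_iff_integrable_sq_norm hvc.aestronglyMeasurable).1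
      (MemLp.of_bound hvc.aestronglyMeasurable _ (ae_of_all _
        ((hu.2.mul_left).exists_bound_of_continuous hvc).choose_spec))
  have i4 : Integrable (fun v => u v * conj (u v) + (v i : ℝ) *
        (u v * conj (velPartial u i v) + velPartial u i v * conj (u v)))
      ℳ := integrable_maxwell_of_compactSupport (by fun_prop) (hu.2.mul_right.add
        ((hu.2.mul_right.add hdc.mul_right).mul_left))
  have k1 : (∫ v : Vel d, (β : ℂ) * ((v i : ℝ) : ℂ) * (((v i : ℝ) : ℂ) * (u v * conj (u v)))
      ∂ℳ) = ((β * ∫ v : Vel d, ‖((v i : ℝ) : ℂ) * u v‖ ^ 2 ∂ℳ : ℝ) : ℂ) := by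
    rw [ofReal_mul, ← integral_complex_ofReal, ← integral_const_mul]
    refine integral_congr_fun fun v => ?_
    rw [mul_conj, norm_mul, mul_pow, norm_real, Real.norm_eq_abs, sq_abs, normSq_eq_norm_sq]
    push_cast
    ring
  have k2 := congrArg re (key.trans k1)
  rw [ofReal_re, ← reCLM_apply, ← ContinuousLinearMap.integral_comp_comm _ i4] at k2
  have k3 : ∫ v : Vel d, reCLM (u v * conj (u v) + (v i : ℝ) *
        (u v * conj (velPartial u i v) + velPartial u i v * conj (u v)))
      ∂ℳ ≤ ∫ v, (‖u v‖ ^ 2 + (β / 2 * ‖((v i : ℝ) : ℂ) * u v‖ ^ 2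
        + 2 / β * ‖velPartial u i v‖ ^ 2)) ∂ℳ := by
    refine integral_mono (reCLM.integrable_comp i4)
      (i1.add ((i3.const_mul (β / 2)).add (i2.const_mul (2 / β)))) fun v => ?_
    simp only [reCLM_apply, add_re, re_ofReal_mul]
    rw [(by rw [mul_conj, ofReal_re, normSq_eq_norm_sq] : (u v * conj (u v)).re = ‖u v‖ ^ 2), (by
        simp only [mul_re, conj_re, conj_im]; ring : (u v * conj (velPartial u i v)).re +
        (velPartial u i v * conj (u v)).re = 2 * (velPartial u i v * conj (u v)).re), norm_mul,
        norm_real, Real.norm_eq_abs]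
    have b3 : |(velPartial u i v * conj (u v)).re| ≤ ‖velPartial u i v‖ * ‖u v‖ := by
      refine (abs_re_le_norm _).trans ?_
      rw [norm_mul, RCLike.norm_conj]
    have b4 : v i * (2 * (velPartial u i v * conj (u v)).re)
        ≤ 2 * (|v i| * ‖u v‖) * ‖velPartial u i v‖ := by
      calc _ ≤ |v i * (2 * (velPartial u i v * conj (u v)).re)| := le_abs_self _
        _ = |v i| * (2 * |(velPartial u i v * conj (u v)).re|) := by rw [abs_mul, abs_mul, abs_two]
        _ ≤ |v i| * (2 * (‖velPartial u i v‖ * ‖u v‖)) := by gcongr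
        _ = _ := by ring
    have b5 : 2 * (|v i| * ‖u v‖) * ‖velPartial u i v‖ ≤ β / 2 * (|v i| * ‖u v‖) ^ 2
        + 2 / β * ‖velPartial u i v‖ ^ 2 := by
      have : β / 2 * (|v i| * ‖u v‖) ^ 2 + 2 / β * ‖velPartial u i v‖ ^ 2
          - 2 * (|v i| * ‖u v‖) * ‖velPartial u i v‖
          = 2 / β * (β / 2 * (|v i| * ‖u v‖) - ‖velPartial u i v‖) ^ 2 := by
        field_simp
        ring
      have h0 : 0 ≤ 2 / β * (β / 2 * (|v i| * ‖u v‖) - ‖velPartial u i v‖) ^ 2 := by positivity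
      linarith
    linarith
  have i5 : Integrable (fun v => β / 2 * ‖((v i : ℝ) : ℂ) * u v‖ ^ 2
      + 2 / β * ‖velPartial u i v‖ ^ 2) ℳ := (i3.const_mul _).add (i2.const_mul _)
  rw [k2, integral_add i1 i5, integral_add (i3.const_mul (β / 2)) (i2.const_mul (2 / β)),
      integral_const_mul,
    integral_const_mul] at k3
  set X := ∫ v : Vel d, ‖((v i : ℝ) : ℂ) * u v‖ ^ 2 ∂ℳ
  set Y := ∫ v, ‖u v‖ ^ 2 ∂ℳ
  set Z := ∫ v, ‖velPartial u i v‖ ^ 2 ∂ℳ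
  have k4 : β / 2 * X ≤ Y + 2 / β * Z := by linarith
  calc X = 2 / β * (β / 2 * X) := by field_simp
    _ ≤ 2 / β * (Y + 2 / β * Z) := by gcongr
    _ = _ := by ring

/-- The velocity moment inequality for functions with compact support. -/
lemma eLpNorm_vel_mul_le {f Df : Vel d → ℂ} {i : Fin d} {R A : ℝ} (hA : 0 < A)
    (hf : Integrable f) (hDf : Integrable Df)
    (hR : ∀ v, R < ‖v‖ → f v = 0) (hR' : ∀ v, R < ‖v‖ → Df v = 0)
    (hfA : eLpNorm f 2 ℳ ≤ ENNReal.ofReal A)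
    (hDA : eLpNorm Df 2 ℳ ≤ ENNReal.ofReal A)
    (hw : ∀ φ : Vel d → ℂ, IsVelTest φ → ∫ v, f v * velPartial φ i v = -∫ v, Df v * φ v) :
    eLpNorm (fun v => ((v i : ℝ) : ℂ) * f v) 2 ℳ
      ≤ ENNReal.ofReal ((2 / β + 1) * (2 * A)) := by
  have hb := hβ.out
  set s : ℝ := 1 / (2 * β * (|R| + 1)) with hs
  set b : ℕ → ContDiffBump (0 : Vel d) := fun k =>
    ⟨s / (k + 1) / 2, s / (k + 1), by positivity, half_lt_self (by positivity)⟩ with hbdef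
  have hsb : ∀ k, β * (R * (b k).rOut) ≤ 1 / 2 := by
    intro k
    have h2 : R * (b k).rOut ≤ (|R| + 1) * s :=
      mul_le_mul (by grind) (div_le_self (by positivity : 0 < s).le (by linarith)) (b
          k).rOut_pos.le (by positivity)
    calc _ ≤ β * ((|R| + 1) * s) := by gcongr
      _ = 1 / 2 := by rw [hs]; field_simp
  have hlim : ∀ᵐ v, Tendsto (fun k => mollify (b k) f v) atTop (𝓝 (f v)) := by
    refine ContDiffBump.ae_convolution_tendsto_right_of_locallyIntegrable (K := 2) ?_ ?_
      hf.locallyIntegrable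
    · have := tendsto_one_div_add_atTop_nhds_zero_nat (𝕜 := ℝ)
      have h2 := this.const_mul s
      rw [mul_zero] at h2
      refine h2.congr fun k => ?_
      ring
    · refine Eventually.of_forall fun k => ?_
      simp only [hbdef]
      linarith
  have hA0 : ENNReal.ofReal A ≠ 0 := by simpa using hA
  have htest := fun k => isVelTest_mollify (b k) hf.locallyIntegrable (HasCompactSupport.intro
      (isCompact_closedBall (0 : Vel d) R) fun v hv => hR v (by simpa using hv))
  have e2 : 2 * ENNReal.ofReal A = ENNReal.ofReal (2 * A) := by
    rw [ENNReal.ofReal_mul (by norm_num)]; norm_num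
  refine Lp.eLpNorm_le_of_ae_tendsto (u := atTop) (f := fun k v => ((v i : ℝ) : ℂ) * mollify (b k)
      f v)
    (Eventually.of_forall fun k => ?_) (fun k => ?_) ?_
  · have huc := (htest k).1.continuous
    have hdc : Continuous (velPartial (mollify (b k) f) i) :=
      ((htest k).1.continuous_fderiv (by simp)).clm_apply continuous_const
    have hint : ∀ {θ : Vel d → ℂ}, Continuous θ → HasCompactSupport θ →
        Integrable (fun v => ‖θ v‖ ^ 2) ℳ := fun hθ hc =>
      (memLp_two_iff_integrable_sq_norm hθ.aestronglyMeasurable).1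
        (MemLp.of_bound hθ.aestronglyMeasurable _ (ae_of_all _
          (hc.exists_bound_of_continuous hθ).choose_spec))
    have m1 := (fun k => eLpNorm_mollify_le (b k) (hsb k) hf.1 hR hA0 ENNReal.ofReal_ne_top hfA) k
    have m2 := (fun k => eLpNorm_mollify_le (b k) (hsb k) hDf.1 hR' hA0 ENNReal.ofReal_ne_top hDA) k
    rw [← velPartial_mollify (b k) hf.locallyIntegrable hw, e2,
      eLpNorm_two_le_ofReal (by positivity) (hint hdc ((htest k).2.fderiv_apply (𝕜 := ℝ) _))] at m2
    rw [e2, eLpNorm_two_le_ofReal (by positivity) (hint huc (htest k).2)] at m1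
    rw [eLpNorm_two_le_ofReal (by positivity) (hint (by fun_prop : Continuous fun v => ((v i : ℝ) :
        ℂ) * mollify (b k) f v) (htest k).2.mul_left)]
    refine (integral_sq_mul_sq_le (htest k) i).trans ?_
    calc _ ≤ 2 / β * (2 * A) ^ 2 + (2 / β) ^ 2 * (2 * A) ^ 2 := by gcongr
      _ ≤ _ := by
        have : 0 ≤ (2 / β + 1) * (2 * A) ^ 2 := by positivity
        nlinarith
  · have huc := (htest k).1.continuous
    fun_prop
  · filter_upwards [(withDensity_absolutelyContinuous _ _ : ℳ ≪ volume).ae_le hlim] with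
        v hv
    exact hv.const_mul _

lemma integrable_mul_of_compactSupport {f θ : Vel d → ℂ} (hf : Integrable f ℳ)
    (hθ : Continuous θ) (hc : HasCompactSupport θ) : Integrable (fun v => f v * θ v) := by
  have hpos := fun v : Vel d => maxwellDensity_pos hβ.out v
  have hcont : Continuous fun v => θ v * ((maxwellDensity β v)⁻¹ : ℝ) :=
    hθ.mul (continuous_ofReal.comp ((continuous_maxwellDensity β).inv₀ fun v => (hpos v).ne'))
  obtain ⟨C, hC⟩ := (hc.mul_right (f' := fun v => (((maxwellDensity β v)⁻¹ : ℝ) :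
      ℂ))).exists_bound_of_continuous
    hcont
  have h1 := hf.mul_bdd hcont.aestronglyMeasurable (ae_of_all _ hC)
  rw [maxwell, integrable_withDensity_iff_integrable_smul'
    (continuous_maxwellDensity β).measurable.ennreal_ofReal
    (ae_of_all _ fun _ => ENNReal.ofReal_lt_top)] at h1
  refine h1.congr (ae_of_all _ fun v => ?_)
  have : (maxwellDensity β v : ℂ) ≠ 0 := by exact_mod_cast (hpos v).ne'
  simp only [ENNReal.toReal_ofReal (hpos v).le, real_smul]
  push_cast
  field_simp

/-- Functions in `H¹` have square-integrable first velocity moments. -/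
lemma IsH1.memLp_vel_mul (hg : IsH1 β g Dg)
    (i : Fin d) : MemLp (fun v => ((v i : ℝ) : ℂ) * g v) 2 ℳ := by
  have hDi := hg.memLp_grad_apply i
  have hgi := hg.memLp.integrable (by norm_num)
  have hDii := hDi.integrable (by norm_num)
  set b : ContDiffBump (0 : Vel d) := ⟨1, 2, one_pos, one_lt_two⟩ with hb
  set χ : ℕ → Vel d → ℝ := fun n v => b (((n : ℝ) + 1)⁻¹ • v) with hχ
  set χ' : ℕ → Vel d → ℝ := fun n v =>
    ((n : ℝ) + 1)⁻¹ * fderiv ℝ b (((n : ℝ) + 1)⁻¹ • v) (EuclideanSpace.single i 1) with hχ'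
  have hbs : ContDiff ℝ (⊤ : ℕ∞) b := b.contDiff
  have hχs : ∀ n, ContDiff ℝ (⊤ : ℕ∞) (χ n) := fun n => hbs.comp (by fun_prop)
  have hbd : Continuous fun v => fderiv ℝ b v (EuclideanSpace.single i 1) :=
    (hbs.continuous_fderiv (by simp)).clm_apply continuous_const
  obtain ⟨C, hC⟩ := (b.hasCompactSupport.fderiv_apply (𝕜 := ℝ)
    (EuclideanSpace.single i 1)).exists_bound_of_continuous hbd
  have hC0 := (norm_nonneg _).trans (hC 0)
  have hχ1 : ∀ n v, ‖(χ n v : ℂ)‖ ≤ 1 := fun n v => by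
    rw [norm_real, Real.norm_of_nonneg b.nonneg]; exact b.le_one
  have hχ'1 : ∀ n v, ‖(χ' n v : ℂ)‖ ≤ C := fun n v => by
    rw [norm_real, hχ', norm_mul, Real.norm_of_nonneg (by positivity)]
    exact (mul_le_of_le_one_left (norm_nonneg _) ((fun n => inv_le_one_of_one_le₀ (by linarith))
        n)).trans (hC _)
  have hχR : ∀ (n : ℕ) (v : Vel d), 2 * ((n : ℝ) + 1) < ‖v‖ → χ n v = 0 ∧ χ' n v = 0 := by
    intro n v hv
    have h1 : (2 : ℝ) < ‖((n : ℝ) + 1)⁻¹ • v‖ := by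
      rw [norm_smul, Real.norm_of_nonneg (by positivity), inv_mul_eq_div,
        lt_div_iff₀ (by positivity)]
      exact hv
    have h2 : ((n : ℝ) + 1)⁻¹ • v ∉ tsupport b := by
      rw [b.tsupport_eq, mem_closedBall_zero_iff]
      simpa using h1
    refine ⟨image_eq_zero_of_notMem_tsupport (f := b) h2, ?_⟩
    have h3 : fderiv ℝ b (((n : ℝ) + 1)⁻¹ • v) = 0 := by
      by_contra h
      exact h2 (support_fderiv_subset ℝ h)
    simp [hχ', h3]
  have hcs : ∀ n, HasCompactSupport (fun v => (χ n v : ℂ)) ∧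
      HasCompactSupport (fun v => (χ' n v : ℂ)) := fun n =>
    ⟨HasCompactSupport.intro (isCompact_closedBall (0 : Vel d) (2 * ((n : ℝ) + 1)))
      fun v hv => ofReal_eq_zero.2 (hχR n v (by simpa using hv)).1,
    HasCompactSupport.intro (isCompact_closedBall (0 : Vel d) (2 * ((n : ℝ) + 1)))
      fun v hv => ofReal_eq_zero.2 (hχR n v (by simpa using hv)).2⟩
  have hcχ : ∀ n, Continuous fun v => (χ n v : ℂ) := fun n =>
    continuous_ofReal.comp (hχs n).continuous
  have hcχ' : ∀ n, Continuous fun v => (χ' n v : ℂ) := fun n => continuous_ofReal.comp ((fun n =>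
      continuous_const.mul (hbd.comp (by fun_prop))) n)
  set A : ℝ := (eLpNorm g 2 ℳ).toReal + (eLpNorm (fun v => Dg v i) 2 (maxwell d
      β)).toReal
    + C * (eLpNorm g 2 ℳ).toReal + 1 with hA
  have hN1 := ENNReal.ofReal_toReal hg.memLp.2.ne
  have hbound : ∀ n, eLpNorm (fun v => ((v i : ℝ) : ℂ) * (g v * χ n v)) 2 ℳ
      ≤ ENNReal.ofReal ((2 / β + 1) * (2 * A)) := by
    intro n
    refine eLpNorm_vel_mul_le (Df := fun v => Dg v i * χ n v + g v * χ' n v)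
      (by positivity) (integrable_mul_of_compactSupport hgi (hcχ n) (hcs n).1)
      ((integrable_mul_of_compactSupport hDii (hcχ n) (hcs n).1).add
        (integrable_mul_of_compactSupport hgi (hcχ' n) (hcs n).2))
      (fun v hv => by rw [(hχR n v hv).1]; simp)
      (fun v hv => by rw [(hχR n v hv).1, (hχR n v hv).2]; simp) ?_ ?_ ?_
    · refine (eLpNorm_mono (g := g) fun v => ?_).trans ?_
      · rw [norm_mul]; exact mul_le_of_le_one_right (norm_nonneg _) (hχ1 n v)
      · rw [← hN1]
        refine ENNReal.ofReal_le_ofReal ?_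
        rw [hA]
        have := mul_nonneg hC0 (ENNReal.toReal_nonneg (a := eLpNorm g 2 ℳ))
        linarith [ENNReal.toReal_nonneg (a := eLpNorm (fun v => Dg v i) 2 ℳ)]
    · refine (eLpNorm_add_le (hDi.1.mul (hcχ n).aestronglyMeasurable)
        (hg.memLp.1.mul (hcχ' n).aestronglyMeasurable) (by norm_num)).trans ?_
      have a1 : eLpNorm (fun v => Dg v i * χ n v) 2 ℳ
          ≤ ENNReal.ofReal (eLpNorm (fun v => Dg v i) 2 ℳ).toReal := by
        rw [ENNReal.ofReal_toReal hDi.2.ne]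
        refine eLpNorm_mono fun v => ?_
        rw [norm_mul]; exact mul_le_of_le_one_right (norm_nonneg _) (hχ1 n v)
      have a2 : eLpNorm (fun v => g v * χ' n v) 2 ℳ
          ≤ ENNReal.ofReal (C * (eLpNorm g 2 ℳ).toReal) := by
        rw [ENNReal.ofReal_mul hC0, hN1]
        refine eLpNorm_le_mul_eLpNorm_of_ae_le_mul (ae_of_all _ fun v => ?_) 2
        rw [norm_mul, mul_comm]
        gcongr
        exact hχ'1 n v
      refine (add_le_add a1 a2).trans ?_
      rw [← ENNReal.ofReal_add ENNReal.toReal_nonneg (by positivity)]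
      refine ENNReal.ofReal_le_ofReal ?_
      rw [hA]
      linarith [ENNReal.toReal_nonneg (a := eLpNorm g 2 ℳ)]
    · intro φ hφ
      have hφc := hφ.1.continuous
      have hp : ∀ v, velPartial (fun v => (χ n v : ℂ) * φ v) i v
          = χ n v * velPartial φ i v + χ' n v * φ v := by
        intro v
        have c1 : HasFDerivAt (χ n) (((n : ℝ) + 1)⁻¹ • fderiv ℝ b (((n : ℝ) + 1)⁻¹ • v)) v := by
          have := (hbs.differentiable (by simp) (((n : ℝ) + 1)⁻¹ • v)).hasFDerivAt.comp v
            ((hasFDerivAt_id v).const_smul ((n : ℝ) + 1)⁻¹)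
          refine this.congr_fderiv ?_
          ext w
          simp
        have c3 : HasFDerivAt (fun v => (χ n v : ℂ) * φ v) _ v :=
          (ofRealCLM.hasFDerivAt.comp v c1).mul (hφ.1.differentiable (by simp) v).hasFDerivAt
        rw [velPartial, c3.fderiv]
        simp [velPartial, hχ']
        ring
      have hk := hg.weak_grad _ (⟨(ofRealCLM.contDiff.comp (hχs n)).mul hφ.1, hφ.2.mul_left⟩ :
          IsVelTest fun v => (χ n v : ℂ) * φ v) i
      simp_rw [hp] at hk
      have j2 := integrable_mul_of_compactSupport hgi (θ := fun v => (χ' n v : ℂ) * φ v)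
        ((hcχ' n).mul hφc) hφ.2.mul_left
      simp_rw [mul_add] at hk
      rw [integral_add (integrable_mul_of_compactSupport hgi (θ := fun v => (χ n v : ℂ) *
          velPartial φ i v) ((hcχ n).mul ((hφ.1.continuous_fderiv (by simp)).clm_apply
              continuous_const)) ((hcs n).1).mul_right) j2] at hk
      simp_rw [add_mul, mul_assoc]
      rw [integral_add (integrable_mul_of_compactSupport hDii (θ := fun v => (χ n v : ℂ) * φ v)
          ((hcχ n).mul hφc) hφ.2.mul_left) j2]
      linear_combination hk
  refine ⟨(by fun_prop : Continuous fun v : Vel d => ((v i : ℝ) : ℂ)).aestronglyMeasurable.mul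
      hg.memLp.1, (Lp.eLpNorm_le_of_ae_tendsto (u := atTop)
    (Eventually.of_forall hbound) (fun n => ?_)
    (ae_of_all _ fun v => ?_)).trans_lt ENNReal.ofReal_lt_top⟩
  · exact (by fun_prop : Continuous fun v : Vel d => ((v i : ℝ) : ℂ)).aestronglyMeasurable.mul
      (hg.memLp.1.mul (hcχ n).aestronglyMeasurable)
  · refine tendsto_const_nhds.congr' ?_
    filter_upwards [eventually_ge_atTop ⌈‖v‖⌉₊] with n hn
    have h2 : χ n v = 1 := by
      refine b.one_of_mem_closedBall ?_
      rw [mem_closedBall_zero_iff, norm_smul, Real.norm_of_nonneg (by positivity), inv_mul_eq_div]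
      exact div_le_one_of_le₀ ((Nat.le_ceil _).trans ((Nat.cast_le.2 hn).trans (by linarith))) (by
          positivity)
    simp [h2]

lemma IsH1.memLp_twistedGrad_apply (hg : IsH1 β g Dg) (i : Fin d) : MemLp (fun v => twistedGrad β g Dg v i) 2 ℳ := by
  refine ((hg.memLp_grad_apply i).sub ((hg.memLp_vel_mul i).const_mul (β : ℂ))).ae_eq
    (ae_of_all _ fun v => ?_)
  simp [twistedGrad, mul_assoc]

/-! ### Series of Fourier modes -/

lemma hasSum_mFourier_comp {X : Type*} [MeasurableSpace X] {μ : Measure X} {f : Torus d → ℂ}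
    (hf : MemLp f 2 𝔗) {T : X → Torus d} (hT : MeasurePreserving T μ 𝔗)
    {W : X → ℂ} (hW : MemLp W 2 μ) :
    HasSum (fun n => (∫ x, mFourier (-n) x * f x ∂𝔗) * ∫ z, mFourier n (T z) * W z ∂μ)
      (∫ z, f (T z) * W z ∂μ) := by
  have h := (Lp.compMeasurePreservingₗᵢ ℂ T hT).toContinuousLinearMap.hasSum
    (hasSum_mFourier_series_L2 (hf.toLp f))
  have hco : ∀ n, mFourierCoeff (hf.toLp f) n = ∫ x, mFourier (-n) x * f x ∂𝔗 :=
    fun n => integral_congr_ae (by filter_upwards [hf.coeFn_toLp] with x hx; rw [hx, smul_eq_mul])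
  have e : ∫ z, f (T z) * W z ∂μ = ∫ z, (Lp.compMeasurePreservingₗᵢ ℂ T hT).toContinuousLinearMap
      (hf.toLp f) z * W z ∂μ := by
    refine integral_congr_ae ?_
    have h1 := Lp.coeFn_compMeasurePreserving (hf.toLp f) hT
    filter_upwards [h1, hT.quasiMeasurePreserving.ae hf.coeFn_toLp] with x h1 h2
    refine Eq.trans ?_ (congrArg (· * W x) h1.symm)
    rw [comp_apply, h2]
  rw [e]
  refine (hasSum_integral_mul_of_Lp h hW).congr_fun fun n => ?_
  refine (integral_const_mul _ _).symm.trans (integral_congr_ae ?_)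
  have h1 := Lp.coeFn_compMeasurePreserving (mFourierCoeff (hf.toLp f) n •
    mFourierLp 2 n : Lp ℂ 2 𝔗) hT
  have h2 := hT.quasiMeasurePreserving.ae (Lp.coeFn_smul (mFourierCoeff (hf.toLp f) n)
    (mFourierLp 2 n : Lp ℂ 2 𝔗))
  have h3 := hT.quasiMeasurePreserving.ae (coeFn_mFourierLp 2 n)
  filter_upwards [h1, h2, h3] with x h1 h2 h3
  refine Eq.trans ?_ (congrArg (· * W x) h1.symm)
  rw [comp_apply, h2, Pi.smul_apply, h3, hco, smul_eq_mul, mul_assoc]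

/-- Absolutely convergent series in `L²`. -/
lemma exists_hasSum_of_summable_eLpNorm {X ι : Type*} [MeasurableSpace X] {μ : Measure X}
    {f : ι → X → ℂ} (hf : ∀ i, MemLp (f i) 2 μ) {c : ι → ℝ} (hc0 : ∀ i, 0 ≤ c i)
    (hc : ∀ i, eLpNorm (f i) 2 μ ≤ ENNReal.ofReal (c i)) (hs : Summable c) :
    ∃ F : X → ℂ, MemLp F 2 μ ∧ ∀ W : X → ℂ, MemLp W 2 μ →
      HasSum (fun i => ∫ x, f i x * W x ∂μ) (∫ x, F x * W x ∂μ) := by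
  obtain ⟨F, hF⟩ : Summable fun i => (hf i).toLp (f i) := .of_norm <|
    hs.of_nonneg_of_le (fun i => norm_nonneg _) fun i => by
      rw [Lp.norm_toLp]; exact ENNReal.toReal_le_of_le_ofReal (hc0 i) (hc i)
  refine ⟨F, Lp.memLp F, fun W hW => (hasSum_integral_mul_of_Lp hF hW).congr_fun fun i =>
    integral_congr_ae ?_⟩
  filter_upwards [(hf i).coeFn_toLp] with z hz
  rw [hz]

lemma measurePreserving_pos_sub (d : ℕ) (β : ℝ) [Fact (0 < β)] {j l : Fin n} (hjl : j ≠ l) :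
    MeasurePreserving (fun z : Fin n → Phase d => (z j).1 - (z l).1) (phaseMeasureN d β n)
      (torusMeasure d) := by
  have : SecondCountableTopology (Torus d) :=
    inferInstanceAs (SecondCountableTopology (Fin d → UnitAddCircle))
  have : (torusMeasure d).IsAddHaarMeasure := by unfold torusMeasure; infer_instance
  have := Measure.pi.isAddHaarMeasure fun _ : Fin n => torusMeasure d
  have h := AddMonoidHom.measurePreserving (μ := torusMeasureN d n) (ν := torusMeasure d)
    (f := Pi.evalAddMonoidHom (fun _ => Torus d) j - Pi.evalAddMonoidHom (fun _ => Torus d) l)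
    ((continuous_apply j).sub (continuous_apply l)) (fun y => ⟨Pi.single j y, by
      simp [Pi.single_eq_of_ne hjl.symm]⟩) (by simp)
  exact h.comp (measurePreserving_fst.comp (measurePreserving_split d β n))

/-- A superposition of modes solves the resolvent equation if each mode does. -/
lemma resolvent_of_modes [Fact (0 < β)] {m : ℕ} (hV : IsPotential V DV K)
    {ι : Type*} {κ : ι → Fin (m + 1) → ℤᵈ} {B S : ι → (Fin (m + 1) → Vel d) → ℂ}
    (hB : ∀ i, MemLp (B i) 2 (𝔙 (m + 1)))
    (hS : ∀ i, MemLp (S i) 2 (𝔙 (m + 1)))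
    {G R : (Fin (m + 1) → Phase d) → ℂ} (hG : MemLp G 2 (𝔓 (m + 1)))
    (hGs : ∀ W, MemLp W 2 (𝔓 (m + 1)) →
      HasSum (fun i => ∫ z, modeFun (κ i) (B i) z * W z ∂𝔓 (m + 1))
        (∫ z, G z * W z ∂𝔓 (m + 1)))
    {φ : (Fin (m + 1) → Phase d) → ℂ} (hφ : IsPhaseTest φ)
    (hRs : HasSum (fun i => ∫ z, modeFun (κ i) (S i) z * φ z ∂𝔓 (m + 1))
      (∫ z, R z * φ z ∂𝔓 (m + 1)))
    (heq : ∀ i v, I * modeOp N β V (κ i) (B i) v - I * ω * B i v = S i v) :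
    vlasovPair N m β DV G φ - I * ω * ∫ z, G z * φ z ∂𝔓 (m + 1)
      = ∫ z, R z * φ z ∂𝔓 (m + 1) := by
  have hb := hφ.isBddTest
  obtain ⟨C, hC⟩ := exists_norm_vlasovAdj_le N (m := m) (β := β) hV.le hφ
  have hW := MemLp.of_bound (μ := 𝔓 (m + 1)) (p := 2)
    (measurable_vlasovAdj N (β := β) hV.measurable hφ).aestronglyMeasurable C (ae_of_all _ hC)
  rw [vlasovPair_eq N hV.measurable hV.le hφ (hG.integrable (by norm_num))]
  refine ((hGs _ hW).sub ((hGs _ hb.memLp).mul_left (I * ω))).unique (hRs.congr_fun fun i => ?_)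
  rw [← vlasovPair_eq N hV.measurable hV.le hφ ((memLp_modeFun (κ i) (hB i)).integrable (by norm_num)),
    vlasovPair_modeFun N hV (κ i) (hB i) hφ, ← integral_const_mul, ← integral_sub]
  · refine integral_congr_fun fun z => ?_
    simp only [modeFun, ← heq i]
    ring
  · have h1 := (integrable_modeFun_mul (κ i) (hS i) hb).add
      ((integrable_modeFun_mul (κ i) (hB i) hb).const_mul (I * ω))
    refine h1.congr (ae_of_all _ fun z => ?_)
    simp only [modeFun, Pi.add_apply, ← heq i]
    ring
  · exact (integrable_modeFun_mul (κ i) (hB i) hb).const_mul (I * ω)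

/-- The mean operator applied to a superposition of modes. -/
lemma hasSum_meanPair [Fact (0 < β)] {m : ℕ} (hDm : Measurable DV) (hDb : ∀ x, ‖DV x‖ ≤ K)
    {ι : Type*} {κ : ι → Fin (m + 1 + 1) → ℤᵈ} {B : ι → (Fin (m + 1 + 1) → Vel d) → ℂ}
    (hB : ∀ i, MemLp (B i) 2 (𝔙 (m + 1 + 1)))
    {G : (Fin (m + 1 + 1) → Phase d) → ℂ} (hG : MemLp G 2 (𝔓 (m + 1 + 1)))
    (hGs : ∀ W, MemLp W 2 (𝔓 (m + 1 + 1)) →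
      HasSum (fun i => ∫ z, modeFun (κ i) (B i) z * W z ∂𝔓 (m + 1 + 1))
        (∫ z, G z * W z ∂𝔓 (m + 1 + 1)))
    {φ : (Fin (m + 1) → Phase d) → ℂ} (hφ : IsPhaseTest φ) :
    HasSum (fun i => meanPair N m β DV (modeFun (κ i) (B i)) φ) (meanPair N m β DV G φ) := by
  obtain ⟨C, hC⟩ := exists_norm_meanAdj_le hDb hφ
  have hW := MemLp.of_bound (μ := 𝔓 (m + 1 + 1)) (p := 2)
    (measurable_meanAdj hDm hφ).aestronglyMeasurable C (ae_of_all _ hC)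
  rw [meanPair_eq N hDm hDb hφ (hG.integrable (by norm_num))]
  refine ((hGs _ hW).mul_left _).congr_fun fun i => ?_
  rw [meanPair_eq N hDm hDb hφ ((memLp_modeFun (κ i) (hB i)).integrable (by norm_num))]

/-! ### The source term -/

/-- The wave vectors of the modes of the three-particle correlation. -/
def waveThree (n : ℤᵈ) : Fin 3 → ℤᵈ := ![0, n, -n]

lemma torusChar_waveThree (n : ℤᵈ) (x : Fin 3 → Torus d) :
    torusChar (waveThree n) x = mFourier n (x 1 - x 2) := by
  rw [torusChar, Fin.prod_univ_three, sub_eq_add_neg, mFourier_apply_add, mFourier_apply_neg]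
  simp [waveThree, mFourier_zero]

/-- The modes of the source term. -/
def sourceMode (β : ℝ) (V : Torus d → ℝ) (g : Vel d → ℂ) (n : ℤᵈ) (v : Fin 3 → Vel d) : ℂ :=
  -(β * (I * potHat V n)) * ((⟪n, v 1⟫ : ℂ) - ⟪n, v 2⟫)
    * g (v 0)

lemma hasSum_sourceThree [Fact (0 < β)] (hV : IsPotential V DV K) (hg : MemLp g 2 ℳ)
    {φ : (Fin 3 → Phase d) → ℂ} (hφ : IsPhaseTest φ) :
    HasSum (fun n => ∫ z, modeFun (waveThree n) (sourceMode β V g n) z * φ z ∂𝔓 3)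
      (∫ z, sourceThree β DV g z * φ z ∂𝔓 3) := by
  have hg0 : MemLp (fun z : Fin 3 → Phase d => g (z 0).2) 2 (𝔓 3) :=
    hg.comp_measurePreserving (measurePreserving_snd.comp (measurePreserving_eval_phase d β 3 0))
  have hD : ∀ i, MemLp (fun x => (DV x i : ℂ)) 2 𝔗 := fun i =>
    MemLp.of_bound (continuous_ofReal.comp_aestronglyMeasurable (hV.aestronglyMeasurable_apply i)) K
      (by filter_upwards [hV.abs_apply_le i] with x hx; rwa [norm_real])
  have hΨ : ∀ (j : Fin 3) (i : Fin d), MemLp (fun z : Fin 3 → Phase d =>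
      -(β : ℂ) * g (z 0).2 * (((z j).2 i : ℝ) * φ z)) 2 (𝔓 3) := fun j i => by
    obtain ⟨C, hC⟩ := (hφ.isBddTest.vel_mul j i).bound
    refine (hg0.const_mul (-(β : ℂ))).of_le_mul (c := C)
      ((hg0.const_mul (-(β : ℂ))).1.mul (hφ.isBddTest.vel_mul j i).meas.aestronglyMeasurable)
      (ae_of_all _ fun z => ?_)
    rw [norm_mul _ (_ * φ z), mul_comm]
    exact mul_le_mul_of_nonneg_right (hC z) (norm_nonneg _)
  have key : ∀ {j l : Fin 3}, j ≠ l → HasSum (fun n => ∑ i, I * waveVec n i * potHat V n *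
      ∫ z : Fin 3 → Phase d, mFourier n ((z j).1 - (z l).1) *
        (-(β : ℂ) * g (z 0).2 * (((z j).2 i : ℝ) * φ z)) ∂𝔓 3)
      (∫ z : Fin 3 → Phase d, ((inner ℝ (DV ((z j).1 - (z l).1)) (-(β • (z j).2)) : ℝ) : ℂ)
        * g (z 0).2 * φ z ∂𝔓 3) ∧
      Integrable (fun z : Fin 3 → Phase d => ((inner ℝ (DV ((z j).1 - (z l).1)) (-(β • (z j).2)) : ℝ) : ℂ)
        * g (z 0).2 * φ z) (𝔓 3) := by
    intro j l hjl
    have hT := measurePreserving_pos_sub d β hjl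
    have hi : ∀ i, Integrable (fun z : Fin 3 → Phase d => (DV ((z j).1 - (z l).1) i : ℂ) *
        (-(β : ℂ) * g (z 0).2 * (((z j).2 i : ℝ) * φ z))) (𝔓 3) := fun i =>
      ((hD i).comp_measurePreserving hT).integrable_mul (hΨ j i)
    have e : ∀ z : Fin 3 → Phase d, ((inner ℝ (DV ((z j).1 - (z l).1)) (-(β • (z j).2)) : ℝ) : ℂ)
        * g (z 0).2 * φ z = ∑ i, (DV ((z j).1 - (z l).1) i : ℂ) *
        (-(β : ℂ) * g (z 0).2 * (((z j).2 i : ℝ) * φ z)) := by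
      intro z
      rw [inner_eq_sum_mul]
      push_cast
      rw [sum_mul, sum_mul]
      refine sum_congr rfl fun i _ => ?_
      simp only [PiLp.neg_apply, PiLp.smul_apply, smul_eq_mul, ofReal_neg, ofReal_mul]
      ring
    simp_rw [e]
    refine ⟨?_, integrable_finsetSum _ fun i _ => hi i⟩
    rw [integral_finsetSum _ fun i _ => hi i]
    refine hasSum_sum fun i _ => (hasSum_mFourier_comp (hD i) hT (hΨ j i)).congr_fun fun n => ?_
    rw [integral_mFourier_mul_grad hV.1 hV.even n i]
  obtain ⟨h1, i1⟩ := key (j := 1) (l := 2) (by decide)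
  obtain ⟨h2, i2⟩ := key (j := 2) (l := 1) (by decide)
  have hs := h1.add ((Equiv.neg (ℤᵈ)).hasSum_iff.2 h2)
  rw [← integral_add i1 i2] at hs
  have e3 : ∀ z : Fin 3 → Phase d, sourceThree β DV g z * φ z
      = ((inner ℝ (DV ((z 1).1 - (z 2).1)) (-(β • (z 1).2)) : ℝ) : ℂ) * g (z 0).2 * φ z
      + ((inner ℝ (DV ((z 2).1 - (z 1).1)) (-(β • (z 2).2)) : ℝ) : ℂ) * g (z 0).2 * φ z := by
    intro z
    rw [sourceThree, ofReal_add, add_mul, add_mul]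
  simp_rw [e3]
  refine hs.congr_fun fun n => ?_
  have hm : ∀ (j : Fin 3) (i : Fin d), Integrable (fun z : Fin 3 → Phase d =>
      mFourier n ((z 1).1 - (z 2).1) * (-(β : ℂ) * g (z 0).2 * (((z j).2 i : ℝ) * φ z)))
      (𝔓 3) := fun j i => by
    refine ((hΨ j i).integrable (by norm_num)).bdd_mul (c := 1)
      (((ContinuousMap.continuous _).measurable.comp
        (measurePreserving_pos_sub d β (by decide)).measurable).aestronglyMeasurable)
      (ae_of_all _ fun z => (norm_mFourier_apply n _).le)
  simp only [comp_apply, Equiv.neg_apply, waveVec_neg, potHat_neg hV.even]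
  have e4 : ∀ z : Fin 3 → Phase d, mFourier (-n) ((z 2).1 - (z 1).1)
      = mFourier n ((z 1).1 - (z 2).1) := fun z => by
    rw [← mFourier_apply_neg, neg_sub]
  simp_rw [e4, ← integral_const_mul]
  rw [← integral_finsetSum _ fun i _ => (hm 1 i).const_mul _,
    ← integral_finsetSum _ fun i _ => (hm 2 i).const_mul _, ← integral_add
      (integrable_finsetSum _ fun i _ => (hm 1 i).const_mul _)
      (integrable_finsetSum _ fun i _ => (hm 2 i).const_mul _)]
  refine integral_congr_fun fun z => ?_
  simp only [modeFun, sourceMode, torusChar_waveThree, posOf, velOf, inner_eq_sum_mul, ofReal_sum]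
  rw [← Finset.sum_add_distrib, ← Finset.sum_sub_distrib, mul_sum, sum_mul,
    mul_sum, sum_mul]
  refine sum_congr rfl fun i _ => ?_
  simp only [PiLp.neg_apply]
  push_cast
  ring

/-! ### The three-particle correlation -/

lemma one_le_norm_waveVec {n : ℤᵈ} (hn : n ≠ 0) : 1 ≤ ‖waveVec n‖ := by
  obtain ⟨i, hi⟩ := ne_iff.1 hn
  have h1 : (1 : ℝ) ≤ |(n i : ℝ)| := by exact_mod_cast Int.one_le_abs hi
  refine le_trans ?_ (PiLp.norm_apply_le (waveVec n) i)
  rw [waveVec, Real.norm_eq_abs, abs_mul, abs_of_pos Real.two_pi_pos]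
  nlinarith [Real.pi_gt_three]

lemma modeScale_ratio (hβ : 0 < β) {n : ℤᵈ} (hn : n ≠ 0) (hω : 0 < ω.im) : 0 < (ω / modeScale β n).im ∧
      ‖ω / modeScale β n‖ / (ω / modeScale β n).im = ‖ω‖ / ω.im ∧
      ‖ω / modeScale β n‖ / (ω / modeScale β n).im ^ 2 = modeScale β n * (‖ω‖ / ω.im ^ 2) := by
  have hc := modeScale_pos hβ hn
  rw [div_ofReal_im, norm_div, norm_real, Real.norm_of_nonneg hc.le]
  refine ⟨by positivity, ?_, ?_⟩ <;> field_simp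

/-- The coefficient of the mean-field interaction of the mode `n` for three particles. -/
def meanCoupling (N : ℕ) (β : ℝ) (V : Torus d → ℝ) (n : ℤᵈ) : ℝ :=
  ((N : ℝ) - 1) / N * (β * potHat V n)

lemma fraction_mem (hN : 1 ≤ N) : 0 ≤ ((N : ℝ) - 1) / N ∧ ((N : ℝ) - 1) / N ≤ 1 := by
  have : (1 : ℝ) ≤ N := by exact_mod_cast hN
  exact ⟨div_nonneg (by linarith) (by linarith), by rw [div_le_one (by linarith)]; linarith⟩

lemma IsPotential.potHat_le (hV : IsPotential V DV K) (n : ℤᵈ) : potHat V n ≤ K :=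
  (le_abs_self _).trans (abs_potHat_le hV.1 n)

lemma meanCoupling_mem (hβ : 0 < β) (hN : 1 ≤ N) (hV : IsPotential V DV K) (n : ℤᵈ) :
    0 ≤ meanCoupling N β V n ∧ meanCoupling N β V n ≤ β * K := by
  obtain ⟨h1, h2⟩ := fraction_mem hN
  have h3 := hV.pos n
  have h4 := hV.potHat_le n
  refine ⟨by unfold meanCoupling; positivity, ?_⟩
  exact (mul_le_of_le_one_left (by positivity) h2).trans (by gcongr)

/-- The amplitude of the mode `n` of the three-particle correlation. -/
def corrCoeff (N : ℕ) (β : ℝ) (V : Torus d → ℝ) (n : ℤᵈ) : ℝ :=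
  -(β * potHat V n) / (1 + meanCoupling N β V n)

lemma abs_corrCoeff_le (hβ : 0 < β) (hN : 1 ≤ N) (hV : IsPotential V DV K) (n : ℤᵈ) : |corrCoeff N β V n| ≤ β * potHat V n := by
  have h1 := (meanCoupling_mem hβ hN hV n).1
  have h2 := hV.pos n
  rw [corrCoeff, abs_div, abs_neg, abs_of_nonneg (by positivity), abs_of_nonneg (by positivity)]
  exact div_le_self (by positivity) (by linarith)

/-- The modes of the three-particle correlation. -/
def threeMode (N : ℕ) (β : ℝ) (V : Torus d → ℝ) (g : Vel d → ℂ) (ω : ℂ) (n : ℤᵈ)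
    (v : Fin 3 → Vel d) : ℂ :=
  if n = 0 then 0 else corrCoeff N β V n * (g (v 0) *
    corrKernel (meanCoupling N β V n) (ω / modeScale β n) (modeVel β n (v 1)) (modeVel β n (v 2)))

lemma threeMode_neg (heven : ∀ᵐ x ∂𝔗, V (-x) = V x) (N : ℕ) (g : Vel d → ℂ) (ω : ℂ)
    (n : ℤᵈ) (v : Fin 3 → Vel d) : threeMode N β V g ω (-n) v
      = threeMode N β V g ω n fun j => v (Equiv.swap 1 2 j) := by
  have e0 : Equiv.swap (1 : Fin 3) 2 0 = 0 := by decide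
  simp only [threeMode, neg_eq_zero, corrCoeff, meanCoupling, potHat_neg heven, modeScale_neg,
    modeVel_neg, corrKernel_symm, Equiv.swap_apply_left, Equiv.swap_apply_right, e0]

/-- The mode `n` of the three-particle correlation solves the mode equation. -/
lemma threeMode_equation [hβ : Fact (0 < β)] (hN : 1 ≤ N) (hV : IsPotential V DV K) (g : Vel d → ℂ)
    (hω : 0 < ω.im) (n : ℤᵈ) (v : Fin 3 → Vel d) :
    I * modeOp (m := 2) N β V (waveThree n) (threeMode N β V g ω n) v
      - I * ω * threeMode N β V g ω n v = sourceMode β V g n v := by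
  by_cases hn : n = 0
  · simp [modeOp_three, waveThree, threeMode, sourceMode, hn, waveVec_zero]
  obtain ⟨hα, -⟩ := meanCoupling_mem hβ.out hN hV n
  obtain ⟨hz, -⟩ := modeScale_ratio hβ.out hn hω
  have hc := (modeScale_pos hβ.out hn).ne'
  have hk := corrKernel_equation hα hz (modeVel β n (v 1)) (modeVel β n (v 2))
  have e1 : ∫ s, threeMode N β V g ω n ![v 0, s, v 2] ∂ℳ = corrCoeff N β V n * (g (v 0) *
      corrMean (meanCoupling N β V n) (ω / modeScale β n) (-modeVel β n (v 2))) := by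
    simp only [threeMode, hn, if_false, Matrix.cons_val_zero, Matrix.cons_val_one, Matrix.cons_val]
    rw [integral_const_mul, integral_const_mul, ← integral_corrKernel_left hα hz,
      integral_modeVel hβ.out hn (f := fun p => corrKernel _ _ p _)
      ((stronglyMeasurable_corrKernel _ _).comp_measurable
        (measurable_id.prodMk measurable_const)).aestronglyMeasurable]
  have e2 : ∫ s, threeMode N β V g ω n ![v 0, v 1, s] ∂ℳ = corrCoeff N β V n * (g (v 0) *
      corrMean (meanCoupling N β V n) (ω / modeScale β n) (modeVel β n (v 1))) := by
    simp only [threeMode, hn, if_false, Matrix.cons_val_zero, Matrix.cons_val_one, Matrix.cons_val]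
    rw [integral_const_mul, integral_const_mul, ← integral_corrKernel_right hα hz,
      integral_modeVel hβ.out hn (f := fun p => corrKernel _ _ _ p)
      ((stronglyMeasurable_corrKernel _ _).comp_measurable
        (measurable_const.prodMk measurable_id)).aestronglyMeasurable]
  rw [modeOp_three, e1, e2]
  have hc1 : (corrCoeff N β V n : ℂ) * (1 + meanCoupling N β V n) = -(β * potHat V n) := by
    have : 1 + meanCoupling N β V n ≠ 0 := by linarith
    rw [corrCoeff]
    exact_mod_cast div_mul_cancel₀ _ this
  simp only [waveThree, Matrix.cons_val_zero, Matrix.cons_val_one, Matrix.cons_val, waveVec_zero,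
    waveVec_neg, inner_zero_left, inner_neg_left, potHat_neg hV.even, sourceMode,
    ← modeScale_mul_modeVel hβ.out hn]
  rw [← meanCoupling]
  simp only [threeMode, hn, if_false]
  set Θ := corrKernel (meanCoupling N β V n) (ω / modeScale β n) (modeVel β n (v 1)) (modeVel β n (v 2))
  set F₁ := corrMean (meanCoupling N β V n) (ω / modeScale β n) (-modeVel β n (v 2))
  set F₂ := corrMean (meanCoupling N β V n) (ω / modeScale β n) (modeVel β n (v 1))
  have hω' : ω = modeScale β n * (ω / modeScale β n) := by
    rw [mul_div_cancel₀ _ (by exact_mod_cast hc)]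
  set z := ω / modeScale β n
  rw [hω']
  push_cast
  linear_combination I * corrCoeff N β V n * g (v 0) * modeScale β n * hk
    + I * g (v 0) * modeScale β n * (modeVel β n (v 1) - modeVel β n (v 2)) * hc1

lemma eLpNorm_mul_comp {X U W : Type*} [MeasurableSpace X] [MeasurableSpace U] [MeasurableSpace W]
    {ρ : Measure X} {μ : Measure U} {ν : Measure W} [SFinite ν] {T : X → U × W}
    (hT : MeasurePreserving T ρ (μ.prod ν)) {f : U → ℂ} {h : W → ℂ} (hf : MemLp f 2 μ)
    (hh : MemLp h 2 ν) : MemLp (fun x => f (T x).1 * h (T x).2) 2 ρ ∧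
      eLpNorm (fun x => f (T x).1 * h (T x).2) 2 ρ = eLpNorm f 2 μ * eLpNorm h 2 ν :=
  have hm := memLp_mul_prod hf hh
  ⟨hm.comp_measurePreserving hT,
    (eLpNorm_comp_measurePreserving hm.1 hT).trans (eLpNorm_mul_prod hf.1 hh.1)⟩

lemma eLpNorm_vec_two [Fact (0 < β)] {f h : Vel d → ℂ} (hf : MemLp f 2 ℳ) (hh : MemLp h 2 ℳ) :
    MemLp (fun v : Fin 2 → Vel d => f (v 0) * h (v 1)) 2 (𝔙 2) ∧
    eLpNorm (fun v : Fin 2 → Vel d => f (v 0) * h (v 1)) 2 (𝔙 2)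
      = eLpNorm f 2 ℳ * eLpNorm h 2 ℳ :=
  eLpNorm_mul_comp (measurePreserving_finTwoArrow ℳ) hf hh

lemma eLpNorm_vec_three [Fact (0 < β)] {f : Vel d → ℂ} {h : Vel d × Vel d → ℂ}
    (hf : MemLp f 2 ℳ) (hh : MemLp h 2 ((ℳ).prod ℳ)) :
    MemLp (fun v : Fin 3 → Vel d => f (v 0) * h (v 1, v 2)) 2 (𝔙 3) ∧
    eLpNorm (fun v : Fin 3 → Vel d => f (v 0) * h (v 1, v 2)) 2 (𝔙 3)
      = eLpNorm f 2 ℳ * eLpNorm h 2 ((ℳ).prod ℳ) :=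
  eLpNorm_mul_comp (((MeasurePreserving.id ℳ).prod (measurePreserving_finTwoArrow ℳ)).comp
    (measurePreserving_piFinSuccAbove (fun _ : Fin 3 => ℳ) 0)) hf hh

lemma eLpNorm_comp_modeVel [hβ : Fact (0 < β)] {n : ℤᵈ} (hn : n ≠ 0) {f : ℝ → ℂ} {c : ℝ}
    (hf : AEStronglyMeasurable f stdNormal) (hc : eLpNorm f 2 stdNormal ≤ ENNReal.ofReal c) :
    MemLp (fun v => f (modeVel β n v)) 2 ℳ ∧
      eLpNorm (fun v => f (modeVel β n v)) 2 ℳ ≤ ENNReal.ofReal c := by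
  refine ⟨memLp_comp_modeVel hn ⟨hf, hc.trans_lt ENNReal.ofReal_lt_top⟩, ?_⟩
  exact (eLpNorm_comp_measurePreserving hf (measurePreserving_modeVel hβ.out hn)).trans_le hc

lemma exists_threeMode_bound [hβ : Fact (0 < β)] (hN : 1 ≤ N) (hV : IsPotential V DV K) (hg : MemLp g 2 ℳ)
    (hω : 0 < ω.im) : ∃ C : ℝ, 0 ≤ C ∧ ∀ n,
      MemLp (threeMode N β V g ω n) 2 (𝔙 3) ∧
      eLpNorm (threeMode N β V g ω n) 2 (𝔙 3)
        ≤ ENNReal.ofReal (C * (‖waveVec n‖ * potHat V n)) := by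
  obtain ⟨C, hC0, hC⟩ := exists_corr_bounds (β * K)
  have hb := hβ.out
  have hq : 0 ≤ ‖ω‖ / ω.im := by positivity
  refine ⟨β * ((eLpNorm g 2 ℳ).toReal * (C * (1 + ‖ω‖ / ω.im))), by positivity,
    fun n => ?_⟩
  by_cases hn : n = 0
  · have : threeMode N β V g ω n = 0 := by funext v; simp [threeMode, hn]
    rw [this]
    exact ⟨MemLp.zero, by simp⟩
  obtain ⟨hα, hαA⟩ := meanCoupling_mem hb hN hV n
  obtain ⟨hz, hz1, -⟩ := modeScale_ratio hb hn hω
  have hk := (hC _ hα hαA _ hz).1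
  rw [hz1] at hk
  set k := fun x : ℝ × ℝ => corrKernel (meanCoupling N β V n) (ω / modeScale β n) x.1 x.2
  have hks : StronglyMeasurable k := stronglyMeasurable_corrKernel _ _
  have hp := measurePreserving_modeVel hb hn
  have hpm := (continuous_modeVel β n).measurable
  have ek := eLpNorm_comp_measurePreserving (p := 2) hks.aestronglyMeasurable (hp.prod hp)
  obtain ⟨hm, e⟩ := eLpNorm_vec_three hg ⟨hks.aestronglyMeasurable.comp_measurePreserving (hp.prod hp),
      (ek.trans_le hk).trans_lt ENNReal.ofReal_lt_top⟩
  have e1 : threeMode N β V g ω n = (corrCoeff N β V n : ℂ) • fun v => g (v 0) *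
      (k ∘ Prod.map (modeVel β n) (modeVel β n)) (v 1, v 2) := by
    funext v; simp [threeMode, hn, k]
  rw [e1]
  refine ⟨hm.const_smul _, ?_⟩
  · rw [eLpNorm_const_smul, e, ek]
    calc _ ≤ ENNReal.ofReal (β * potHat V n) * (ENNReal.ofReal (eLpNorm g 2 ℳ).toReal *
          ENNReal.ofReal (C * (1 + ‖ω‖ / ω.im))) := by
          gcongr
          · rw [← ofReal_norm, norm_real]
            exact ENNReal.ofReal_le_ofReal (abs_corrCoeff_le hb hN hV n)
          · rw [ENNReal.ofReal_toReal hg.2.ne]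
      _ = ENNReal.ofReal (β * potHat V n * ((eLpNorm g 2 ℳ).toReal *
          (C * (1 + ‖ω‖ / ω.im)))) := by
          rw [ENNReal.ofReal_mul (mul_nonneg hb.le (hV.pos n)), ENNReal.ofReal_mul ENNReal.toReal_nonneg]
      _ ≤ _ := ENNReal.ofReal_le_ofReal <| by
          have h1 := one_le_norm_waveVec hn
          have h2 := hV.pos n
          calc _ = β * ((eLpNorm g 2 ℳ).toReal * (C * (1 + ‖ω‖ / ω.im))) *
              (1 * potHat V n) := by ring
            _ ≤ _ := by gcongr

lemma injective_waveThree : Injective (waveThree (d := d)) := fun n n' h => by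
  simpa [waveThree] using congrFun h 1

/-- The three-particle correlation as a superposition of modes. -/
lemma exists_resolvent_three [hβ : Fact (0 < β)] (hN : 1 ≤ N) (hV : IsPotential V DV K) (hg : MemLp g 2 ℳ)
    (hω : 0 < ω.im) :
    ∃ G : (Fin 3 → Phase d) → ℂ, IsResolvent N 2 β DV ω (sourceThree β DV g) G ∧
      ∀ W, MemLp W 2 (𝔓 3) →
        HasSum (fun n => ∫ z, modeFun (waveThree n) (threeMode N β V g ω n) z * W z
          ∂𝔓 3) (∫ z, G z * W z ∂𝔓 3) := by
  obtain ⟨C, hC0, hC⟩ := exists_threeMode_bound hN hV hg hω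
  obtain ⟨G, hG, hGs⟩ := exists_hasSum_modeFun injective_waveThree (fun n => (hC n).1)
    (fun n => mul_nonneg hC0 (mul_nonneg (norm_nonneg _) (hV.pos n))) (fun n => (hC n).2)
    (by simpa only [mul_pow] using (summable_sq_waveVec_mul_potHat hV.1 hV.even).1.mul_left (C ^ 2))
  have hS : ∀ n, MemLp (sourceMode β V g n) 2 (𝔙 3) := fun n => by
    have h1 := memLp_inner_maxwell (β := β) n
    refine ((eLpNorm_vec_three hg (h := fun x => (⟪n, x.1⟫ : ℂ) - ⟪n, x.2⟫) ((h1.comp_measurePreserving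
      measurePreserving_fst).sub (h1.comp_measurePreserving measurePreserving_snd))).1.const_mul
      (-(β * (I * potHat V n)))).ae_eq (ae_of_all _ fun v => ?_)
    simp only [sourceMode]
    ring
  refine ⟨G, ⟨⟨hG, fun σ hσ => ?_⟩, fun φ hφ => ?_⟩, hGs⟩
  · obtain rfl | rfl : σ = 1 ∨ σ = Equiv.swap 1 2 := by
      revert σ; decide
    · exact ae_of_all _ fun z => rfl
    · have hσ : MeasurePreserving (fun (z : Fin 3 → Phase d) j => z (Equiv.swap 1 2 j))
          (𝔓 3) (𝔓 3) :=
        measurePreserving_arrowCongr' (fun _ => ℨ) (fun _ => ℨ)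
          (Equiv.swap 1 2) (MeasurableEquiv.refl _) fun _ => MeasurePreserving.id _
      have hinv : ∀ z : Fin 3 → Phase d, (fun j => z (Equiv.swap 1 2 (Equiv.swap 1 2 j))) = z :=
        fun z => by simp
      have hswap : ∀ f : (Fin 3 → Phase d) → ℂ, Integrable f (𝔓 3) →
          ∫ z, f (fun j => z (Equiv.swap 1 2 j)) ∂𝔓 3
            = ∫ z, f z ∂𝔓 3 := fun f hf => by
        conv_rhs => rw [← hσ.map_eq]
        rw [integral_map hσ.measurable.aemeasurable (by rw [hσ.map_eq]; exact hf.1)]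
      refine ae_eq_of_forall_test (hG.comp_measurePreserving hσ) hG fun φ hφ => ?_
      have hφ2 := hφ.isBddTest.memLp (β := β)
      have hφσ := hφ2.comp_measurePreserving hσ
      have e1 : ∫ z, G (fun j => z (Equiv.swap 1 2 j)) * φ z ∂𝔓 3
          = ∫ z, G z * φ (fun j => z (Equiv.swap 1 2 j)) ∂𝔓 3 := by
        rw [← hswap (fun z => G z * φ (fun j => z (Equiv.swap 1 2 j)))
          (hG.integrable_mul hφσ)]
        simp only [hinv]
      refine e1.trans ((hGs _ hφσ).unique ?_)
      refine ((Equiv.neg _).hasSum_iff.2 (hGs _ hφ2)).congr_fun fun n => ?_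
      refine (hswap (fun z => modeFun (waveThree n) (threeMode N β V g ω n) z *
        φ (fun j => z (Equiv.swap 1 2 j)))
        ((memLp_modeFun (waveThree n) (hC n).1).integrable_mul hφσ)).symm.trans ?_
      refine integral_congr_fun fun z => ?_
      simp only [hinv, Equiv.neg_apply, modeFun, torusChar_waveThree, posOf,
        velOf, threeMode_neg hV.even, Equiv.swap_apply_left, Equiv.swap_apply_right]
      rw [← mFourier_apply_neg, neg_sub]
      rfl
  · exact resolvent_of_modes hV (fun n => (hC n).1) hS hG hGs hφ
      (hasSum_sourceThree hV hg hφ) fun n v => threeMode_equation hN hV g hω n v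

/-! ### The two-particle correlation -/

/-- The wave vectors of the modes of the two-particle correlation. -/
def waveTwo (n : ℤᵈ) : Fin 2 → ℤᵈ := ![-n, n]

lemma injective_waveTwo : Injective (waveTwo (d := d)) := fun n n' h => by
  simpa [waveTwo] using congrFun h 1

/-- `k · (∇_v - β v) g`. -/
def waveGrad (β : ℝ) (g : Vel d → ℂ) (Dg : Vel d → ℂᵈ) (n : ℤᵈ)
    (v : Vel d) : ℂ := ∑ i, (waveVec n i : ℂ) * twistedGrad β g Dg v i

lemma norm_waveGrad_le (n : ℤᵈ) (v : Vel d) :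
    ‖waveGrad β g Dg n v‖ ≤ ‖waveVec n‖ * ‖twistedGrad β g Dg v‖ := by
  refine (norm_sum_le _ _).trans ?_
  rw [EuclideanSpace.norm_eq, EuclideanSpace.norm_eq]
  refine le_trans (le_of_eq ?_) (Real.sum_mul_le_sqrt_mul_sqrt _ _ _)
  simp

lemma memLp_waveGrad (htg : MemLp (twistedGrad β g Dg) 2 ℳ) (n : ℤᵈ) :
    MemLp (waveGrad β g Dg n) 2 ℳ ∧ eLpNorm (waveGrad β g Dg n) 2 ℳ
      ≤ ENNReal.ofReal (‖waveVec n‖ * (eLpNorm (twistedGrad β g Dg) 2 ℳ).toReal) := by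
  have hm : AEStronglyMeasurable (waveGrad β g Dg n) ℳ := by
    have h : Continuous fun x : ℂᵈ => ∑ i, (waveVec n i : ℂ) * x i := by
      fun_prop
    exact h.comp_aestronglyMeasurable htg.1
  refine ⟨htg.of_le_mul hm (ae_of_all _ fun v => norm_waveGrad_le n v), ?_⟩
  rw [ENNReal.ofReal_mul (norm_nonneg _), ENNReal.ofReal_toReal htg.2.ne]
  exact eLpNorm_le_mul_eLpNorm_of_ae_le_mul (ae_of_all _ fun v => norm_waveGrad_le n v) 2

lemma eLpNorm_vec_two_le [Fact (0 < β)] {f h : Vel d → ℂ} (hf : MemLp f 2 ℳ)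
    (hh : MemLp h 2 ℳ) {A B : ℝ} (hA0 : 0 ≤ A)
    (hA : eLpNorm f 2 ℳ ≤ ENNReal.ofReal A)
    (hB : eLpNorm h 2 ℳ ≤ ENNReal.ofReal B) (s : ℂ) :
    MemLp (fun v : Fin 2 → Vel d => s * (f (v 0) * h (v 1))) 2 (𝔙 2) ∧
    eLpNorm (fun v : Fin 2 → Vel d => s * (f (v 0) * h (v 1))) 2 (𝔙 2)
      ≤ ENNReal.ofReal (‖s‖ * (A * B)) := by
  obtain ⟨h1, h2⟩ := eLpNorm_vec_two hf hh
  refine ⟨h1.const_mul s, (eLpNorm_const_smul s _ 2 _).trans_le ?_⟩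
  rw [h2, ENNReal.ofReal_mul (norm_nonneg _), ENNReal.ofReal_mul hA0, ofReal_norm]
  gcongr

/-- The Fourier modes of the mean operator applied to the three-particle correlation. -/
def meanMode (N : ℕ) (β : ℝ) (V : Torus d → ℝ) (g : Vel d → ℂ)
    (Dg : Vel d → ℂᵈ) (ω : ℂ) (n : ℤᵈ) (v : Fin 2 → Vel d) : ℂ :=
  if n = 0 then 0 else
    -((((N : ℝ) - 1) / N : ℝ) * (I * potHat V n) * corrCoeff N β V n) * (waveGrad β g Dg n (v 0) *
      corrMean (meanCoupling N β V n) (ω / modeScale β n) (modeVel β n (v 1)))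

/-- The contribution of the mode `n` to the space-homogeneous part. -/
def restMode (N : ℕ) (β : ℝ) (V : Torus d → ℝ) (g : Vel d → ℂ) (ω : ℂ) (n : ℤᵈ)
    (v : Fin 2 → Vel d) : ℂ :=
  if n = 0 then 0 else
    -((((N : ℝ) - 1) / N : ℝ) * (I * potHat V n) * corrCoeff N β V n) * (g (v 0) *
      (β * modeScale β n *
        (corrMeanDeriv (meanCoupling N β V n) (ω / modeScale β n) (modeVel β n (v 1)) -
        modeVel β n (v 1) *
          corrMean (meanCoupling N β V n) (ω / modeScale β n) (modeVel β n (v 1)))))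

lemma HasTwistedDeriv.neg_dir {w : Vel d} {h h' : Vel d → ℂ} (hw : HasTwistedDeriv β w h h') :
    HasTwistedDeriv β (-w) h fun v => -h' v := fun ψ hψ => by
  simp only [map_neg, mul_neg, neg_mul, integral_neg, hw ψ hψ]

lemma corrMean_memLp [hβ : Fact (0 < β)] (hN : 1 ≤ N) (hV : IsPotential V DV K) (hω : 0 < ω.im) : ∃ C : ℝ, 0 ≤ C ∧ ∀ n : ℤᵈ, n ≠ 0 →
    (MemLp (corrMean (meanCoupling N β V n) (ω / modeScale β n)) 2 stdNormal ∧
      eLpNorm (corrMean (meanCoupling N β V n) (ω / modeScale β n)) 2 stdNormal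
        ≤ ENNReal.ofReal C) ∧
    MemLp (fun p : ℝ => (p : ℂ) * corrMean (meanCoupling N β V n) (ω / modeScale β n) p) 2 stdNormal ∧
    MemLp (corrMeanDeriv (meanCoupling N β V n) (ω / modeScale β n)) 2 stdNormal ∧
    eLpNorm (fun p : ℝ => β * modeScale β n *
      (corrMeanDeriv (meanCoupling N β V n) (ω / modeScale β n) p -
        p * corrMean (meanCoupling N β V n) (ω / modeScale β n) p)) 2 stdNormal
        ≤ ENNReal.ofReal (C * ‖waveVec n‖ ^ 2) := by
  have hb := hβ.out
  obtain ⟨C, hC0, hC⟩ := exists_corr_bounds (β * K)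
  have hq : 0 ≤ ‖ω‖ / ω.im := by positivity
  have hq' : 0 ≤ ‖ω‖ / ω.im ^ 2 := by positivity
  set s := √β with hs
  have hs0 : 0 < s := Real.sqrt_pos.2 hb
  set D := C * (1 + ‖ω‖ / ω.im) + β / s * (2 * (C * (1 + ‖ω‖ / ω.im + (‖ω‖ / ω.im ^ 2) / s))) with hD
  refine ⟨D, by positivity, fun n hn => ?_⟩
  obtain ⟨hα, hαA⟩ := meanCoupling_mem hb hN hV n
  obtain ⟨hz, hz1, hz2⟩ := modeScale_ratio hb hn hω
  obtain ⟨-, h1, h2, h3⟩ := hC _ hα hαA _ hz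
  rw [hz1] at h1 h2 h3
  rw [hz2] at h2 h3
  set α := meanCoupling N β V n
  set z := ω / modeScale β n
  have hm := (stronglyMeasurable_corrMean α z).aestronglyMeasurable (μ := stdNormal)
  have hm' := (stronglyMeasurable_corrMeanDeriv α z).aestronglyMeasurable (μ := stdNormal)
  have hp : AEStronglyMeasurable (fun p : ℝ => (p : ℂ)) stdNormal :=
    continuous_ofReal.aestronglyMeasurable
  have hc := modeScale_pos hb hn
  have hk := one_le_norm_waveVec hn
  refine ⟨⟨⟨hm, h1.trans_lt ENNReal.ofReal_lt_top⟩, h1.trans (ENNReal.ofReal_le_ofReal ?_)⟩,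
    ⟨hp.mul hm, h2.trans_lt ENNReal.ofReal_lt_top⟩, ⟨hm', h3.trans_lt ENNReal.ofReal_lt_top⟩, ?_⟩
  · rw [hD]
    exact le_add_of_nonneg_right (by positivity)
  refine (eLpNorm_const_smul (β * modeScale β n : ℂ) (fun p : ℝ => corrMeanDeriv α z p -
    (p : ℂ) * corrMean α z p) 2 stdNormal).trans_le ?_
  refine (mul_le_mul_right ((eLpNorm_sub_le hm' (hp.mul hm) (by norm_num)).trans (add_le_add h3 h2))
    _).trans ?_
  rw [← ENNReal.ofReal_add (by positivity) (by positivity), ← ofReal_norm, norm_mul, norm_real,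
    norm_real, Real.norm_of_nonneg hb.le, Real.norm_of_nonneg hc.le, ← ENNReal.ofReal_mul
    (by positivity)]
  refine ENNReal.ofReal_le_ofReal ?_
  have e : modeScale β n = ‖waveVec n‖ / s := rfl
  rw [e, hD, add_mul]
  refine le_trans ?_ (le_add_of_nonneg_left (by positivity))
  have hk2 : 0 < ‖waveVec n‖ := by linarith
  calc β * (‖waveVec n‖ / s) * _ = β / s * (2 * (C * (‖waveVec n‖ * 1 + ‖waveVec n‖ * (‖ω‖ / ω.im) +
        (‖ω‖ / ω.im ^ 2) / s * ‖waveVec n‖ ^ 2))) := by ring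
    _ ≤ β / s * (2 * (C * (‖waveVec n‖ ^ 2 * 1 + ‖waveVec n‖ ^ 2 * (‖ω‖ / ω.im) +
        (‖ω‖ / ω.im ^ 2) / s * ‖waveVec n‖ ^ 2))) := by
        have : ‖waveVec n‖ ≤ ‖waveVec n‖ ^ 2 := le_self_pow₀ hk two_ne_zero
        gcongr
    _ = _ := by ring

lemma norm_meanMode_coeff_le (hβ : 0 < β) (hN : 1 ≤ N) (hV : IsPotential V DV K) (n : ℤᵈ) :
    ‖(-((((N : ℝ) - 1) / N : ℝ) * (I * potHat V n) * corrCoeff N β V n) : ℂ)‖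
      ≤ β * potHat V n ^ 2 := by
  obtain ⟨h1, h2⟩ := fraction_mem hN
  have h3 := hV.pos n
  simp only [norm_neg, norm_mul, norm_I, one_mul, norm_real, Real.norm_of_nonneg h1,
    Real.norm_of_nonneg h3]
  calc _ ≤ 1 * potHat V n * (β * potHat V n) := by
        gcongr; exact abs_corrCoeff_le hβ hN hV n
    _ = _ := by ring

lemma exists_meanMode_bound [hβ : Fact (0 < β)] (hN : 1 ≤ N) (hV : IsPotential V DV K) (hg : MemLp g 2 ℳ)
    (htg : MemLp (twistedGrad β g Dg) 2 ℳ) (hω : 0 < ω.im) :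
    ∃ C : ℝ, 0 ≤ C ∧ ∀ n,
      (MemLp (meanMode N β V g Dg ω n) 2 (𝔙 2) ∧
        eLpNorm (meanMode N β V g Dg ω n) 2 (𝔙 2)
          ≤ ENNReal.ofReal (C * (‖waveVec n‖ * potHat V n))) ∧
      MemLp (restMode N β V g ω n) 2 (𝔙 2) ∧
        eLpNorm (restMode N β V g ω n) 2 (𝔙 2)
          ≤ ENNReal.ofReal (C * (‖waveVec n‖ ^ 2 * potHat V n ^ 2)) := by
  have hb := hβ.out
  have hK := hV.nonneg
  obtain ⟨C, hC0, hC⟩ := corrMean_memLp (β := β) hN hV hω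
  set T := (eLpNorm (twistedGrad β g Dg) 2 ℳ).toReal
  set A := (eLpNorm g 2 ℳ).toReal with hA
  have hT0 : 0 ≤ T := ENNReal.toReal_nonneg
  have hA0 : 0 ≤ A := ENNReal.toReal_nonneg
  refine ⟨β * K * (T * C) + β * (A * C), by positivity, fun n => ?_⟩
  by_cases hn : n = 0
  · have e1 : meanMode N β V g Dg ω n = 0 := by funext v; simp [meanMode, hn]
    have e2 : restMode N β V g ω n = 0 := by funext v; simp [restMode, hn]
    rw [e1, e2]
    exact ⟨⟨MemLp.zero, by simp⟩, MemLp.zero, by simp⟩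
  obtain ⟨⟨-, h1⟩, h2, h3, h4⟩ := hC n hn
  have hc := norm_meanMode_coeff_le hb hN hV n
  have hVn := hV.pos n
  have hVK := hV.potHat_le n
  obtain ⟨hw, hwT⟩ := memLp_waveGrad htg n
  set s : ℂ := -((((N : ℝ) - 1) / N : ℝ) * (I * potHat V n) * corrCoeff N β V n) with hs
  obtain ⟨a1, a2⟩ := eLpNorm_comp_modeVel (β := β) hn
    (stronglyMeasurable_corrMean _ _).aestronglyMeasurable h1
  obtain ⟨b1, b2⟩ := eLpNorm_comp_modeVel (β := β) hn ((h3.sub h2).const_mul _).1 h4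
  obtain ⟨c1, c2⟩ := eLpNorm_vec_two_le hw a1 (by positivity) hwT a2 s
  obtain ⟨d1, d2⟩ := eLpNorm_vec_two_le hg b1 hA0 (ENNReal.ofReal_toReal hg.2.ne).ge b2 s
  have e1 : meanMode N β V g Dg ω n = fun v => s * (waveGrad β g Dg n (v 0) * corrMean
      (meanCoupling N β V n) (ω / modeScale β n) (modeVel β n (v 1))) := by
    funext v; simp only [meanMode, hn, if_false, hs]
  have e2 : restMode N β V g ω n = fun v => s * (g (v 0) * (β * modeScale β n *
      (corrMeanDeriv (meanCoupling N β V n) (ω / modeScale β n) (modeVel β n (v 1)) - modeVel β n (v 1)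
        * corrMean (meanCoupling N β V n) (ω / modeScale β n) (modeVel β n (v 1))))) := by
    funext v; simp only [restMode, hn, if_false, hs]
  rw [e1, e2]
  refine ⟨⟨c1, c2.trans (ENNReal.ofReal_le_ofReal ?_)⟩, d1, d2.trans (ENNReal.ofReal_le_ofReal ?_)⟩
  · calc _ ≤ β * potHat V n ^ 2 * (‖waveVec n‖ * T * C) := by gcongr
      _ = β * potHat V n * (T * C) * (‖waveVec n‖ * potHat V n) := by ring
      _ ≤ β * K * (T * C) * (‖waveVec n‖ * potHat V n) := by gcongr
      _ ≤ _ := by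
        gcongr
        exact le_add_of_nonneg_right (by positivity)
  · calc _ ≤ β * potHat V n ^ 2 * (A * (C * ‖waveVec n‖ ^ 2)) := by gcongr
      _ = β * (A * C) * (‖waveVec n‖ ^ 2 * potHat V n ^ 2) := by ring
      _ ≤ _ := by
        gcongr
        exact le_add_of_nonneg_left (by positivity)

/-- The mean operator on the modes of the three-particle correlation. -/
lemma meanPair_threeMode [hβ : Fact (0 < β)] (hN : 1 ≤ N) (hV : IsPotential V DV K) (hg : IsH1 β g Dg)
    (htg : MemLp (twistedGrad β g Dg) 2 ℳ) (hω : 0 < ω.im) (n : ℤᵈ)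
    {φ : (Fin 2 → Phase d) → ℂ} (hφ : IsPhaseTest φ) :
    meanPair N 1 β DV (modeFun (waveThree n) (threeMode N β V g ω n)) φ
      = (∫ z, modeFun (waveTwo n) (meanMode N β V g Dg ω n) z * φ z ∂𝔓 2)
        + ∫ z, modeFun 0 (restMode N β V g ω n) z * φ z ∂𝔓 2 := by
  by_cases hn : n = 0
  · have h : modeFun (waveThree n) (threeMode N β V g ω n) = fun _ => 0 := funext fun z => by
      simp [modeFun, threeMode, hn]
    rw [h]
    simp [meanPair, h, modeFun, meanMode, restMode, hn]
  obtain ⟨hα, -⟩ := meanCoupling_mem hβ.out hN hV n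
  obtain ⟨hz, -⟩ := modeScale_ratio hβ.out hn hω
  obtain ⟨C, -, hC⟩ := corrMean_memLp (β := β) hN hV hω
  obtain ⟨⟨h1, -⟩, h2, h3, -⟩ := hC n hn
  set α := meanCoupling N β V n with hαd
  set z := ω / modeScale β n with hzd
  have hw := (memLp_waveGrad htg n).1
  have hF := memLp_comp_modeVel (β := β) hn h1
  have hF' := memLp_comp_modeVel (β := β) hn ((h3.sub h2).const_mul (β * modeScale β n : ℂ))
  have e0 : ∀ v : Fin 2 → Vel d, ∫ s, threeMode N β V g ω n (Fin.snoc (α := fun _ => Vel d) v s)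
      ∂ℳ = corrCoeff N β V n * (g (v 0) * corrMean α z (modeVel β n (v 1))) := fun v => by
    have : ∀ s, threeMode N β V g ω n (Fin.snoc (α := fun _ => Vel d) v s) = corrCoeff N β V n *
        (g (v 0) * corrKernel α z (modeVel β n (v 1)) (modeVel β n s)) := fun s => by
      simp only [threeMode, hn, if_false]
      rfl
    simp_rw [this]
    rw [integral_const_mul, integral_const_mul, ← integral_corrKernel_right hα hz,
      integral_modeVel hβ.out hn (f := fun p => corrKernel _ _ _ p)
      ((stronglyMeasurable_corrKernel _ _).comp_measurable
        (measurable_const.prodMk measurable_id)).aestronglyMeasurable]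
  have k0 : (fun l : Fin 2 => waveThree n l.castSucc) + Pi.single 0 (-n) = waveTwo n := by
    funext l; fin_cases l <;> simp [waveThree, waveTwo]
  have k1 : (fun l : Fin 2 => waveThree n l.castSucc) + Pi.single 1 (-n) = 0 := by
    funext l; fin_cases l <;> simp [waveThree]
  have hlast : waveThree n (Fin.last (1 + 1)) = -n := rfl
  have j0 := integral_modeFun_mul_velDeriv (waveTwo n) 0 (HasTwistedDeriv.neg_dir
    (hg.hasTwistedDeriv (fun i => htg.of_le ((by fun_prop : Continuous fun x :
      ℂᵈ => x i).comp_aestronglyMeasurable htg.1)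
      (ae_of_all _ fun v => PiLp.norm_apply_le _ i)) (waveVec n)))
    (r := fun v => corrCoeff N β V n * corrMean α z (modeVel β n (v 1)))
    (fun v s => by simp)
    (((eLpNorm_vec_two hg.memLp hF).1.const_mul (corrCoeff N β V n : ℂ)).ae_eq
      (ae_of_all _ fun v => by ring))
    (((eLpNorm_vec_two hw hF).1.const_mul (-corrCoeff N β V n : ℂ)).ae_eq
      (ae_of_all _ fun v => by simp only [waveGrad]; ring)) hφ
  have j1 := integral_modeFun_mul_velDeriv 0 1 (HasTwistedDeriv.neg_dir
    (hasTwistedDeriv_modeVel hn (hasDerivAt_corrMean hα hz) h1 h3))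
    (r := fun v => corrCoeff N β V n * g (v 0))
    (fun v s => by simp)
    (((eLpNorm_vec_two hg.memLp hF).1.const_mul (corrCoeff N β V n : ℂ)).ae_eq
      (ae_of_all _ fun v => by ring))
    (((eLpNorm_vec_two hg.memLp hF').1.const_mul (-corrCoeff N β V n : ℂ)).ae_eq
      (ae_of_all _ fun v => by simp only [Pi.sub_apply]; ring)) hφ
  rw [meanPair_modeFun N hV _ _ hφ]
  simp_rw [e0]
  rw [Fin.sum_univ_two]
  simp only [hlast, k0, k1, waveVec_neg, potHat_neg hV.even, Nat.cast_one]
  have r0 : ∀ v : Fin 2 → Vel d, (corrCoeff N β V n : ℂ) * (g (v 0) * corrMean α z (modeVel β n (v 1)))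
      = corrCoeff N β V n * corrMean α z (modeVel β n (v 1)) * g (v 0) := fun v => by ring
  have r1 : ∀ v : Fin 2 → Vel d, (corrCoeff N β V n : ℂ) * (g (v 0) * corrMean α z (modeVel β n (v 1)))
      = corrCoeff N β V n * g (v 0) * corrMean α z (modeVel β n (v 1)) := fun v => by ring
  conv_lhs => enter [2, 1]; simp only [r0]
  conv_lhs => enter [2, 2]; simp only [r1]
  rw [j0, j1, ← integral_neg, ← integral_neg, mul_add, ← integral_const_mul, ← integral_const_mul]
  congr 1 <;> refine integral_congr_fun fun z => ?_
  · simp only [modeFun, meanMode, hn, if_false, waveGrad]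
    ring
  · simp only [modeFun, restMode, hn, if_false]
    ring

/-- The Cauchy transform of the mean correlation. -/
def corrCauchy (α : ℝ) (z ζ : ℂ) : ℂ := ∫ p : ℝ, corrMean α z p * ((p : ℂ) - ζ)⁻¹ ∂stdNormal

lemma im_add_ofReal_pos (hz : 0 < z.im) (q : ℝ) : 0 < (z + q).im := by simpa using hz

lemma stronglyMeasurable_corrCauchy_div (α γ : ℝ) (hz : 0 < z.im) :
    StronglyMeasurable fun q : ℝ => corrCauchy α z (z + q) / gaussEps γ (z + q) := by
  have hc : Continuous fun x : ℝ × ℝ => ((x.2 : ℂ) - (z + x.1))⁻¹ := by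
    have h : ∀ x : ℝ × ℝ, (x.2 : ℂ) - (z + x.1) ≠ 0 := fun x =>
      sub_ne_zero_of_im_pos (im_add_ofReal_pos hz x.1) x.2
    fun_prop (disch := exact h _)
  have h1 : StronglyMeasurable fun q : ℝ => corrCauchy α z (z + q) :=
    StronglyMeasurable.integral_prod_right' (f := fun x : ℝ × ℝ =>
      corrMean α z x.2 * ((x.2 : ℂ) - (z + x.1))⁻¹)
      (((stronglyMeasurable_corrMean α z).comp_measurable measurable_snd).mul hc.stronglyMeasurable)
  have h2 : Continuous fun q : ℝ => gaussEps γ (z + q) := by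
    have : Continuous fun q : ℝ => gaussJ (z + q) :=
      continuousOn_gaussJ.comp_continuous (by fun_prop) fun q => (im_add_ofReal_pos hz q).le
    simp only [gaussEps, gaussK]
    fun_prop
  exact h1.div h2.stronglyMeasurable

/-- The amplitude of the Fourier mode `n` of the two-particle correlation. -/
def twoCoeff (N : ℕ) (β : ℝ) (V : Torus d → ℝ) (n : ℤᵈ) : ℝ :=
  -(((N : ℝ) - 1) / N * potHat V n * corrCoeff N β V n / modeScale β n)

/-- The ratio of the Cauchy transform of the mean correlation and the dispersion function. -/
def screened (N : ℕ) (β : ℝ) (V : Torus d → ℝ) (ω : ℂ) (n : ℤᵈ) (v : Vel d) : ℂ :=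
  corrCauchy (meanCoupling N β V n) (ω / modeScale β n) (ω / modeScale β n + modeVel β n v) /
    gaussEps (β * potHat V n) (ω / modeScale β n + modeVel β n v)

/-- The Fourier modes of the two-particle correlation. -/
def twoMode (N : ℕ) (β : ℝ) (V : Torus d → ℝ) (g : Vel d → ℂ)
    (Dg : Vel d → ℂᵈ) (ω : ℂ) (n : ℤᵈ) (v : Fin 2 → Vel d) : ℂ :=
  if n = 0 then 0 else
    twoCoeff N β V n * (waveGrad β g Dg n (v 0) *
      ((corrMean (meanCoupling N β V n) (ω / modeScale β n) (modeVel β n (v 1))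
        - β * potHat V n * modeVel β n (v 1) * screened N β V ω n (v 0)) *
      ((modeVel β n (v 1) : ℂ) - (ω / modeScale β n + modeVel β n (v 0)))⁻¹))

lemma integral_twoMode [hβ : Fact (0 < β)] (hN : 1 ≤ N) (hV : IsPotential V DV K) (hω : 0 < ω.im) {n : ℤᵈ} (hn : n ≠ 0) (u : Vel d) :
    ∫ s, twoMode N β V g Dg ω n ![u, s] ∂ℳ
      = twoCoeff N β V n * (waveGrad β g Dg n u * screened N β V ω n u) := by
  obtain ⟨hz, -⟩ := modeScale_ratio hβ.out hn hω
  obtain ⟨C, -, hC⟩ := corrMean_memLp (β := β) hN hV hω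
  obtain ⟨⟨h1, -⟩, -⟩ := hC n hn
  set α := meanCoupling N β V n with hαd
  set z := ω / modeScale β n with hzd
  have hζ := im_add_ofReal_pos hz (modeVel β n u)
  set ζ := z + modeVel β n u with hζd
  simp only [twoMode, hn, if_false, Matrix.cons_val_zero, Matrix.cons_val_one, Matrix.cons_val]
  rw [← hαd, ← hzd, ← hζd, integral_const_mul, integral_const_mul]
  have hi := aestronglyMeasurable_inv_sub hζ
  have hb : ∀ᵐ p : ℝ ∂stdNormal, ‖((p : ℂ) - ζ)⁻¹‖ ≤ ζ.im⁻¹ := ae_of_all _ (norm_inv_sub_le hζ)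
  have i1 : Integrable (fun p : ℝ => corrMean α z p * ((p : ℂ) - ζ)⁻¹) stdNormal :=
    (h1.integrable (by norm_num)).mul_bdd (c := ζ.im⁻¹) hi hb
  have hp := memLp_pow_stdNormal 1
  simp only [pow_one] at hp
  have i2 : Integrable (fun p : ℝ => (p : ℂ) / (p - ζ)) stdNormal :=
    (hp.integrable (by norm_num)).mul_bdd (c := ζ.im⁻¹) hi hb
  rw [integral_modeVel hβ.out hn (f := fun p : ℝ => (corrMean α z p - β * potHat V n * p *
    screened N β V ω n u) * ((p : ℂ) - ζ)⁻¹) (((h1.1.sub ((hp.1.const_mul _).mul_const _)).mul hi))]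
  have e : ∀ p : ℝ, (corrMean α z p - β * potHat V n * p * screened N β V ω n u) * ((p : ℂ) - ζ)⁻¹
      = corrMean α z p * ((p : ℂ) - ζ)⁻¹ - β * potHat V n * screened N β V ω n u *
        ((p : ℂ) / (p - ζ)) := fun p => by ring
  simp_rw [e]
  rw [integral_sub i1 (i2.const_mul _), integral_const_mul, integral_div_sub hζ, ← corrCauchy]
  have hε := gaussEps_ne_zero (mul_nonneg hβ.out.le (hV.pos n)) hζ.le
  have hJ : screened N β V ω n u * gaussEps (β * potHat V n) ζ = corrCauchy α z ζ :=
    div_mul_cancel₀ _ hε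
  rw [← hJ, gaussEps]
  push_cast
  ring

lemma twoMode_equation [hβ : Fact (0 < β)] (hN : 1 ≤ N) (hV : IsPotential V DV K) (hω : 0 < ω.im) {n : ℤᵈ} (hn : n ≠ 0)
    (v : Fin 2 → Vel d) :
    I * modeOp (m := 1) N β V (waveTwo n) (twoMode N β V g Dg ω n) v
      - I * ω * twoMode N β V g Dg ω n v = meanMode N β V g Dg ω n v := by
  obtain ⟨hz, -⟩ := modeScale_ratio hβ.out hn hω
  have hc : (modeScale β n : ℂ) ≠ 0 := by exact_mod_cast (modeScale_pos hβ.out hn).ne'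
  rw [modeOp_two hN, integral_twoMode hN hV hω hn]
  simp only [waveTwo, Matrix.cons_val_zero, Matrix.cons_val_one, Matrix.cons_val, waveVec_neg,
    inner_neg_left, ← modeScale_mul_modeVel hβ.out hn]
  simp only [twoMode, meanMode, hn, if_false]
  have hω' : ω = modeScale β n * (ω / modeScale β n) := by rw [mul_div_cancel₀ _ hc]
  set z := ω / modeScale β n with hzd
  have hne := sub_ne_zero_of_im_pos (im_add_ofReal_pos hz (modeVel β n (v 0))) (modeVel β n (v 1))
  set F := corrMean (meanCoupling N β V n) z (modeVel β n (v 1))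
  rw [hω']
  have ht : (twoCoeff N β V n : ℂ) * modeScale β n
      = -(((N : ℝ) - 1) / N * potHat V n * corrCoeff N β V n : ℝ) := by
    rw [twoCoeff]
    push_cast
    field_simp
  push_cast at ht ⊢
  linear_combination (norm := skip) I * waveGrad β g Dg n (v 0) * F * ht
  field_simp
  ring

lemma exists_twoMode_bound [hβ : Fact (0 < β)] (hN : 1 ≤ N) (hV : IsPotential V DV K) (htg : MemLp (twistedGrad β g Dg) 2 ℳ)
    (hω : 0 < ω.im) : ∃ C : ℝ, 0 ≤ C ∧ ∀ n, MemLp (twoMode N β V g Dg ω n) 2 (𝔙 2) ∧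
      eLpNorm (twoMode N β V g Dg ω n) 2 (𝔙 2)
        ≤ ENNReal.ofReal (C * (‖waveVec n‖ * potHat V n)) := by
  have hb := hβ.out
  have hK := hV.nonneg
  obtain ⟨C, hC0, hC⟩ := corrMean_memLp (β := β) hN hV hω
  obtain ⟨C', hC'0, hC'⟩ := exists_norm_integral_corrMean_le (β * K)
  obtain ⟨c, hc0, hc⟩ := exists_le_norm_gaussEps (β * K)
  set T := (eLpNorm (twistedGrad β g Dg) 2 ℳ).toReal
  have hT0 : 0 ≤ T := ENNReal.toReal_nonneg
  set P := (eLpNorm (fun p : ℝ => (p : ℂ) ^ 1) 2 stdNormal).toReal with hP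
  have hP0 : 0 ≤ P := ENNReal.toReal_nonneg
  set D := C + β * K * (C' / c) * P with hD
  refine ⟨β * K / ω.im * (T * D), by positivity, fun n => ?_⟩
  by_cases hn : n = 0
  · have e1 : twoMode N β V g Dg ω n = 0 := by funext v; simp [twoMode, hn]
    rw [e1]
    exact ⟨MemLp.zero, by simp⟩
  obtain ⟨⟨h1, h1C⟩, -⟩ := hC n hn
  obtain ⟨hα, hαA⟩ := meanCoupling_mem hb hN hV n
  obtain ⟨hz, -⟩ := modeScale_ratio hb hn hω
  have hsc := modeScale_pos hb hn
  obtain ⟨hw, hwT⟩ := memLp_waveGrad htg n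
  have hVn := hV.pos n
  have hVK := hV.potHat_le n
  set α := meanCoupling N β V n with hαd
  set z := ω / modeScale β n with hzd
  have hscr : ∀ u, ‖screened N β V ω n u‖ ≤ C' / c := fun u => by
    have hζ := im_add_ofReal_pos hz (modeVel β n u)
    rw [screened, norm_div]
    exact div_le_div₀ hC'0 (hC' α hα hαA z _ hz hζ).2 hc0
      (hc _ (by positivity) (by gcongr) _ hζ.le)
  have hp := memLp_pow_stdNormal 1
  set h : ℝ → ℂ := fun p => (‖corrMean α z p‖ : ℂ) + (β * K * (C' / c) : ℝ) * (‖(p : ℂ) ^ 1‖ : ℂ)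
    with hh
  have hhn : ∀ p, ‖h p‖ = ‖corrMean α z p‖ + β * K * (C' / c) * |p| := fun p => by
    have : h p = (‖corrMean α z p‖ + β * K * (C' / c) * |p| : ℝ) := by simp [hh]
    rw [this, norm_real, Real.norm_of_nonneg (by positivity)]
  have n1 : eLpNorm (fun p => (‖corrMean α z p‖ : ℂ)) 2 stdNormal = eLpNorm (corrMean α z) 2 stdNormal :=
    eLpNorm_congr_norm_ae (ae_of_all _ fun p => by simp)
  have n2 : eLpNorm (fun p : ℝ => (‖(p : ℂ) ^ 1‖ : ℂ)) 2 stdNormal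
      = eLpNorm (fun p : ℝ => (p : ℂ) ^ 1) 2 stdNormal :=
    eLpNorm_congr_norm_ae (ae_of_all _ fun p => by simp)
  have m1 : AEStronglyMeasurable (fun p => (‖corrMean α z p‖ : ℂ)) stdNormal :=
    continuous_ofReal.comp_aestronglyMeasurable h1.1.norm
  have m2 : AEStronglyMeasurable (fun p : ℝ => (‖(p : ℂ) ^ 1‖ : ℂ)) stdNormal :=
    continuous_ofReal.comp_aestronglyMeasurable hp.1.norm
  have hhD : eLpNorm h 2 stdNormal ≤ ENNReal.ofReal D := by
    refine (eLpNorm_add_le m1 (m2.const_mul _) (by norm_num)).trans ?_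
    refine (add_le_add (n1.trans_le h1C) (eLpNorm_const_smul (β * K * (C' / c) : ℝ)
      (fun p : ℝ => (‖(p : ℂ) ^ 1‖ : ℂ)) 2 stdNormal).le).trans ?_
    rw [n2, ← ENNReal.ofReal_toReal hp.2.ne, ← ofReal_norm, Real.norm_of_nonneg (by positivity),
      ← ENNReal.ofReal_mul (by positivity), ← ENNReal.ofReal_add hC0 (by positivity)]
  obtain ⟨a1, a2⟩ := eLpNorm_comp_modeVel (β := β) hn (m1.add (m2.const_mul _)) hhD
  set s : ℝ := |twoCoeff N β V n| * (modeScale β n / ω.im) with hs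
  obtain ⟨c1, c2⟩ := eLpNorm_vec_two_le hw a1 (by positivity) hwT a2 (s : ℂ)
  have hle : ∀ v : Fin 2 → Vel d, ‖twoMode N β V g Dg ω n v‖
      ≤ ‖(s : ℂ) * (waveGrad β g Dg n (v 0) * h (modeVel β n (v 1)))‖ := fun v => by
    have hζ := im_add_ofReal_pos hz (modeVel β n (v 0))
    have hi := norm_inv_sub_le hζ (modeVel β n (v 1))
    have him : (z + modeVel β n (v 0)).im⁻¹ = modeScale β n / ω.im := by
      rw [add_im, ofReal_im, add_zero, hzd, div_ofReal_im, inv_div]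
    rw [him] at hi
    simp only [twoMode, hn, if_false]
    rw [norm_mul, norm_mul, norm_mul (_ - _), norm_mul, norm_mul (waveGrad _ _ _ _ _), hhn, norm_real,
      norm_real, Real.norm_eq_abs, Real.norm_of_nonneg (by positivity), hs]
    have hsub : ‖corrMean α z (modeVel β n (v 1)) - β * potHat V n * modeVel β n (v 1) *
        screened N β V ω n (v 0)‖ ≤ ‖corrMean α z (modeVel β n (v 1))‖
        + β * K * (C' / c) * |modeVel β n (v 1)| := by
      refine (norm_sub_le _ _).trans (add_le_add le_rfl ?_)
      rw [norm_mul, norm_mul, norm_mul, norm_real, norm_real, norm_real, Real.norm_of_nonneg hb.le,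
        Real.norm_of_nonneg hVn, Real.norm_eq_abs]
      calc _ ≤ β * K * |modeVel β n (v 1)| * (C' / c) := by gcongr; exact hscr _
        _ = _ := by ring
    calc _ ≤ |twoCoeff N β V n| * (‖waveGrad β g Dg n (v 0)‖ * ((‖corrMean α z (modeVel β n (v 1))‖
        + β * K * (C' / c) * |modeVel β n (v 1)|) * (modeScale β n / ω.im))) := by gcongr
      _ = _ := by ring
  have hm : AEStronglyMeasurable (twoMode N β V g Dg ω n) (𝔙 2) := by
    have hv : ∀ j : Fin 2, Measurable fun v : Fin 2 → Vel d => modeVel β n (v j) := fun j =>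
      (continuous_modeVel β n).measurable.comp (measurable_pi_apply j)
    have hvc : ∀ j : Fin 2, StronglyMeasurable fun v : Fin 2 → Vel d => (modeVel β n (v j) : ℂ) :=
      fun j => (measurable_ofReal.comp (hv j)).stronglyMeasurable
    have b1 := ((stronglyMeasurable_corrMean α z).comp_measurable (hv 1)).sub
      (((hvc 1).const_mul (β * potHat V n : ℂ)).mul ((stronglyMeasurable_corrCauchy_div α
        (β * potHat V n) hz).comp_measurable (hv 0)))
    have b2 : StronglyMeasurable fun v : Fin 2 → Vel d =>
        ((modeVel β n (v 1) : ℂ) - (z + modeVel β n (v 0)))⁻¹ :=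
      ((hvc 1).sub ((hvc 0).const_add z)).measurable.inv.stronglyMeasurable
    refine (((hw.1.comp_measurePreserving (measurePreserving_eval _ 0)).mul
      (b1.mul b2).aestronglyMeasurable).const_mul (twoCoeff N β V n : ℂ)).congr
      (ae_of_all _ fun v => ?_)
    simp only [twoMode, hn, if_false]
    rfl
  refine ⟨c1.of_le hm (ae_of_all _ hle), (eLpNorm_mono hle).trans (c2.trans
    (ENNReal.ofReal_le_ofReal ?_))⟩
  obtain ⟨f1, f2⟩ := fraction_mem hN
  have hs1 : s ≤ β * K / ω.im * potHat V n := by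
    rw [hs, twoCoeff, abs_neg, abs_div, abs_of_pos hsc, abs_mul, abs_mul, abs_of_nonneg f1,
      abs_of_nonneg hVn]
    calc _ = ((N : ℝ) - 1) / N * potHat V n * |corrCoeff N β V n| / ω.im := by field_simp
      _ ≤ 1 * potHat V n * (β * K) / ω.im := by
        gcongr
        exact (abs_corrCoeff_le hb hN hV n).trans (by gcongr)
      _ = _ := by ring
  rw [norm_real, Real.norm_of_nonneg (by positivity)]
  calc _ ≤ β * K / ω.im * potHat V n * (‖waveVec n‖ * T * D) := by gcongr
    _ = _ := by ring

lemma memL2_one_of_memLp {R : (Fin 2 → Phase d) → ℂ} (hR : MemLp R 2 (𝔓 2)) :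
    MemL2 β 1 R := by
  refine ⟨hR, fun σ hσ => ?_⟩
  obtain rfl : σ = 1 := by revert σ; decide
  exact ae_of_all _ fun z => rfl

/-- The field whose twisted divergence is the space average of the mean of the two-particle
correlation. -/
def corrField (N : ℕ) (β : ℝ) (V : Torus d → ℝ) (g : Vel d → ℂ)
    (Dg : Vel d → ℂᵈ) (ω : ℂ) (n : ℤᵈ) (v : Vel d) : ℂ :=
  I * potHat V n * (twoCoeff N β V n * (waveGrad β g Dg n v * screened N β V ω n v))

lemma isPhaseTest_of_isVelTest {φ : Vel d → ℂ} (hφ : IsVelTest φ) :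
    IsPhaseTest fun z : Fin 1 → Phase d => φ (z 0).2 := by
  refine ⟨hφ.1.comp (f := fun y : Fin 1 → Vel d × Vel d => (y 0).2) (by fun_prop), ?_⟩
  refine HasCompactSupport.intro (K := univ.pi fun _ : Fin 1 => (univ : Set (Torus d)) ×ˢ tsupport φ)
    (isCompact_univ_pi fun _ => isCompact_univ.prod hφ.2) fun z hz => ?_
  refine image_eq_zero_of_notMem_tsupport fun h => hz fun j _ => ?_
  rw [Subsingleton.elim j 0]
  exact ⟨mem_univ _, h⟩

lemma exists_hasSum_update [Fact (0 < β)] {m : ℕ} {ι : Type*} [DecidableEq ι]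
    {κ : ι → Fin m → ℤᵈ} (hκ : Injective κ) {B : ι → (Fin m → Vel d) → ℂ}
    {c : ι → ℝ} (hc0 : ∀ i, 0 ≤ c i)
    (hB : ∀ i, MemLp (B i) 2 (𝔙 m) ∧
      eLpNorm (B i) 2 (𝔙 m) ≤ ENNReal.ofReal (c i))
    (hsum : Summable fun i => c i ^ 2) (i₀ : ι) {r : (Fin m → Vel d) → ℂ}
    (hr : MemLp r 2 (𝔙 m)) :
    (∀ i, MemLp (update B i₀ r i) 2 (𝔙 m)) ∧
    ∃ G : (Fin m → Phase d) → ℂ, MemLp G 2 (𝔓 m) ∧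
      ∀ W : (Fin m → Phase d) → ℂ, MemLp W 2 (𝔓 m) →
        HasSum (fun i => ∫ z, modeFun (κ i) (update B i₀ r i) z * W z ∂𝔓 m)
          (∫ z, G z * W z ∂𝔓 m) := by
  have h : ∀ i, MemLp (update B i₀ r i) 2 (𝔙 m) ∧
      eLpNorm (update B i₀ r i) 2 (𝔙 m) ≤ ENNReal.ofReal
        (update c i₀ (eLpNorm r 2 (𝔙 m)).toReal i) := fun i => by
    by_cases hi : i = i₀
    · subst hi
      simpa only [update_self] using ⟨hr, (ENNReal.ofReal_toReal hr.2.ne).ge⟩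
    · simpa only [update_of_ne hi] using hB i
  refine ⟨fun i => (h i).1, exists_hasSum_modeFun hκ (fun i => (h i).1) (fun i => ?_)
    (fun i => (h i).2) ?_⟩
  · by_cases hi : i = i₀
    · subst hi; simp
    · simpa only [update_of_ne hi] using hc0 i
  · refine (hsum.update i₀ ((eLpNorm r 2 (𝔙 m)).toReal ^ 2)).congr fun i => ?_
    by_cases hi : i = i₀
    · subst hi; simp
    · simp [hi]

lemma aestronglyMeasurable_corrField [hβ : Fact (0 < β)]
    (htg : MemLp (twistedGrad β g Dg) 2 ℳ) (hω : 0 < ω.im) (n : ℤᵈ) :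
    AEStronglyMeasurable (corrField N β V g Dg ω n) ℳ := by
  by_cases hn : n = 0
  · have : corrField N β V g Dg ω n = 0 := by
      funext v; simp [corrField, waveGrad, hn, waveVec_zero]
    rw [this]
    exact aestronglyMeasurable_zero
  have hz := (modeScale_ratio hβ.out hn hω).1
  exact (((memLp_waveGrad htg n).1.1.mul ((stronglyMeasurable_corrCauchy_div _ _ hz).comp_measurable
    (continuous_modeVel β n).measurable).aestronglyMeasurable).const_mul _).const_mul _

/-- Existence of the successive correlations, and the modes of their space average. -/
lemma exists_isThreeCorr [hβ : Fact (0 < β)] (hN : 1 ≤ N) (hV : IsPotential V DV K) (hg : IsH1 β g Dg)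
    (htg : MemLp (twistedGrad β g Dg) 2 ℳ) (hω : 0 < ω.im) :
    ∃ G₃ R G₂, IsThreeCorr N β DV g ω G₃ R G₂ ∧ ∀ φ : Vel d → ℂ, IsVelTest φ →
      HasSum (fun n => -∫ v, corrField N β V g Dg ω n v * fderiv ℝ φ v (waveVec n) ∂ℳ)
        (spaceAvgMean N β DV G₂ φ) := by
  obtain ⟨G₃, hG₃, hs₃⟩ := exists_resolvent_three hN hV hg.memLp hω
  obtain ⟨C₃, -, hC₃⟩ := exists_threeMode_bound hN hV hg.memLp hω
  obtain ⟨C, hC0, hC⟩ := exists_meanMode_bound hN hV hg.memLp htg hω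
  obtain ⟨C', hC'0, hC'⟩ := exists_twoMode_bound hN hV htg hω
  have hsum := (summable_sq_waveVec_mul_potHat hV.1 hV.even).1
  have hsum' : ∀ A : ℝ, Summable fun n => (A * (‖waveVec n‖ * potHat V n)) ^ 2 := fun A => by
    simpa only [mul_pow] using hsum.mul_left (A ^ 2)
  have hnn : ∀ A : ℝ, 0 ≤ A → ∀ n, 0 ≤ A * (‖waveVec n‖ * potHat V n) := fun A hA n =>
    mul_nonneg hA (mul_nonneg (norm_nonneg _) (hV.pos n))
  obtain ⟨r, hr, hrs⟩ := exists_hasSum_of_summable_eLpNorm (fun n => (hC n).2.1)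
    (fun n => mul_nonneg hC0 (by positivity)) (fun n => (hC n).2.2) (hsum.mul_left C)
  obtain ⟨hB₁, R, hR, hRs⟩ := exists_hasSum_update injective_waveTwo (hnn C hC0)
    (fun n => (hC n).1) (hsum' C) 0 hr
  have hω0 : ω ≠ 0 := fun h => by simp [h] at hω
  obtain ⟨hB₂, G₂, hG₂, hs₂⟩ := exists_hasSum_update injective_waveTwo (hnn C' hC'0) hC' (hsum' C') 0
    (hr.const_mul (-(I * ω)⁻¹))
  have hzero : waveTwo (0 : ℤᵈ) = 0 := by
    funext l; fin_cases l <;> simp [waveTwo]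
  have hmean : ∀ φ : (Fin 2 → Phase d) → ℂ, IsPhaseTest φ →
      meanPair N 1 β DV G₃ φ = ∫ z, R z * φ z ∂𝔓 2 := fun φ hφ => by
    have hφ2 := hφ.isBddTest.memLp (β := β)
    have hrest : ∀ ψ : (Fin 2 → Vel d) → ℂ, MemLp ψ 2 (𝔙 2) →
        ∫ z, modeFun 0 ψ z * φ z ∂𝔓 2
          = ∫ v, ψ v * modeProj 0 φ v ∂𝔙 2 := fun ψ hψ => by
      have h := integral_mul_modeFun 0 hφ2 hψ
      rw [neg_zero] at h
      simpa only [mul_comm] using h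
    have h1 := hasSum_meanPair (N := N) (m := 1) hV.measurable hV.le (fun n => (hC₃ n).1) hG₃.1.1 hs₃ hφ
    simp_rw [meanPair_threeMode hN hV hg htg hω _ hφ] at h1
    have h2 : HasSum (fun n => ∫ z, modeFun 0 (restMode N β V g ω n) z * φ z ∂𝔓 2)
        (∫ z, modeFun 0 r z * φ z ∂𝔓 2) := by
      rw [hrest r hr]
      exact (hrs _ (memLp_modeProj 0 hφ2)).congr_fun fun n => hrest _ (hC n).2.1
    have h3 := (h1.sub h2).update 0 (∫ z, modeFun 0 r z * φ z ∂𝔓 2)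
    refine (?_ : meanPair N 1 β DV G₃ φ = _).trans (h3.unique ((hRs φ hφ2).congr_fun fun n => ?_))
    · simp [meanMode, modeFun]
    · by_cases hn : n = 0
      · subst hn; simp [hzero]
      · simp [hn]
  refine ⟨G₃, R, G₂, ⟨hG₃, memL2_one_of_memLp hR, hmean, memL2_one_of_memLp hG₂, fun φ hφ => ?_⟩,
    fun φ hφ => ?_⟩
  · refine resolvent_of_modes hV hB₂ hB₁ hG₂ hs₂ hφ (hRs φ hφ.isBddTest.memLp)
      fun n v => ?_
    by_cases hn : n = 0
    · subst hn
      simp only [update_self]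
      rw [modeOp_two hN, hzero]
      simp only [Pi.zero_apply, waveVec_zero, inner_zero_left]
      field_simp
      simp
    · simp only [update_of_ne hn]
      exact twoMode_equation hN hV hω hn v
  · have hφ' := isPhaseTest_of_isVelTest hφ
    refine (hasSum_meanPair (N := N) (m := 0) hV.measurable hV.le hB₂ hG₂ hs₂ hφ').congr_fun fun n => ?_
    rw [meanPair_modeFun N hV _ _ hφ']
    have hlast : waveTwo n (Fin.last (0 + 1)) = n := rfl
    have hN0 : ((((N : ℝ) - (0 : ℕ)) / N : ℝ) : ℂ) = 1 := by
      have : (N : ℝ) ≠ 0 := by positivity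
      rw [Nat.cast_zero, sub_zero, div_self this, ofReal_one]
    have hvd : ∀ z : Fin 1 → Phase d, velDeriv 0 (waveVec n) (fun z => φ (z 0).2) z
        = fderiv ℝ φ (z 0).2 (waveVec n) := fun z => by
      have h1 : HasDerivAt (fun t : ℝ => (z 0).2 + t • waveVec n) (waveVec n) 0 := by
        simpa using ((hasDerivAt_id (0 : ℝ)).smul_const (waveVec n)).const_add (z 0).2
      have h2 : HasFDerivAt φ (fderiv ℝ φ (z 0).2) ((z 0).2 + (0 : ℝ) • waveVec n) := by
        simpa using (hφ.1.differentiable (by simp) (z 0).2).hasFDerivAt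
      simp only [velDeriv, update_self]
      exact (h2.comp_hasDerivAt 0 h1).deriv
    rw [hN0, Fin.sum_univ_one, hlast]
    simp_rw [hvd]
    by_cases hn : n = 0
    · subst hn; simp [waveVec_zero]
    have hk : (fun l : Fin 1 => waveTwo n l.castSucc) + Pi.single 0 n = 0 := by
      funext l; fin_cases l; simp [waveTwo]
    simp only [update_of_ne hn]
    have hi : ∀ v : Fin 1 → Vel d, ∫ s, twoMode N β V g Dg ω n (Fin.snoc (α := fun _ => Vel d) v s)
        ∂ℳ = twoCoeff N β V n * (waveGrad β g Dg n (v 0) * screened N β V ω n (v 0)) :=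
      fun v => by
        rw [← integral_twoMode hN hV hω hn]
        rfl
    simp_rw [hi]
    have hdφ : Continuous fun v => fderiv ℝ φ v (waveVec n) :=
      (hφ.1.continuous_fderiv (by simp)).clm_apply continuous_const
    have hp := measurePreserving_snd.comp (measurePreserving_eval_phase d β 1 0)
    have hm := (aestronglyMeasurable_corrField (N := N) (V := V) htg hω n).mul
      hdφ.aestronglyMeasurable
    rw [hk]
    conv_lhs => rw [← hp.map_eq, integral_map hp.measurable.aemeasurable (by rw [hp.map_eq]; exact hm)]
    rw [mul_assoc, ← integral_const_mul, neg_one_mul]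
    congr 1
    refine integral_congr_fun fun z => ?_
    simp [modeFun, corrField, velOf, torusChar_zero]
    ring

/-! ### The limiting field -/

/-- The wave vector as a complex vector. -/
def cWaveVec (n : ℤᵈ) : ℂᵈ := WithLp.toLp 2 fun i => (waveVec n i : ℂ)

lemma norm_cWaveVec (n : ℤᵈ) : ‖cWaveVec n‖ = ‖waveVec n‖ := by
  simp [cWaveVec, EuclideanSpace.norm_eq]

/-- The vector field with the longitudinal Fourier modes `u`. -/
def modeField (u : (ℤᵈ) → Vel d → ℂ) (v : Vel d) : ℂᵈ :=
  ∑' n, u n v • cWaveVec n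

lemma hasSum_modeField {u : (ℤᵈ) → Vel d → ℂ} {w : (ℤᵈ) → ℝ} (hw : Summable w)
    {h : ℝ} {v : Vel d} (hu : ∀ n, ‖u n v‖ * ‖waveVec n‖ ≤ w n * h) :
    HasSum (fun n => u n v • cWaveVec n) (modeField u v) ∧ ‖modeField u v‖ ≤ (∑' n, w n) * h := by
  have hs : Summable fun n => ‖u n v • cWaveVec n‖ :=
    (hw.mul_right h).of_nonneg_of_le (fun n => norm_nonneg _) fun n => by
      rw [norm_smul, norm_cWaveVec]; exact hu n
  refine ⟨hs.of_norm.hasSum, (norm_tsum_le_tsum_norm hs).trans ?_⟩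
  rw [← tsum_mul_right]
  exact hs.tsum_le_tsum (fun n => by rw [norm_smul, norm_cWaveVec]; exact hu n) (hw.mul_right h)

lemma aestronglyMeasurable_modeField {u : (ℤᵈ) → Vel d → ℂ} {μ : Measure (Vel d)}
    (hm : ∀ n, AEStronglyMeasurable (u n) μ)
    (hs : ∀ v, HasSum (fun n => u n v • cWaveVec n) (modeField u v)) :
    AEStronglyMeasurable (modeField u) μ :=
  aestronglyMeasurable_of_tendsto_ae atTop (f := fun (s : Finset (ℤᵈ)) v =>
    ∑ n ∈ s, u n v • cWaveVec n)
    (fun s => Finset.aestronglyMeasurable_fun_sum s fun n _ => (hm n).smul_const _)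
    (ae_of_all _ fun v => hs v)

lemma modeField_apply {u : (ℤᵈ) → Vel d → ℂ} {v : Vel d}
    (hs : HasSum (fun n => u n v • cWaveVec n) (modeField u v)) (i : Fin d) :
    HasSum (fun n => u n v * waveVec n i) (modeField u v i) :=
  ((EuclideanSpace.proj (𝕜 := ℂ) i).hasSum hs).congr_fun fun n => by simp [cWaveVec]

/-- The ratio `J / ε` on the closed upper half plane. -/
def gaussRatio (γ : ℝ) (z : ℂ) : ℂ := gaussJ z / gaussEps γ z

lemma continuousOn_gaussRatio (hγ : 0 ≤ γ) : ContinuousOn (gaussRatio γ) {z | 0 ≤ z.im} :=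
  continuousOn_gaussJ.div (continuousOn_const.add (continuousOn_const.mul continuousOn_gaussK))
    fun _ hz => gaussEps_ne_zero hγ hz

lemma gaussJ_neg_ofReal (x : ℝ) : gaussJ (-x) = -conj (gaussJ x) := by
  rw [gaussJ, gaussJ, gaussCauchy, gaussCauchy, map_mul, conj_I, neg_mul, neg_neg, ← integral_conj]
  congr 2
  funext t
  rw [map_mul, ← exp_conj, gaussMoment_zero, conj_ofReal]
  simp

lemma gaussEps_neg_ofReal (γ x : ℝ) : gaussEps γ (-x) = conj (gaussEps γ x) := by
  rw [gaussEps, gaussEps, gaussK, gaussK, gaussJ_neg_ofReal]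
  simp

lemma gaussRatio_neg_ofReal (γ x : ℝ) :
    gaussRatio γ (-x) = -conj (gaussRatio γ x) := by
  rw [gaussRatio, gaussRatio, gaussJ_neg_ofReal, gaussEps_neg_ofReal, map_div₀, neg_div]

lemma gaussRatio_im (x : ℝ) :
    (gaussRatio γ x).im = (1 + γ) * (gaussJ x).im / ‖gaussEps γ x‖ ^ 2 := by
  have h : gaussJ x * conj (gaussEps γ x)
      = (1 + γ) * gaussJ x + (γ * x * normSq (gaussJ x) : ℝ) := by
    rw [gaussEps, gaussK]
    simp only [map_add, map_mul, map_one, conj_ofReal]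
    push_cast
    rw [← mul_conj]
    ring
  rw [gaussRatio, div_eq_mul_inv, inv_def, ← mul_assoc, h, ← normSq_eq_norm_sq]
  have e : ((1 : ℂ) + γ) = ((1 + γ : ℝ) : ℂ) := by push_cast; ring
  rw [e, im_mul_ofReal, add_im, ofReal_im, im_ofReal_mul]
  ring

/-- The amplitude of the mode `n` of the diffusion tensor. -/
def diffCoeff (N : ℕ) (β : ℝ) (V : Torus d → ℝ) (n : ℤᵈ) : ℝ :=
  potHat V n * twoCoeff N β V n

lemma diffCoeff_bound (hβ : 0 < β) (hN : 1 ≤ N) (hV : IsPotential V DV K) (n : ℤᵈ) :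
    |diffCoeff N β V n| * ‖waveVec n‖ ^ 2
      ≤ β * K * √β * (‖waveVec n‖ ^ 2 * potHat V n ^ 2) := by
  by_cases hn : n = 0
  · simp [hn, waveVec_zero]
  obtain ⟨f1, f2⟩ := fraction_mem hN
  have hVn := hV.pos n
  have hVK := hV.potHat_le n
  have hK := hV.nonneg
  have hs := Real.sqrt_pos.2 hβ
  have hk := one_le_norm_waveVec hn
  have hc : (modeScale β n)⁻¹ ≤ √β := by
    rw [modeScale, inv_div]
    exact div_le_self hs.le hk
  have hc0 := modeScale_pos hβ hn
  have h : |diffCoeff N β V n| ≤ β * K * √β * potHat V n ^ 2 := by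
    rw [diffCoeff, twoCoeff, abs_mul, abs_neg, abs_div, abs_of_pos hc0, abs_mul, abs_mul,
      abs_of_nonneg f1, abs_of_nonneg hVn, div_eq_mul_inv]
    calc _ ≤ potHat V n * (1 * potHat V n * (β * K) * √β) := by
          gcongr
          exact (abs_corrCoeff_le hβ hN hV n).trans (by gcongr)
      _ = _ := by ring
  calc _ ≤ β * K * √β * potHat V n ^ 2 * ‖waveVec n‖ ^ 2 := by gcongr
    _ = _ := by ring

lemma diffCoeff_neg (heven : ∀ᵐ x ∂𝔗, V (-x) = V x) (n : ℤᵈ) :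
    diffCoeff N β V (-n) = diffCoeff N β V n := by
  simp only [diffCoeff, twoCoeff, corrCoeff, meanCoupling, potHat_neg heven, modeScale_neg]

lemma tensorTerm_eq (hβ : 0 < β) (hN : 1 ≤ N) (hpos : ∀ n, 0 ≤ potHat V n) (v : Vel d) (i l : Fin d)
    (n : ℤᵈ) : tensorTerm N β V v i l n = diffCoeff N β V n *
      (gaussRatio (β * potHat V n) (modeVel β n v)).im * (waveVec n i * waveVec n l) := by
  by_cases hn : n = 0
  · simp [tensorTerm, hn, waveVec_zero]
  have hN0 : (N : ℝ) ≠ 0 := by positivity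
  have e1 : (((N : ℝ) + 1 - (1 : ℕ)) / N) * β * potHat V n = β * potHat V n := by
    rw [Nat.cast_one, add_sub_cancel_right, div_self hN0, one_mul]
  rw [tensorTerm, dispersionBdry_eq hβ V hn, e1, mul_right_comm π, deltaAvg_eq hβ hn,
    gaussRatio_im, ← modeVel, diffCoeff, twoCoeff, corrCoeff, meanCoupling]
  ring

lemma norm_mul_waveGrad_le (hβ : 0 < β) (hN : 1 ≤ N) (hV : IsPotential V DV K) (n : ℤᵈ) (v : Vel d) {q : ℂ} {M : ℝ} (hq : ‖q‖ ≤ M) :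
    ‖diffCoeff N β V n * (waveGrad β g Dg n v * q)‖ * ‖waveVec n‖
      ≤ β * K * √β * (‖waveVec n‖ ^ 2 * potHat V n ^ 2) * M * ‖twistedGrad β g Dg v‖ := by
  have h := diffCoeff_bound hβ hN hV n
  have hM := (norm_nonneg q).trans hq
  have hw := norm_waveGrad_le (β := β) (g := g) (Dg := Dg) n v
  rw [norm_mul, norm_mul, norm_real, Real.norm_eq_abs]
  calc _ ≤ |diffCoeff N β V n| * (‖waveVec n‖ * ‖twistedGrad β g Dg v‖ * M) * ‖waveVec n‖ := by gcongr
    _ = |diffCoeff N β V n| * ‖waveVec n‖ ^ 2 * M * ‖twistedGrad β g Dg v‖ := by ring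
    _ ≤ _ := by gcongr

/-- The modes of the limiting field. -/
def limitMode (N : ℕ) (β : ℝ) (V : Torus d → ℝ) (g : Vel d → ℂ)
    (Dg : Vel d → ℂᵈ) (n : ℤᵈ) (v : Vel d) : ℂ :=
  diffCoeff N β V n * (waveGrad β g Dg n v * (I * gaussRatio (β * potHat V n) (modeVel β n v)))

/-- A uniform bound for the ratios entering the fields. -/
lemma exists_ratio_bound (hβ : 0 < β) (hK : 0 ≤ K) : ∃ M : ℝ, 0 ≤ M ∧
    (∀ γ, 0 ≤ γ → γ ≤ β * K → ∀ z : ℂ, 0 ≤ z.im → ‖gaussRatio γ z‖ ≤ M) ∧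
    ∀ α γ, 0 ≤ α → α ≤ β * K → 0 ≤ γ → γ ≤ β * K → ∀ z ζ : ℂ, 0 < z.im → 0 < ζ.im →
      ‖corrCauchy α z ζ / gaussEps γ ζ‖ ≤ M ∧
      ‖corrCauchy α z ζ / gaussEps γ ζ - gaussRatio γ ζ‖ ≤ M * ‖z‖ := by
  obtain ⟨C, hC0, hC⟩ := exists_norm_integral_corrMean_le (β * K)
  obtain ⟨c, hc0, hc⟩ := exists_le_norm_gaussEps (β * K)
  refine ⟨(C + 20) / c, by positivity, fun γ h0 h1 z hz => ?_,
    fun α γ a0 a1 h0 h1 z ζ hz hζ => ⟨?_, ?_⟩⟩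
  · rw [gaussRatio, norm_div]
    exact div_le_div₀ (by positivity) ((norm_gaussJ_le hz).trans (by linarith)) hc0 (hc γ h0 h1 z hz)
  · rw [norm_div]
    exact div_le_div₀ (by positivity) ((hC α a0 a1 z ζ hz hζ).2.trans (by linarith)) hc0
      (hc γ h0 h1 ζ hζ.le)
  · rw [gaussRatio, ← sub_div, norm_div, div_mul_eq_mul_div]
    refine div_le_div₀ (by positivity) ((hC α a0 a1 z ζ hz hζ).1.trans ?_) hc0 (hc γ h0 h1 ζ hζ.le)
    gcongr
    linarith

lemma beta_potHat_mem (hβ : 0 < β) (hV : IsPotential V DV K)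
    (n : ℤᵈ) : 0 ≤ β * potHat V n ∧ β * potHat V n ≤ β * K :=
  ⟨mul_nonneg hβ.le (hV.pos n),
    mul_le_mul_of_nonneg_left (hV.potHat_le n) hβ.le⟩

lemma summable_weight (hV : IsPotential V DV K) (M : ℝ) :
    Summable fun n => β * K * √β * (‖waveVec n‖ ^ 2 * potHat V n ^ 2) * M :=
  ((summable_sq_waveVec_mul_potHat hV.1 hV.even).1.mul_left _).mul_right M

lemma summable_tensorTerm (hβ : 0 < β) (hN : 1 ≤ N) (hV : IsPotential V DV K) (v : Vel d)
    (i l : Fin d) : Summable (tensorTerm N β V v i l) := by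
  obtain ⟨M, hM0, hM, -⟩ := exists_ratio_bound hβ hV.nonneg
  refine .of_norm <| (summable_weight (β := β) hV M).of_nonneg_of_le (fun n => norm_nonneg _) fun n => ?_
  obtain ⟨h0, h1⟩ := beta_potHat_mem hβ hV n
  have hq := (abs_im_le_norm _).trans (hM _ h0 h1 (modeVel β n v) (by simp))
  have h := diffCoeff_bound hβ hN hV n
  rw [tensorTerm_eq hβ hN hV.pos, norm_mul, norm_mul, norm_mul, Real.norm_eq_abs, Real.norm_eq_abs]
  have b1 := PiLp.norm_apply_le (waveVec n) i
  have b2 := PiLp.norm_apply_le (waveVec n) l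
  calc _ ≤ |diffCoeff N β V n| * M * (‖waveVec n‖ * ‖waveVec n‖) := by gcongr
    _ = |diffCoeff N β V n| * ‖waveVec n‖ ^ 2 * M := by ring
    _ ≤ _ := by gcongr

/-- The limiting field is the superposition of its modes. -/
lemma limitField_eq (hβ : 0 < β) (hN : 1 ≤ N) (hV : IsPotential V DV K) (v : Vel d) :
    limitField N β V g Dg v = -modeField (limitMode N β V g Dg) v ∧
      HasSum (fun n => limitMode N β V g Dg n v • cWaveVec n)
        (modeField (limitMode N β V g Dg) v) := by
  obtain ⟨M, hM0, hM, -⟩ := exists_ratio_bound hβ hV.nonneg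
  have hs := (hasSum_modeField (u := limitMode N β V g Dg) (v := v) (summable_weight (β := β) hV M)
    (fun n => norm_mul_waveGrad_le hβ hN hV n v (by
      obtain ⟨h0, h1⟩ := beta_potHat_mem hβ hV n
      rw [norm_mul, norm_I, one_mul]; exact hM _ h0 h1 _ (by simp)))).1
  refine ⟨?_, hs⟩
  ext i
  have h1 := modeField_apply hs i
  have h2 := h1.add ((Equiv.neg _).hasSum_iff.2 h1)
  have h3 : HasSum (fun n => ∑ l, (tensorTerm N β V v i l n : ℂ) * twistedGrad β g Dg v l)
      (limitField N β V g Dg v i) :=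
    hasSum_sum fun l _ => (ofRealCLM.hasSum
      (summable_tensorTerm hβ hN hV v i l).hasSum).mul_right _
  have h4 := (h3.mul_left (-2)).unique (h2.congr_fun fun n => ?_)
  · rw [PiLp.neg_apply]
    linear_combination -(1 / 2 : ℂ) * h4
  · have e : (gaussRatio (β * potHat V n) (modeVel β n v) -
        conj (gaussRatio (β * potHat V n) (modeVel β n v)))
        = 2 * I * (gaussRatio (β * potHat V n) (modeVel β n v)).im := by
      rw [sub_conj]; push_cast; ring
    simp only [comp_apply, Equiv.neg_apply, limitMode, diffCoeff_neg hV.even, modeVel_neg,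
      potHat_neg hV.even, waveGrad, waveVec_neg, PiLp.neg_apply, ofReal_neg, gaussRatio_neg_ofReal,
      tensorTerm_eq hβ hN hV.pos, neg_mul, Finset.sum_neg_distrib]
    push_cast
    have e2 : ∑ l, (diffCoeff N β V n : ℂ) * (gaussRatio (β * potHat V n) (modeVel β n v)).im *
        (waveVec n i * waveVec n l) * twistedGrad β g Dg v l
        = diffCoeff N β V n * (gaussRatio (β * potHat V n) (modeVel β n v)).im * waveVec n i *
          ∑ l, (waveVec n l : ℂ) * twistedGrad β g Dg v l := by
      rw [mul_sum]
      exact sum_congr rfl fun l _ => by ring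
    rw [e2]
    linear_combination (norm := skip) -(diffCoeff N β V n : ℂ) * I * waveVec n i *
      (∑ l, (waveVec n l : ℂ) * twistedGrad β g Dg v l) * e
    ring_nf
    simp only [I_sq]
    ring

/-! ### The field of the two-particle correlation and its limit -/

/-- The summable weights of the modes. -/
def modeWeight (β K : ℝ) (V : Torus d → ℝ) (n : ℤᵈ) : ℝ :=
  β * K * √β * (‖waveVec n‖ ^ 2 * potHat V n ^ 2)

lemma corrField_eq (n : ℤᵈ) (v : Vel d) : corrField N β V g Dg ω n v
    = diffCoeff N β V n * (waveGrad β g Dg n v * (I * screened N β V ω n v)) := by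
  rw [corrField, diffCoeff]
  push_cast
  ring

lemma norm_fderiv_le (φ : Vel d → ℂ) (F : ℂᵈ) (v : Vel d) :
    ‖∑ i, F i * velPartial φ i v‖ ≤ ‖F‖ * √(∑ i, ‖velPartial φ i v‖ ^ 2) := by
  refine (norm_sum_le _ _).trans ?_
  simp_rw [norm_mul]
  rw [EuclideanSpace.norm_eq]
  exact Real.sum_mul_le_sqrt_mul_sqrt _ _ _

lemma IsVelTest.bounded_grad {φ : Vel d → ℂ} (hφ : IsVelTest φ) :
    Continuous (fun v => √(∑ i, ‖velPartial φ i v‖ ^ 2)) ∧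
    (∀ i, Continuous (velPartial φ i)) ∧ ∃ C : ℝ, ∀ v, √(∑ i, ‖velPartial φ i v‖ ^ 2) ≤ C := by
  have h1 : ∀ i, Continuous (velPartial φ i) := fun i =>
    (hφ.1.continuous_fderiv (by simp)).clm_apply continuous_const
  have h2 : Continuous (fun v => √(∑ i, ‖velPartial φ i v‖ ^ 2)) := by fun_prop
  refine ⟨h2, h1, ?_⟩
  have h3 : HasCompactSupport fun v => √(∑ i, ‖velPartial φ i v‖ ^ 2) := by
    refine (hφ.2.fderiv (𝕜 := ℝ)).mono fun v hv => ?_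
    contrapose! hv
    rw [Function.notMem_support] at hv ⊢
    simp [velPartial, hv]
  obtain ⟨C, hC⟩ := h3.exists_bound_of_continuous h2
  exact ⟨C, fun v => (le_abs_self _).trans (hC v)⟩

/-- The twisted divergence of a superposition of modes. -/
lemma hasSum_twistedDiv [Fact (0 < β)] {u : (ℤᵈ) → Vel d → ℂ}
    (hm : ∀ n, AEStronglyMeasurable (u n) ℳ) {w : (ℤᵈ) → ℝ} (hw : Summable w)
    {h : Vel d → ℝ} (hh : Integrable h ℳ)
    (hu : ∀ n v, ‖u n v‖ * ‖waveVec n‖ ≤ w n * h v) {φ : Vel d → ℂ} (hφ : IsVelTest φ) :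
    HasSum (fun n => -∫ v, u n v * fderiv ℝ φ v (waveVec n) ∂ℳ)
      (twistedDiv β (modeField u) φ) := by
  obtain ⟨hc, hci, C, hC⟩ := hφ.bounded_grad
  have hs := fun v => (hasSum_modeField hw fun n => hu n v).1
  have hdφ : ∀ n, Continuous fun v => fderiv ℝ φ v (waveVec n) := fun n =>
    (hφ.1.continuous_fderiv (by simp)).clm_apply continuous_const
  set D : Vel d → ℝ := fun v => √(∑ i, ‖velPartial φ i v‖ ^ 2)
  have hm' : ∀ n, AEStronglyMeasurable (fun v => u n v * fderiv ℝ φ v (waveVec n)) ℳ :=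
    fun n => (hm n).mul (hdφ n).aestronglyMeasurable
  have hb : ∀ n v, ‖u n v * fderiv ℝ φ v (waveVec n)‖ ≤ w n * (h v * D v) := fun n v => by
    have h1 := norm_fderiv_le φ (cWaveVec n) v
    rw [norm_cWaveVec] at h1
    rw [fderiv_apply_eq_sum, norm_mul, ← mul_assoc]
    refine (mul_le_mul_of_nonneg_left h1 (norm_nonneg _)).trans ?_
    rw [← mul_assoc]
    exact mul_le_mul_of_nonneg_right (hu n v) (Real.sqrt_nonneg _)
  have hi : Integrable (fun v => ∑' n, w n * (h v * D v)) ℳ := by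
    simp_rw [tsum_mul_right]
    exact (hh.mul_bdd hc.aestronglyMeasurable (ae_of_all _ fun v => by
      rw [Real.norm_of_nonneg (Real.sqrt_nonneg _)]; exact hC v)).const_mul _
  have hl : ∀ v, HasSum (fun n => u n v * fderiv ℝ φ v (waveVec n))
      (∑ i, modeField u v i * velPartial φ i v) := fun v => by
    refine (hasSum_sum fun i _ => (modeField_apply (hs v) i).mul_right (velPartial φ i v)).congr_fun
      fun n => ?_
    rw [fderiv_apply_eq_sum, mul_sum]
    exact sum_congr rfl fun i _ => by ring
  exact (hasSum_integral_of_dominated_convergence (fun n v => w n * (h v * D v)) hm'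
    (fun n => ae_of_all _ (hb n)) (ae_of_all _ fun v => hw.mul_right (h v * D v)) hi
    (ae_of_all _ hl)).neg

lemma norm_twistedDiv_le [Fact (0 < β)] {F : Vel d → ℂᵈ} {h : Vel d → ℝ}
    (hh : MemLp h 2 ℳ) (hF : ∀ v, ‖F v‖ ≤ h v) {ε : ℝ} (hε : 0 ≤ ε)
    (hhε : ∫ v, h v ^ 2 ∂ℳ ≤ ε ^ 2) {φ : Vel d → ℂ} (hφ : IsVelTest φ) :
    ‖twistedDiv β F φ‖ ≤ ε * h1Norm β φ := by
  obtain ⟨hc, hci, C, hC⟩ := hφ.bounded_grad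
  set D : Vel d → ℝ := fun v => √(∑ i, ‖velPartial φ i v‖ ^ 2) with hD
  have hD2 : MemLp D 2 ℳ := MemLp.of_bound hc.aestronglyMeasurable C
    (ae_of_all _ fun v => by rw [Real.norm_of_nonneg (Real.sqrt_nonneg _)]; exact hC v)
  have h0 : ∀ v, 0 ≤ h v := fun v => (norm_nonneg _).trans (hF v)
  have hcs := integral_mul_le_Lp_mul_Lq_of_nonneg (μ := ℳ) (f := h) (g := D)
    Real.HolderConjugate.two_two (ae_of_all _ h0) (ae_of_all _ fun v => Real.sqrt_nonneg _)
    (by simpa using hh) (by simpa using hD2)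
  simp only [Real.rpow_two] at hcs
  rw [← Real.sqrt_eq_rpow, ← Real.sqrt_eq_rpow] at hcs
  rw [twistedDiv, norm_neg]
  refine (norm_integral_le_of_norm_le (hh.integrable_mul hD2) (ae_of_all _ fun v =>
    (norm_fderiv_le φ (F v) v).trans (mul_le_mul_of_nonneg_right (hF v) (Real.sqrt_nonneg _)))).trans
    (hcs.trans (mul_le_mul ((Real.sqrt_le_sqrt hhε).trans_eq (Real.sqrt_sq hε)) ?_
    (Real.sqrt_nonneg _) hε))
  obtain ⟨C', hC'⟩ := hφ.2.exists_bound_of_continuous hφ.1.continuous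
  have hφ2 : MemLp φ 2 ℳ :=
    MemLp.of_bound hφ.1.continuous.aestronglyMeasurable C' (ae_of_all _ hC')
  refine Real.sqrt_le_sqrt (integral_mono hD2.integrable_sq ?_ fun v => ?_)
  · have e : ∀ v, ∑ i, ‖velPartial φ i v‖ ^ 2 = D v ^ 2 := fun v =>
      (Real.sq_sqrt (by positivity)).symm
    simp_rw [e]
    exact hφ2.norm.integrable_sq.add hD2.integrable_sq
  · simp only [hD]
    rw [Real.sq_sqrt (by positivity)]
    exact le_add_of_nonneg_left (by positivity)

/-- The deviation of the mode `n` of the field from its limit. -/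
def errTerm (β : ℝ) (V : Torus d → ℝ) (M : ℝ) (ω : ℂ) (v : Vel d) (n : ℤᵈ) : ℝ :=
  M * (√β * ‖ω‖) + ‖gaussRatio (β * potHat V n) (ω / modeScale β n + modeVel β n v)
    - gaussRatio (β * potHat V n) (modeVel β n v)‖

lemma im_phase_nonneg (hβ : 0 < β) (hω : 0 < ω.im) (n : ℤᵈ) (v : Vel d) :
    0 ≤ (ω / modeScale β n + modeVel β n v).im := by
  have : 0 ≤ modeScale β n := by unfold modeScale; positivity
  rw [add_im, ofReal_im, add_zero, div_ofReal_im]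
  positivity

lemma errTerm_le (hβ : 0 < β) (hV : IsPotential V DV K) {M : ℝ}
    (hM : ∀ γ, 0 ≤ γ → γ ≤ β * K → ∀ z : ℂ, 0 ≤ z.im → ‖gaussRatio γ z‖ ≤ M) (hω : 0 < ω.im)
    (v : Vel d) (n : ℤᵈ) : errTerm β V M ω v n ≤ M * (√β * ‖ω‖) + (M + M) := by
  obtain ⟨h0, h1⟩ := beta_potHat_mem hβ hV n
  exact add_le_add le_rfl ((norm_sub_le _ _).trans (add_le_add
    (hM _ h0 h1 _ (im_phase_nonneg hβ hω n v)) (hM _ h0 h1 _ (by simp))))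

lemma errTerm_nonneg {M : ℝ} (hM : 0 ≤ M) (v : Vel d) (n : ℤᵈ) : 0 ≤ errTerm β V M ω v n := by
  unfold errTerm; positivity

lemma modeWeight_nonneg (hβ : 0 < β) (hV : IsW1Infty V DV K) (n : ℤᵈ) :
    0 ≤ modeWeight β K V n := by
  have := hV.nonneg
  unfold modeWeight
  positivity

lemma tendsto_errSum (hβ : 0 < β) (hV : IsPotential V DV K) {M : ℝ} (hM0 : 0 ≤ M)
    (hM : ∀ γ, 0 ≤ γ → γ ≤ β * K → ∀ z : ℂ, 0 ≤ z.im → ‖gaussRatio γ z‖ ≤ M) (v : Vel d) :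
    Tendsto (fun ω => ∑' n, modeWeight β K V n * errTerm β V M ω v n) (𝓝[{ω : ℂ | 0 < ω.im}] 0)
      (𝓝 0) := by
  suffices h : Tendsto (fun ω => ∑' n, modeWeight β K V n * errTerm β V M ω v n)
    (𝓝[{ω : ℂ | 0 < ω.im}] 0) (𝓝 (∑' _ : ℤᵈ, 0)) by simpa using h
  refine tendsto_tsum_of_dominated_convergence
    (summable_weight (β := β) hV (M * (√β * 1) + (M + M))) (fun n => ?_) ?_
  · have hmaps : Tendsto (fun ω : ℂ => ω / modeScale β n + modeVel β n v)
        (𝓝[{ω : ℂ | 0 < ω.im}] 0) (𝓝[{z : ℂ | 0 ≤ z.im}] (modeVel β n v : ℂ)) := by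
      refine tendsto_nhdsWithin_iff.2 ⟨?_, eventually_mem_nhdsWithin.mono fun ω hω =>
        im_phase_nonneg hβ hω n v⟩
      have : Continuous fun ω : ℂ => ω / modeScale β n + modeVel β n v := by fun_prop
      simpa using this.continuousAt.tendsto.mono_left (nhdsWithin_le_nhds (a := (0 : ℂ)))
    have h1 := ((continuousOn_gaussRatio (beta_potHat_mem hβ hV n).1) (modeVel β n v : ℂ)
      (by simp)).tendsto.comp hmaps
    have h2 : Tendsto (fun ω : ℂ => M * (√β * ‖ω‖)) (𝓝[{ω : ℂ | 0 < ω.im}] 0) (𝓝 0) := by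
      have : Continuous fun ω : ℂ => M * (√β * ‖ω‖) := by fun_prop
      simpa using this.continuousAt.tendsto.mono_left (nhdsWithin_le_nhds (a := (0 : ℂ)))
    simpa [errTerm] using ((h2.add (tendsto_iff_norm_sub_tendsto_zero.1 h1)).const_mul
      (modeWeight β K V n))
  · have hball : ∀ᶠ ω : ℂ in 𝓝[{ω : ℂ | 0 < ω.im}] 0, ‖ω‖ < 1 :=
      nhdsWithin_le_nhds ((continuous_norm.tendsto (0 : ℂ)).eventually_lt_const (by simp))
    filter_upwards [eventually_mem_nhdsWithin, hball] with ω hω h1 n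
    rw [Real.norm_of_nonneg (mul_nonneg (modeWeight_nonneg hβ hV.1 n) (errTerm_nonneg hM0 v n))]
    refine mul_le_mul_of_nonneg_left ((errTerm_le hβ hV hM hω v n).trans ?_)
      (modeWeight_nonneg hβ hV.1 n)
    gcongr

lemma errSum_bound (hβ : 0 < β) (hV : IsPotential V DV K) {M : ℝ} (hM0 : 0 ≤ M)
    (hM : ∀ γ, 0 ≤ γ → γ ≤ β * K → ∀ z : ℂ, 0 ≤ z.im → ‖gaussRatio γ z‖ ≤ M) (hω : 0 < ω.im) :
    Continuous (fun v => ∑' n, modeWeight β K V n * errTerm β V M ω v n) ∧ ∀ v,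
      0 ≤ ∑' n, modeWeight β K V n * errTerm β V M ω v n ∧
      Summable (fun n => modeWeight β K V n * errTerm β V M ω v n) ∧
      ∑' n, modeWeight β K V n * errTerm β V M ω v n
        ≤ ∑' n, modeWeight β K V n * (M * (√β * ‖ω‖) + (M + M)) := by
  have hw := summable_weight (β := β) hV (M * (√β * ‖ω‖) + (M + M))
  have h0 : ∀ v n, 0 ≤ modeWeight β K V n * errTerm β V M ω v n := fun v n =>
    mul_nonneg (modeWeight_nonneg hβ hV.1 n) (errTerm_nonneg hM0 v n)
  have hle : ∀ v n, modeWeight β K V n * errTerm β V M ω v n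
      ≤ modeWeight β K V n * (M * (√β * ‖ω‖) + (M + M)) := fun v n =>
    mul_le_mul_of_nonneg_left (errTerm_le hβ hV hM hω v n) (modeWeight_nonneg hβ hV.1 n)
  refine ⟨continuous_tsum (fun n => ?_) hw fun n v => ?_, fun v => ?_⟩
  · have hr := continuousOn_gaussRatio (beta_potHat_mem hβ hV n).1
    have hp := continuous_modeVel β n
    have h1 : Continuous fun v => gaussRatio (β * potHat V n) (ω / modeScale β n + modeVel β n v) :=
      hr.comp_continuous (by fun_prop) fun v => im_phase_nonneg hβ hω n v
    have h2 : Continuous fun v => gaussRatio (β * potHat V n) (modeVel β n v) :=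
      hr.comp_continuous (by fun_prop) fun v => by simp
    unfold errTerm
    fun_prop
  · rw [Real.norm_of_nonneg (h0 v n)]
    exact hle v n
  · have hs := hw.of_nonneg_of_le (h0 v) (hle v)
    exact ⟨tsum_nonneg (h0 v), hs, hs.tsum_le_tsum (hle v) hw⟩

lemma tendsto_integral_errSum [hβ : Fact (0 < β)] (hV : IsPotential V DV K) {M : ℝ} (hM0 : 0 ≤ M)
    (hM : ∀ γ, 0 ≤ γ → γ ≤ β * K → ∀ z : ℂ, 0 ≤ z.im → ‖gaussRatio γ z‖ ≤ M)
    (htg : MemLp (twistedGrad β g Dg) 2 ℳ) :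
    Tendsto (fun ω => ∫ v, ((∑' n, modeWeight β K V n * errTerm β V M ω v n) *
      ‖twistedGrad β g Dg v‖) ^ 2 ∂ℳ) (𝓝[{ω : ℂ | 0 < ω.im}] 0) (𝓝 0) := by
  have hball : ∀ᶠ ω : ℂ in 𝓝[{ω : ℂ | 0 < ω.im}] 0, ‖ω‖ < 1 :=
    nhdsWithin_le_nhds ((continuous_norm.tendsto (0 : ℂ)).eventually_lt_const (by simp))
  set B := ∑' n, modeWeight β K V n * (M * (√β * 1) + (M + M))
  have h := tendsto_integral_filter_of_dominated_convergence (μ := ℳ)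
    (l := 𝓝[{ω : ℂ | 0 < ω.im}] 0) (F := fun ω v => ((∑' n, modeWeight β K V n *
      errTerm β V M ω v n) * ‖twistedGrad β g Dg v‖) ^ 2) (f := fun _ => 0)
    (fun v => (B * ‖twistedGrad β g Dg v‖) ^ 2) ?_ ?_ ?_ ?_
  · simpa using h
  · filter_upwards [eventually_mem_nhdsWithin] with ω hω
    exact ((errSum_bound hβ.out hV hM0 hM hω).1.aestronglyMeasurable.mul htg.1.norm).pow 2
  · filter_upwards [eventually_mem_nhdsWithin, hball] with ω hω h1
    obtain ⟨-, hb⟩ := errSum_bound hβ.out hV hM0 hM hω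
    refine ae_of_all _ fun v => ?_
    obtain ⟨b0, -, b1⟩ := hb v
    rw [Real.norm_of_nonneg (by positivity)]
    have hB := b1.trans (Summable.tsum_le_tsum (fun n => mul_le_mul_of_nonneg_left
      (by gcongr : M * (√β * ‖ω‖) + (M + M) ≤ M * (√β * 1) + (M + M))
      (modeWeight_nonneg hβ.out hV.1 n)) (summable_weight hV _) (summable_weight hV _))
    gcongr
  · exact (htg.norm.const_mul B).integrable_sq
  · refine ae_of_all _ fun v => ?_
    simpa using ((tendsto_errSum hβ.out hV hM0 hM v).mul_const
      ‖twistedGrad β g Dg v‖).pow 2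

/-! ### Modification of the force on null sets -/

variable {DV' : Torus d → Vel d}

lemma ae_sub_of_ae_eq [Fact (0 < β)] (h : DV =ᵐ[𝔗] DV') (x : Torus d) :
    ∀ᵐ zs : Phase d ∂ℨ, DV (x - zs.1) = DV' (x - zs.1) :=
  ((Measure.measurePreserving_sub_left 𝔗 x).comp
    measurePreserving_fst).quasiMeasurePreserving.ae h

lemma IsW1Infty.congr (hV : IsW1Infty V DV K) (h : DV =ᵐ[𝔗] DV') :
    IsW1Infty V DV' K where
  meas := hV.meas
  meas_grad := hV.meas_grad.congr h
  bound := hV.bound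
  bound_grad := by filter_upwards [hV.bound_grad, h] with x hx e; rwa [← e]
  weak_grad ψ hψ i := (hV.weak_grad ψ hψ i).trans (congrArg _ (integral_congr_ae (by
    filter_upwards [h] with x e; rw [e])))

lemma vlasovPair_congr [Fact (0 < β)] (h : DV =ᵐ[𝔗] DV') (N m : ℕ)
    (G φ : (Fin (m + 1) → Phase d) → ℂ) : vlasovPair N m β DV G φ = vlasovPair N m β DV' G φ := by
  refine sum_congr rfl fun j _ => ?_
  have e : ∀ z : Fin (m + 1) → Phase d,
      ∫ zs, ((β * inner ℝ (z j).2 (DV ((z j).1 - zs.1)) : ℝ) : ℂ) * G (update z j zs)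
        ∂ℨ
      = ∫ zs, ((β * inner ℝ (z j).2 (DV' ((z j).1 - zs.1)) : ℝ) : ℂ) * G (update z j zs)
        ∂ℨ := fun z => integral_congr_ae (by
    filter_upwards [ae_sub_of_ae_eq h (z j).1] with zs e
    rw [e])
  simp_rw [e]

lemma meanPair_congr [Fact (0 < β)] (h : DV =ᵐ[𝔗] DV') (N m : ℕ)
    (G : (Fin (m + 1 + 1) → Phase d) → ℂ) (φ : (Fin (m + 1) → Phase d) → ℂ) :
    meanPair N m β DV G φ = meanPair N m β DV' G φ := by
  have e : ∀ (j : Fin (m + 1)) (z : Fin (m + 1) → Phase d),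
      ∫ zs, G (Fin.snoc (α := fun _ => Phase d) z zs) * velDeriv j (DV ((z j).1 - zs.1)) φ z
        ∂ℨ
      = ∫ zs, G (Fin.snoc (α := fun _ => Phase d) z zs) * velDeriv j (DV' ((z j).1 - zs.1)) φ z
        ∂ℨ := fun j z => integral_congr_ae (by
    filter_upwards [ae_sub_of_ae_eq h (z j).1] with zs e
    rw [e])
  simp_rw [meanPair, e]

lemma IsThreeCorr.congr [Fact (0 < β)] (h : DV =ᵐ[𝔗] DV') {G₃ : (Fin 3 → Phase d) → ℂ}
    {R G₂ : (Fin 2 → Phase d) → ℂ} (hc : IsThreeCorr N β DV g ω G₃ R G₂) :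
    IsThreeCorr N β DV' g ω G₃ R G₂ where
  resolvent_three := by
    refine ⟨hc.resolvent_three.1, fun φ hφ => ?_⟩
    rw [← vlasovPair_congr h, hc.resolvent_three.2 φ hφ]
    refine integral_congr_ae ?_
    filter_upwards [(measurePreserving_pos_sub d β (by decide : (1 : Fin 3) ≠ 2)).quasiMeasurePreserving.ae
      h, (measurePreserving_pos_sub d β (by decide : (2 : Fin 3) ≠ 1)).quasiMeasurePreserving.ae h]
      with z h1 h2
    rw [sourceThree, sourceThree, h1, h2]
  memL2_mean := hc.memL2_mean
  mean_three φ hφ := by rw [← meanPair_congr h, hc.mean_three φ hφ]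
  resolvent_two := ⟨hc.resolvent_two.1, fun φ hφ => by
    rw [← vlasovPair_congr h, hc.resolvent_two.2 φ hφ]⟩

lemma IsW1Infty.exists_measurable (hV : IsW1Infty V DV K) : ∃ DV' : Torus d → Vel d,
    DV =ᵐ[𝔗] DV' ∧ Measurable DV' ∧ ∀ x, ‖DV' x‖ ≤ K := by
  set m := hV.meas_grad.mk DV
  have hm : Measurable m := hV.meas_grad.stronglyMeasurable_mk.measurable
  have hms : MeasurableSet {x | ‖m x‖ ≤ K} := measurableSet_le hm.norm measurable_const
  refine ⟨{x | ‖m x‖ ≤ K}.indicator m, ?_, hm.indicator hms, fun x => ?_⟩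
  · filter_upwards [hV.meas_grad.ae_eq_mk, hV.bound_grad] with x h1 h2
    exact h1.trans (indicator_of_mem (s := {x | ‖m x‖ ≤ K})
      ((congrArg norm h1).symm.trans_le h2) m).symm
  · by_cases hx : x ∈ {x | ‖m x‖ ≤ K}
    · rw [indicator_of_mem hx]; exact hx
    · rw [indicator_of_notMem hx, norm_zero]; exact hV.nonneg

/-! ### Conclusion -/

lemma IsThreeCorr.unique [Fact (0 < β)] (hN : 1 ≤ N) (hV : IsPotential V DV K) (hω : 0 < ω.im) {G₃ G₃' : (Fin 3 → Phase d) → ℂ}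
    {R G₂ R' G₂' : (Fin 2 → Phase d) → ℂ} (h : IsThreeCorr N β DV g ω G₃ R G₂)
    (h' : IsThreeCorr N β DV g ω G₃' R' G₂') : G₃ =ᵐ[𝔓 3] G₃' ∧
      R =ᵐ[𝔓 2] R' ∧ G₂ =ᵐ[𝔓 2] G₂' := by
  have h3 := IsResolvent.unique (m := 2) (Or.inr rfl) hN hV hω
    (Eventually.of_forall fun _ => rfl) h.resolvent_three h'.resolvent_three
  have hR : R =ᵐ[𝔓 2] R' := by
    refine ae_eq_of_forall_test h.memL2_mean.1 h'.memL2_mean.1 fun φ hφ => ?_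
    rw [← h.mean_three φ hφ, ← h'.mean_three φ hφ,
      meanPair_eq N hV.measurable hV.le hφ (h.resolvent_three.1.1.integrable (by norm_num)),
      meanPair_eq N hV.measurable hV.le hφ (h'.resolvent_three.1.1.integrable (by norm_num))]
    congr 1
    refine integral_congr_ae ?_
    filter_upwards [h3] with z hz
    rw [hz]
  exact ⟨h3, hR, IsResolvent.unique (m := 1) (Or.inl rfl) hN hV hω hR
    h.resolvent_two h'.resolvent_two⟩

lemma IsH1.memLp_twistedGrad [Fact (0 < β)] (hg : IsH1 β g Dg) :
    MemLp (twistedGrad β g Dg) 2 ℳ := by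
  have h := memLp_finsetSum Finset.univ fun i _ =>
    (ContinuousLinearMap.toSpanSingleton ℂ (EuclideanSpace.single i (1 : ℂ))).comp_memLp'
      (hg.memLp_twistedGrad_apply i)
  refine h.ae_eq (ae_of_all _ fun v => ?_)
  ext i
  simp [Finset.sum_apply, Pi.single_apply]

lemma corrField_bound (hβ : 0 < β) (hN : 1 ≤ N) (hV : IsPotential V DV K) {M : ℝ} (hM0 : 0 ≤ M)
    (hM : ∀ α γ, 0 ≤ α → α ≤ β * K → 0 ≤ γ → γ ≤ β * K → ∀ z ζ : ℂ, 0 < z.im → 0 < ζ.im →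
      ‖corrCauchy α z ζ / gaussEps γ ζ‖ ≤ M ∧
      ‖corrCauchy α z ζ / gaussEps γ ζ - gaussRatio γ ζ‖ ≤ M * ‖z‖) (hω : 0 < ω.im)
    (n : ℤᵈ) (v : Vel d) :
    ‖corrField N β V g Dg ω n v‖ * ‖waveVec n‖
        ≤ modeWeight β K V n * M * ‖twistedGrad β g Dg v‖ ∧
      ‖corrField N β V g Dg ω n v - limitMode N β V g Dg n v‖ * ‖waveVec n‖
        ≤ modeWeight β K V n * errTerm β V M ω v n * ‖twistedGrad β g Dg v‖ := by
  rw [corrField_eq, limitMode, ← mul_sub, ← mul_sub, ← mul_sub]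
  by_cases hn : n = 0
  · have h0 := modeWeight_nonneg hβ hV.1 n
    have h1 := errTerm_nonneg (V := V) (β := β) (ω := ω) hM0 v n
    have h2 : ‖waveVec n‖ = 0 := by rw [hn, waveVec_zero, norm_zero]
    rw [h2, mul_zero, mul_zero]
    constructor <;> positivity
  obtain ⟨a0, a1⟩ := meanCoupling_mem hβ hN hV n
  obtain ⟨b0, b1⟩ := beta_potHat_mem hβ hV n
  obtain ⟨hz, -⟩ := modeScale_ratio hβ hn hω
  have hc0 := modeScale_pos hβ hn
  obtain ⟨h1, h2⟩ := hM _ _ a0 a1 b0 b1 _ _ hz (im_add_ofReal_pos hz (modeVel β n v))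
  refine ⟨norm_mul_waveGrad_le hβ hN hV n v (by rw [norm_mul, norm_I, one_mul]; exact h1),
    norm_mul_waveGrad_le hβ hN hV n v ?_⟩
  rw [norm_mul, norm_I, one_mul]
  refine (norm_sub_le_norm_sub_add_norm_sub _ (gaussRatio (β * potHat V n)
    (ω / modeScale β n + modeVel β n v)) _).trans (add_le_add (h2.trans ?_) le_rfl)
  rw [norm_div, norm_real, Real.norm_of_nonneg hc0.le]
  refine mul_le_mul_of_nonneg_left ?_ hM0
  have hk := one_le_norm_waveVec hn
  rw [modeScale, div_div_eq_mul_div, mul_comm]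
  exact div_le_self (by positivity) hk

theorem proposition5p6 (d : ℕ) (hd : 1 ≤ d) (β : ℝ) (hβ : 0 < β) (K : ℝ) :
    ∃ C : ℝ, ∀ (V : Torus d → ℝ) (DV : Torus d → Vel d), IsW1Infty V DV K →
      (∀ᵐ x ∂torusMeasure d, V (-x) = V x) → (∀ n : Fin d → ℤ, 0 ≤ potHat V n) →
      ∀ (g : Vel d → ℂ) (Dg : Vel d → EuclideanSpace ℂ (Fin d)), IsH1 β g Dg →
        -- the pre-limit quantity is well defined
        (∀ N : ℕ, 1 ≤ N → ∀ ω : ℂ, 0 < ω.im →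
          (∃ G₃ R G₂, IsThreeCorr N β DV g ω G₃ R G₂) ∧
          (∀ G₃ R G₂ G₃' R' G₂', IsThreeCorr N β DV g ω G₃ R G₂ →
            IsThreeCorr N β DV g ω G₃' R' G₂' →
              G₃ =ᵐ[phaseMeasureN d β 3] G₃' ∧ R =ᵐ[phaseMeasureN d β 2] R' ∧
                G₂ =ᵐ[phaseMeasureN d β 2] G₂')) ∧
        -- the limit is well defined
        (∀ N : ℕ, 1 ≤ N →
          (∀ n : Fin d → ℤ, n ≠ 0 → ∀ v : Vel d,
            Tendsto (fun η : ℝ => dispersion N 1 β V n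
                (((inner ℝ (waveVec n) v : ℝ) : ℂ) + (η : ℂ) * Complex.I))
              (𝓝[>] 0) (𝓝 (dispersionBdry N 1 β V n (inner ℝ (waveVec n) v))) ∧
            dispersionBdry N 1 β V n (inner ℝ (waveVec n) v) ≠ 0 ∧
            Tendsto (deltaApprox β (waveVec n) v) (𝓝[>] 0) (𝓝 (deltaAvg β (waveVec n) v))) ∧
          (∀ (v : Vel d) (i l : Fin d), Summable (tensorTerm N β V v i l)) ∧
          MemLp (limitField N β V g Dg) 2 (maxwell d β)) ∧
        -- convergence in `H^{-1}_β` as `ω → 0` with `Im ω > 0`, uniformly in `N`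
        (∀ ε : ℝ, 0 < ε → ∃ δ : ℝ, 0 < δ ∧ ∀ N : ℕ, 1 ≤ N → ∀ ω : ℂ, 0 < ω.im → ‖ω‖ < δ →
          ∀ G₃ R G₂, IsThreeCorr N β DV g ω G₃ R G₂ →
            HNegOneLe β (fun φ => spaceAvgMean N β DV G₂ φ
              - -twistedDiv β (limitField N β V g Dg) φ) ε) ∧
        -- the uniform pointwise bound
        (∀ N : ℕ, 1 ≤ N → ∀ ω : ℂ, 0 < ω.im → ∀ G₃ R G₂, IsThreeCorr N β DV g ω G₃ R G₂ →
          ∃ Gω : Vel d → EuclideanSpace ℂ (Fin d), AEStronglyMeasurable Gω (maxwell d β) ∧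
            (∀ φ : Vel d → ℂ, IsVelTest φ → spaceAvgMean N β DV G₂ φ = twistedDiv β Gω φ) ∧
            ∀ᵐ v ∂maxwell d β, ‖Gω v‖ ≤ C * ‖twistedGrad β g Dg v‖) := by
  by_cases hK : 0 ≤ K
  swap
  · exact ⟨0, fun V DV hV => absurd hV.nonneg hK⟩
  have : Fact (0 < β) := ⟨hβ⟩
  obtain ⟨M, hM0, hM, hM'⟩ := exists_ratio_bound hβ hK
  refine ⟨β * K * √β * (d * K ^ 2) * M, fun V DV₀ hV₀ heven hpos g Dg hg => ?_⟩
  obtain ⟨DV, hDV, hDm, hDb⟩ := hV₀.exists_measurable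
  have hV : IsPotential V DV K := ⟨hV₀.congr hDV, heven, hpos, hDm, hDb⟩
  have htg := hg.memLp_twistedGrad
  have hw := summable_weight (β := β) hV M
  have hcorr := fun {N : ℕ} (hN : 1 ≤ N) {ω : ℂ} (hω : 0 < ω.im) =>
    corrField_bound (N := N) (g := g) (Dg := Dg) hβ hN hV hM0 hM' hω
  have hm := fun {N : ℕ} {ω : ℂ} (hω : 0 < ω.im) =>
    aestronglyMeasurable_corrField (N := N) (V := V) htg hω
  have hfield : ∀ {N : ℕ}, 1 ≤ N → ∀ {ω : ℂ}, 0 < ω.im → ∀ {G₃ R G₂},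
      IsThreeCorr N β DV₀ g ω G₃ R G₂ → ∀ φ, IsVelTest φ → spaceAvgMean N β DV₀ G₂ φ
        = twistedDiv β (modeField (corrField N β V g Dg ω)) φ := by
    intro N hN ω hω G₃ R G₂ h φ hφ
    obtain ⟨G₃', R', G₂', h', hs⟩ := exists_isThreeCorr hN hV hg htg hω
    have hu := (IsThreeCorr.unique hN hV hω (h.congr hDV) h').2.2
    have hφ' := isPhaseTest_of_isVelTest hφ
    have e : spaceAvgMean N β DV₀ G₂ φ = spaceAvgMean N β DV G₂' φ := by
      rw [spaceAvgMean, spaceAvgMean, meanPair_congr hDV,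
        meanPair_eq N hDm hDb hφ' (h.resolvent_two.1.1.integrable (by norm_num)),
        meanPair_eq N hDm hDb hφ' (h'.resolvent_two.1.1.integrable (by norm_num))]
      congr 1
      refine integral_congr_ae ?_
      filter_upwards [hu] with z hz
      rw [hz]
    rw [e]
    exact (hs φ hφ).unique (hasSum_twistedDiv (hm hω) hw (htg.norm.integrable (by norm_num))
      (fun n v => (hcorr hN hω n v).1) hφ)
  have hlim : ∀ {N : ℕ}, 1 ≤ N → MemLp (limitField N β V g Dg) 2 (maxwell d β) := by
    intro N hN
    have hl := fun v => limitField_eq (g := g) (Dg := Dg) hβ hN hV v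
    have e : limitField N β V g Dg = fun v => -modeField (limitMode N β V g Dg) v :=
      funext fun v => (hl v).1
    have hmm : AEStronglyMeasurable (limitField N β V g Dg) (maxwell d β) := by
      rw [e]
      refine (aestronglyMeasurable_modeField (fun n => ?_) fun v => (hl v).2).neg
      have hc : Continuous fun v => gaussRatio (β * potHat V n) (modeVel β n v) := by
        have := continuous_modeVel β n
        exact (continuousOn_gaussRatio (beta_potHat_mem hβ hV n).1).comp_continuous
          (by fun_prop) fun v => by simp
      exact ((memLp_waveGrad htg n).1.1.mul (hc.aestronglyMeasurable.const_mul _)).const_mul _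
    refine htg.of_le_mul (c := ∑' n, β * K * √β * (‖waveVec n‖ ^ 2 * potHat V n ^ 2) * M)
      hmm (ae_of_all _ fun v => ?_)
    rw [e, norm_neg]
    exact (hasSum_modeField hw fun n => norm_mul_waveGrad_le hβ hN hV n v (by
      obtain ⟨h0, h1⟩ := beta_potHat_mem hβ hV n
      rw [norm_mul, norm_I, one_mul]; exact hM _ h0 h1 _ (by simp))).2
  have hmod : ∀ {N : ℕ}, 1 ≤ N → ∀ {ω : ℂ}, 0 < ω.im → ∀ v,
      HasSum (fun n => corrField N β V g Dg ω n v • cWaveVec n)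
        (modeField (corrField N β V g Dg ω) v) := fun hN ω hω v =>
    (hasSum_modeField hw fun n => (hcorr hN hω n v).1).1
  refine ⟨fun N hN ω hω => ⟨?_, fun G₃ R G₂ G₃' R' G₂' h h' => IsThreeCorr.unique hN hV hω (h.congr hDV) (h'.congr hDV)⟩, fun N hN => ⟨fun n hn v => ⟨?_, ?_, ?_⟩,
    fun v i l => summable_tensorTerm hβ hN hV v i l, hlim hN⟩, fun ε hε => ?_,
    fun N hN ω hω G₃ R G₂ h => ⟨modeField (corrField N β V g Dg ω),
      aestronglyMeasurable_modeField (hm hω) (hmod hN hω), hfield hN hω h, ae_of_all _ fun v => ?_⟩⟩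
  · obtain ⟨G₃, R, G₂, h, -⟩ := exists_isThreeCorr hN hV hg htg hω
    exact ⟨G₃, R, G₂, h.congr hDV.symm⟩
  · rw [dispersionBdry_eq hβ V hn]
    exact tendsto_dispersion hβ V hn _
  · rw [dispersionBdry_eq hβ V hn, Nat.cast_one, add_sub_cancel_right]
    have := hpos n
    exact gaussEps_ne_zero (by positivity) (by simp)
  · rw [deltaAvg, (tendsto_deltaApprox hβ hn v).limUnder_eq]
    exact tendsto_deltaApprox hβ hn v
  · have ht := (tendsto_integral_errSum hV hM0 hM htg).eventually_lt_const (pow_pos hε 2)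
    obtain ⟨δ, hδ, hball⟩ := Metric.mem_nhdsWithin_iff.1 ht
    refine ⟨δ, hδ, fun N hN ω hω hωδ G₃ R G₂ h φ hφ => ?_⟩
    have hint := hball ⟨mem_ball_zero_iff.2 hωδ, hω⟩
    obtain ⟨hcont, hb⟩ := errSum_bound hβ hV hM0 hM hω
    set E : Vel d → ℝ := fun v => ∑' n, modeWeight β K V n * errTerm β V M ω v n with hE
    have hmF := aestronglyMeasurable_modeField (hm (N := N) hω) (hmod hN hω)
    obtain ⟨-, hci, C, hC⟩ := hφ.bounded_grad
    have hF : MemLp (modeField (corrField N β V g Dg ω)) 2 (maxwell d β) :=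
      htg.of_le_mul hmF (ae_of_all _ fun v =>
        (hasSum_modeField hw fun n => (hcorr hN hω n v).1).2)
    have hint : ∀ {F : Vel d → EuclideanSpace ℂ (Fin d)}, MemLp F 2 (maxwell d β) →
        Integrable (fun v => ∑ i, F v i * velPartial φ i v) (maxwell d β) := fun {F} hF =>
      ((hF.integrable (by norm_num)).norm.mul_const C).mono'
        (Finset.aestronglyMeasurable_fun_sum _ fun i _ =>
          ((by fun_prop : Continuous fun x : EuclideanSpace ℂ (Fin d) =>
            x i).comp_aestronglyMeasurable hF.1).mul (hci i).aestronglyMeasurable)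
        (ae_of_all _ fun v => (norm_fderiv_le φ (F v) v).trans (by gcongr; exact hC v))
    have hadd : spaceAvgMean N β DV₀ G₂ φ - -twistedDiv β (limitField N β V g Dg) φ
        = twistedDiv β (fun v => modeField (corrField N β V g Dg ω) v + limitField N β V g Dg v) φ := by
      rw [hfield hN hω h φ hφ, twistedDiv, twistedDiv, twistedDiv, sub_neg_eq_add, ← neg_add,
        ← integral_add (hint hF) (hint (hlim hN))]
      congr 2
      funext v
      rw [← Finset.sum_add_distrib]
      exact sum_congr rfl fun i _ => by rw [PiLp.add_apply, add_mul]
    simp only [hadd]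
    refine norm_twistedDiv_le (h := fun v => E v * ‖twistedGrad β g Dg v‖) ?_ (fun v => ?_) hε.le
      (le_of_lt ‹_›) hφ
    · refine htg.of_le_mul (c := ∑' n, modeWeight β K V n * (M * (√β * ‖ω‖) + (M + M)))
        (hcont.aestronglyMeasurable.mul htg.1.norm) (ae_of_all _ fun v => ?_)
      rw [norm_mul, norm_norm, Real.norm_of_nonneg (hb v).1]
      exact mul_le_mul_of_nonneg_right (hb v).2.2 (norm_nonneg _)
    · obtain ⟨l1, l2⟩ := limitField_eq (g := g) (Dg := Dg) hβ hN hV v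
      obtain ⟨s1, s2⟩ := hasSum_modeField (u := fun n v => corrField N β V g Dg ω n v
        - limitMode N β V g Dg n v) (hb v).2.1 (fun n => (hcorr hN hω n v).2)
      have e := s1.unique (((hmod hN hω v).sub l2).congr_fun fun n => sub_smul _ _ _)
      rw [l1, ← sub_eq_add_neg, ← e]
      exact s2
  · refine (hasSum_modeField hw fun n => (hcorr hN hω n v).1).2.trans ?_
    refine mul_le_mul_of_nonneg_right ?_ (norm_nonneg _)
    rw [tsum_mul_right, tsum_mul_left]
    have := (summable_sq_waveVec_mul_potHat hV.1 heven).2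
    gcongr

end
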